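/- **Setting.** Consider $$\dot x=\partial_yH(x,y)+t^{-a/q}f(x,y,S(t),t),\qquad \dot y=-\partial_xH(x,y)+t^{-a/q}g(x,y,S(t),t),\qquad S(t)=s\,t^{1+b/q},$$ with integers $1\le a,b\le q$, $s>0$, $H=\frac{y^2}{2}+U(x)$, $U(x)=\frac{x^{2h}}{2h}+\sum_{i=1}^{2h-1}u_ix^i$, $h\ge 2$. The functions $f,g$ are $C^\infty$ for $t>0$, $2\pi$-periodic in $S$, and $f\sim\sum_{k\ge0}t^{-k/q}f_k$, $g\sim\sum_{k\ge0}t^{-k/q}g_k$ as $t\to\infty$ (remainders uniform in $S$ and, up to a fixed polynomial weight, in $(x,y)$), where $f_k=\sum_{i\le p,\,j\le l-1}A_{k,i,j}(S)x^iy^j$, $g_k=\sum_{i\le p,\,j\le l}B_{k,i,j}(S)x^iy^j$, $0\le l\le p\le 2h-1$, the coefficients are smooth and $2\pi$-periodic, and they vanish for $i+j>p$. Put $$\sigma=\tfrac bq\Big(l-1+\tfrac{p-1}{h-1}\Big)-\tfrac aq,\quad \mu=\tfrac12\Big(\tfrac bq-\sigma\Big),\quad \nu=1+2\mu+\sigma,\quad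 M=2\mu q(h-1),\quad N=2\nu q(h-1),\quad \vartheta=s\Big(1+\tfrac bq\Big),$$ and assume (rc): $-1\le\sigma<b/q$; then $M,N$ are integers with $M\ge1$, $N\ge2M$. Let $E_0>0$ be such that no level line $H=E$, $E>E_0$, contains a fixed point of the system with $f=g=0$. For $E>E_0$ let $(X(\phi,E),Y(\phi,E))$ be the solution of $\omega(E)\partial_\phi X=Y$, $\omega(E)\partial_\phi Y=-U'(X)$ with $H(X,Y)=E$, $X(0,E)>0$, $Y(0,E)=0$ and least period $2\pi$ in $\phi$. Fix a positive integer $\varkappa$, let $E_1>E_0$ be such that $\omega'>0$ on $[E_1,\infty)$, and let $I_*(t)\ge E_1$ solve $\omega(I_*(t))=S'(t)/\varkappa$ for large $t$. The substitution $$x=X(\phi,I),\quad y=Y(\phi,I),\quad I=I_*(t)\big(1+t^{-\mu}r\big)^{2h},\quad \phi=\theta+S(t)/\varkappa,\quad \tau=t^\nu/\nu$$ gives a system $r'=\tau^{-M/N}\mathcal A(r,\theta,\tau)$, $\theta'=\tau^{-M/N}\mathcal B(r,\theta,\tau)$ (prime $=d/d\tau$) with $\mathcal A\sim\sum_K\tau^{-K/N}\mathcal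 A_K(r,\theta,\zeta)$, $\mathcal B\sim\sum_K\tau^{-K/N}\mathcal B_K(r,\theta,\zeta)$ as $\tau\to\infty$, $\zeta=\vartheta\tau$, with coefficients $2\pi\varkappa$-periodic in $\zeta$. Averaging. There are unique functions $\Lambda_K(r,\theta),\Omega_K(r,\theta)$ and $2\pi\varkappa$-periodic zero-mean (in $\zeta$) functions $\rho_K,\psi_K(r,\theta,\zeta)$ such that for each $n$ the substitution $$R=r+\sum_{K=0}^n\tau^{-\frac{M+K}N}\rho_K(r,\theta,\vartheta\tau),\qquad \Psi=\theta+\sum_{K=0}^n\tau^{-\frac{M+K}N}\psi_K(r,\theta,\vartheta\tau)$$ has derivatives along the $(r,\theta)$-system equal to $\sum_{K\le n}\tau^{-(M+K)/N}\Lambda_K(R,\Psi)$ and $\sum_{K\le n}\tau^{-(M+K)/N}\Omega_K(R,\Psi)$ up to and including order $\tau^{-(M+n)/N}$; they are computed order by order in powers of $\tau^{-1/N}$. Fix $r_0>0$. Inverting the substitution on $|r|\le r_0$ (for large $\tau$) and denoting by $\widetilde\Lambda_n,\widetilde\Omega_n$ the exact differences, one obtains the *full averaged system* $$R'=\sum_{K=0}^n\tau^{-\frac{M+K}N}\Lambda_K(R,\Psi)+\widetilde\Lambda_n(R,\Psi,\tau),\qquad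 \Psi'=\sum_{K=0}^n\tau^{-\frac{M+K}N}\Omega_K(R,\Psi)+\widetilde\Omega_n(R,\Psi,\tau).$$ **Assumptions.** Besides (rc): * (as0) $0\le L\le\min\{N-M,2M-1\}$, $\Lambda_K\equiv0$ for $K<L$, $\Lambda_L\not\equiv0$. * (as1) with $\lambda_L<0$: $\Lambda_L(0,\varphi_0)=0$ and $\lambda_L:=\partial_\varphi\Lambda_L(0,\varphi_0)<0$ for some $\varphi_0\in\mathbb R$. * (asg) for some $D\ge M$: $\partial_\varrho\Lambda_K+\partial_\varphi\Omega_K\equiv0$ for all $K<D$, and $\gamma_D:=\partial_\varrho\Lambda_D(0,\varphi_0)+\partial_\varphi\Omega_D(0,\varphi_0)\ne0$. Let $n\ge L+D$, and let $(\varrho_*,\varphi_*)$ be a solution for $\tau>\tau_0$ (with some $\tau_0>0$) of the truncated system $$\varrho'=\sum_{K=L}^n\tau^{-\frac{M+K}N}\Lambda_K(\varrho,\varphi),\qquad \varphi'=\sum_{K=0}^n\tau^{-\frac{M+K}N}\Omega_K(\varrho,\varphi)$$ having asymptotic expansions $\varrho_*(\tau)\sim\sum_{K\ge0}\varrho_K\tau^{-(M+K)/N}$,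 $\varphi_*(\tau)\sim\varphi_0+\sum_{K\ge1}\varphi_K\tau^{-K/N}$ as $\tau\to\infty$ with constant coefficients. **Lemma.** Suppose that one of the following holds: * $\gamma_D<0$ and $M+D<N$; * $\gamma_D+\frac LN<0$ and $M+D=N$; * $\gamma_D<0$, $L=0$ and $M+D>N$. Then for every $\epsilon>0$ there exist $\delta>0$ and $\tau_s>\tau_0$ such that for all $(R_s,\Psi_s)$ with $|R_s-\varrho_*(\tau_s)|<\delta$ and $|\Psi_s-\varphi_*(\tau_s)|<\delta$, a solution $(R,\Psi)$ of the full averaged system with $R(\tau_s)=R_s$, $\Psi(\tau_s)=\Psi_s$ exists for all $\tau\ge\tau_s$, and every solution with these initial data satisfies $$|R(\tau)-\varrho_*(\tau)|+|\Psi(\tau)-\varphi_*(\tau)|<\epsilon$$ for all $\tau>\tau_s$ in its interval of existence. -/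

import Mathlib

open Filter Topology Asymptotics Set
open scoped ContDiff

noncomputable section

/-- The perturbed system
`dx/dt = ∂_y H + t^(-a/q) f(x,y,S(t),t)`, `dy/dt = -∂_x H + t^(-a/q) g(x,y,S(t),t)`,
`S(t) = s t^(1+b/q)`, `H = y²/2 + U(x)`, `U(x) = x^(2h)/(2h) + ∑_{1 ≤ i ≤ 2h-1} u_i x^i`,
with all standing assumptions on the parameters and on the perturbations `f`, `g`. -/
structure PerturbedOscillator where
  h : ℕ
  u : ℕ → ℝ
  a : ℕ
  b : ℕ
  q : ℕ
  s : ℝ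
  l : ℕ
  p : ℕ
  /-- the coefficients `A_{k,i,j}(S)` of `x^i y^j` in `f_k` -/
  A : ℕ → ℕ → ℕ → ℝ → ℝ
  /-- the coefficients `B_{k,i,j}(S)` of `x^i y^j` in `g_k` -/
  B : ℕ → ℕ → ℕ → ℝ → ℝ
  f : ℝ → ℝ → ℝ → ℝ → ℝ
  g : ℝ → ℝ → ℝ → ℝ → ℝ
  two_le_h : 2 ≤ h
  one_le_a : 1 ≤ a
  a_le_q : a ≤ q
  one_le_b : 1 ≤ b
  b_le_q : b ≤ q
  s_pos : 0 < s
  l_le_p : l ≤ p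
  p_le : p + 1 ≤ 2 * h
  A_smooth : ∀ k i j, ContDiff ℝ ∞ (A k i j)
  B_smooth : ∀ k i j, ContDiff ℝ ∞ (B k i j)
  A_periodic : ∀ k i j, Function.Periodic (A k i j) (2 * Real.pi)
  B_periodic : ∀ k i j, Function.Periodic (B k i j) (2 * Real.pi)
  A_zero : ∀ k i j S, p < i + j → A k i j S = 0
  B_zero : ∀ k i j S, p < i + j → B k i j S = 0
  f_smooth : ContDiffOn ℝ ∞ (fun z : ℝ × ℝ × ℝ × ℝ => f z.1 z.2.1 z.2.2.1 z.2.2.2)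
    {z | 0 < z.2.2.2}
  g_smooth : ContDiffOn ℝ ∞ (fun z : ℝ × ℝ × ℝ × ℝ => g z.1 z.2.1 z.2.2.1 z.2.2.2)
    {z | 0 < z.2.2.2}
  f_periodic : ∀ x y t, 0 < t → Function.Periodic (fun S => f x y S t) (2 * Real.pi)
  g_periodic : ∀ x y t, 0 < t → Function.Periodic (fun S => g x y S t) (2 * Real.pi)
  /-- `f = ∑_k t^(-k/q) f_k` as `t → ∞`, `f_k = ∑_{i ≤ p} ∑_{j ≤ l-1} A_{k,i,j}(S) x^i y^j`;
  the remainders are uniform in `S` and, up to a fixed polynomial weight, in `(x,y)`. -/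
  f_expansion : ∃ m : ℕ, ∀ n : ℕ, ∃ C t₀ : ℝ, 0 < t₀ ∧ ∀ t ≥ t₀, ∀ x y S : ℝ,
    |f x y S t - ∑ k ∈ Finset.range (n + 1), t ^ (-((k : ℝ) / q)) *
        ∑ i ∈ Finset.range (p + 1), ∑ j ∈ Finset.range l, A k i j S * x ^ i * y ^ j|
      ≤ C * t ^ (-(((n : ℝ) + 1) / q)) * (1 + |x| + |y|) ^ m
  /-- `g = ∑_k t^(-k/q) g_k` as `t → ∞`, `g_k = ∑_{i ≤ p} ∑_{j ≤ l} B_{k,i,j}(S) x^i y^j`. -/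
  g_expansion : ∃ m : ℕ, ∀ n : ℕ, ∃ C t₀ : ℝ, 0 < t₀ ∧ ∀ t ≥ t₀, ∀ x y S : ℝ,
    |g x y S t - ∑ k ∈ Finset.range (n + 1), t ^ (-((k : ℝ) / q)) *
        ∑ i ∈ Finset.range (p + 1), ∑ j ∈ Finset.range (l + 1), B k i j S * x ^ i * y ^ j|
      ≤ C * t ^ (-(((n : ℝ) + 1) / q)) * (1 + |x| + |y|) ^ m

namespace PerturbedOscillator

variable (P : PerturbedOscillator)

/-- The potential `U`. -/
def U (x : ℝ) : ℝ :=
  x ^ (2 * P.h) / (2 * P.h) + ∑ i ∈ Finset.Ico 1 (2 * P.h), P.u i * x ^ i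

/-- The Hamiltonian `H(x,y) = y²/2 + U(x)`. -/
def H (x y : ℝ) : ℝ := y ^ 2 / 2 + P.U x

/-- The phase `S(t) = s t^(1+b/q)` of the perturbation. -/
def S (t : ℝ) : ℝ := P.s * t ^ (1 + (P.b : ℝ) / P.q)

def sigma : ℝ :=
  (P.b : ℝ) / P.q * ((P.l : ℝ) - 1 + ((P.p : ℝ) - 1) / ((P.h : ℝ) - 1)) - (P.a : ℝ) / P.q

def mu : ℝ := ((P.b : ℝ) / P.q - P.sigma) / 2

def nu : ℝ := 1 + 2 * P.mu + P.sigma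

/-- The integer `M = 2 μ q (h-1)`. -/
def M : ℕ := ⌊2 * P.mu * P.q * ((P.h : ℝ) - 1)⌋₊

/-- The integer `N = 2 ν q (h-1)`. -/
def N : ℕ := ⌊2 * P.nu * P.q * ((P.h : ℝ) - 1)⌋₊

/-- `ϑ = s (1 + b/q)`. -/
def vartheta : ℝ := P.s * (1 + (P.b : ℝ) / P.q)

/-- The condition `-1 ≤ σ < b/q`. -/
def ResonanceCondition : Prop := -1 ≤ P.sigma ∧ P.sigma < (P.b : ℝ) / P.q

theorem q_pos : (0 : ℝ) < P.q := by
  have h1 := P.one_le_a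
  have h2 := P.a_le_q
  exact_mod_cast (by omega : 0 < P.q)

theorem h_sub_one_pos : (0 : ℝ) < (P.h : ℝ) - 1 := by
  have h1 : (2 : ℝ) ≤ P.h := by exact_mod_cast P.two_le_h
  linarith

theorem N_cast : (P.N : ℝ) = 2 * P.nu * P.q * ((P.h : ℝ) - 1) := by
  have hq := P.q_pos
  have hh := P.two_le_h
  have e : 2 * P.nu * P.q * ((P.h : ℝ) - 1) = ((2 * (P.q + P.b) * (P.h - 1) : ℕ) : ℝ) := by
    push_cast [Nat.cast_sub (by omega : 1 ≤ P.h)]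
    unfold nu mu
    field_simp
    ring
  unfold N
  rw [e, Nat.floor_natCast]

theorem M_cast (hrc : P.ResonanceCondition) :
    (P.M : ℝ) = 2 * P.mu * P.q * ((P.h : ℝ) - 1) := by
  have hq := P.q_pos
  have hh := P.h_sub_one_pos
  have e : 2 * P.mu * P.q * ((P.h : ℝ) - 1) =
      ((((P.h : ℤ) - 1) * (P.a + P.b * (2 - P.l)) - P.b * (P.p - 1) : ℤ) : ℝ) := by
    push_cast
    unfold mu sigma
    field_simp
    ring
  have hpos : 0 < 2 * P.mu * P.q * ((P.h : ℝ) - 1) := by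
    have : 0 < P.mu := by unfold mu; linarith [hrc.2]
    positivity
  have hnn : 0 ≤ (((P.h : ℤ) - 1) * (P.a + P.b * (2 - P.l)) - P.b * (P.p - 1) : ℤ) := by
    have h3 := hpos
    rw [e] at h3
    exact le_of_lt (by exact_mod_cast h3)
  unfold M
  obtain ⟨m, hm⟩ := Int.eq_ofNat_of_zero_le hnn
  rw [e, hm, Int.cast_natCast, Nat.floor_natCast]

end PerturbedOscillator

/-- The energy-angle variables of the unperturbed Hamiltonian system above the energy `E₀`, an
integer resonance order `ϰ ≥ 1` (field `kap`) and the resonant energy `I_*(t)`. All fields that are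
propositions are the equations that determine these objects. -/
structure ResonantFrame (P : PerturbedOscillator) where
  E₀ : ℝ
  X : ℝ → ℝ → ℝ
  Y : ℝ → ℝ → ℝ
  om : ℝ → ℝ
  kap : ℕ
  E₁ : ℝ
  t₁ : ℝ
  Istar : ℝ → ℝ
  E₀_pos : 0 < E₀
  /-- the level lines `H = E` with `E > E₀` contain no fixed points (so they are closed curves) -/
  no_fixed_point : ∀ x, E₀ < P.U x → deriv P.U x ≠ 0
  om_pos : ∀ E > E₀, 0 < om E
  /-- `ω(E) ∂_φ X = ∂_Y H(X,Y)` -/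
  X_deriv : ∀ E > E₀, ∀ φ, HasDerivAt (fun φ' => X φ' E) (Y φ E / om E) φ
  /-- `ω(E) ∂_φ Y = - ∂_X H(X,Y)` -/
  Y_deriv : ∀ E > E₀, ∀ φ, HasDerivAt (fun φ' => Y φ' E) (-(deriv P.U (X φ E)) / om E) φ
  energy : ∀ E > E₀, ∀ φ, P.H (X φ E) (Y φ E) = E
  /-- the angle is counted from the right turning point `(x_+(E), 0)` -/
  X_zero : ∀ E > E₀, 0 < X 0 E
  Y_zero : ∀ E > E₀, Y 0 E = 0
  periodic : ∀ E > E₀, Function.Periodic (fun φ => (X φ E, Y φ E)) (2 * Real.pi)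
  /-- `2π` is the least period in `φ`, that is, `ω(E) = 2π / T(E)` -/
  least_period : ∀ E > E₀, ∀ c > 0, Function.Periodic (fun φ => (X φ E, Y φ E)) c →
    2 * Real.pi ≤ c
  kap_pos : 1 ≤ kap
  E₀_lt_E₁ : E₀ < E₁
  om_deriv_pos : ∀ E ≥ E₁, 0 < deriv om E
  t₁_pos : 0 < t₁
  Istar_ge : ∀ t ≥ t₁, E₁ ≤ Istar t
  /-- the resonance equation `ω(I_*(t)) = S'(t)/ϰ` -/
  Istar_eq : ∀ t ≥ t₁, om (Istar t) = deriv P.S t / kap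

/-- Coefficients of an asymptotic expansion `Φ(τ) = ∑_K τ^(-K/N) c_K(ϑ τ)`, `τ → ∞`, with
coefficients `c_K(ζ)` of period `per` in `ζ`: `c_K(ζ)` is the limit of
`τ^(K/N) (Φ(τ) - ∑_{j<K} τ^(-j/N) c_j(ζ))` along the sequence `τ = (ζ + m per)/ϑ`, `m → ∞`. -/
def asympCoeff (N : ℕ) (vth per : ℝ) (Φ : ℝ → ℝ) (K : ℕ) (ζ : ℝ) : ℝ :=
  limUnder atTop (fun m : ℕ =>
    ((ζ + m * per) / vth) ^ ((K : ℝ) / N) *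
      (Φ ((ζ + m * per) / vth) -
        ∑ j : Fin K, ((ζ + m * per) / vth) ^ (-((j : ℝ) / N)) * asympCoeff N vth per Φ j ζ))
termination_by K
decreasing_by exact j.2

/-- The average of a function of period `per`. -/
def periodAvg (per : ℝ) (c : ℝ → ℝ) : ℝ := (∫ x in (0 : ℝ)..per, c x) / per

/-- The zero-mean solution `w` of `ϑ w' = ⟨c⟩ - c`. -/
def zeroMeanPrimitive (vth per : ℝ) (c : ℝ → ℝ) (ζ : ℝ) : ℝ :=
  -(1 / vth) * (∫ x in (0 : ℝ)..ζ, (c x - periodAvg per c)) -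
    periodAvg per (fun z => -(1 / vth) * ∫ x in (0 : ℝ)..z, (c x - periodAvg per c))

/-- One order of the averaging procedure: `ρ_K(r,θ,ζ)`, `ψ_K(r,θ,ζ)`, `Λ_K(r,θ)`, `Ω_K(r,θ)`. -/
structure AvgTerm where
  rho : ℝ → ℝ → ℝ → ℝ
  psi : ℝ → ℝ → ℝ → ℝ
  Lam : ℝ → ℝ → ℝ
  Om : ℝ → ℝ → ℝ

/-- With `e = τ^(-1/N)`: the total derivative, along
`dr/dτ = e^M ∑_j e^j A_j`, `dθ/dτ = e^M ∑_j e^j B_j`, `dζ/dτ = ϑ`, of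
`r + ∑_{j<K} e^(M+j) ρ_j`, without the terms `ϑ ∂_ζ ρ_j`, minus the averaged right-hand side
`∑_{j<K} e^(M+j) Λ_j` taken at the transformed point, all divided by `e^M`. -/
def mismatchR (M N : ℕ) (A B : ℕ → ℝ → ℝ → ℝ → ℝ) (K : ℕ) (prev : Fin K → AvgTerm)
    (r θ ζ e : ℝ) : ℝ :=
  (∑ j ∈ Finset.range (K + 1), e ^ j * A j r θ ζ) *
      (1 + ∑ j : Fin K, e ^ (M + j) * deriv (fun r' => (prev j).rho r' θ ζ) r)
    + (∑ j ∈ Finset.range (K + 1), e ^ j * B j r θ ζ) *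
      (∑ j : Fin K, e ^ (M + j) * deriv (fun θ' => (prev j).rho r θ' ζ) θ)
    - ∑ j : Fin K, ((M + j : ℕ) : ℝ) / N * e ^ (N + j) * (prev j).rho r θ ζ
    - ∑ j : Fin K, e ^ (j : ℕ) *
        (prev j).Lam (r + ∑ i : Fin K, e ^ (M + i) * (prev i).rho r θ ζ)
          (θ + ∑ i : Fin K, e ^ (M + i) * (prev i).psi r θ ζ)

/-- The same for `θ + ∑_{j<K} e^(M+j) ψ_j` and `∑_{j<K} e^(M+j) Ω_j`. -/
def mismatchPsi (M N : ℕ) (A B : ℕ → ℝ → ℝ → ℝ → ℝ) (K : ℕ) (prev : Fin K → AvgTerm)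
    (r θ ζ e : ℝ) : ℝ :=
  (∑ j ∈ Finset.range (K + 1), e ^ j * A j r θ ζ) *
      (∑ j : Fin K, e ^ (M + j) * deriv (fun r' => (prev j).psi r' θ ζ) r)
    + (∑ j ∈ Finset.range (K + 1), e ^ j * B j r θ ζ) *
      (1 + ∑ j : Fin K, e ^ (M + j) * deriv (fun θ' => (prev j).psi r θ' ζ) θ)
    - ∑ j : Fin K, ((M + j : ℕ) : ℝ) / N * e ^ (N + j) * (prev j).psi r θ ζ
    - ∑ j : Fin K, e ^ (j : ℕ) *
        (prev j).Om (r + ∑ i : Fin K, e ^ (M + i) * (prev i).rho r θ ζ)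
          (θ + ∑ i : Fin K, e ^ (M + i) * (prev i).psi r θ ζ)

/-- `A_K + 𝔄_K`: the coefficient of `e^K` in `mismatchR`. -/
def matchR (M N : ℕ) (A B : ℕ → ℝ → ℝ → ℝ → ℝ) (K : ℕ) (prev : Fin K → AvgTerm)
    (r θ ζ : ℝ) : ℝ :=
  iteratedDeriv K (mismatchR M N A B K prev r θ ζ) 0 / (K.factorial : ℝ)

/-- `B_K + 𝔅_K`: the coefficient of `e^K` in `mismatchPsi`. -/
def matchPsi (M N : ℕ) (A B : ℕ → ℝ → ℝ → ℝ → ℝ) (K : ℕ) (prev : Fin K → AvgTerm)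
    (r θ ζ : ℝ) : ℝ :=
  iteratedDeriv K (mismatchPsi M N A B K prev r θ ζ) 0 / (K.factorial : ℝ)

/-- The averaging recursion: `Λ_K = ⟨A_K + 𝔄_K⟩`, `ϑ ∂_ζ ρ_K = Λ_K - A_K - 𝔄_K`, `⟨ρ_K⟩ = 0`, and
likewise for `Ω_K`, `ψ_K`. -/
def avgTerm (M N : ℕ) (vth per : ℝ) (A B : ℕ → ℝ → ℝ → ℝ → ℝ) (K : ℕ) : AvgTerm :=
  let prev : Fin K → AvgTerm := fun j => avgTerm M N vth per A B j
  { rho := fun r θ => zeroMeanPrimitive vth per (matchR M N A B K prev r θ)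
    psi := fun r θ => zeroMeanPrimitive vth per (matchPsi M N A B K prev r θ)
    Lam := fun r θ => periodAvg per (matchR M N A B K prev r θ)
    Om := fun r θ => periodAvg per (matchPsi M N A B K prev r θ) }
termination_by K
decreasing_by exact j.2

namespace ResonantFrame

variable {P : PerturbedOscillator} (Q : ResonantFrame P)

/-- `dI/dt = t^(-a/q) F(I,φ,t)`. -/
def F (I φ t : ℝ) : ℝ :=
  P.f (Q.X φ I) (Q.Y φ I) (P.S t) t * deriv P.U (Q.X φ I)
    + P.g (Q.X φ I) (Q.Y φ I) (P.S t) t * Q.Y φ I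

/-- `dφ/dt = ω(I) + t^(-a/q) G(I,φ,t)`. -/
def G (I φ t : ℝ) : ℝ :=
  Q.om I * (P.f (Q.X φ I) (Q.Y φ I) (P.S t) t * deriv (fun E => Q.Y φ E) I
    - P.g (Q.X φ I) (Q.Y φ I) (P.S t) t * deriv (fun E => Q.X φ E) I)

/-- The time `t = (ν τ)^(1/ν)`, inverse to `τ = t^ν / ν`. -/
def time (_ : ResonantFrame P) (τ : ℝ) : ℝ := (P.nu * τ) ^ (1 / P.nu)

/-- The fast phase `ζ(τ) = S(t)`. -/
def zeta (τ : ℝ) : ℝ := P.S (Q.time τ)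

/-- `I = I_*(t) (1 + t^(-μ) r)^(2h)`. -/
def energyOf (r t : ℝ) : ℝ := Q.Istar t * (1 + t ^ (-P.mu) * r) ^ (2 * P.h)

/-- `dr/dτ`, obtained by substituting `I = I_*(t) (1 + t^(-μ) r)^(2h)`, `φ = θ + S(t)/ϰ`,
`τ = t^ν/ν` into the equations for `I` and `φ`, i.e. by differentiating
`r = t^μ ((I/I_*(t))^(1/(2h)) - 1)` and dividing by `dτ/dt = t^(ν-1)`. -/
def rField (r θ τ : ℝ) : ℝ :=
  let t := Q.time τ
  let I := Q.energyOf r t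
  let φ := θ + P.S t / Q.kap
  t ^ (1 - P.nu) *
    (P.mu * r / t + t ^ P.mu * (1 + t ^ (-P.mu) * r) / (2 * P.h) *
      (t ^ (-((P.a : ℝ) / P.q)) * Q.F I φ t / I - deriv Q.Istar t / Q.Istar t))

/-- `dθ/dτ` in the same variables. -/
def thetaField (r θ τ : ℝ) : ℝ :=
  let t := Q.time τ
  let I := Q.energyOf r t
  let φ := θ + P.S t / Q.kap
  t ^ (1 - P.nu) *
    (Q.om I + t ^ (-((P.a : ℝ) / P.q)) * Q.G I φ t - deriv P.S t / Q.kap)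

/-- The period `2πϰ` of the averaging in `ζ`. -/
def period : ℝ := 2 * Real.pi * Q.kap

/-- The coefficients `A_K(r,θ,ζ)` of the expansion of `τ^(M/N) dr/dτ`. -/
def Acoeff (K : ℕ) (r θ ζ : ℝ) : ℝ :=
  asympCoeff P.N P.vartheta Q.period
    (fun τ => τ ^ ((P.M : ℝ) / P.N) * Q.rField r θ τ) K ζ

/-- The coefficients `B_K(r,θ,ζ)` of the expansion of `τ^(M/N) dθ/dτ`. -/
def Bcoeff (K : ℕ) (r θ ζ : ℝ) : ℝ :=
  asympCoeff P.N P.vartheta Q.period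
    (fun τ => τ ^ ((P.M : ℝ) / P.N) * Q.thetaField r θ τ) K ζ

/-- The terms `ρ_K, ψ_K, Λ_K, Ω_K` of the averaging procedure. -/
def term (K : ℕ) : AvgTerm :=
  avgTerm P.M P.N P.vartheta Q.period Q.Acoeff Q.Bcoeff K

def Lam (K : ℕ) (R Ψ : ℝ) : ℝ := (Q.term K).Lam R Ψ

def Om (K : ℕ) (R Ψ : ℝ) : ℝ := (Q.term K).Om R Ψ

/-- `τ^(-(M+K)/N)`. -/
def weight (_ : ResonantFrame P) (K : ℕ) (τ : ℝ) : ℝ := τ ^ (-(((P.M : ℝ) + K) / P.N))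

/-- The near-identity transformation, first component. -/
def Rn (n : ℕ) (r θ τ : ℝ) : ℝ :=
  r + ∑ K ∈ Finset.range (n + 1), Q.weight K τ * (Q.term K).rho r θ (Q.zeta τ)

/-- The near-identity transformation, second component. -/
def Psin (n : ℕ) (r θ τ : ℝ) : ℝ :=
  θ + ∑ K ∈ Finset.range (n + 1), Q.weight K τ * (Q.term K).psi r θ (Q.zeta τ)

/-- The total derivative of a function `W(r,θ,τ)` along the system for `(r,θ)`. -/
def totalDeriv (W : ℝ → ℝ → ℝ → ℝ) (r θ τ : ℝ) : ℝ :=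
  deriv (fun r' => W r' θ τ) r * Q.rField r θ τ
    + deriv (fun θ' => W r θ' τ) θ * Q.thetaField r θ τ
    + deriv (fun τ' => W r θ τ') τ

/-- The near-identity transformation at time `τ` as a map `(r,θ) ↦ (R,Ψ)`. -/
def nearId (n : ℕ) (τ : ℝ) (z : ℝ × ℝ) : ℝ × ℝ := (Q.Rn n z.1 z.2 τ, Q.Psin n z.1 z.2 τ)

/-- The strip `|r| ≤ r₀` on which the transformation is inverted. -/
def strip (r₀ : ℝ) : Set (ℝ × ℝ) := {z | |z.1| ≤ r₀}

/-- The preimage `(r,θ)`, `|r| ≤ r₀`, of `(R,Ψ)` under the near-identity transformation. -/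
def preimage (n : ℕ) (r₀ R Ψ τ : ℝ) : ℝ × ℝ :=
  Function.invFunOn (Q.nearId n τ) (strip r₀) (R, Ψ)

/-- The remainder in the equation for `R`. -/
def LamRem (n : ℕ) (r₀ R Ψ τ : ℝ) : ℝ :=
  Q.totalDeriv (Q.Rn n) (Q.preimage n r₀ R Ψ τ).1 (Q.preimage n r₀ R Ψ τ).2 τ
    - ∑ K ∈ Finset.range (n + 1), Q.weight K τ * Q.Lam K R Ψ

/-- The remainder in the equation for `Ψ`. -/
def OmRem (n : ℕ) (r₀ R Ψ τ : ℝ) : ℝ :=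
  Q.totalDeriv (Q.Psin n) (Q.preimage n r₀ R Ψ τ).1 (Q.preimage n r₀ R Ψ τ).2 τ
    - ∑ K ∈ Finset.range (n + 1), Q.weight K τ * Q.Om K R Ψ

/-- `(R,Ψ)` solves the full averaged system on the time set `J`; at each time the point lies in the
image of the strip `|r| ≤ r₀`, where the system is defined. -/
def IsAveragedSolution (n : ℕ) (r₀ : ℝ) (R Ψ : ℝ → ℝ) (J : Set ℝ) : Prop :=
  ∀ τ ∈ J, (R τ, Ψ τ) ∈ Q.nearId n τ '' strip r₀ ∧
    HasDerivWithinAt R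
      (∑ K ∈ Finset.range (n + 1), Q.weight K τ * Q.Lam K (R τ) (Ψ τ)
        + Q.LamRem n r₀ (R τ) (Ψ τ) τ) J τ ∧
    HasDerivWithinAt Ψ
      (∑ K ∈ Finset.range (n + 1), Q.weight K τ * Q.Om K (R τ) (Ψ τ)
        + Q.OmRem n r₀ (R τ) (Ψ τ) τ) J τ

/-- `(ϱ,φ)` solves the truncated system for `τ > τ₀`. -/
def IsTruncatedSolution (L n : ℕ) (ϱ φ : ℝ → ℝ) (τ₀ : ℝ) : Prop :=
  ∀ τ > τ₀,
    HasDerivAt ϱ (∑ K ∈ Finset.Icc L n, Q.weight K τ * Q.Lam K (ϱ τ) (φ τ)) τ ∧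
    HasDerivAt φ (∑ K ∈ Finset.range (n + 1), Q.weight K τ * Q.Om K (ϱ τ) (φ τ)) τ

/-- The asymptotic expansions `ϱ = ∑_{K ≥ 0} ϱ_K τ^(-(M+K)/N)`,
`φ = φ₀ + ∑_{K ≥ 1} φ_K τ^(-K/N)` as `τ → ∞`, with constant coefficients. -/
def HasLockedExpansion (φ₀ : ℝ) (ϱ φ : ℝ → ℝ) : Prop :=
  ∃ c d : ℕ → ℝ, d 0 = φ₀ ∧ ∀ m : ℕ,
    ((fun τ => ϱ τ - ∑ K ∈ Finset.range (m + 1), c K * Q.weight K τ)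
      =O[atTop] fun τ => Q.weight (m + 1) τ) ∧
    ((fun τ => φ τ - ∑ K ∈ Finset.range (m + 1), d K * τ ^ (-((K : ℝ) / P.N)))
      =O[atTop] fun τ => τ ^ (-(((m : ℝ) + 1) / P.N)))

/-- `0 ≤ L ≤ min(N-M, 2M-1)`, `Λ_K ≡ 0` for `K < L`, and `Λ_L ≢ 0`. -/
def IsLeadingOrder (L : ℕ) : Prop :=
  L + P.M ≤ P.N ∧ L + 1 ≤ 2 * P.M ∧ (∀ K < L, ∀ R Ψ, Q.Lam K R Ψ = 0) ∧ ∃ R Ψ, Q.Lam L R Ψ ≠ 0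

/-- `λ_L`, the derivative of `Λ_L^0(φ) = Λ_L(0,φ)` at `φ₀`. -/
def lamL (L : ℕ) (φ₀ : ℝ) : ℝ := deriv (fun φ => Q.Lam L 0 φ) φ₀

/-- The divergence `∂_ϱ Λ_K + ∂_φ Ω_K`. -/
def divergence (K : ℕ) (ϱ φ : ℝ) : ℝ :=
  deriv (fun x => Q.Lam K x φ) ϱ + deriv (fun y => Q.Om K ϱ y) φ

/-- `γ_D`. -/
def gam (D : ℕ) (φ₀ : ℝ) : ℝ := Q.divergence D 0 φ₀

end ResonantFrame

end

/-! Put e = τ^(-1/N) and s = e^(1/2). The heart of the matter is that the averaged system is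
Hamiltonian up to order D. Write Ω_K = ∂_ϱ H_K and Λ_K = E_K - ∂_φ H_K with E_K = 0 on the line ϱ =
0 (`exists_potentials`). Then ∂_ϱ E_K is the divergence, so E_K = 0 for K < D, while ∂_ϱ E_D(0,φ₀) =
γ_D is the damping rate.

Let p be the reference solution, z the displacement from it, and V the second-order Taylor remainder
at p of the Hamiltonian ∑ e^K H_K. Because Ω_0 = c ϱ with c > 0, and λ_L < 0, V is close to (c z₁² -
λ_L e^L z₂²)/2 (`isBigO_V`). This is definite, but its second weight degenerates. The Lyapunov
function is therefore e^(-L) (V + κ e^D z₁ z₂), and the displacement is measured by W = max(|z₁|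
e^(-L/2), |z₂|). In its derivative the Hamiltonian terms cancel, and up to the factor e^(-L) the
leading part is e^(M+D) ((γ_D + κ) c z₁² + κ λ_L e^L z₂²) + e^N L c z₁² / (2N) (`isBigO_bracket`).
The last term comes from the time-dependent weights, and the cross term with κ passes the damping
from z₁ to z₂. If M + D < N the last term is negligible; if M + D = N it shifts γ_D by L/(2N); in
both cases a small κ > 0 makes the form negative definite. If M + D > N and L = 0, κ = 0 suffices:
the derivative is at most a multiple of s^(2N+1) = τ^(-1-1/(2N)), which is integrable
(`exists_bracket_bound`).

The remaining errors do not vanish with z: the velocity of p is O(e^(N+1)) (`exists_reference`) and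
the remainders of the full system are O(e^(M+n+1)) with n ≥ L + D (`remainder_bound`). Hence the
sign of the derivative is controlled only in a shell η ≤ W ≤ w and for large τ. This is enough for a
barrier argument (`LockedSystem.stability`), which gives stability rather than decay.

The remainder bound rests on the expansions of the (r,θ)-system. At energy E = z^(2h), the scaling x
= z ξ, y = z^h η turns the level curve into one that depends smoothly on 1/z up to 1/z = 0. The
energy-angle variables, the resonant energy and the right-hand sides thus become smooth functions of
e, with periodic dependence on θ and ζ, up to O(e^(n+1)) (`exists_scaled`, `nonempty_scaling`,
`exists_isExp_rField`, `exists_isExp_thetaField`). The averaging recursion annihilates the Taylor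
coefficients of the error up to order n (`tcoef_fullMismatch`).

For existence the (r,θ)-system is cut off to a bounded smooth field, whose solutions are global
(`exists_cutoff_field`, `exists_solution_Ici`). The near-identity map sends them to solutions of the
averaged system while |r| ≤ r₀ (`hasDerivWithinAt_nearId`), and the stability estimate keeps |r|
well below r₀ for ever. -/

set_option linter.unusedSectionVars false

/-! ### Smooth parameter integrals, Hadamard quotients and Taylor coefficients -/

section ParametricIntegrals

variable {G : Type} [NormedAddCommGroup G] [NormedSpace ℝ G] [ProperSpace G]

/-- Properness of `G` makes the closed unit ball around the parameter compact, so the continuous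
derivative is bounded there by a constant. This constant dominates in the differentiation under the
integral. -/
theorem hasFDerivAt_intervalIntegral_param {E : Type} [NormedAddCommGroup E] [NormedSpace ℝ E]
    {f : G × ℝ → E} (hf : ContDiff ℝ 1 f) (a b : ℝ) (x₀ : G) :
    HasFDerivAt (fun x => ∫ t in a..b, f (x, t))
      (∫ t in a..b, (fderiv ℝ f (x₀, t)).comp (ContinuousLinearMap.inl ℝ G ℝ)) x₀ := by
  have hcont : Continuous (fun p : G × ℝ =>
      (fderiv ℝ f p).comp (ContinuousLinearMap.inl ℝ G ℝ)) :=
    (hf.continuous_fderiv one_ne_zero).clm_comp continuous_const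
  obtain ⟨C, hC⟩ := ((isCompact_closedBall x₀ 1).prod isCompact_uIcc).exists_bound_of_continuousOn
    (hcont.continuousOn (s := Metric.closedBall x₀ 1 ×ˢ uIcc a b))
  refine intervalIntegral.hasFDerivAt_integral_of_dominated_of_fderiv_le
    (F' := fun x t => (fderiv ℝ f (x, t)).comp (ContinuousLinearMap.inl ℝ G ℝ))
    (bound := fun _ => C)
    (Metric.closedBall_mem_nhds x₀ one_pos) (.of_forall fun x => ?_) ?_ ?_ ?_ ?_ ?_
  · exact (hf.continuous.comp (by fun_prop : Continuous fun t : ℝ => (x, t))).aestronglyMeasurable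
  · exact (hf.continuous.comp (by fun_prop : Continuous fun t : ℝ => (x₀, t))).intervalIntegrable _ _
  · exact (hcont.comp (by fun_prop : Continuous fun t : ℝ => (x₀, t))).aestronglyMeasurable
  · refine .of_forall fun t ht x hx => hC (x, t) ⟨hx, uIoc_subset_uIcc ht⟩
  · exact intervalIntegrable_const
  · refine .of_forall fun t _ x _ => ?_
    have h1 : HasFDerivAt f (fderiv ℝ f (x, t)) (x, t) :=
      (hf.differentiable one_ne_zero _).hasFDerivAt
    exact h1.comp x (hasFDerivAt_prodMk_left x t)

/-- Induction on the order. The target space is quantified inside the statement because the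
induction hypothesis is applied to the derivative, whose values are linear maps. -/
theorem contDiff_nat_intervalIntegral_param (n : ℕ) :
    ∀ {E : Type} [NormedAddCommGroup E] [NormedSpace ℝ E] {f : G × ℝ → E},
      ContDiff ℝ n f → ∀ a b : ℝ, ContDiff ℝ n (fun x => ∫ t in a..b, f (x, t)) := by
  induction n with
  | zero =>
    intro E _ _ f hf a b
    rw [Nat.cast_zero, contDiff_zero] at hf ⊢
    exact intervalIntegral.continuous_parametric_intervalIntegral_of_continuous'
      (f := fun x t => f (x, t)) (by simpa [Function.uncurry_def] using! hf) a b
  | succ n ih =>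
    intro E _ _ f hf a b
    have h1 : ContDiff ℝ 1 f := hf.of_le (by exact_mod_cast Nat.le_add_left 1 n)
    push_cast
    refine (contDiff_succ_iff_hasFDerivAt).2 ⟨_, ?_, hasFDerivAt_intervalIntegral_param h1 a b⟩
    refine ih (f := fun p => (fderiv ℝ f p).comp (ContinuousLinearMap.inl ℝ G ℝ)) ?_ a b
    exact (hf.fderiv_right (by push_cast; rfl)).clm_comp contDiff_const

theorem contDiff_intervalIntegral_param {E : Type} [NormedAddCommGroup E] [NormedSpace ℝ E]
    {f : G × ℝ → E} (hf : ContDiff ℝ ∞ f) (a b : ℝ) :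
    ContDiff ℝ ∞ (fun x => ∫ t in a..b, f (x, t)) :=
  contDiff_infty.2 fun n => contDiff_nat_intervalIntegral_param n (contDiff_infty.1 hf n) a b

/-- The substitution t = p.2 · s moves the variable endpoint into the integrand, which leaves an
integral over a fixed interval. -/
theorem contDiff_primitive_param {f : G × ℝ → ℝ} (hf : ContDiff ℝ ∞ f) :
    ContDiff ℝ ∞ (fun p : G × ℝ => ∫ t in (0 : ℝ)..p.2, f (p.1, t)) := by
  have h : (fun p : G × ℝ => ∫ t in (0 : ℝ)..p.2, f (p.1, t)) =
      fun p => p.2 * ∫ s in (0 : ℝ)..1, f (p.1, p.2 * s) := by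
    funext p
    have := intervalIntegral.smul_integral_comp_mul_left (a := 0) (b := 1)
      (fun t => f (p.1, t)) p.2
    simpa using this.symm
  rw [h]
  refine contDiff_snd.mul (contDiff_intervalIntegral_param
    (f := fun x : (G × ℝ) × ℝ => f (x.1.1, x.1.2 * x.2)) ?_ 0 1)
  fun_prop

/-- The partial derivative with respect to the last variable. -/
noncomputable def lastDeriv (u : G × ℝ → ℝ) (p : G × ℝ) : ℝ := deriv (fun e => u (p.1, e)) p.2

theorem hasDerivAt_last {u : G × ℝ → ℝ} (hu : ContDiff ℝ ∞ u) (x : G) (e : ℝ) :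
    HasDerivAt (fun e => u (x, e)) (lastDeriv u (x, e)) e := by
  have : Differentiable ℝ (fun e : ℝ => u (x, e)) :=
    (hu.comp (by fun_prop : ContDiff ℝ ∞ fun e : ℝ => (x, e))).differentiable (by simp)
  exact (this e).hasDerivAt

theorem lastDeriv_eq {u : G × ℝ → ℝ} (hu : ContDiff ℝ ∞ u) (p : G × ℝ) :
    lastDeriv u p = fderiv ℝ u p (0, 1) := by
  have h1 : HasFDerivAt u (fderiv ℝ u p) (p.1, p.2) := (hu.differentiable (by simp) p).hasFDerivAt
  have h2 : HasDerivAt (fun e : ℝ => (p.1, e)) ((0 : G), (1 : ℝ)) p.2 :=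
    (hasDerivAt_const _ _).prodMk (hasDerivAt_id _)
  exact (h1.comp_hasDerivAt p.2 h2).deriv

theorem contDiff_lastDeriv {u : G × ℝ → ℝ} (hu : ContDiff ℝ ∞ u) : ContDiff ℝ ∞ (lastDeriv u) := by
  have : lastDeriv u = fun p => fderiv ℝ u p (0, 1) := funext (lastDeriv_eq hu)
  rw [this]
  exact (hu.fderiv_right (m := ∞) (by simp)).clm_apply contDiff_const

/-- The quotient `(u(x,e) - u(x,0)) / e`, as a smooth function. -/
noncomputable def hadQ (u : G × ℝ → ℝ) (p : G × ℝ) : ℝ :=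
  ∫ s in (0 : ℝ)..1, lastDeriv u (p.1, p.2 * s)

theorem contDiff_hadQ {u : G × ℝ → ℝ} (hu : ContDiff ℝ ∞ u) : ContDiff ℝ ∞ (hadQ u) := by
  refine contDiff_intervalIntegral_param
    (f := fun x : (G × ℝ) × ℝ => lastDeriv u (x.1.1, x.1.2 * x.2)) ?_ 0 1
  exact (contDiff_lastDeriv hu).comp (by fun_prop)

/-- Hadamard's lemma: the fundamental theorem of calculus on [0,e], rescaled to [0,1]. -/
theorem eq_add_mul_hadQ {u : G × ℝ → ℝ} (hu : ContDiff ℝ ∞ u) (x : G) (e : ℝ) :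
    u (x, e) = u (x, 0) + e * hadQ u (x, e) := by
  have h := intervalIntegral.smul_integral_comp_mul_left (a := 0) (b := 1)
      (fun t => lastDeriv u (x, t)) e
  have hc : Continuous fun t : ℝ => lastDeriv u (x, t) :=
    (contDiff_lastDeriv hu).continuous.comp (by fun_prop)
  have h2 := intervalIntegral.integral_eq_sub_of_hasDerivAt (a := 0) (b := e)
    (fun t _ => hasDerivAt_last hu x t) (hc.intervalIntegrable _ _)
  simp only [smul_eq_mul, mul_zero, mul_one] at h
  simp only [hadQ]
  rw [h, h2]; ring

/-- This passes periodicity in the parameters from a function to its quotients and Taylor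
coefficients. -/
theorem hadQ_congr {u : G × ℝ → ℝ} {x y : G} (h : ∀ e, u (x, e) = u (y, e)) (e : ℝ) :
    hadQ u (x, e) = hadQ u (y, e) := by
  simp only [hadQ, lastDeriv, h]

theorem hadQ_iterate_congr {u : G × ℝ → ℝ} {x y : G} (h : ∀ e, u (x, e) = u (y, e)) (k : ℕ)
    (e : ℝ) : hadQ^[k] u (x, e) = hadQ^[k] u (y, e) := by
  induction k generalizing e with
  | zero => exact h e
  | succ k ih => simp only [Function.iterate_succ_apply']; exact hadQ_congr ih e

theorem contDiff_hadQ_iterate {u : G × ℝ → ℝ} (hu : ContDiff ℝ ∞ u) (k : ℕ) :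
    ContDiff ℝ ∞ (hadQ^[k] u) := by
  induction k with
  | zero => exact hu
  | succ k ih => simp only [Function.iterate_succ_apply']; exact contDiff_hadQ ih

/-- The `k`-th Taylor coefficient in the last variable at `0`. -/
noncomputable def tcoef (u : G × ℝ → ℝ) (k : ℕ) (x : G) : ℝ := hadQ^[k] u (x, 0)

theorem contDiff_tcoef {u : G × ℝ → ℝ} (hu : ContDiff ℝ ∞ u) (k : ℕ) :
    ContDiff ℝ ∞ (tcoef u k) :=
  (contDiff_hadQ_iterate hu k).comp (by fun_prop : ContDiff ℝ ∞ fun x : G => (x, (0 : ℝ)))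

/-- Iterated Hadamard's lemma. This form of the remainder is again smooth and periodic in the
parameters, so it can be bounded uniformly in all phases. -/
theorem taylor_hadQ {u : G × ℝ → ℝ} (hu : ContDiff ℝ ∞ u) (n : ℕ) (x : G) (e : ℝ) :
    u (x, e) = ∑ j ∈ Finset.range n, e ^ j * tcoef u j x + e ^ n * hadQ^[n] u (x, e) := by
  induction n with
  | zero => simp
  | succ n ih =>
    rw [ih, Finset.sum_range_succ, eq_add_mul_hadQ (contDiff_hadQ_iterate hu n) x e,
      Function.iterate_succ_apply', tcoef]
    ring

end ParametricIntegrals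

section TaylorCoefficients

theorem iteratedDeriv_pow_mul_zero {f : ℝ → ℝ} (hf : ContDiff ℝ ∞ f) {k n : ℕ} (h : k < n) :
    iteratedDeriv k (fun e => e ^ n * f e) 0 = 0 := by
  have := iteratedDeriv_mul (n := k) (x := (0 : ℝ)) (f := fun e : ℝ => e ^ n) (g := f)
    (by fun_prop) ((hf.of_le (by exact_mod_cast le_top)).contDiffAt)
  have h2 : (fun e => e ^ n * f e) = (fun e : ℝ => e ^ n) * f := rfl
  rw [h2, this]
  refine Finset.sum_eq_zero fun i hi => ?_
  rw [Finset.mem_range] at hi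
  rw [iteratedDeriv_fun_pow_zero, if_neg (by omega)]
  simp

theorem iteratedDeriv_taylor {f g : ℝ → ℝ} {c : ℕ → ℝ} {n : ℕ} (hg : ContDiff ℝ ∞ g)
    (h : ∀ e, f e = ∑ j ∈ Finset.range n, e ^ j * c j + e ^ n * g e) {k : ℕ} (hk : k < n) :
    iteratedDeriv k f 0 / (k.factorial : ℝ) = c k := by
  have hf : f = (fun e => ∑ j ∈ Finset.range n, c j * e ^ j) + fun e => e ^ n * g e := by
    funext e; simp [h e, mul_comm]
  have hg' : ContDiffAt ℝ k g 0 := (hg.of_le (by exact_mod_cast le_top)).contDiffAt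
  rw [hf, iteratedDeriv_add (by fun_prop) (by fun_prop), iteratedDeriv_pow_mul_zero hg hk,
    iteratedDeriv_fun_sum (fun i _ => by fun_prop), Finset.sum_eq_single k]
  · rw [iteratedDeriv_const_mul_field, iteratedDeriv_fun_pow_zero, if_pos rfl]
    field_simp
    simp
  · intro b _ hb
    rw [iteratedDeriv_const_mul_field, iteratedDeriv_fun_pow_zero, if_neg (by omega)]
    simp
  · intro h; exact absurd (Finset.mem_range.2 hk) h

variable {G : Type} [NormedAddCommGroup G] [NormedSpace ℝ G] [ProperSpace G]

/-- The averaging recursion extracts coefficients by `iteratedDeriv`, one parameter point at a time.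
Identifying them with `tcoef` shows that they are jointly smooth in the parameters. -/
theorem iteratedDeriv_eq_tcoef {u : G × ℝ → ℝ} (hu : ContDiff ℝ ∞ u) (k : ℕ) (x : G) :
    iteratedDeriv k (fun e => u (x, e)) 0 / (k.factorial : ℝ) = tcoef u k x :=
  iteratedDeriv_taylor (n := k + 1) (g := fun e => hadQ^[k+1] u (x, e))
    ((contDiff_hadQ_iterate hu (k + 1)).comp (by fun_prop)) (taylor_hadQ hu (k + 1) x) (by omega)

end TaylorCoefficients

/-! ### Cut-offs and smooth dependence of roots -/

/-- A smooth bounded function that is the identity near `0`. -/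
theorem exists_smooth_clamp {δ : ℝ} (hδ : 0 < δ) :
    ∃ β : ℝ → ℝ, ContDiff ℝ ∞ β ∧ (∀ x, |β x| < δ) ∧ ∀ x, |x| ≤ δ / 2 → β x = x := by
  let b : ContDiffBump (0 : ℝ) := ⟨δ / 2, δ, by linarith, by linarith⟩
  refine ⟨fun x => x * b x, contDiff_id.mul b.contDiff, fun x => ?_, fun x hx => ?_⟩
  · change |x * b x| < δ
    rcases lt_or_ge |x| δ with h | h
    · rw [abs_mul, abs_of_nonneg b.nonneg]
      calc |x| * b x ≤ |x| * 1 := by gcongr; exact b.le_one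
        _ < δ := by linarith
    · rw [b.zero_of_le_dist (by simpa using h)]; simpa using hδ
  · change x * b x = x
    rw [b.one_of_mem_closedBall (by simpa using hx), mul_one]

section ImplicitRoot

variable {G : Type} [NormedAddCommGroup G] [NormedSpace ℝ G] [ProperSpace G]

/-- Near a point with invertible last derivative, the zero set is the graph of the smooth implicit
function. A continuous choice of roots stays on that graph. -/
theorem contDiffAt_root {g : G × ℝ → ℝ} {r : G → ℝ} {x₀ : G} (hg : ContDiff ℝ ∞ g)
    (hr : ContinuousAt r x₀) (h0 : ∀ᶠ x in 𝓝 x₀, g (x, r x) = 0)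
    (hd : lastDeriv g (x₀, r x₀) ≠ 0) : ContDiffAt ℝ ∞ r x₀ := by
  have cdf : ContDiffAt ℝ ∞ g (x₀, r x₀) := hg.contDiffAt
  have hinv : (fderiv ℝ g (x₀, r x₀) ∘L .inr ℝ G ℝ).IsInvertible := by
    have hc : lastDeriv g (x₀, r x₀) = fderiv ℝ g (x₀, r x₀) (0, 1) := lastDeriv_eq hg _
    refine ⟨ContinuousLinearEquiv.unitsEquivAut ℝ (Units.mk0 _ hd), ?_⟩
    ext
    simp [hc]
  have h1 := cdf.eventually_apply_eq_iff_implicitFunction (by simp) hinv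
  have h2 : Tendsto (fun x => (x, r x)) (𝓝 x₀) (𝓝 (x₀, r x₀)) :=
    (continuousAt_id.prodMk hr)
  have h3 := h2.eventually h1
  have h00 : g (x₀, r x₀) = 0 := h0.self_of_nhds
  have h4 : r =ᶠ[𝓝 x₀] cdf.implicitFunction (by simp) hinv := by
    filter_upwards [h3, h0] with x hx hx0
    exact (hx.1 (by rw [hx0, h00])).symm
  exact (cdf.contDiffAt_implicitFunction (by simp) hinv).congr_of_eventuallyEq h4

/-- Only continuity of the root is missing. By monotonicity, g is negative just below and positive
just above the root at x₀; these signs persist for nearby x and enclose the root there. -/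
theorem contDiffAt_root_of_strictMonoOn {g : G × ℝ → ℝ} {r : G → ℝ} {x₀ : G}
    (hg : ContDiff ℝ ∞ g) {a b : ℝ} (ha : a < r x₀) (hb : r x₀ < b)
    (hr : ∀ᶠ x in 𝓝 x₀, r x ∈ Icc a b) (h0 : ∀ᶠ x in 𝓝 x₀, g (x, r x) = 0)
    (hm : ∀ᶠ x in 𝓝 x₀, StrictMonoOn (fun y => g (x, y)) (Icc a b))
    (hd : lastDeriv g (x₀, r x₀) ≠ 0) : ContDiffAt ℝ ∞ r x₀ := by
  refine contDiffAt_root hg ?_ h0 hd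
  have hm0 := hm.self_of_nhds
  have h00 : g (x₀, r x₀) = 0 := h0.self_of_nhds
  rw [ContinuousAt, tendsto_order]
  constructor
  · intro c hc
    set y := max a c
    have hy : y ∈ Icc a b := ⟨le_max_left _ _, (max_lt ha hc).le.trans hb.le⟩
    have hlt : g (x₀, y) < 0 := by
      rw [← h00]; exact hm0 hy ⟨ha.le, hb.le⟩ (max_lt ha hc)
    have hc' : Continuous fun x => g (x, y) := hg.continuous.comp (by fun_prop)
    filter_upwards [hr, h0, hm, hc'.continuousAt.eventually_lt_const hlt] with x h1 h2 h3 h4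
    have : y < r x := (h3.lt_iff_lt hy h1).1 (by simpa [h2] using h4)
    exact (le_max_right _ _).trans_lt this
  · intro c hc
    set y := min b c
    have hy : y ∈ Icc a b := ⟨ha.le.trans (lt_min hb hc).le, min_le_left _ _⟩
    have hlt : 0 < g (x₀, y) := by
      rw [← h00]; exact hm0 ⟨ha.le, hb.le⟩ hy (lt_min hb hc)
    have hc' : Continuous fun x => g (x, y) := hg.continuous.comp (by fun_prop)
    filter_upwards [hr, h0, hm, hc'.continuousAt.eventually_const_lt hlt] with x h1 h2 h3 h4
    have : r x < y := (h3.lt_iff_lt h1 hy).1 (by simpa [h2] using h4)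
    exact this.trans_le (min_le_right _ _)

end ImplicitRoot

/-- Positivity is an open condition, and compactness of K makes the neighbourhood of 0 uniform. -/
theorem exists_pos_of_compact {X : Type} [TopologicalSpace X] {K : Set X} (hK : IsCompact K)
    {F : X × ℝ → ℝ} (hF : Continuous F) (h0 : ∀ x ∈ K, 0 < F (x, 0)) :
    ∃ δ > 0, ∀ e : ℝ, |e| < δ → ∀ x ∈ K, 0 < F (x, e) := by
  have h : ∀ᶠ e in 𝓝 (0 : ℝ), ∀ x ∈ K, 0 < F (x, e) := by
    refine hK.eventually_forall_of_forall_eventually fun x hx => ?_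
    have : Continuous fun z : ℝ × X => F (z.2, z.1) := by fun_prop
    exact (this.continuousAt (x := ((0 : ℝ), x))).eventually_const_lt (h0 x hx)
  obtain ⟨δ, hδ, h⟩ := Metric.eventually_nhds_iff.1 h
  exact ⟨δ, hδ, fun e he => h (by simpa using he)⟩

/-! ### The rescaled potential and its closed level curve -/

/-- The potential in the scaled variables `ξ = x / E^(1/(2h))`, `ε = E^(-1/(2h))`. -/
noncomputable def scaledU (h : ℕ) (u : ℕ → ℝ) (ξ ε : ℝ) : ℝ :=
  ξ ^ (2 * h) / (2 * h) + ∑ i ∈ Finset.Ico 1 (2 * h), u i * ε ^ (2 * h - i) * ξ ^ i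

/-- The derivative of `scaledU` in `ξ`. -/
noncomputable def scaledU' (h : ℕ) (u : ℕ → ℝ) (ξ ε : ℝ) : ℝ :=
  ξ ^ (2 * h - 1) + ∑ i ∈ Finset.Ico 1 (2 * h), u i * ε ^ (2 * h - i) * (i * ξ ^ (i - 1))

section ScaledCurve

variable {h : ℕ} (hh : 2 ≤ h) (u : ℕ → ℝ)

theorem contDiff_scaledU : ContDiff ℝ ∞ (fun p : ℝ × ℝ => scaledU h u p.1 p.2) := by
  unfold scaledU
  fun_prop

theorem contDiff_scaledU' : ContDiff ℝ ∞ (fun p : ℝ × ℝ => scaledU' h u p.1 p.2) := by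
  unfold scaledU'
  fun_prop

include hh in
theorem hasDerivAt_scaledU (ξ ε : ℝ) :
    HasDerivAt (fun ξ => scaledU h u ξ ε) (scaledU' h u ξ ε) ξ := by
  unfold scaledU scaledU'
  have h0 : (h : ℝ) ≠ 0 := by positivity
  refine HasDerivAt.add ?_ (HasDerivAt.fun_sum fun i _ => ?_)
  · refine ((hasDerivAt_pow (2 * h) ξ).div_const (2 * h : ℝ)).congr_deriv ?_
    push_cast
    field_simp
  · exact (hasDerivAt_pow i ξ).const_mul _

theorem scaledU_zero (ξ : ℝ) : scaledU h u ξ 0 = ξ ^ (2 * h) / (2 * h) := by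
  unfold scaledU
  rw [Finset.sum_eq_zero, add_zero]
  intro i hi
  rw [Finset.mem_Ico] at hi
  rw [zero_pow (by omega)]; ring

theorem scaledU'_zero (ξ : ℝ) : scaledU' h u ξ 0 = ξ ^ (2 * h - 1) := by
  unfold scaledU'
  rw [Finset.sum_eq_zero, add_zero]
  intro i hi
  rw [Finset.mem_Ico] at hi
  rw [zero_pow (by omega)]; ring

/-- `ρ² s²/2 + U(ρ c, ε) - 1` with `ρ` last. -/
noncomputable def radialEq (h : ℕ) (u : ℕ → ℝ) (p : (ℝ × ℝ × ℝ) × ℝ) : ℝ :=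
  (p.2 * p.1.2.2) ^ 2 / 2 + scaledU h u (p.2 * p.1.2.1) p.1.1 - 1

noncomputable def radialEq' (h : ℕ) (u : ℕ → ℝ) (p : (ℝ × ℝ × ℝ) × ℝ) : ℝ :=
  p.2 * p.1.2.2 ^ 2 + scaledU' h u (p.2 * p.1.2.1) p.1.1 * p.1.2.1

theorem contDiff_radialEq : ContDiff ℝ ∞ (radialEq h u) := by
  unfold radialEq
  have := contDiff_scaledU (h := h) u
  exact ((by fun_prop : ContDiff ℝ ∞ fun p : (ℝ × ℝ × ℝ) × ℝ => (p.2 * p.1.2.2) ^ 2 / 2).add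
    (this.comp (by fun_prop :
      ContDiff ℝ ∞ fun p : (ℝ × ℝ × ℝ) × ℝ => (p.2 * p.1.2.1, p.1.1)))).sub contDiff_const

theorem continuous_radialEq' : Continuous (radialEq' h u) := by
  unfold radialEq' scaledU'
  fun_prop

include hh in
theorem hasDerivAt_radialEq (x : ℝ × ℝ × ℝ) (y : ℝ) :
    HasDerivAt (fun y => radialEq h u (x, y)) (radialEq' h u (x, y)) y := by
  unfold radialEq radialEq'
  have h1 : HasDerivAt (fun y : ℝ => y * x.2.1) x.2.1 y := by
    simpa using (hasDerivAt_id y).mul_const x.2.1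
  have h2 : HasDerivAt (fun y : ℝ => (y * x.2.2) ^ 2 / 2) (y * x.2.2 ^ 2) y := by
    have : HasDerivAt (fun y : ℝ => y * x.2.2) x.2.2 y := by
      simpa using (hasDerivAt_id y).mul_const x.2.2
    refine ((this.pow 2).div_const 2).congr_deriv ?_
    push_cast; ring
  have h3 := (hasDerivAt_scaledU hh u (y * x.2.1) x.1).comp y h1
  simpa using! (h2.add h3).sub_const 1

include hh in
-- By compactness of the circle it suffices to treat e = 0. At radius 1 the value is below 1/2 + 1/4
-- - 1. At radius 3 either s² ≥ 1/2 and the kinetic term is at least 9/4, or c² ≥ 1/2 and Bernoulli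
-- gives (9/2)^h ≥ 1 + 7h/2 > 2h. The radial derivative is y s² + y^(2h-1) c^(2h) > 0.
theorem exists_radial_bounds : ∃ δ > 0, ∀ e : ℝ, |e| < δ → ∀ c s : ℝ, c ^ 2 + s ^ 2 = 1 →
    radialEq h u ((e, c, s), 1) < 0 ∧ 0 < radialEq h u ((e, c, s), 3) ∧
      ∀ y ∈ Icc (1 : ℝ) 3, 0 < radialEq' h u ((e, c, s), y) := by
  have hhr : (2 : ℝ) ≤ h := by exact_mod_cast hh
  have hK1 : IsCompact {z : ℝ × ℝ | z.1 ^ 2 + z.2 ^ 2 = 1} := by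
    refine Metric.isCompact_of_isClosed_isBounded (isClosed_eq (by fun_prop) (by fun_prop)) ?_
    refine (Metric.isBounded_closedBall (x := (0 : ℝ × ℝ)) (r := 1)).subset fun z hz => ?_
    have hz' : z.1 ^ 2 + z.2 ^ 2 = 1 := hz
    rw [mem_closedBall_zero_iff, Prod.norm_def]
    refine max_le ?_ ?_ <;> rw [Real.norm_eq_abs, abs_le] <;> constructor <;>
      nlinarith [sq_nonneg z.1, sq_nonneg z.2]
  have hK := hK1.prod (isCompact_Icc (a := (1 : ℝ)) (b := 3))
  have hpow : ∀ c : ℝ, 0 ≤ c ^ (2 * h) := fun c => by rw [pow_mul]; positivity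
  have hradc := (contDiff_radialEq (h := h) u).continuous
  obtain ⟨δ₁, hδ₁, H₁⟩ := exists_pos_of_compact hK1
    (F := fun q => - radialEq h u ((q.2, q.1.1, q.1.2), 1)) (by fun_prop) (by
      rintro ⟨c, s⟩ hcs
      have hcs' : c ^ 2 + s ^ 2 = 1 := hcs
      simp only [radialEq, scaledU_zero]
      have h1 : (1 * c) ^ (2 * h) ≤ 1 := by
        rw [one_mul, pow_mul]
        exact pow_le_one₀ (sq_nonneg c) (by nlinarith [sq_nonneg s])
      have h2 : (1 * c) ^ (2 * h) / (2 * h) ≤ 1 / 4 := by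
        rw [div_le_iff₀ (by linarith)]; nlinarith
      nlinarith [sq_nonneg c])
  obtain ⟨δ₂, hδ₂, H₂⟩ := exists_pos_of_compact hK1
    (F := fun q => radialEq h u ((q.2, q.1.1, q.1.2), 3)) (by fun_prop) (by
      rintro ⟨c, s⟩ hcs
      have hcs' : c ^ 2 + s ^ 2 = 1 := hcs
      simp only [radialEq, scaledU_zero]
      rcases le_total (1 / 2) (s ^ 2) with h1 | h1
      · have h2 : 0 ≤ (3 * c) ^ (2 * h) / (2 * h) := div_nonneg (hpow _) (by linarith)
        nlinarith
      · have h2 : (9 / 2 : ℝ) ^ h ≤ (3 * c) ^ (2 * h) := by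
          rw [pow_mul]
          exact pow_le_pow_left₀ (by norm_num) (by nlinarith) h
        have h3 : 1 + (h : ℝ) * (7 / 2) ≤ (9 / 2 : ℝ) ^ h := by
          have := one_add_mul_le_pow (a := (7 / 2 : ℝ)) (by norm_num) h
          norm_num at this ⊢; linarith
        have h4 : 1 < (3 * c) ^ (2 * h) / (2 * h) := by
          rw [lt_div_iff₀ (by linarith)]; linarith
        nlinarith [sq_nonneg s])
  obtain ⟨δ₃, hδ₃, H₃⟩ := exists_pos_of_compact hK
    (F := fun q => radialEq' h u ((q.2, q.1.1.1, q.1.1.2), q.1.2))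
    ((continuous_radialEq' u).comp (by fun_prop)) (by
      rintro ⟨⟨c, s⟩, y⟩ ⟨hcs, hy⟩
      have hcs' : c ^ 2 + s ^ 2 = 1 := hcs
      have hy0 : 0 < y := by linarith [hy.1]
      simp only [radialEq', scaledU'_zero]
      have h1 : (y * c) ^ (2 * h - 1) * c = y ^ (2 * h - 1) * (c ^ 2) ^ h := by
        rw [mul_pow, mul_assoc, ← pow_succ, ← pow_mul]
        congr 2; omega
      rw [h1]
      rcases eq_or_ne c 0 with rfl | hc
      · have : s ^ 2 = 1 := by nlinarith
        rw [this, zero_pow two_ne_zero, zero_pow (by omega)]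
        linarith
      · positivity)
  refine ⟨min δ₁ (min δ₂ δ₃), by positivity, fun e he c s hcs => ⟨?_, ?_, fun y hy => ?_⟩⟩
  · have := H₁ e (he.trans_le (min_le_left _ _)) (c, s) hcs
    simpa using this
  · exact H₂ e (he.trans_le ((min_le_right _ _).trans (min_le_left _ _))) (c, s) hcs
  · exact H₃ e (he.trans_le ((min_le_right _ _).trans (min_le_right _ _))) ((c, s), y) ⟨hcs, hy⟩

include hh in
/-- The level curve `η²/2 + U(ξ,ε) = 1` in polar coordinates. -/
theorem exists_radius : ∃ ε₀ > 0, ∃ β : ℝ → ℝ, ContDiff ℝ ∞ β ∧ (∀ x, |x| ≤ ε₀ → β x = x) ∧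
    ∃ ρ : ℝ × ℝ → ℝ, ContDiff ℝ ∞ ρ ∧ (∀ p, 0 < ρ p) ∧
      (∀ ε α, ρ (ε, α + 2 * Real.pi) = ρ (ε, α)) ∧
      (∀ ε α, (ρ (ε, α) * Real.sin α) ^ 2 / 2 +
        scaledU h u (ρ (ε, α) * Real.cos α) (β ε) = 1) ∧
      (∀ ε α, 0 < ρ (ε, α) * Real.sin α ^ 2 +
        scaledU' h u (ρ (ε, α) * Real.cos α) (β ε) * Real.cos α) := by
  obtain ⟨δ, hδ, H⟩ := exists_radial_bounds hh u
  -- The cut-off keeps the parameter in the range where the bounds hold, so that the radius is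
  -- defined and smooth for every ε, with the true equation for small ε.
  obtain ⟨β, hβ, hβδ, hβid⟩ := exists_smooth_clamp hδ
  have H' : ∀ p : ℝ × ℝ, radialEq h u ((β p.1, Real.cos p.2, Real.sin p.2), 1) < 0 ∧
      0 < radialEq h u ((β p.1, Real.cos p.2, Real.sin p.2), 3) ∧
      ∀ y ∈ Icc (1 : ℝ) 3, 0 < radialEq' h u ((β p.1, Real.cos p.2, Real.sin p.2), y) :=
    fun p => H (β p.1) (hβδ p.1) (Real.cos p.2) (Real.sin p.2) (Real.cos_sq_add_sin_sq p.2)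
  obtain ⟨m, hm, hmdef⟩ : ∃ m : ℝ × ℝ → ℝ × ℝ × ℝ, ContDiff ℝ ∞ m ∧
      ∀ p, m p = (β p.1, Real.cos p.2, Real.sin p.2) :=
    ⟨_, (hβ.comp contDiff_fst).prodMk ((Real.contDiff_cos.comp contDiff_snd).prodMk
      (Real.contDiff_sin.comp contDiff_snd)), fun _ => rfl⟩
  simp only [← hmdef] at H'
  obtain ⟨g, hg, hg_def⟩ : ∃ g : (ℝ × ℝ) × ℝ → ℝ, ContDiff ℝ ∞ g ∧
      ∀ p y, g (p, y) = radialEq h u (m p, y) :=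
    ⟨fun q => radialEq h u (m q.1, q.2), (contDiff_radialEq u).comp
      ((hm.comp contDiff_fst).prodMk contDiff_snd), fun _ _ => rfl⟩
  have hgd : ∀ p y, HasDerivAt (fun y => g (p, y)) (radialEq' h u (m p, y)) y := fun p y => by
    simp only [hg_def]
    exact hasDerivAt_radialEq hh u (m p) y
  have hmono : ∀ p, StrictMonoOn (fun y => g (p, y)) (Icc 1 3) := fun p => by
    refine strictMonoOn_of_deriv_pos (convex_Icc 1 3)
      (fun y _ => (hgd p y).continuousAt.continuousWithinAt) fun y hy => ?_
    rw [(hgd p y).deriv]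
    exact (H' p).2.2 y (interior_subset hy)
  have hex : ∀ p, ∃ y ∈ Ioo (1 : ℝ) 3, g (p, y) = 0 := fun p => by
    have := intermediate_value_Ioo (a := (1 : ℝ)) (b := 3) (by norm_num)
      (f := fun y => g (p, y)) (fun y _ => (hgd p y).continuousAt.continuousWithinAt)
    exact this ⟨by simpa only [hg_def] using (H' p).1, by simpa only [hg_def] using (H' p).2.1⟩
  choose ρ hρI hρ0 using hex
  refine ⟨δ / 2, by positivity, β, hβ, hβid, ρ, ?_, ?_, ?_, ?_, ?_⟩
  · refine contDiff_iff_contDiffAt.2 fun p => ?_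
    refine contDiffAt_root_of_strictMonoOn hg (hρI p).1 (hρI p).2
      (.of_forall fun q => Ioo_subset_Icc_self (hρI q)) (.of_forall hρ0) (.of_forall hmono) ?_
    rw [lastDeriv, (hgd p (ρ p)).deriv]
    exact ((H' p).2.2 _ (Ioo_subset_Icc_self (hρI p))).ne'
  · exact fun p => one_pos.trans (hρI p).1
  · intro ε α
    refine (hmono (ε, α)).injOn (Ioo_subset_Icc_self (hρI _)) (Ioo_subset_Icc_self (hρI _)) ?_
    rw [hρ0 (ε, α), ← hρ0 (ε, α + 2 * Real.pi)]
    simp only [hg_def, hmdef, Real.cos_add_two_pi, Real.sin_add_two_pi]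
  · intro ε α
    have := hρ0 (ε, α)
    simp only [hg_def, hmdef, radialEq] at this
    linarith
  · intro ε α
    have := (H' (ε, α)).2.2 _ (Ioo_subset_Icc_self (hρI (ε, α)))
    simpa only [radialEq', hmdef] using this

end ScaledCurve

/-- Along a level curve in polar coordinates, the tangent vector is proportional to the Hamiltonian
vector field. -/
theorem hasDerivAt_polar_level {V : ℝ → ℝ} {V' : ℝ → ℝ} (hV : ∀ ξ, HasDerivAt V (V' ξ) ξ)
    {ρ : ℝ → ℝ} (hρ : Differentiable ℝ ρ)
    (hlev : ∀ α, (ρ α * Real.sin α) ^ 2 / 2 + V (ρ α * Real.cos α) = 1)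
    (hD : ∀ α, 0 < ρ α * Real.sin α ^ 2 + V' (ρ α * Real.cos α) * Real.cos α) (α : ℝ) :
    HasDerivAt (fun α => ρ α * Real.cos α) (-(ρ α * Real.sin α) *
      (ρ α / (ρ α * Real.sin α ^ 2 + V' (ρ α * Real.cos α) * Real.cos α))) α ∧
    HasDerivAt (fun α => -(ρ α * Real.sin α)) (-V' (ρ α * Real.cos α) *
      (ρ α / (ρ α * Real.sin α ^ 2 + V' (ρ α * Real.cos α) * Real.cos α))) α := by
  have h1 := (hρ α).hasDerivAt.mul (Real.hasDerivAt_cos α)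
  have h2 := (hρ α).hasDerivAt.mul (Real.hasDerivAt_sin α)
  set r := ρ α with hr
  set r' := deriv ρ α
  set c := Real.cos α with hc
  set s := Real.sin α with hs
  set v := V' (r * c)
  have hcs : c ^ 2 + s ^ 2 = 1 := Real.cos_sq_add_sin_sq α
  have h3 : HasDerivAt (fun α => (ρ α * Real.sin α) ^ 2 / 2 + V (ρ α * Real.cos α))
      ((r * s) * (r' * s + r * c) + v * (r' * c + r * -s)) α := by
    refine HasDerivAt.add ?_ ?_
    · refine ((h2.pow 2).div_const 2).congr_deriv ?_
      simp only [Pi.mul_apply, ← hr, ← hs]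
      push_cast; ring
    · exact (hV (r * c)).comp α h1
  -- The level equation has constant value, so its derivative vanishes. This linear relation
  -- determines r', and combined with c² + s² = 1 it yields both components.
  have h4 : (r * s) * (r' * s + r * c) + v * (r' * c + r * -s) = 0 := by
    have : (fun α => (ρ α * Real.sin α) ^ 2 / 2 + V (ρ α * Real.cos α)) = fun _ => 1 := funext hlev
    rw [this] at h3
    exact h3.unique (hasDerivAt_const _ _)
  have hDp : 0 < r * s ^ 2 + v * c := hD α
  constructor
  · refine h1.congr_deriv ?_
    rw [← mul_div_assoc, eq_div_iff hDp.ne']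
    linear_combination c * h4 - (r ^ 2 * s) * hcs
  · refine h2.neg.congr_deriv ?_
    rw [← mul_div_assoc, eq_div_iff hDp.ne']
    linear_combination (-s) * h4 - v * r * hcs

section ScaledOrbit

variable {h : ℕ} (hh : 2 ≤ h) (u : ℕ → ℝ)

include hh in
/-- The normalised closed orbits `η²/2 + U(ξ,ε) = 1` of the scaled system, in the angle variable. -/
theorem exists_scaled_orbit : ∃ ε₀ > 0, ∃ (Ξ Η : ℝ × ℝ → ℝ) (w : ℝ → ℝ), ContDiff ℝ ∞ Ξ ∧
    ContDiff ℝ ∞ Η ∧ ContDiff ℝ ∞ w ∧ (∀ ε, 0 < w ε) ∧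
    (∀ ε φ, Ξ (ε, φ + 2 * Real.pi) = Ξ (ε, φ)) ∧ (∀ ε φ, Η (ε, φ + 2 * Real.pi) = Η (ε, φ)) ∧
    (∀ ε, 0 < Ξ (ε, 0) ∧ Η (ε, 0) = 0) ∧
    (∀ ε c, 0 < c → Ξ (ε, c) = Ξ (ε, 0) → Η (ε, c) = Η (ε, 0) → 2 * Real.pi ≤ c) ∧
    ∀ ε, |ε| ≤ ε₀ → ∀ φ, Η (ε, φ) ^ 2 / 2 + scaledU h u (Ξ (ε, φ)) ε = 1 ∧
      HasDerivAt (fun φ => Ξ (ε, φ)) (Η (ε, φ) / w ε) φ ∧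
      HasDerivAt (fun φ => Η (ε, φ)) (-scaledU' h u (Ξ (ε, φ)) ε / w ε) φ := by
  obtain ⟨ε₀, hε₀, β, hβ, hβid, ρ, hρ, hρ0, hρper, hlev, hD⟩ := exists_radius hh u
  have hpi := Real.pi_pos
  -- the angular slowness `ρ / D`
  obtain ⟨D, hDs, hDdef⟩ : ∃ D : ℝ × ℝ → ℝ, ContDiff ℝ ∞ D ∧ ∀ ε α, D (ε, α) =
      ρ (ε, α) * Real.sin α ^ 2 +
        scaledU' h u (ρ (ε, α) * Real.cos α) (β ε) * Real.cos α := by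
    refine ⟨fun p => ρ p * Real.sin p.2 ^ 2 +
      scaledU' h u (ρ p * Real.cos p.2) (β p.1) * Real.cos p.2, ?_, fun _ _ => rfl⟩
    have hs := Real.contDiff_sin.comp (contDiff_snd (𝕜 := ℝ) (E := ℝ) (F := ℝ) (n := ∞))
    have hc := Real.contDiff_cos.comp (contDiff_snd (𝕜 := ℝ) (E := ℝ) (F := ℝ) (n := ∞))
    have hU := (contDiff_scaledU' (h := h) u).comp ((hρ.mul hc).prodMk (hβ.comp contDiff_fst))
    exact (hρ.mul (hs.pow 2)).add (hU.mul hc)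
  have hD0 : ∀ p, 0 < D p := fun ⟨ε, α⟩ => by rw [hDdef]; exact hD ε α
  obtain ⟨k, hk, hkdef⟩ : ∃ k : ℝ × ℝ → ℝ, ContDiff ℝ ∞ k ∧ ∀ p, k p = ρ p / D p :=
    ⟨_, hρ.div hDs fun p => (hD0 p).ne', fun _ => rfl⟩
  have hk0 : ∀ p, 0 < k p := fun p => by rw [hkdef]; exact div_pos (hρ0 p) (hD0 p)
  have hkper : ∀ ε, Function.Periodic (fun α => k (ε, α)) (2 * Real.pi) := fun ε α => by
    simp only [hkdef, hDdef, hρper, Real.sin_add_two_pi, Real.cos_add_two_pi]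
  have hkc : ∀ ε, Continuous fun α => k (ε, α) := fun ε => hk.continuous.comp (by fun_prop)
  -- s(ε,α) is the time in which the flow moves from polar angle 0 to α along the level curve, since
  -- k is the time per unit of angle. Accordingly T below is the period.
  obtain ⟨s, hs, hsdef⟩ : ∃ s : ℝ × ℝ → ℝ, ContDiff ℝ ∞ s ∧
      ∀ ε α, s (ε, α) = ∫ a in (0 : ℝ)..α, k (ε, a) :=
    ⟨_, contDiff_primitive_param hk, fun _ _ => rfl⟩
  have hsd : ∀ ε α, HasDerivAt (fun α => s (ε, α)) (k (ε, α)) α := fun ε α => by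
    simp only [hsdef]
    exact intervalIntegral.integral_hasDerivAt_right ((hkc ε).intervalIntegrable _ _)
      ((hkc ε).stronglyMeasurableAtFilter _ _) (hkc ε).continuousAt
  have hsm : ∀ ε, StrictMono fun α => s (ε, α) := fun ε =>
    strictMono_of_deriv_pos fun α => by rw [(hsd ε α).deriv]; exact hk0 _
  have hs0 : ∀ ε, s (ε, 0) = 0 := fun ε => by simp [hsdef]
  have hsper : ∀ ε α, s (ε, α + 2 * Real.pi) = s (ε, α) + s (ε, 2 * Real.pi) := fun ε α => by
    simp only [hsdef]
    rw [← intervalIntegral.integral_add_adjacent_intervals (b := α)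
      ((hkc ε).intervalIntegrable _ _) ((hkc ε).intervalIntegrable _ _),
      (hkper ε).intervalIntegral_add_eq α 0, zero_add]
  have hssurj : ∀ ε, Function.Surjective fun α => s (ε, α) := fun ε => by
    refine (hs.continuous.comp (by fun_prop : Continuous fun α : ℝ => (ε, α))).surjective ?_ ?_
    · simp only [Function.comp_def, hsdef]
      exact (hkper ε).tendsto_atTop_intervalIntegral_of_pos' ((hkc ε).intervalIntegrable _ _)
        (fun _ => hk0 _) (by positivity)
    · simp only [Function.comp_def, hsdef]
      exact (hkper ε).tendsto_atBot_intervalIntegral_of_pos' ((hkc ε).intervalIntegrable _ _)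
        (fun _ => hk0 _) (by positivity)
  obtain ⟨T, hT, hTdef⟩ : ∃ T : ℝ → ℝ, ContDiff ℝ ∞ T ∧ ∀ ε, T ε = s (ε, 2 * Real.pi) :=
    ⟨fun ε => s (ε, 2 * Real.pi), hs.comp (by fun_prop), fun _ => rfl⟩
  have hT0 : ∀ ε, 0 < T ε := fun ε => by
    rw [hTdef, ← hs0 ε]; exact hsm ε (by positivity)
  -- A(ε,φ) is the polar angle reached at phase φ, that is, at time φ T/(2π).
  have hex : ∀ p : ℝ × ℝ, ∃ α, s (p.1, α) = p.2 * (T p.1 / (2 * Real.pi)) :=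
    fun p => hssurj p.1 _
  choose A hA using hex
  have hAs : ContDiff ℝ ∞ A := by
    obtain ⟨g, hg, hgdef⟩ : ∃ g : (ℝ × ℝ) × ℝ → ℝ, ContDiff ℝ ∞ g ∧
        ∀ p y, g (p, y) = s (p.1, y) - p.2 * (T p.1 / (2 * Real.pi)) :=
      ⟨fun q => s (q.1.1, q.2) - q.1.2 * (T q.1.1 / (2 * Real.pi)),
        (hs.comp (by fun_prop)).sub (ContDiff.mul (by fun_prop)
          ((hT.comp (by fun_prop)).div_const _)), fun _ _ => rfl⟩
    refine contDiff_iff_contDiffAt.2 fun p => ?_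
    refine contDiffAt_root_of_strictMonoOn hg (a := A p - 1) (b := A p + 1) (by linarith)
      (by linarith) ?_ (.of_forall fun q => ?_) (.of_forall fun q => ?_) ?_
    · -- continuity of the root
      have h1 : ∀ᶠ q in 𝓝 p, g (q, A p - 1) < 0 :=
        (hg.continuous.comp (by fun_prop : Continuous fun q : ℝ × ℝ => (q, A p - 1))).continuousAt
          |>.eventually_lt_const (by
            change g (p, A p - 1) < 0
            rw [hgdef, ← hA p, sub_neg]; exact hsm _ (by linarith))
      have h2 : ∀ᶠ q in 𝓝 p, 0 < g (q, A p + 1) :=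
        (hg.continuous.comp (by fun_prop : Continuous fun q : ℝ × ℝ => (q, A p + 1))).continuousAt
          |>.eventually_const_lt (by
            change 0 < g (p, A p + 1)
            rw [hgdef, ← hA p, sub_pos]; exact hsm _ (by linarith))
      filter_upwards [h1, h2] with q h3 h4
      rw [hgdef, ← hA q, sub_neg] at h3
      rw [hgdef, ← hA q, sub_pos] at h4
      exact ⟨((hsm q.1).lt_iff_lt.1 h3).le, ((hsm q.1).lt_iff_lt.1 h4).le⟩
    · rw [hgdef, hA, sub_self]
    · intro x _ y _ hxy
      simp only [hgdef]
      exact sub_lt_sub_right (hsm q.1 hxy) _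
    · have : HasDerivAt (fun y => g (p, y)) (k (p.1, A p)) (A p) := by
        simp only [hgdef]; exact (hsd p.1 (A p)).sub_const _
      rw [lastDeriv, this.deriv]; exact (hk0 _).ne'
  have hA0 : ∀ ε, A (ε, 0) = 0 := fun ε => (hsm ε).injective (by
    simp only [hs0]; rw [hA (ε, 0)]; simp)
  have hAper : ∀ ε φ, A (ε, φ + 2 * Real.pi) = A (ε, φ) + 2 * Real.pi := fun ε φ =>
    (hsm ε).injective (by
      simp only [hsper]; rw [hA (ε, φ + 2 * Real.pi), hA (ε, φ), ← hTdef]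
      field_simp)
  have hAd : ∀ ε φ, HasDerivAt (fun φ => A (ε, φ)) (T ε / (2 * Real.pi) / k (ε, A (ε, φ))) φ := by
    intro ε φ
    have h1 : HasDerivAt (fun φ => A (ε, φ)) (lastDeriv A (ε, φ)) φ := hasDerivAt_last hAs ε φ
    have h2 := (hsd ε (A (ε, φ))).comp φ h1
    have h3 : ((fun α => s (ε, α)) ∘ fun φ => A (ε, φ)) = fun φ => φ * (T ε / (2 * Real.pi)) :=
      funext fun φ => hA (ε, φ)
    rw [h3] at h2
    have h4 := h2.unique ((hasDerivAt_id φ).mul_const (T ε / (2 * Real.pi)))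
    refine h1.congr_deriv ?_
    rw [eq_div_iff (hk0 _).ne']
    linarith
  have hρA : ContDiff ℝ ∞ fun p : ℝ × ℝ => ρ (p.1, A p) := hρ.comp (contDiff_fst.prodMk hAs)
  -- The second coordinate is -ρ sin A because the Hamiltonian flow runs clockwise; the frequency is
  -- 2π/T.
  refine ⟨ε₀, hε₀, fun p => ρ (p.1, A p) * Real.cos (A p), fun p => -(ρ (p.1, A p) * Real.sin (A p)),
    fun ε => 2 * Real.pi / T ε, hρA.mul (Real.contDiff_cos.comp hAs),
    (hρA.mul (Real.contDiff_sin.comp hAs)).neg, contDiff_const.div hT fun ε => (hT0 ε).ne',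
    fun ε => div_pos (by positivity) (hT0 ε), ?_, ?_, ?_, ?_, ?_⟩
  · intro ε φ
    simp only [hAper, hρper, Real.cos_add_two_pi]
  · intro ε φ
    simp only [hAper, hρper, Real.sin_add_two_pi]
  · intro ε
    simp [hA0, hρ0]
  · intro ε c hc h1 h2
    simp only [hA0, Real.cos_zero, Real.sin_zero, mul_zero, neg_zero, neg_eq_zero, mul_one,
      mul_eq_zero, (hρ0 _).ne', false_or] at h1 h2
    have hcos : 0 < Real.cos (A (ε, c)) := by
      have := hρ0 (ε, 0)
      rw [← h1] at this
      exact pos_of_mul_pos_right this (hρ0 _).le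
    have hApos : 0 < A (ε, c) := (hsm ε).lt_iff_lt.1 (by
      simp only [hs0]; rw [hA (ε, c)]
      exact mul_pos hc (div_pos (hT0 ε) (by positivity)))
    -- On 0 < A < 2π the sine vanishes only at π, where the cosine is negative; so a return to the
    -- positive half-axis requires A ≥ 2π.
    have hA2 : 2 * Real.pi ≤ A (ε, c) := by
      by_contra hlt
      push Not at hlt
      rcases lt_trichotomy (A (ε, c)) Real.pi with h3 | h3 | h3
      · exact (Real.sin_pos_of_pos_of_lt_pi hApos h3).ne' h2
      · rw [h3, Real.cos_pi] at hcos; linarith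
      · have := Real.sin_pos_of_pos_of_lt_pi (x := A (ε, c) - Real.pi) (by linarith) (by linarith)
        rw [Real.sin_sub_pi, h2] at this; linarith
    have h3 := (hsm ε).monotone hA2
    change s (ε, 2 * Real.pi) ≤ s ((ε, c).1, A (ε, c)) at h3
    rw [hA (ε, c), ← hTdef, ← mul_div_assoc, le_div_iff₀ (by positivity)] at h3
    exact le_of_mul_le_mul_left (by linarith) (hT0 ε)
  · intro ε hε φ
    have hb := hβid ε hε
    have hl := hlev ε
    simp only [hb] at hl
    have hdd := hasDerivAt_polar_level (V := fun ξ => scaledU h u ξ ε)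
      (V' := fun ξ => scaledU' h u ξ ε) (fun ξ => hasDerivAt_scaledU hh u ξ ε)
      (ρ := fun α => ρ (ε, α))
      ((hρ.comp (by fun_prop : ContDiff ℝ ∞ fun α : ℝ => (ε, α))).differentiable (by simp))
      hl (fun α => by have := hD ε α; simpa only [hb] using this) (A (ε, φ))
    have hkk : k (ε, A (ε, φ)) = ρ (ε, A (ε, φ)) / (ρ (ε, A (ε, φ)) * Real.sin (A (ε, φ)) ^ 2 +
        scaledU' h u (ρ (ε, A (ε, φ)) * Real.cos (A (ε, φ))) ε * Real.cos (A (ε, φ))) := by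
      rw [hkdef, hDdef, hb]
    simp only [← hkk] at hdd
    have hkp := hk0 (ε, A (ε, φ))
    have hTp := hT0 ε
    refine ⟨?_, ?_, ?_⟩
    · have := hl (A (ε, φ)); simpa [neg_sq] using this
    · refine (hdd.1.comp φ (hAd ε φ)).congr_deriv ?_
      field_simp
    · refine (hdd.2.comp φ (hAd ε φ)).congr_deriv ?_
      field_simp

end ScaledOrbit

/-! ### Energy-angle variables at large energy -/

theorem PerturbedOscillator.U_eq_scaledU (P : PerturbedOscillator) (x : ℝ) :
    P.U x = scaledU P.h P.u x 1 := by
  simp [PerturbedOscillator.U, scaledU]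

theorem PerturbedOscillator.hasDerivAt_U (P : PerturbedOscillator) (x : ℝ) :
    HasDerivAt P.U (scaledU' P.h P.u x 1) x := by
  have : P.U = fun x => scaledU P.h P.u x 1 := funext P.U_eq_scaledU
  rw [this]
  exact hasDerivAt_scaledU P.two_le_h P.u x 1

/-- Quasi-homogeneity: after division by z^(2h) the coefficient u_i carries the factor (1/z)^(2h-i).
-/
theorem scaledU_mul (h : ℕ) (u : ℕ → ℝ) {z : ℝ} (hz : 0 < z) (ξ : ℝ) :
    scaledU h u (z * ξ) 1 = z ^ (2 * h) * scaledU h u ξ (1 / z) := by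
  unfold scaledU
  rw [mul_add, Finset.mul_sum]
  congr 1
  · rw [mul_pow]; ring
  · refine Finset.sum_congr rfl fun i hi => ?_
    rw [Finset.mem_Ico] at hi
    have : z ^ (2 * h) = z ^ (2 * h - i) * z ^ i := by rw [← pow_add]; congr 1; omega
    rw [this, mul_pow, one_div, inv_pow, one_pow]
    field_simp

theorem scaledU'_mul (h : ℕ) (u : ℕ → ℝ) {z : ℝ} (hz : 0 < z) (ξ : ℝ) :
    scaledU' h u (z * ξ) 1 = z ^ (2 * h - 1) * scaledU' h u ξ (1 / z) := by
  unfold scaledU'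
  rw [mul_add, Finset.mul_sum]
  congr 1
  · rw [mul_pow]
  · refine Finset.sum_congr rfl fun i hi => ?_
    rw [Finset.mem_Ico] at hi
    have : z ^ (2 * h - 1) = z ^ (2 * h - i) * z ^ (i - 1) := by rw [← pow_add]; congr 1; omega
    rw [this, mul_pow, one_div, inv_pow, one_pow]
    field_simp

namespace ResonantFrame

variable {P : PerturbedOscillator} (Q : ResonantFrame P)

/-- There is only one positive turning point at an energy above `E₀`. -/
theorem eq_of_U_eq {E x y : ℝ} (hE : Q.E₀ < E) (hx : 0 < x) (hy : 0 < y) (hUx : P.U x = E)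
    (hUy : P.U y = E) : x = y := by
  wlog hxy : x < y generalizing x y
  · rcases eq_or_lt_of_le (not_lt.1 hxy) with h | h
    · exact h.symm
    · exact (this hy hx hUy hUx h).symm
  exfalso
  have hcont : Continuous P.U := continuous_iff_continuousAt.2 fun x => (P.hasDerivAt_U x).continuousAt
  have hU0 : P.U 0 = 0 := by
    have h2 := P.two_le_h
    unfold PerturbedOscillator.U
    rw [zero_pow (by omega), Finset.sum_eq_zero]
    · simp
    · intro i hi
      rw [Finset.mem_Ico] at hi
      rw [zero_pow (by omega), mul_zero]
  have hE0 := Q.E₀_pos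
  obtain ⟨m, hm, hmax⟩ := isCompact_Icc.exists_isMaxOn (nonempty_Icc.2 hy.le)
    (hcont.continuousOn (s := Icc 0 y))
  have hmE : E ≤ P.U m := by rw [← hUx]; exact hmax ⟨hx.le, hxy.le⟩
  -- an interior maximum above `E₀` is a fixed point
  have key : ∀ c ∈ Ioo 0 y, IsMaxOn P.U (Icc 0 y) c → E ≤ P.U c → False := by
    intro c hc hcm hcE
    exact Q.no_fixed_point c (by linarith)
      (hcm.isLocalMax (Icc_mem_nhds hc.1 hc.2)).deriv_eq_zero
  rcases eq_or_lt_of_le hm.1 with h0 | h0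
  · rw [← h0, hU0] at hmE; linarith
  rcases eq_or_lt_of_le hm.2 with h1 | h1
  -- If the maximum sits at the endpoint y, then U(x) = U(y) makes the interior point x a maximum as
  -- well.
  · refine key x ⟨hx, hxy⟩ (fun t ht => ?_) hUx.ge
    have := hmax ht
    simp only [mem_ofPred_eq, h1, hUy] at this ⊢
    rw [hUx]; exact this
  · exact key m ⟨h0, h1⟩ hmax hmE

/-- Both curves solve Newton's equation with the same initial point: the positive turning point of
energy E is unique. Periodicity confines them to a ball, on which the polynomial field is Lipschitz,
so uniqueness applies. -/
theorem orbit_eq {E : ℝ} (hE : Q.E₀ < E) {x y : ℝ → ℝ} {T : ℝ} (hT : T ≠ 0)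
    (hx : ∀ s, HasDerivAt x (y s) s) (hy : ∀ s, HasDerivAt y (-(deriv P.U (x s))) s)
    (hper : Function.Periodic (fun s => (x s, y s)) T)
    (hx0 : 0 < x 0) (hy0 : y 0 = 0) (hEn : P.H (x 0) (y 0) = E) (s : ℝ) :
    x s = Q.X (Q.om E * s) E ∧ y s = Q.Y (Q.om E * s) E := by
  have hom := Q.om_pos E hE
  have hd : deriv P.U = fun x => scaledU' P.h P.u x 1 := funext fun x => (P.hasDerivAt_U x).deriv
  set v : ℝ × ℝ → ℝ × ℝ := fun p => (p.2, -(deriv P.U p.1)) with hv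
  have hvs : ContDiff ℝ 1 v := by
    rw [hv, hd]
    have := (contDiff_scaledU' (h := P.h) P.u).of_le (show (1 : WithTop ℕ∞) ≤ ∞ by exact_mod_cast le_top)
    exact contDiff_snd.prodMk (this.comp (contDiff_fst.prodMk contDiff_const)).neg
  set c₁ : ℝ → ℝ × ℝ := fun s => (x s, y s)
  set c₂ : ℝ → ℝ × ℝ := fun s => (Q.X (Q.om E * s) E, Q.Y (Q.om E * s) E)
  have hc₁ : ∀ s, HasDerivAt c₁ (v (c₁ s)) s := fun s => (hx s).prodMk (hy s)
  have hlin : ∀ s, HasDerivAt (fun s => Q.om E * s) (Q.om E) s := fun s => by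
    simpa using (hasDerivAt_id s).const_mul (Q.om E)
  have hc₂ : ∀ s, HasDerivAt c₂ (v (c₂ s)) s := fun s => by
    refine HasDerivAt.prodMk ?_ ?_
    · refine ((Q.X_deriv E hE (Q.om E * s)).comp s (hlin s)).congr_deriv ?_
      change _ = Q.Y (Q.om E * s) E
      field_simp
    · refine ((Q.Y_deriv E hE (Q.om E * s)).comp s (hlin s)).congr_deriv ?_
      change _ = -(deriv P.U (Q.X (Q.om E * s) E))
      field_simp
  have hper₂ : Function.Periodic c₂ (2 * Real.pi / Q.om E) := fun s => by
    have := Q.periodic E hE (Q.om E * s)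
    simp only [c₂]
    rw [mul_add, mul_div_cancel₀ _ hom.ne']
    exact this
  have hb₁ := (hper.compact_of_continuous hT
    (continuous_iff_continuousAt.2 fun s => (hc₁ s).continuousAt)).isBounded
  have hb₂ := (hper₂.compact_of_continuous (by positivity)
    (continuous_iff_continuousAt.2 fun s => (hc₂ s).continuousAt)).isBounded
  obtain ⟨R, hR⟩ := (hb₁.union hb₂).subset_closedBall 0
  obtain ⟨K, hK⟩ := hvs.contDiffOn.exists_lipschitzOnWith (by norm_num)
    (convex_closedBall (0 : ℝ × ℝ) R) (isCompact_closedBall _ _)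
  have hX0 : x 0 = Q.X 0 E := by
    refine Q.eq_of_U_eq hE hx0 (Q.X_zero E hE) ?_ ?_
    · rw [← hEn, PerturbedOscillator.H, hy0]; simp
    · have := Q.energy E hE 0
      rw [PerturbedOscillator.H, Q.Y_zero E hE] at this
      simpa using this
  have : c₁ = c₂ := ODE_solution_unique_univ (v := fun _ => v) (s := fun _ => Metric.closedBall 0 R)
    (t₀ := 0) (K := K) (fun _ => hK) (fun s => ⟨hc₁ s, hR (.inl ⟨s, rfl⟩)⟩)
    (fun s => ⟨hc₂ s, hR (.inr ⟨s, rfl⟩)⟩) (by simp [c₁, c₂, hX0, hy0, Q.Y_zero E hE])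
  have h := congrFun this s
  simp only [c₁, c₂, Prod.mk.injEq] at h
  exact h

/-- The energy-angle variables at large energies `E = z^(2h)` in terms of smooth functions of
`1/z` and the angle. -/
theorem exists_scaled : ∃ (Ξ Η : ℝ × ℝ → ℝ) (w : ℝ → ℝ), ContDiff ℝ ∞ Ξ ∧
    ContDiff ℝ ∞ Η ∧ ContDiff ℝ ∞ w ∧ (∀ ε, 0 < w ε) ∧
    (∀ ε φ, Ξ (ε, φ + 2 * Real.pi) = Ξ (ε, φ)) ∧ (∀ ε φ, Η (ε, φ + 2 * Real.pi) = Η (ε, φ)) ∧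
    ∃ z₀ ≥ 1, ∀ z ≥ z₀, Q.E₀ < z ^ (2 * P.h) ∧ Q.om (z ^ (2 * P.h)) = z ^ (P.h - 1) * w (1 / z) ∧
      ∀ φ, Q.X φ (z ^ (2 * P.h)) = z * Ξ (1 / z, φ) ∧
        Q.Y φ (z ^ (2 * P.h)) = z ^ P.h * Η (1 / z, φ) := by
  obtain ⟨ε₀, hε₀, Ξ, Η, w, hΞ, hΗ, hw, hw0, hΞp, hΗp, h0, hleast, hode⟩ :=
    exists_scaled_orbit P.two_le_h P.u
  have h2 := P.two_le_h
  refine ⟨Ξ, Η, w, hΞ, hΗ, hw, hw0, hΞp, hΗp, max (1 / ε₀) (max 1 (Q.E₀ + 1)),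
    (le_max_left _ _).trans (le_max_right _ _), fun z hz => ?_⟩
  have hz1 : 1 ≤ z := ((le_max_left _ _).trans (le_max_right _ _)).trans hz
  have hz0 : 0 < z := by linarith
  have hzE : Q.E₀ + 1 ≤ z := ((le_max_right _ _).trans (le_max_right _ _)).trans hz
  have hE : Q.E₀ < z ^ (2 * P.h) := by
    have := le_self_pow₀ hz1 (show 2 * P.h ≠ 0 by omega)
    linarith
  have hε : |1 / z| ≤ ε₀ := by
    rw [abs_of_pos (by positivity), div_le_iff₀ hz0]
    have : 1 / ε₀ ≤ z := (le_max_left _ _).trans hz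
    rwa [div_le_iff₀' hε₀] at this
  set ε := 1 / z with hεdef
  -- W is the frequency of the rescaled orbit in the original time; the goal is W = ω(E).
  set W := z ^ (P.h - 1) * w ε with hW
  have hwp := hw0 ε
  have hWp : 0 < W := by positivity
  have hpi := Real.pi_pos
  have hzh : z ^ P.h = z ^ (P.h - 1) * z := by rw [← pow_succ]; congr 1; omega
  have hz2 : z ^ (2 * P.h - 1) = z ^ P.h * z ^ (P.h - 1) := by rw [← pow_add]; congr 1; omega
  have hlin : ∀ s, HasDerivAt (fun s => W * s) W s := fun s => by
    simpa using (hasDerivAt_id s).const_mul W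
  have hd : ∀ x, deriv P.U x = scaledU' P.h P.u x 1 := fun x => (P.hasDerivAt_U x).deriv
  have hsol := Q.orbit_eq hE (x := fun s => z * Ξ (ε, W * s)) (y := fun s => z ^ P.h * Η (ε, W * s))
    (T := 2 * Real.pi / W) (by positivity)
    (fun s => by
      refine (((hode ε hε (W * s)).2.1.comp s (hlin s)).const_mul z).congr_deriv ?_
      rw [hzh, hW]; field_simp)
    (fun s => by
      refine (((hode ε hε (W * s)).2.2.comp s (hlin s)).const_mul (z ^ P.h)).congr_deriv ?_
      rw [hd, scaledU'_mul _ _ hz0, hz2, ← hεdef, hW]; field_simp)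
    (fun s => by
      simp only [mul_add, mul_div_cancel₀ _ hWp.ne', hΞp, hΗp])
    (by simpa using mul_pos hz0 (h0 ε).1) (by simp [(h0 ε).2])
    (by
      have := (hode ε hε 0).1
      rw [(h0 ε).2] at this
      simp only [mul_zero, (h0 ε).2, PerturbedOscillator.H, P.U_eq_scaledU, scaledU_mul _ _ hz0]
      rw [← hεdef]
      linear_combination z ^ (2 * P.h) * this)
  set E := z ^ (2 * P.h)
  have hom := Q.om_pos E hE
  have hX : ∀ φ, Q.X φ E = z * Ξ (ε, W / Q.om E * φ) ∧ Q.Y φ E = z ^ P.h * Η (ε, W / Q.om E * φ) := by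
    intro φ
    have := hsol (φ / Q.om E)
    rw [mul_div_cancel₀ _ hom.ne'] at this
    rw [← this.1, ← this.2]
    constructor <;> congr 3 <;> ring
  -- The two parametrisations of the orbit differ by the factor W/ω(E) in the phase. Minimality of
  -- 2π on either side gives W ≤ ω(E) and ω(E) ≤ W.
  have hper1 : 2 * Real.pi ≤ Q.om E * (2 * Real.pi / W) := by
    refine Q.least_period E hE _ (by positivity) fun φ => ?_
    simp only [hX, mul_add]
    have : W / Q.om E * (Q.om E * (2 * Real.pi / W)) = 2 * Real.pi := by field_simp
    rw [this, hΞp, hΗp]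
  have hper2 : 2 * Real.pi ≤ W / Q.om E * (2 * Real.pi) := by
    have h3 := Q.periodic E hE 0
    simp only [hX, zero_add, mul_zero, Prod.mk.injEq, mul_eq_mul_left_iff, hz0.ne',
      or_false, (pow_pos hz0 P.h).ne'] at h3
    exact hleast ε _ (by positivity) h3.1 h3.2
  have heq : Q.om E = W := by
    refine le_antisymm ?_ ?_
    · rw [div_mul_eq_mul_div, le_div_iff₀ hom] at hper2
      nlinarith
    · rw [← mul_div_assoc, le_div_iff₀ hWp] at hper1
      nlinarith
  refine ⟨hE, heq, fun φ => ?_⟩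
  have := hX φ
  rwa [heq, div_self hWp.ne', one_mul] at this

end ResonantFrame

/-! ### Integer powers of e = τ^(-1/N) and the resonant energy -/

/-- A smooth branch of roots through a simple root at parameter `0`. -/
theorem exists_smooth_root {g : ℝ × ℝ → ℝ} (hg : ContDiff ℝ ∞ g) {y₀ η : ℝ} (hη : 0 < η)
    (h0 : g (0, y₀) = 0) (hd : 0 < lastDeriv g (0, y₀)) :
    ∃ δ > 0, ∃ r : ℝ → ℝ, ContDiff ℝ ∞ r ∧ (∀ d, |r d - y₀| < η) ∧
      ∀ d, |d| ≤ δ → g (d, r d) = 0 := by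
  have hcl : Continuous (lastDeriv g) := (contDiff_lastDeriv hg).continuous
  have hev : ∀ᶠ y in 𝓝 y₀, 0 < lastDeriv g (0, y) :=
    (hcl.comp (by fun_prop : Continuous fun y : ℝ => ((0 : ℝ), y))).continuousAt
      |>.eventually_const_lt hd
  obtain ⟨κ, hκ, hκd⟩ := Metric.eventually_nhds_iff.1 hev
  set ρ := min (κ / 2) (η / 2) with hρ
  have hρ0 : 0 < ρ := by positivity
  have hρκ : ρ ≤ κ / 2 := min_le_left _ _
  have hρη : ρ ≤ η / 2 := min_le_right _ _
  set a := y₀ - ρ with ha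
  set b := y₀ + ρ with hb
  have hgd : ∀ d y, HasDerivAt (fun y => g (d, y)) (lastDeriv g (d, y)) y :=
    fun d y => hasDerivAt_last hg d y
  have hpos0 : ∀ y ∈ Icc a b, 0 < lastDeriv g (0, y) := fun y hy => hκd (by
    rw [Real.dist_eq, abs_lt]; constructor <;> linarith [hy.1, hy.2])
  have hm0 : StrictMonoOn (fun y => g (0, y)) (Icc a b) :=
    strictMonoOn_of_deriv_pos (convex_Icc a b)
      (fun y _ => (hgd 0 y).continuousAt.continuousWithinAt)
      fun y hy => by rw [(hgd 0 y).deriv]; exact hpos0 y (interior_subset hy)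
  have hyI : y₀ ∈ Icc a b := ⟨by linarith, by linarith⟩
  have hga : g (0, a) < 0 := by
    have := hm0 (⟨le_rfl, by linarith⟩ : a ∈ Icc a b) hyI (by linarith)
    simpa only [h0] using this
  have hgb : 0 < g (0, b) := by
    have := hm0 hyI (⟨by linarith, le_rfl⟩ : b ∈ Icc a b) (by linarith)
    simpa only [h0] using this
  have hgc := hg.continuous
  obtain ⟨δ₁, hδ₁, H₁⟩ := exists_pos_of_compact (isCompact_singleton (x := a))
    (F := fun q : ℝ × ℝ => -g (q.2, q.1)) (by fun_prop) (by simpa using hga)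
  obtain ⟨δ₂, hδ₂, H₂⟩ := exists_pos_of_compact (isCompact_singleton (x := b))
    (F := fun q : ℝ × ℝ => g (q.2, q.1)) (by fun_prop) (by simpa using hgb)
  obtain ⟨δ₃, hδ₃, H₃⟩ := exists_pos_of_compact (isCompact_Icc (a := a) (b := b))
    (F := fun q : ℝ × ℝ => lastDeriv g (q.2, q.1)) (by fun_prop) hpos0
  set δ := min δ₁ (min δ₂ δ₃)
  have hδ : 0 < δ := by positivity
  obtain ⟨β, hβ, hβδ, hβid⟩ := exists_smooth_clamp hδ
  have h1 : ∀ d, g (β d, a) < 0 := fun d => by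
    have := H₁ (β d) ((hβδ d).trans_le (min_le_left _ _)) a rfl; simpa using this
  have h2 : ∀ d, 0 < g (β d, b) := fun d =>
    H₂ (β d) ((hβδ d).trans_le ((min_le_right _ _).trans (min_le_left _ _))) b rfl
  have h3 : ∀ d, ∀ y ∈ Icc a b, 0 < lastDeriv g (β d, y) := fun d y hy =>
    H₃ (β d) ((hβδ d).trans_le ((min_le_right _ _).trans (min_le_right _ _))) y hy
  have hm : ∀ d, StrictMonoOn (fun y => g (β d, y)) (Icc a b) := fun d =>
    strictMonoOn_of_deriv_pos (convex_Icc a b)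
      (fun y _ => (hgd _ y).continuousAt.continuousWithinAt)
      fun y hy => by rw [(hgd _ y).deriv]; exact h3 d y (interior_subset hy)
  have hex : ∀ d, ∃ y ∈ Ioo a b, g (β d, y) = 0 := fun d => by
    have := intermediate_value_Ioo (a := a) (b := b) (by linarith)
      (f := fun y => g (β d, y)) (fun y _ => (hgd _ y).continuousAt.continuousWithinAt)
    exact this ⟨h1 d, h2 d⟩
  choose r hrI hr0 using hex
  refine ⟨δ / 2, by positivity, r, ?_, fun d => ?_, fun d hd => ?_⟩
  · obtain ⟨G, hG, hGdef⟩ : ∃ G : ℝ × ℝ → ℝ, ContDiff ℝ ∞ G ∧ ∀ d y, G (d, y) = g (β d, y) :=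
      ⟨fun q => g (β q.1, q.2), hg.comp ((hβ.comp contDiff_fst).prodMk contDiff_snd),
        fun _ _ => rfl⟩
    refine contDiff_iff_contDiffAt.2 fun d => ?_
    refine contDiffAt_root_of_strictMonoOn hG (hrI d).1 (hrI d).2
      (.of_forall fun q => Ioo_subset_Icc_self (hrI q)) (.of_forall fun q => by rw [hGdef, hr0])
      (.of_forall fun q => by simpa only [hGdef] using hm q) ?_
    have : lastDeriv G (d, r d) = lastDeriv g (β d, r d) := by
      simp only [lastDeriv, hGdef]
    rw [this]
    exact (h3 d _ (Ioo_subset_Icc_self (hrI d))).ne'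
  · rw [abs_lt]; constructor <;> linarith [(hrI d).1, (hrI d).2]
  · have := hr0 d
    rwa [hβid d hd] at this

namespace PerturbedOscillator

variable (P : PerturbedOscillator)

theorem nu_eq : P.nu = 1 + (P.b : ℝ) / P.q := by unfold nu mu; ring

theorem nu_pos : 0 < P.nu := by
  rw [nu_eq]; have := P.q_pos; positivity

theorem N_eq : P.N = 2 * (P.q + P.b) * (P.h - 1) := by
  have hq := P.q_pos
  have hh := P.two_le_h
  have : (P.N : ℝ) = ((2 * (P.q + P.b) * (P.h - 1) : ℕ) : ℝ) := by
    rw [P.N_cast, nu_eq]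
    push_cast [Nat.cast_sub (by omega : 1 ≤ P.h)]
    field_simp
  exact_mod_cast this

theorem N_pos : 0 < P.N := by
  have h1 := P.one_le_b
  have h2 := P.two_le_h
  rw [N_eq]
  exact Nat.mul_pos (by omega) (by omega)

theorem vartheta_pos : 0 < P.vartheta := by
  have := P.s_pos; have := P.q_pos
  unfold vartheta; positivity

theorem M_pos (hrc : P.ResonanceCondition) : 0 < P.M := by
  have : (0 : ℝ) < P.M := by
    rw [P.M_cast hrc]
    have h1 := P.q_pos; have h2 := P.h_sub_one_pos
    have : 0 < P.mu := by unfold mu; linarith [hrc.2]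
    positivity
  exact_mod_cast this

/-- `M` in terms of the integer parameters. -/
theorem M_eq (hrc : P.ResonanceCondition) :
    (P.M : ℤ) = ((P.h : ℤ) - 1) * (P.a + P.b * (2 - P.l)) - P.b * (P.p - 1) := by
  have hq := P.q_pos
  have hh := P.h_sub_one_pos
  have : ((P.M : ℤ) : ℝ) =
      ((((P.h : ℤ) - 1) * (P.a + P.b * (2 - P.l)) - P.b * (P.p - 1) : ℤ) : ℝ) := by
    push_cast
    rw [P.M_cast hrc]
    unfold mu sigma
    field_simp
    ring
  exact_mod_cast this

/-- This is the lower bound σ ≥ -1, since ν - 2μ = 1 + σ. It keeps the exponent N - 2M of the slow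
drift nonnegative. -/
theorem two_M_le_N (hrc : P.ResonanceCondition) : 2 * P.M ≤ P.N := by
  have : ((2 * P.M : ℕ) : ℝ) ≤ P.N := by
    push_cast
    rw [P.N_cast, P.M_cast hrc]
    have h1 := P.q_pos; have h2 := P.h_sub_one_pos
    have h3 : 2 * P.mu ≤ P.nu := by unfold nu; linarith [hrc.1]
    have : 0 < P.q * ((P.h : ℝ) - 1) := by positivity
    nlinarith
  exact_mod_cast this

/-- The natural number `2 q (h - 1)`, the exponent in `t = c e^(-2q(h-1))`, `e = τ^(-1/N)`. -/
def tdeg : ℕ := 2 * P.q * (P.h - 1)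

theorem tdeg_cast : (P.tdeg : ℝ) = 2 * P.q * ((P.h : ℝ) - 1) := by
  have hh := P.two_le_h
  unfold tdeg
  push_cast [Nat.cast_sub (by omega : 1 ≤ P.h)]
  ring

theorem tdeg_pos : 0 < P.tdeg := by
  have h1 := P.q_pos; have h2 := P.h_sub_one_pos
  have : (0 : ℝ) < P.tdeg := by rw [tdeg_cast]; positivity
  exact_mod_cast this

theorem N_cast_tdeg : (P.N : ℝ) = P.nu * P.tdeg := by
  rw [N_cast, tdeg_cast]; ring

/-- The constant in `t = c e^(-2q(h-1))`. -/
noncomputable def tcon : ℝ := P.nu ^ (1 / P.nu)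

theorem tcon_pos : 0 < P.tcon := Real.rpow_pos_of_pos P.nu_pos _

/-- The time `t` as a function of `e = τ^(-1/N)`. -/
noncomputable def tOf (e : ℝ) : ℝ := P.tcon / e ^ P.tdeg

theorem tOf_pos {e : ℝ} (he : 0 < e) : 0 < P.tOf e := div_pos P.tcon_pos (by positivity)

/-- `e = τ^(-1/N)`. -/
noncomputable def eOf (τ : ℝ) : ℝ := τ ^ (-(1 / (P.N : ℝ)))

theorem eOf_pos {τ : ℝ} (hτ : 0 < τ) : 0 < P.eOf τ := Real.rpow_pos_of_pos hτ _

theorem eOf_pow {τ : ℝ} (hτ : 0 < τ) (k : ℕ) : P.eOf τ ^ k = τ ^ (-((k : ℝ) / P.N)) := by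
  rw [eOf, ← Real.rpow_natCast, ← Real.rpow_mul hτ.le]
  congr 1; ring

theorem eOf_pow_N {τ : ℝ} (hτ : 0 < τ) : P.eOf τ ^ P.N = 1 / τ := by
  have hN : (P.N : ℝ) ≠ 0 := by exact_mod_cast P.N_pos.ne'
  rw [eOf_pow P hτ, div_self hN, Real.rpow_neg hτ.le, Real.rpow_one, one_div]

theorem tendsto_eOf : Tendsto P.eOf atTop (𝓝 0) := by
  have : (0 : ℝ) < 1 / P.N := by have := P.N_pos; positivity
  exact tendsto_rpow_neg_atTop this

theorem time_eq (Q : ResonantFrame P) {τ : ℝ} (hτ : 0 < τ) : Q.time τ = P.tOf (P.eOf τ) := by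
  have hν := P.nu_pos
  have hN : (0 : ℝ) < P.N := by exact_mod_cast P.N_pos
  have ht : (0 : ℝ) < P.tdeg := by exact_mod_cast P.tdeg_pos
  rw [ResonantFrame.time, tOf, tcon, eOf_pow P hτ, Real.mul_rpow hν.le hτ.le, Real.rpow_neg hτ.le,
    div_inv_eq_mul]
  congr 2
  rw [N_cast_tdeg]; field_simp

/-- Through this lemma all real powers of t that occur turn into integer powers of e. -/
theorem tOf_rpow {e : ℝ} (he : 0 < e) (x : ℝ) (m : ℤ) (hm : P.tdeg * x = m) :
    P.tOf e ^ x = P.tcon ^ x * e ^ (-m) := by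
  rw [tOf, Real.div_rpow P.tcon_pos.le (by positivity), ← Real.rpow_natCast, ← Real.rpow_mul he.le,
    hm, Real.rpow_intCast, zpow_neg, div_eq_mul_inv]

theorem hasDerivAt_S {t : ℝ} (ht : 0 < t) :
    HasDerivAt P.S (P.vartheta * t ^ ((P.b : ℝ) / P.q)) t := by
  have := (Real.hasDerivAt_rpow_const (x := t) (p := 1 + (P.b : ℝ) / P.q) (.inl ht.ne')).const_mul P.s
  refine this.congr_deriv ?_
  rw [vartheta]
  rw [add_sub_cancel_left]; ring

/-- The exponent of S is 1 + b/q = ν, the same as that of τ = t^ν/ν; so the phase is exactly linear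
in τ. -/
theorem zeta_eq (Q : ResonantFrame P) {τ : ℝ} (hτ : 0 < τ) : Q.zeta τ = P.vartheta * τ := by
  have hν := P.nu_pos
  rw [ResonantFrame.zeta, S, ResonantFrame.time, ← nu_eq, ← Real.rpow_mul (by positivity),
    one_div_mul_cancel hν.ne', Real.rpow_one, vartheta, ← nu_eq]
  ring

end PerturbedOscillator

/-- Smooth functions describing the energy-angle variables and the resonant energy at infinity. -/
structure ResonantFrame.Scaling {P : PerturbedOscillator} (Q : ResonantFrame P) where
  X : ℝ × ℝ → ℝ
  Y : ℝ × ℝ → ℝ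
  w : ℝ → ℝ
  k : ℝ → ℝ
  z₀ : ℝ
  e₀ : ℝ
  hX : ContDiff ℝ ∞ X
  hY : ContDiff ℝ ∞ Y
  hw : ContDiff ℝ ∞ w
  hk : ContDiff ℝ ∞ k
  w_pos : ∀ ε, 0 < w ε
  k_pos : ∀ e, 0 < k e
  X_per : ∀ ε φ, X (ε, φ + 2 * Real.pi) = X (ε, φ)
  Y_per : ∀ ε φ, Y (ε, φ + 2 * Real.pi) = Y (ε, φ)
  one_le_z₀ : 1 ≤ z₀
  om_eq : ∀ z ≥ z₀, Q.om (z ^ (2 * P.h)) = z ^ (P.h - 1) * w (1 / z)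
  X_eq : ∀ z ≥ z₀, ∀ φ, Q.X φ (z ^ (2 * P.h)) = z * X (1 / z, φ)
  Y_eq : ∀ z ≥ z₀, ∀ φ, Q.Y φ (z ^ (2 * P.h)) = z ^ P.h * Y (1 / z, φ)
  e₀_pos : 0 < e₀
  Istar_eq : ∀ e, 0 < e → e < e₀ →
    Q.Istar (P.tOf e) = (1 / (e ^ (2 * P.b) * k e)) ^ (2 * P.h)
  t₁_le : ∀ e, 0 < e → e < e₀ → Q.t₁ ≤ P.tOf e

/-- Seek I_* = z^(2h) with z = 1/(d y), d = e^(2b). As ω(z^(2h)) = z^(h-1) w(1/z) and S'/ϰ = C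
d^(-(h-1)), the resonance equation becomes C y^(h-1) = w(d y). This has a simple positive root at d
= 0, hence a smooth branch y(d), and k(e) = y(e^(2b)). Since ω is strictly increasing on [E₁,∞),
this solution is I_*. -/
theorem ResonantFrame.nonempty_scaling {P : PerturbedOscillator} (Q : ResonantFrame P) :
    Nonempty Q.Scaling := by
  obtain ⟨Ξ, Η, w, hΞ, hΗ, hw, hw0, hΞp, hΗp, z₀, hz₀, H⟩ := Q.exists_scaled
  have h2 := P.two_le_h
  have hq := P.q_pos
  have hb1 := P.one_le_b
  have hkap : (0 : ℝ) < Q.kap := by exact_mod_cast Q.kap_pos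
  have hth := P.vartheta_pos
  have htc := P.tcon_pos
  set C := P.vartheta * P.tcon ^ ((P.b : ℝ) / P.q) / Q.kap with hC
  have hC0 : 0 < C := by have := Real.rpow_pos_of_pos htc ((P.b : ℝ) / P.q); positivity
  set y₀ := (w 0 / C) ^ (1 / ((P.h - 1 : ℕ) : ℝ)) with hy₀
  have hwC : 0 < w 0 / C := div_pos (hw0 0) hC0
  have hy₀p : 0 < y₀ := Real.rpow_pos_of_pos hwC _
  have hy₀pow : y₀ ^ (P.h - 1) = w 0 / C := by
    rw [hy₀, one_div]
    exact Real.rpow_inv_natCast_pow hwC.le (by omega)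
  obtain ⟨g, hg, hgdef⟩ : ∃ g : ℝ × ℝ → ℝ, ContDiff ℝ ∞ g ∧
      ∀ d y, g (d, y) = C * y ^ (P.h - 1) - w (d * y) :=
    ⟨fun p => C * p.2 ^ (P.h - 1) - w (p.1 * p.2),
      (ContDiff.mul contDiff_const (contDiff_snd.pow _)).sub (hw.comp (by fun_prop)),
      fun _ _ => rfl⟩
  have hld : lastDeriv g (0, y₀) = C * ((P.h - 1 : ℕ) * y₀ ^ (P.h - 1 - 1)) := by
    simp only [lastDeriv, hgdef, zero_mul]
    exact (((hasDerivAt_pow (P.h - 1) y₀).const_mul C).sub_const _).deriv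
  obtain ⟨δ, hδ, r, hr, hry, hroot⟩ := exists_smooth_root hg (y₀ := y₀) (η := y₀ / 2)
    (by positivity) (by rw [hgdef, hy₀pow, zero_mul]; field_simp; ring) (by
      rw [hld]
      have : (0 : ℝ) < (P.h - 1 : ℕ) := by exact_mod_cast (by omega : 0 < P.h - 1)
      positivity)
  have hrp : ∀ d, 0 < r d := fun d => by have := abs_lt.1 (hry d); linarith
  -- A nonzero value of `deriv` entails differentiability, which supplies the continuity needed
  -- here.
  have hmono : StrictMonoOn Q.om (Ici Q.E₁) := by
    refine strictMonoOn_of_deriv_pos (convex_Ici _) (fun E hE => ?_) (fun E hE => ?_)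
    · exact (differentiableAt_of_deriv_ne_zero
        (Q.om_deriv_pos E hE).ne').continuousAt.continuousWithinAt
    · exact Q.om_deriv_pos E (interior_subset hE)
  -- smallness conditions on `e`
  have hlim0 : Tendsto (fun e : ℝ => e ^ (2 * P.b) * r (e ^ (2 * P.b))) (𝓝 0) (𝓝 0) := by
    have : Continuous fun e : ℝ => e ^ (2 * P.b) * r (e ^ (2 * P.b)) := by
      have := hr.continuous; fun_prop
    have h0 := this.tendsto 0
    rwa [zero_pow (by omega), zero_mul] at h0
  have hev : ∀ᶠ e in 𝓝[>] (0 : ℝ), |e ^ (2 * P.b)| ≤ δ ∧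
      z₀ ≤ 1 / (e ^ (2 * P.b) * r (e ^ (2 * P.b))) ∧
      Q.E₁ ≤ 1 / (e ^ (2 * P.b) * r (e ^ (2 * P.b))) ∧ Q.t₁ ≤ P.tOf e := by
    have h1 : ∀ᶠ e in 𝓝[>] (0 : ℝ), |e ^ (2 * P.b)| ≤ δ := by
      have : Tendsto (fun e : ℝ => |e ^ (2 * P.b)|) (𝓝 0) (𝓝 0) := by
        have hc : Continuous fun e : ℝ => |e ^ (2 * P.b)| := by fun_prop
        have h0 := hc.tendsto 0
        rwa [zero_pow (by omega), abs_zero] at h0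
      exact (this.eventually_le_const hδ).filter_mono nhdsWithin_le_nhds
    have h3 : Tendsto (fun e : ℝ => 1 / (e ^ (2 * P.b) * r (e ^ (2 * P.b)))) (𝓝[>] 0) atTop := by
      simp only [one_div]
      refine tendsto_inv_nhdsGT_zero.comp (tendsto_nhdsWithin_iff.2
        ⟨hlim0.mono_left nhdsWithin_le_nhds, ?_⟩)
      filter_upwards [self_mem_nhdsWithin] with e he
      have he : 0 < e := he
      have := hrp (e ^ (2 * P.b))
      exact mul_pos (by positivity) this
    have h4 : Tendsto P.tOf (𝓝[>] 0) atTop := by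
      unfold PerturbedOscillator.tOf
      have : Tendsto (fun e : ℝ => e ^ P.tdeg) (𝓝[>] 0) (𝓝[>] 0) := by
        refine tendsto_nhdsWithin_iff.2 ⟨?_, ?_⟩
        · have hc : Continuous fun e : ℝ => e ^ P.tdeg := by fun_prop
          have h0 := hc.tendsto 0
          rw [zero_pow P.tdeg_pos.ne'] at h0
          exact h0.mono_left nhdsWithin_le_nhds
        · filter_upwards [self_mem_nhdsWithin] with e he
          exact pow_pos (show (0 : ℝ) < e from he) _
      simpa only [div_eq_mul_inv, Function.comp_def] using (tendsto_inv_nhdsGT_zero.comp this).const_mul_atTop htc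
    filter_upwards [h1, h3.eventually_ge_atTop z₀, h3.eventually_ge_atTop Q.E₁,
      h4.eventually_ge_atTop Q.t₁] with e a b c d using ⟨a, b, c, d⟩
  obtain ⟨e₀, he₀, hev⟩ := (eventually_nhdsWithin_iff.trans Metric.eventually_nhds_iff).1 hev
  refine ⟨⟨Ξ, Η, w, fun e => r (e ^ (2 * P.b)), z₀, e₀, hΞ, hΗ, hw, hr.comp (by fun_prop), hw0,
    fun e => hrp _, hΞp, hΗp, hz₀, fun z hz => (H z hz).2.1, fun z hz φ => ((H z hz).2.2 φ).1,
    fun z hz φ => ((H z hz).2.2 φ).2, he₀, fun e he0 he => ?_,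
    fun e he0 he => (hev (by simpa [abs_of_pos he0] using he) he0).2.2.2⟩⟩
  obtain ⟨c1, c2, c3, c4⟩ := hev (by simpa [abs_of_pos he0] using he) he0
  set d := e ^ (2 * P.b) with hd
  have hd0 : 0 < d := by positivity
  have hrd := hrp d
  set z := 1 / (d * r d) with hz
  have hzp : 0 < z := by positivity
  have hz1 : 1 ≤ z := hz₀.trans c2
  have hE : Q.E₁ ≤ z ^ (2 * P.h) := c3.trans (le_self_pow₀ hz1 (by omega))
  refine hmono.injOn (Q.Istar_ge _ c4) hE ?_
  rw [Q.Istar_eq _ c4, (H z c2).2.1, (P.hasDerivAt_S (P.tOf_pos he0)).deriv,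
    P.tOf_rpow he0 _ (2 * (P.h - 1) * P.b) (by rw [P.tdeg_cast]; push_cast; field_simp)]
  have h5 := hroot d c1
  rw [hgdef] at h5
  have h6 : 1 / z = d * r d := by rw [hz, one_div_one_div]
  have h7 : w (1 / z) = C * r d ^ (P.h - 1) := by rw [h6]; linarith
  have h8 : (e : ℝ) ^ (-(2 * ((P.h : ℤ) - 1) * P.b)) = (d ^ (P.h - 1))⁻¹ := by
    rw [hd, ← pow_mul, zpow_neg]
    congr 1
    rw [← zpow_natCast]
    congr 1
    push_cast [Nat.cast_sub (by omega : 1 ≤ P.h)]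
    ring
  rw [h7, h8, hz, hC]
  rw [one_div, inv_pow, mul_pow]
  field_simp

/-! ### Expansions in e with coefficients periodic in the phases -/

/-- Smooth functions of `((r,θ,ζ),e)` that are `2π`-periodic in `θ` and `per`-periodic in `ζ`. -/
structure SmoothPer (per : ℝ) (u : (ℝ × ℝ × ℝ) × ℝ → ℝ) : Prop where
  smooth : ContDiff ℝ ∞ u
  per_θ : ∀ r θ ζ e, u ((r, θ + 2 * Real.pi, ζ), e) = u ((r, θ, ζ), e)
  per_ζ : ∀ r θ ζ e, u ((r, θ, ζ + per), e) = u ((r, θ, ζ), e)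

namespace SmoothPer

variable {per : ℝ} {u v : (ℝ × ℝ × ℝ) × ℝ → ℝ}

theorem add (hu : SmoothPer per u) (hv : SmoothPer per v) : SmoothPer per (fun p => u p + v p) :=
  ⟨hu.smooth.add hv.smooth, fun r θ ζ e => by rw [hu.per_θ, hv.per_θ],
    fun r θ ζ e => by rw [hu.per_ζ, hv.per_ζ]⟩

theorem mul (hu : SmoothPer per u) (hv : SmoothPer per v) : SmoothPer per (fun p => u p * v p) :=
  ⟨hu.smooth.mul hv.smooth, fun r θ ζ e => by rw [hu.per_θ, hv.per_θ],
    fun r θ ζ e => by rw [hu.per_ζ, hv.per_ζ]⟩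

theorem sub (hu : SmoothPer per u) (hv : SmoothPer per v) : SmoothPer per (fun p => u p - v p) :=
  ⟨hu.smooth.sub hv.smooth, fun r θ ζ e => by rw [hu.per_θ, hv.per_θ],
    fun r θ ζ e => by rw [hu.per_ζ, hv.per_ζ]⟩

theorem pow (hu : SmoothPer per u) (n : ℕ) : SmoothPer per (fun p => u p ^ n) :=
  ⟨hu.smooth.pow n, fun r θ ζ e => by rw [hu.per_θ], fun r θ ζ e => by rw [hu.per_ζ]⟩

theorem div (hu : SmoothPer per u) (hv : SmoothPer per v) (h : ∀ p, v p ≠ 0) :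
    SmoothPer per (fun p => u p / v p) :=
  ⟨hu.smooth.div hv.smooth h, fun r θ ζ e => by rw [hu.per_θ, hv.per_θ],
    fun r θ ζ e => by rw [hu.per_ζ, hv.per_ζ]⟩

theorem sum {ι : Type} {s : Finset ι} {f : ι → (ℝ × ℝ × ℝ) × ℝ → ℝ}
    (h : ∀ i ∈ s, SmoothPer per (f i)) : SmoothPer per (fun p => ∑ i ∈ s, f i p) :=
  ⟨ContDiff.sum fun i hi => (h i hi).smooth,
    fun r θ ζ e => Finset.sum_congr rfl fun i hi => (h i hi).per_θ r θ ζ e,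
    fun r θ ζ e => Finset.sum_congr rfl fun i hi => (h i hi).per_ζ r θ ζ e⟩

theorem of_re {g : ℝ × ℝ → ℝ} (hg : ContDiff ℝ ∞ g) : SmoothPer per (fun p => g (p.1.1, p.2)) :=
  ⟨hg.comp (by fun_prop), fun _ _ _ _ => rfl, fun _ _ _ _ => rfl⟩

theorem of_e {g : ℝ → ℝ} (hg : ContDiff ℝ ∞ g) : SmoothPer per (fun p => g p.2) :=
  ⟨hg.comp (by fun_prop), fun _ _ _ _ => rfl, fun _ _ _ _ => rfl⟩

theorem const (c : ℝ) : SmoothPer per (fun _ => c) :=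
  ⟨contDiff_const, fun _ _ _ _ => rfl, fun _ _ _ _ => rfl⟩

theorem of_ζ {g : ℝ → ℝ} (hg : ContDiff ℝ ∞ g) (hp : Function.Periodic g per) :
    SmoothPer per (fun p => g p.1.2.2) :=
  ⟨hg.comp (by fun_prop), fun _ _ _ _ => rfl, fun _ _ _ _ => hp _⟩

/-- Periodic smooth functions are bounded for bounded `r` and `e`. -/
theorem bounded (hper : 0 < per) (hu : SmoothPer per u) (R E : ℝ) :
    ∃ C, 0 ≤ C ∧ ∀ r θ ζ e, |r| ≤ R → |e| ≤ E → |u ((r, θ, ζ), e)| ≤ C := by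
  have hK : IsCompact ((Icc (-R) R ×ˢ Icc (0 : ℝ) (2 * Real.pi) ×ˢ Icc 0 per) ×ˢ Icc (-E) E) :=
    (isCompact_Icc.prod (isCompact_Icc.prod isCompact_Icc)).prod isCompact_Icc
  obtain ⟨C, hC⟩ := hK.exists_bound_of_continuousOn hu.smooth.continuous.continuousOn
  refine ⟨max C 0, le_max_right _ _, fun r θ ζ e hr he => ?_⟩
  have h1 : Function.Periodic (fun θ => u ((r, θ, ζ), e)) (2 * Real.pi) :=
    fun θ => hu.per_θ r θ ζ e
  obtain ⟨θ', hθ', h1'⟩ := h1.exists_mem_Ico₀ Real.two_pi_pos θ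
  have h2 : Function.Periodic (fun ζ => u ((r, θ', ζ), e)) per := fun ζ => hu.per_ζ r θ' ζ e
  obtain ⟨ζ', hζ', h2'⟩ := h2.exists_mem_Ico₀ hper ζ
  rw [show u ((r, θ, ζ), e) = u ((r, θ', ζ'), e) from h1'.trans h2']
  exact (hC ((r, θ', ζ'), e) ⟨⟨abs_le.1 hr, Ico_subset_Icc_self hθ', Ico_subset_Icc_self hζ'⟩,
    abs_le.1 he⟩).trans (le_max_left _ _)

end SmoothPer

theorem ResonantFrame.period_pos {P : PerturbedOscillator} (Q : ResonantFrame P) : 0 < Q.period := by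
  have : (0 : ℝ) < Q.kap := by exact_mod_cast Q.kap_pos
  unfold ResonantFrame.period; have := Real.pi_pos; positivity

/-- `Φ(r,θ,τ) = u(r,θ,ϑτ,e) + O(e^(n+1))` with `e = τ^(-1/N)`, uniformly for bounded `r`. -/
def ResonantFrame.IsExp {P : PerturbedOscillator} (Q : ResonantFrame P) (n : ℕ)
    (u : (ℝ × ℝ × ℝ) × ℝ → ℝ) (Φ : ℝ → ℝ → ℝ → ℝ) : Prop :=
  SmoothPer Q.period u ∧ ∀ R, ∃ C τ₁, ∀ τ ≥ τ₁, ∀ r θ, |r| ≤ R →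
    |Φ r θ τ - u ((r, θ, P.vartheta * τ), P.eOf τ)| ≤ C * P.eOf τ ^ (n + 1)

def ResonantFrame.HasExp {P : PerturbedOscillator} (Q : ResonantFrame P) (Φ : ℝ → ℝ → ℝ → ℝ) :
    Prop := ∀ n, ∃ u, Q.IsExp n u Φ

namespace ResonantFrame

variable {P : PerturbedOscillator} {Q : ResonantFrame P}

theorem exists_eOf_small {η : ℝ} (hη : 0 < η) : ∃ τ₁ > 0, ∀ τ ≥ τ₁, 0 < P.eOf τ ∧ P.eOf τ < η := by
  have := (P.tendsto_eOf.eventually_lt_const hη).and (eventually_gt_atTop 0)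
  obtain ⟨τ₁, h⟩ := eventually_atTop.1 this
  exact ⟨max τ₁ 1, by positivity, fun τ hτ =>
    ⟨P.eOf_pos (h τ ((le_max_left _ _).trans hτ)).2, (h τ ((le_max_left _ _).trans hτ)).1⟩⟩

theorem IsExp.congr {n : ℕ} {u : (ℝ × ℝ × ℝ) × ℝ → ℝ} {Φ Φ' : ℝ → ℝ → ℝ → ℝ}
    (h : Q.IsExp n u Φ) (heq : ∀ R, ∃ τ₁, ∀ τ ≥ τ₁, ∀ r θ, |r| ≤ R → Φ' r θ τ = Φ r θ τ) :
    Q.IsExp n u Φ' := by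
  refine ⟨h.1, fun R => ?_⟩
  obtain ⟨C, τ₁, h1⟩ := h.2 R
  obtain ⟨τ₂, h2⟩ := heq R
  refine ⟨C, max τ₁ τ₂, fun τ hτ r θ hr => ?_⟩
  rw [h2 τ ((le_max_right _ _).trans hτ) r θ hr]
  exact h1 τ ((le_max_left _ _).trans hτ) r θ hr

theorem IsExp.of_smooth {u : (ℝ × ℝ × ℝ) × ℝ → ℝ} (hu : SmoothPer Q.period u) (n : ℕ) :
    Q.IsExp n u (fun r θ τ => u ((r, θ, P.vartheta * τ), P.eOf τ)) :=
  ⟨hu, fun _ => ⟨0, 0, fun τ _ r θ _ => by simp⟩⟩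

theorem IsExp.add {n : ℕ} {u v : (ℝ × ℝ × ℝ) × ℝ → ℝ} {Φ Φ' : ℝ → ℝ → ℝ → ℝ}
    (h : Q.IsExp n u Φ) (h' : Q.IsExp n v Φ') :
    Q.IsExp n (fun p => u p + v p) (fun r θ τ => Φ r θ τ + Φ' r θ τ) := by
  refine ⟨h.1.add h'.1, fun R => ?_⟩
  obtain ⟨C, τ₁, h1⟩ := h.2 R
  obtain ⟨C', τ₂, h2⟩ := h'.2 R
  refine ⟨C + C', max τ₁ τ₂, fun τ hτ r θ hr => ?_⟩
  have a := h1 τ ((le_max_left _ _).trans hτ) r θ hr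
  have b := h2 τ ((le_max_right _ _).trans hτ) r θ hr
  rw [add_mul]
  refine le_trans (le_of_eq ?_) ((abs_add_le _ _).trans (add_le_add a b))
  congr 1; ring

theorem IsExp.smooth_mul {n : ℕ} {u v : (ℝ × ℝ × ℝ) × ℝ → ℝ} {Φ : ℝ → ℝ → ℝ → ℝ}
    (hv : SmoothPer Q.period v) (h : Q.IsExp n u Φ) :
    Q.IsExp n (fun p => v p * u p)
      (fun r θ τ => v ((r, θ, P.vartheta * τ), P.eOf τ) * Φ r θ τ) := by
  refine ⟨hv.mul h.1, fun R => ?_⟩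
  obtain ⟨C, τ₁, h1⟩ := h.2 R
  obtain ⟨C', hC', h2⟩ := hv.bounded Q.period_pos R 1
  obtain ⟨τ₂, hτ₂, h3⟩ := exists_eOf_small (P := P) one_pos
  refine ⟨C' * C, max τ₁ τ₂, fun τ hτ r θ hr => ?_⟩
  have a := h1 τ ((le_max_left _ _).trans hτ) r θ hr
  have b := h3 τ ((le_max_right _ _).trans hτ)
  have c := h2 r θ (P.vartheta * τ) (P.eOf τ) hr (by rw [abs_of_pos b.1]; exact b.2.le)
  rw [← mul_sub, abs_mul, mul_assoc]
  exact mul_le_mul c a (abs_nonneg _) hC'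

end ResonantFrame

/-- A fixed smooth function with values in `(-1/2, 1/2)` that is the identity near `0`. -/
noncomputable def clampHalf : ℝ → ℝ := Classical.choose (exists_smooth_clamp (half_pos one_pos))

theorem contDiff_clampHalf : ContDiff ℝ ∞ clampHalf :=
  (Classical.choose_spec (exists_smooth_clamp (half_pos one_pos))).1

theorem abs_clampHalf_lt (x : ℝ) : |clampHalf x| < 1 / 2 :=
  (Classical.choose_spec (exists_smooth_clamp (half_pos one_pos))).2.1 x

theorem clampHalf_eq {x : ℝ} (hx : |x| ≤ 1 / 4) : clampHalf x = x :=
  (Classical.choose_spec (exists_smooth_clamp (half_pos one_pos))).2.2 x (by linarith)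

namespace ResonantFrame.Scaling

variable {P : PerturbedOscillator} {Q : ResonantFrame P} (sc : Q.Scaling)

/-- The constant in `t^(-μ) = c e^M`. -/
noncomputable def cr (_ : Q.Scaling) : ℝ := P.tcon ^ (-P.mu)

theorem cr_pos : 0 < sc.cr := Real.rpow_pos_of_pos P.tcon_pos _

/-- The factor `1 + t^(-μ) r`. -/
noncomputable def v (p : (ℝ × ℝ × ℝ) × ℝ) : ℝ := 1 + clampHalf (sc.cr * p.2 ^ P.M * p.1.1)

/-- `ε = I^(-1/(2h))`. -/
noncomputable def eps (p : (ℝ × ℝ × ℝ) × ℝ) : ℝ := p.2 ^ (2 * P.b) * (sc.k p.2 / sc.v p)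

/-- The angle `φ = θ + ζ/ϰ`. -/
noncomputable def ang (_ : Q.Scaling) (p : (ℝ × ℝ × ℝ) × ℝ) : ℝ := p.1.2.1 + p.1.2.2 / Q.kap

theorem v_pos (p : (ℝ × ℝ × ℝ) × ℝ) : 1 / 2 < sc.v p := by
  have := abs_lt.1 (abs_clampHalf_lt (sc.cr * p.2 ^ P.M * p.1.1))
  unfold v; linarith

theorem v_ne (p : (ℝ × ℝ × ℝ) × ℝ) : sc.v p ≠ 0 := by
  have := sc.v_pos p; positivity

theorem smoothPer_v : SmoothPer Q.period sc.v :=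
  ⟨contDiff_const.add (contDiff_clampHalf.comp (by fun_prop)), fun _ _ _ _ => rfl,
    fun _ _ _ _ => rfl⟩

theorem smoothPer_k : SmoothPer Q.period (fun p => sc.k p.2) := SmoothPer.of_e sc.hk

theorem smoothPer_epow (_ : Q.Scaling) (n : ℕ) : SmoothPer Q.period (fun p => p.2 ^ n) :=
  SmoothPer.of_e (contDiff_id.pow n)

theorem smoothPer_kv : SmoothPer Q.period (fun p => sc.k p.2 / sc.v p) :=
  sc.smoothPer_k.div sc.smoothPer_v sc.v_ne

theorem smoothPer_vk : SmoothPer Q.period (fun p => sc.v p / sc.k p.2) :=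
  sc.smoothPer_v.div sc.smoothPer_k fun p => (sc.k_pos p.2).ne'

theorem smoothPer_eps : SmoothPer Q.period sc.eps :=
  (sc.smoothPer_epow _).mul sc.smoothPer_kv

/-- Composition of a function of `(ε, φ)` that is periodic in `φ`. -/
theorem smoothPer_comp {g : ℝ × ℝ → ℝ} (hg : ContDiff ℝ ∞ g)
    (hp : ∀ ε φ, g (ε, φ + 2 * Real.pi) = g (ε, φ)) :
    SmoothPer Q.period (fun p => g (sc.eps p, sc.ang p)) := by
  have hkap : (Q.kap : ℝ) ≠ 0 := by have := Q.kap_pos; positivity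
  refine ⟨hg.comp (sc.smoothPer_eps.smooth.prodMk ?_), fun r θ ζ e => ?_, fun r θ ζ e => ?_⟩
  · unfold ang; fun_prop
  · rw [sc.smoothPer_eps.per_θ]
    have : sc.ang ((r, θ + 2 * Real.pi, ζ), e) = sc.ang ((r, θ, ζ), e) + 2 * Real.pi := by
      simp only [ang]; ring
    rw [this, hp]
  · rw [sc.smoothPer_eps.per_ζ]
    have : sc.ang ((r, θ, ζ + Q.period), e) = sc.ang ((r, θ, ζ), e) + 2 * Real.pi := by
      simp only [ang, ResonantFrame.period]; field_simp; ring
    rw [this, hp]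

theorem smoothPer_X : SmoothPer Q.period (fun p => sc.X (sc.eps p, sc.ang p)) :=
  sc.smoothPer_comp sc.hX sc.X_per

theorem smoothPer_Y : SmoothPer Q.period (fun p => sc.Y (sc.eps p, sc.ang p)) :=
  sc.smoothPer_comp sc.hY sc.Y_per

/-- The range of `e` for which all asymptotic formulas are exact when `|r| ≤ R`. -/
structure Good (R e : ℝ) : Prop where
  e_pos : 0 < e
  e_le : e ≤ 1
  e_lt : e < sc.e₀
  r_small : sc.cr * e ^ P.M * R ≤ 1 / 4
  z_large : e ^ (2 * P.b) * sc.k e * 2 * sc.z₀ < 1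

theorem exists_good (hM : 0 < P.M) (R : ℝ) : ∃ τ₁ > 0, ∀ τ ≥ τ₁, sc.Good R (P.eOf τ) := by
  have hb := P.one_le_b
  have h1 : Continuous fun e : ℝ => sc.cr * e ^ P.M * R := by fun_prop
  have h2 : Continuous fun e : ℝ => e ^ (2 * P.b) * sc.k e * 2 * sc.z₀ := by
    have := sc.hk.continuous; fun_prop
  have h1' := h1.tendsto 0
  have h2' := h2.tendsto 0
  rw [zero_pow hM.ne', mul_zero, zero_mul] at h1'
  rw [zero_pow (by omega), zero_mul, zero_mul, zero_mul] at h2'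
  have ev := ((h1'.comp P.tendsto_eOf).eventually_le_const (show (0 : ℝ) < 1 / 4 by norm_num)).and
    (((h2'.comp P.tendsto_eOf).eventually_lt_const one_pos).and
    ((P.tendsto_eOf.eventually_lt_const sc.e₀_pos).and
    ((P.tendsto_eOf.eventually_le_const one_pos).and (eventually_gt_atTop 0))))
  obtain ⟨τ₁, h⟩ := eventually_atTop.1 ev
  refine ⟨max τ₁ 1, by positivity, fun τ hτ => ?_⟩
  obtain ⟨a, b, c, d, f⟩ := h τ ((le_max_left _ _).trans hτ)
  exact ⟨P.eOf_pos f, d, c, a, b⟩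

variable {sc} {R e : ℝ}

theorem Good.v_eq (hg : sc.Good R e) {r θ ζ : ℝ} (hr : |r| ≤ R) :
    sc.v ((r, θ, ζ), e) = 1 + sc.cr * e ^ P.M * r := by
  unfold v
  rw [clampHalf_eq]
  have h1 : 0 ≤ sc.cr * e ^ P.M := by have := sc.cr_pos; have := hg.e_pos; positivity
  rw [abs_mul, abs_of_nonneg h1]
  exact (mul_le_mul_of_nonneg_left hr h1).trans hg.r_small

theorem Good.eps_pos (hg : sc.Good R e) {r θ ζ : ℝ} : 0 < sc.eps ((r, θ, ζ), e) := by
  have h1 := hg.e_pos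
  have h2 := sc.k_pos e
  have h3 := sc.v_pos ((r, θ, ζ), e)
  unfold eps
  positivity

theorem Good.z_gt (hg : sc.Good R e) {r θ ζ : ℝ} : sc.z₀ < 1 / sc.eps ((r, θ, ζ), e) := by
  rw [lt_div_iff₀ hg.eps_pos]
  have h1 := hg.e_pos
  have h2 := sc.k_pos e
  have h3 := sc.v_pos ((r, θ, ζ), e)
  have hz := sc.one_le_z₀
  have h4 : sc.k e / sc.v ((r, θ, ζ), e) ≤ sc.k e * 2 := by
    rw [div_le_iff₀ (by linarith)]; nlinarith
  have := hg.z_large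
  calc sc.z₀ * sc.eps ((r, θ, ζ), e) ≤ sc.z₀ * (e ^ (2 * P.b) * (sc.k e * 2)) := by
        unfold eps; gcongr
    _ < 1 := by linarith

theorem Good.zstar_gt (hg : sc.Good R e) : sc.z₀ < 1 / (e ^ (2 * P.b) * sc.k e) := by
  have h1 := hg.e_pos
  have h2 := sc.k_pos e
  have hz := sc.one_le_z₀
  rw [lt_div_iff₀ (by positivity)]
  have := hg.z_large
  have : 0 < e ^ (2 * P.b) * sc.k e * sc.z₀ := by positivity
  linarith

theorem tpow_mu (hrc : P.ResonanceCondition) (he : 0 < e) : P.tOf e ^ (-P.mu) = sc.cr * e ^ P.M := by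
  rw [P.tOf_rpow he _ (-(P.M : ℤ)), cr, neg_neg, zpow_natCast]
  push_cast
  rw [P.M_cast hrc, P.tdeg_cast]; ring

/-- Both the resonant energy and the factor 1 + t^(-μ) r enter as 2h-th powers, so the scaling
parameter of the energy I is just e^(2b) k/v. -/
theorem Good.energyOf_eq (hrc : P.ResonanceCondition) (hg : sc.Good R e) {r θ ζ : ℝ} (hr : |r| ≤ R) :
    Q.energyOf r (P.tOf e) = (1 / sc.eps ((r, θ, ζ), e)) ^ (2 * P.h) := by
  have h1 := hg.e_pos
  have h2 := sc.k_pos e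
  have h3 := sc.v_ne ((r, θ, ζ), e)
  rw [ResonantFrame.energyOf, sc.Istar_eq e hg.e_pos hg.e_lt, tpow_mu (sc := sc) hrc hg.e_pos,
    ← hg.v_eq (θ := θ) (ζ := ζ) hr, ← mul_pow]
  congr 1
  simp only [eps]
  field_simp

end ResonantFrame.Scaling

/-! ### The perturbation in scaled variables -/

namespace ResonantFrame.Scaling

variable {P : PerturbedOscillator} {Q : ResonantFrame P} (sc : Q.Scaling)

/-- `e^(2b) X`. -/
noncomputable def xs (p : (ℝ × ℝ × ℝ) × ℝ) : ℝ := sc.v p / sc.k p.2 * sc.X (sc.eps p, sc.ang p)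

/-- `e^(2bh) Y`. -/
noncomputable def ys (p : (ℝ × ℝ × ℝ) × ℝ) : ℝ :=
  (sc.v p / sc.k p.2) ^ P.h * sc.Y (sc.eps p, sc.ang p)

theorem smoothPer_xs : SmoothPer Q.period sc.xs := sc.smoothPer_vk.mul sc.smoothPer_X

theorem smoothPer_ys : SmoothPer Q.period sc.ys := (sc.smoothPer_vk.pow _).mul sc.smoothPer_Y

variable {sc} {R e : ℝ}

theorem inv_eps (p : (ℝ × ℝ × ℝ) × ℝ) (he : 0 < p.2) :
    p.2 ^ (2 * P.b) * (1 / sc.eps p) = sc.v p / sc.k p.2 := by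
  have h2 := sc.k_pos p.2
  have h3 := sc.v_ne p
  unfold eps
  field_simp

theorem Good.X_eq (hrc : P.ResonanceCondition) (hg : sc.Good R e) {r θ ζ : ℝ} (hr : |r| ≤ R) :
    Q.X (θ + ζ / Q.kap) (Q.energyOf r (P.tOf e)) =
      1 / sc.eps ((r, θ, ζ), e) * sc.X (sc.eps ((r, θ, ζ), e), sc.ang ((r, θ, ζ), e)) := by
  rw [hg.energyOf_eq hrc (θ := θ) (ζ := ζ) hr, sc.X_eq _ hg.z_gt.le, one_div_one_div]
  rfl

theorem Good.Y_eq (hrc : P.ResonanceCondition) (hg : sc.Good R e) {r θ ζ : ℝ} (hr : |r| ≤ R) :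
    Q.Y (θ + ζ / Q.kap) (Q.energyOf r (P.tOf e)) =
      (1 / sc.eps ((r, θ, ζ), e)) ^ P.h *
        sc.Y (sc.eps ((r, θ, ζ), e), sc.ang ((r, θ, ζ), e)) := by
  rw [hg.energyOf_eq hrc (θ := θ) (ζ := ζ) hr, sc.Y_eq _ hg.z_gt.le, one_div_one_div]
  rfl

theorem Good.mul_X (hrc : P.ResonanceCondition) (hg : sc.Good R e) {r θ ζ : ℝ} (hr : |r| ≤ R) :
    e ^ (2 * P.b) * Q.X (θ + ζ / Q.kap) (Q.energyOf r (P.tOf e)) = sc.xs ((r, θ, ζ), e) := by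
  rw [hg.X_eq hrc hr, ← mul_assoc, inv_eps ((r, θ, ζ), e) hg.e_pos, xs]

theorem Good.mul_Y (hrc : P.ResonanceCondition) (hg : sc.Good R e) {r θ ζ : ℝ} (hr : |r| ≤ R) :
    e ^ (2 * P.b * P.h) * Q.Y (θ + ζ / Q.kap) (Q.energyOf r (P.tOf e)) =
      sc.ys ((r, θ, ζ), e) := by
  rw [hg.Y_eq hrc hr, ← mul_assoc, pow_mul, ← mul_pow, inv_eps ((r, θ, ζ), e) hg.e_pos, ys]

end ResonantFrame.Scaling

namespace ResonantFrame

variable {P : PerturbedOscillator} {Q : ResonantFrame P}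

/-- A perturbation term multiplied by the power of `e` that makes it bounded. -/
noncomputable def scaledPert (Q : ResonantFrame P) (F : ℝ → ℝ → ℝ → ℝ → ℝ) (w : ℤ) (r θ τ : ℝ) : ℝ :=
  P.eOf τ ^ (2 * P.b * w) *
    F (Q.X (θ + P.S (Q.time τ) / Q.kap) (Q.energyOf r (Q.time τ)))
      (Q.Y (θ + P.S (Q.time τ) / Q.kap) (Q.energyOf r (Q.time τ))) (P.S (Q.time τ)) (Q.time τ)

theorem S_time (Q : ResonantFrame P) {τ : ℝ} (hτ : 0 < τ) : P.S (Q.time τ) = P.vartheta * τ :=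
  P.zeta_eq Q hτ

theorem scaledPert_eq (F : ℝ → ℝ → ℝ → ℝ → ℝ) (w : ℤ) (r θ : ℝ) {τ : ℝ} (hτ : 0 < τ) :
    Q.scaledPert F w r θ τ = P.eOf τ ^ (2 * P.b * w) *
      F (Q.X (θ + P.vartheta * τ / Q.kap) (Q.energyOf r (P.tOf (P.eOf τ))))
        (Q.Y (θ + P.vartheta * τ / Q.kap) (Q.energyOf r (P.tOf (P.eOf τ)))) (P.vartheta * τ)
        (P.tOf (P.eOf τ)) := by
  rw [scaledPert, Q.S_time hτ, P.time_eq Q hτ]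

theorem tOf_rpow_neg_div {e : ℝ} (he : 0 < e) (k : ℕ) :
    P.tOf e ^ (-((k : ℝ) / P.q)) = P.tcon ^ (-((k : ℝ) / P.q)) * e ^ (2 * (P.h - 1) * k) := by
  have hq := P.q_pos
  have := P.two_le_h
  rw [P.tOf_rpow he _ (-((2 * (P.h - 1) * k : ℕ) : ℤ)), neg_neg, zpow_natCast]
  rw [P.tdeg_cast]
  push_cast [Nat.cast_sub (by omega : 1 ≤ P.h)]
  field_simp

/-- The expansion of a scaled perturbation term, truncated at order `m`. -/
noncomputable def pertPoly (sc : Q.Scaling) (c : ℕ → ℕ → ℕ → ℝ → ℝ) (l : ℕ) (w : ℤ) (m : ℕ)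
    (p : (ℝ × ℝ × ℝ) × ℝ) : ℝ :=
  ∑ k ∈ Finset.range (m + 1), P.tcon ^ (-((k : ℝ) / P.q)) * p.2 ^ (2 * (P.h - 1) * k) *
    ∑ i ∈ Finset.range (P.p + 1), ∑ j ∈ Finset.range l, c k i j p.1.2.2 *
      (p.2 ^ (2 * P.b * (w - (i + P.h * j))).toNat * sc.xs p ^ i * sc.ys p ^ j)

theorem smoothPer_pertPoly (sc : Q.Scaling) {c : ℕ → ℕ → ℕ → ℝ → ℝ}
    (hc : ∀ k i j, ContDiff ℝ ∞ (c k i j))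
    (hper : ∀ k i j, Function.Periodic (c k i j) (2 * Real.pi)) (l : ℕ) (w : ℤ) (m : ℕ) :
    SmoothPer Q.period (pertPoly sc c l w m) := by
  refine SmoothPer.sum fun k _ => ((SmoothPer.const _).mul (sc.smoothPer_epow _)).mul
    (SmoothPer.sum fun i _ => SmoothPer.sum fun j _ => (SmoothPer.of_ζ (hc k i j) ?_).mul
      (((sc.smoothPer_epow _).mul (sc.smoothPer_xs.pow _)).mul (sc.smoothPer_ys.pow _)))
  have := (hper k i j).nat_mul Q.kap
  rwa [mul_comm] at this

/-- A monomial x^i y^j grows like e^(-2b(i + h j)). Terms with i + j > p have zero coefficient; for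
the others the bound on i + h j makes the exponent nonnegative, so `toNat` loses nothing. -/
theorem pertPoly_eq (hrc : P.ResonanceCondition) {sc : Q.Scaling} {R e : ℝ} (hg : sc.Good R e)
    {c : ℕ → ℕ → ℕ → ℝ → ℝ} (hzero : ∀ k i j S, P.p < i + j → c k i j S = 0) {l : ℕ} {w : ℤ}
    (hw : ∀ i j, j < l → i + j ≤ P.p → ((i + P.h * j : ℕ) : ℤ) ≤ w) (m : ℕ)
    {r θ ζ : ℝ} (hr : |r| ≤ R) :
    e ^ (2 * P.b * w) * ∑ k ∈ Finset.range (m + 1), P.tOf e ^ (-((k : ℝ) / P.q)) *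
        ∑ i ∈ Finset.range (P.p + 1), ∑ j ∈ Finset.range l, c k i j ζ *
          Q.X (θ + ζ / Q.kap) (Q.energyOf r (P.tOf e)) ^ i *
          Q.Y (θ + ζ / Q.kap) (Q.energyOf r (P.tOf e)) ^ j =
      pertPoly sc c l w m ((r, θ, ζ), e) := by
  have he := hg.e_pos
  rw [pertPoly, Finset.mul_sum]
  refine Finset.sum_congr rfl fun k _ => ?_
  rw [tOf_rpow_neg_div he, mul_left_comm, Finset.mul_sum]
  congr 1
  refine Finset.sum_congr rfl fun i _ => ?_
  rw [Finset.mul_sum]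
  refine Finset.sum_congr rfl fun j hj => ?_
  by_cases hij : P.p < i + j
  · simp [hzero k i j ζ hij]
  have h1 := hw i j (Finset.mem_range.1 hj) (not_lt.1 hij)
  rw [← hg.mul_X hrc hr, ← hg.mul_Y hrc hr, ← zpow_natCast e (Int.toNat _), Int.toNat_of_nonneg]
  · have : e ^ (2 * P.b * w) = e ^ (2 * (P.b : ℤ) * (w - (i + P.h * j))) *
        (e ^ (2 * P.b)) ^ i * (e ^ (2 * P.b * P.h)) ^ j := by
      rw [← pow_mul, ← pow_mul, ← zpow_natCast e (2 * P.b * i),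
        ← zpow_natCast e (2 * P.b * P.h * j), ← zpow_add₀ he.ne', ← zpow_add₀ he.ne']
      congr 1
      push_cast
      ring
    rw [this]
    ring
  · push_cast at h1
    have : (0 : ℤ) ≤ w - (i + P.h * j) := by linarith
    positivity

/-- A perturbation with the assumed asymptotic expansion gives an expansion in powers of `e`. -/
theorem hasExp_scaledPert (hrc : P.ResonanceCondition) (sc : Q.Scaling)
    {F : ℝ → ℝ → ℝ → ℝ → ℝ} {c : ℕ → ℕ → ℕ → ℝ → ℝ}
    (hc : ∀ k i j, ContDiff ℝ ∞ (c k i j))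
    (hper : ∀ k i j, Function.Periodic (c k i j) (2 * Real.pi))
    (hzero : ∀ k i j S, P.p < i + j → c k i j S = 0) {l : ℕ} {w : ℤ}
    (hw : ∀ i j, j < l → i + j ≤ P.p → ((i + P.h * j : ℕ) : ℤ) ≤ w)
    (hF : ∃ m : ℕ, ∀ n : ℕ, ∃ C t₀ : ℝ, 0 < t₀ ∧ ∀ t ≥ t₀, ∀ x y S : ℝ,
      |F x y S t - ∑ k ∈ Finset.range (n + 1), t ^ (-((k : ℝ) / P.q)) *
        ∑ i ∈ Finset.range (P.p + 1), ∑ j ∈ Finset.range l, c k i j S * x ^ i * y ^ j|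
      ≤ C * t ^ (-(((n : ℝ) + 1) / P.q)) * (1 + |x| + |y|) ^ m) :
    Q.HasExp (Q.scaledPert F w) := by
  intro n
  obtain ⟨m, hm⟩ := hF
  set B := (2 * (P.b : ℤ) * w).natAbs with hB
  set n' := n + 2 * P.b * P.h * m + B with hn'
  obtain ⟨C, t₀, ht₀, hC⟩ := hm n'
  refine ⟨pertPoly sc c l w n', smoothPer_pertPoly sc hc hper l w n', fun R => ?_⟩
  obtain ⟨C₁, hC₁, hxs⟩ := sc.smoothPer_xs.bounded Q.period_pos R 1
  obtain ⟨C₂, hC₂, hys⟩ := sc.smoothPer_ys.bounded Q.period_pos R 1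
  obtain ⟨τ₁, hτ₁, hgood⟩ := sc.exists_good (P.M_pos hrc) R
  have htime : Tendsto (fun τ => P.tcon / P.eOf τ ^ P.tdeg) atTop atTop := by
    refine Tendsto.const_mul_atTop P.tcon_pos ?_
    refine Tendsto.inv_tendsto_nhdsGT_zero (tendsto_nhdsWithin_iff.2 ⟨?_, ?_⟩)
    · have := P.tendsto_eOf.pow P.tdeg
      rwa [zero_pow P.tdeg_pos.ne'] at this
    · filter_upwards [eventually_gt_atTop 0] with τ hτ
      exact pow_pos (P.eOf_pos hτ) _
  obtain ⟨τ₂, hτ₂⟩ := eventually_atTop.1 (htime.eventually_ge_atTop t₀)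
  refine ⟨|C| * P.tcon ^ (-(((n' : ℝ) + 1) / P.q)) * (1 + C₁ + C₂) ^ m, max τ₁ τ₂,
    fun τ hτ r θ hr => ?_⟩
  have hg := hgood τ ((le_max_left _ _).trans hτ)
  have hτ0 : 0 < τ := hτ₁.trans_le ((le_max_left _ _).trans hτ)
  have ht := hτ₂ τ ((le_max_right _ _).trans hτ)
  set e := P.eOf τ
  have he := hg.e_pos
  have he1 := hg.e_le
  have hea : |e| ≤ 1 := by rwa [abs_of_pos he]
  rw [scaledPert_eq F w r θ hτ0]
  set ζ := P.vartheta * τ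
  set x := Q.X (θ + ζ / Q.kap) (Q.energyOf r (P.tOf e)) with hx
  set y := Q.Y (θ + ζ / Q.kap) (Q.energyOf r (P.tOf e)) with hy
  rw [← pertPoly_eq hrc hg hzero hw n' hr, ← mul_sub, abs_mul, abs_of_pos (zpow_pos he _)]
  have hmain := hC (P.tOf e) ht x y ζ
  have hX : e ^ (2 * P.b) * |x| ≤ C₁ := by
    have := hxs r θ ζ e hr hea
    rwa [← hg.mul_X hrc hr, abs_mul, abs_of_pos (pow_pos he _)] at this
  have hY : e ^ (2 * P.b * P.h) * |y| ≤ C₂ := by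
    have := hys r θ ζ e hr hea
    rwa [← hg.mul_Y hrc hr, abs_mul, abs_of_pos (pow_pos he _)] at this
  have hh : 1 ≤ P.h := by have := P.two_le_h; omega
  have hpw : e ^ (2 * P.b * P.h) ≤ e ^ (2 * P.b) :=
    pow_le_pow_of_le_one he.le he1 (Nat.le_mul_of_pos_right _ hh)
  have hsum : e ^ (2 * P.b * P.h) * (1 + |x| + |y|) ≤ 1 + C₁ + C₂ := by
    have h1 : e ^ (2 * P.b * P.h) ≤ 1 := pow_le_one₀ he.le he1
    have h2 : e ^ (2 * P.b * P.h) * |x| ≤ e ^ (2 * P.b) * |x| :=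
      mul_le_mul_of_nonneg_right hpw (abs_nonneg x)
    linarith
  have hsum' : e ^ (2 * P.b * P.h * m) * (1 + |x| + |y|) ^ m ≤ (1 + C₁ + C₂) ^ m := by
    rw [pow_mul, ← mul_pow]
    exact pow_le_pow_left₀ (by positivity) hsum m
  have hpow : e ^ (2 * P.b * w) * e ^ B ≤ 1 := by
    rw [← zpow_natCast e B, ← zpow_add₀ he.ne']
    have : (0 : ℤ) ≤ 2 * P.b * w + B := by rw [hB]; omega
    obtain ⟨d, hd⟩ := Int.eq_ofNat_of_zero_le this
    rw [hd, zpow_natCast]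
    exact pow_le_one₀ he.le he1
  have htn : P.tOf e ^ (-(((n' : ℝ) + 1) / P.q)) ≤
      P.tcon ^ (-(((n' : ℝ) + 1) / P.q)) * (e ^ (n + 1) * e ^ (2 * P.b * P.h * m) * e ^ B) := by
    have h1 := tOf_rpow_neg_div (P := P) he (n' + 1)
    push_cast at h1
    rw [h1]
    refine mul_le_mul_of_nonneg_left ?_ (Real.rpow_pos_of_pos P.tcon_pos _).le
    rw [← pow_add, ← pow_add]
    refine pow_le_pow_of_le_one he.le he1 ?_
    have h2 := P.two_le_h
    have : n' + 1 ≤ 2 * (P.h - 1) * (n' + 1) := Nat.le_mul_of_pos_left _ (by omega)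
    omega
  have hct := Real.rpow_pos_of_pos P.tcon_pos (-(((n' : ℝ) + 1) / P.q))
  have hpos : 0 ≤ P.tOf e ^ (-(((n' : ℝ) + 1) / P.q)) :=
    Real.rpow_nonneg (P.tOf_pos he).le _
  have hq0 : 0 ≤ (1 + |x| + |y|) ^ m := by positivity
  calc _ ≤ e ^ (2 * P.b * w) * (|C| * P.tOf e ^ (-(((n' : ℝ) + 1) / P.q)) * (1 + |x| + |y|) ^ m) := by
        refine mul_le_mul_of_nonneg_left (hmain.trans ?_) (zpow_pos he _).le
        gcongr
        exact le_abs_self C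
    _ ≤ e ^ (2 * P.b * w) * (|C| * (P.tcon ^ (-(((n' : ℝ) + 1) / P.q)) *
          (e ^ (n + 1) * e ^ (2 * P.b * P.h * m) * e ^ B)) * (1 + |x| + |y|) ^ m) := by
        gcongr
    _ = |C| * P.tcon ^ (-(((n' : ℝ) + 1) / P.q)) * e ^ (n + 1) * (e ^ (2 * P.b * w) * e ^ B) *
          (e ^ (2 * P.b * P.h * m) * (1 + |x| + |y|) ^ m) := by ring
    _ ≤ |C| * P.tcon ^ (-(((n' : ℝ) + 1) / P.q)) * e ^ (n + 1) * 1 * (1 + C₁ + C₂) ^ m := by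
        have : 0 ≤ e ^ (2 * P.b * w) * e ^ B := by positivity
        gcongr
    _ = _ := by ring

/-- The power of `e` used for `f`. -/
def wf (P : PerturbedOscillator) : ℤ := P.p + ((P.h : ℤ) - 1) * ((P.l : ℤ) - 1)

/-- The power of `e` used for `g`. -/
def wg (P : PerturbedOscillator) : ℤ := P.p + ((P.h : ℤ) - 1) * P.l

/-- The weight is the largest growth: i + h j = (i + j) + (h - 1) j ≤ p + (h - 1)(l - 1) for j ≤ l -
1. For g the bound is j ≤ l. -/
theorem hasExp_f (hrc : P.ResonanceCondition) (sc : Q.Scaling) :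
    Q.HasExp (Q.scaledPert P.f (wf P)) := by
  refine hasExp_scaledPert hrc sc P.A_smooth P.A_periodic P.A_zero (fun i j hj hij => ?_)
    P.f_expansion
  have h2 : (2 : ℤ) ≤ P.h := by exact_mod_cast P.two_le_h
  have hj' : (j : ℤ) + 1 ≤ P.l := by exact_mod_cast hj
  have hij' : (i : ℤ) + j ≤ P.p := by exact_mod_cast hij
  rw [wf]; push_cast
  nlinarith

theorem hasExp_g (hrc : P.ResonanceCondition) (sc : Q.Scaling) :
    Q.HasExp (Q.scaledPert P.g (wg P)) := by
  refine hasExp_scaledPert hrc sc P.B_smooth P.B_periodic P.B_zero (fun i j hj hij => ?_)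
    P.g_expansion
  have h2 : (2 : ℤ) ≤ P.h := by exact_mod_cast P.two_le_h
  have hj' : (j : ℤ) + 1 ≤ P.l + 1 := by exact_mod_cast hj
  have hij' : (i : ℤ) + j ≤ P.p := by exact_mod_cast hij
  rw [wg]; push_cast
  nlinarith

end ResonantFrame

/-! ### The equations for r and θ in scaled variables -/

/-- If `G(z^n) = g(z)` for large `z`, then `G'(z^n) = g'(z) z / (n z^n)`. -/
theorem hasDerivAt_of_comp_pow {G g : ℝ → ℝ} {z₀ z g' : ℝ} {n : ℕ} (hn : n ≠ 0) (hz₀ : 0 ≤ z₀)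
    (hG : ∀ z ≥ z₀, G (z ^ n) = g z) (hz : z₀ < z) (hg : HasDerivAt g g' z) :
    HasDerivAt G (g' * (z / (n * z ^ n))) (z ^ n) := by
  have hz0 : 0 < z := hz₀.trans_lt hz
  have hn' : (n : ℝ) ≠ 0 := by exact_mod_cast hn
  have hroot : (z ^ n) ^ (1 / (n : ℝ)) = z := by
    rw [one_div]; exact Real.pow_rpow_inv_natCast hz0.le hn
  have h1 : HasDerivAt (fun E : ℝ => E ^ (1 / (n : ℝ))) (z / (n * z ^ n)) (z ^ n) := by
    refine (Real.hasDerivAt_rpow_const (p := 1 / (n : ℝ)) (Or.inl (pow_pos hz0 n).ne')).congr_deriv ?_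
    rw [Real.rpow_sub_one (pow_pos hz0 n).ne', hroot]
    field_simp
  have h2 : HasDerivAt (fun E : ℝ => g (E ^ (1 / (n : ℝ)))) (g' * (z / (n * z ^ n))) (z ^ n) := by
    rw [← hroot] at hg
    exact HasDerivAt.comp (z ^ n) hg h1
  refine h2.congr_of_eventuallyEq ?_
  have h3 : ∀ᶠ E in 𝓝 (z ^ n), z₀ < E ^ (1 / (n : ℝ)) := by
    have := h1.continuousAt.tendsto
    simp only [hroot] at this
    exact this.eventually_const_lt hz
  filter_upwards [h3, eventually_gt_nhds (pow_pos hz0 n)] with E hE hE0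
  rw [← hG _ hE.le, one_div, Real.rpow_inv_natCast_pow hE0.le hn]

theorem hasDerivAt_fst {g : ℝ × ℝ → ℝ} (hg : ContDiff ℝ ∞ g) (x y : ℝ) :
    HasDerivAt (fun x' => g (x', y)) (fderiv ℝ g (x, y) (1, 0)) x := by
  have h1 : HasFDerivAt g (fderiv ℝ g (x, y)) (x, y) :=
    (hg.differentiable (by simp)).differentiableAt.hasFDerivAt
  exact h1.comp_hasDerivAt x ((hasDerivAt_id x).prodMk (hasDerivAt_const x y))

theorem contDiff_fderiv_fst {g : ℝ × ℝ → ℝ} (hg : ContDiff ℝ ∞ g) :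
    ContDiff ℝ ∞ (fun p => fderiv ℝ g p (1, 0)) :=
  (hg.fderiv_right (m := ∞) (by simp)).clm_apply contDiff_const

theorem fderiv_fst_periodic {g : ℝ × ℝ → ℝ} (hg : ContDiff ℝ ∞ g) {c : ℝ}
    (hp : ∀ x y, g (x, y + c) = g (x, y)) (x y : ℝ) :
    fderiv ℝ g (x, y + c) (1, 0) = fderiv ℝ g (x, y) (1, 0) := by
  refine (hasDerivAt_fst hg x (y + c)).unique ?_
  simp only [hp]
  exact hasDerivAt_fst hg x y

namespace ResonantFrame.Scaling

variable {P : PerturbedOscillator} {Q : ResonantFrame P} (sc : Q.Scaling)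

/-- The z-derivative of z X(1/z,φ), written at ε = 1/z. Likewise `Yd` is the z-derivative of z^h
Y(1/z,φ) without its factor z^(h-1). -/
noncomputable def Xd (p : ℝ × ℝ) : ℝ := sc.X p - p.1 * fderiv ℝ sc.X p (1, 0)

noncomputable def Yd (p : ℝ × ℝ) : ℝ := P.h * sc.Y p - p.1 * fderiv ℝ sc.Y p (1, 0)

theorem contDiff_Xd : ContDiff ℝ ∞ sc.Xd :=
  sc.hX.sub (contDiff_fst.mul (contDiff_fderiv_fst sc.hX))

theorem contDiff_Yd : ContDiff ℝ ∞ sc.Yd :=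
  (contDiff_const.mul sc.hY).sub (contDiff_fst.mul (contDiff_fderiv_fst sc.hY))

theorem Xd_per (ε φ : ℝ) : sc.Xd (ε, φ + 2 * Real.pi) = sc.Xd (ε, φ) := by
  simp only [Xd, sc.X_per, fderiv_fst_periodic sc.hX sc.X_per]

theorem Yd_per (ε φ : ℝ) : sc.Yd (ε, φ + 2 * Real.pi) = sc.Yd (ε, φ) := by
  simp only [Yd, sc.Y_per, fderiv_fst_periodic sc.hY sc.Y_per]

theorem two_h_ne (P : PerturbedOscillator) : 2 * P.h ≠ 0 := by have := P.two_le_h; omega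

theorem deriv_X {z : ℝ} (hz : sc.z₀ < z) (φ : ℝ) :
    deriv (fun E => Q.X φ E) (z ^ (2 * P.h)) =
      sc.Xd (1 / z, φ) * (z / ((2 * P.h : ℕ) * z ^ (2 * P.h))) := by
  have hz0 : 0 < z := by linarith [sc.one_le_z₀]
  refine (hasDerivAt_of_comp_pow (two_h_ne P) (by linarith [sc.one_le_z₀])
    (fun z hz => sc.X_eq z hz φ) hz ?_).deriv
  have h1 : HasDerivAt (fun z : ℝ => 1 / z) (-(1 / z ^ 2)) z := by
    simpa [one_div] using hasDerivAt_inv hz0.ne'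
  have h2 : HasDerivAt (fun z => sc.X (1 / z, φ)) _ z :=
    (hasDerivAt_fst sc.hX (1 / z) φ).comp z h1
  refine ((hasDerivAt_id z).mul h2).congr_deriv ?_
  simp only [Xd, id]
  field_simp
  ring

theorem deriv_Y {z : ℝ} (hz : sc.z₀ < z) (φ : ℝ) :
    deriv (fun E => Q.Y φ E) (z ^ (2 * P.h)) =
      z ^ P.h * sc.Yd (1 / z, φ) / ((2 * P.h : ℕ) * z ^ (2 * P.h)) := by
  have hz0 : 0 < z := by linarith [sc.one_le_z₀]
  have hh : 2 ≤ P.h := P.two_le_h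
  have e := hasDerivAt_of_comp_pow (g' := z ^ (P.h - 1) * sc.Yd (1 / z, φ)) (two_h_ne P)
    (by linarith [sc.one_le_z₀]) (fun z hz => sc.Y_eq z hz φ) hz ?_
  · rw [e.deriv]
    obtain ⟨k, hk⟩ : ∃ k, P.h = k + 1 := ⟨P.h - 1, by omega⟩
    rw [show P.h - 1 = k by omega, show z ^ P.h = z ^ k * z by rw [hk, pow_succ]]
    ring
  · have h1 : HasDerivAt (fun z : ℝ => 1 / z) (-(1 / z ^ 2)) z := by
      simpa [one_div] using hasDerivAt_inv hz0.ne'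
    have h2 : HasDerivAt (fun z => sc.Y (1 / z, φ)) _ z :=
      (hasDerivAt_fst sc.hY (1 / z) φ).comp z h1
    refine ((hasDerivAt_pow P.h z).mul h2).congr_deriv ?_
    obtain ⟨k, hk⟩ : ∃ k, P.h = k + 1 := ⟨P.h - 1, by omega⟩
    rw [show P.h - 1 = k by omega, show z ^ P.h = z ^ k * z by rw [hk, pow_succ]]
    simp only [Yd]
    field_simp
    ring

/-- The logarithmic derivative of `I_*(t)` with respect to `log t`. -/
noncomputable def J (e : ℝ) : ℝ := 2 * P.h / P.tdeg * (2 * P.b + e * deriv sc.k e / sc.k e)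

theorem contDiff_J : ContDiff ℝ ∞ sc.J :=
  contDiff_const.mul (contDiff_const.add ((contDiff_id.mul
    ((contDiff_infty_iff_deriv.1 sc.hk).2)).div sc.hk fun e => (sc.k_pos e).ne'))

/-- Here log I_* = -2h (2b log e + log k(e)), and d log e / d log t = -1/(2q(h-1)) because t is a
constant times e^(-2q(h-1)). -/
theorem deriv_Istar {e : ℝ} (he : 0 < e) (he' : e < sc.e₀) :
    deriv Q.Istar (P.tOf e) / Q.Istar (P.tOf e) = sc.J e / P.tOf e := by
  have ht := P.tOf_pos he
  have hd := P.tdeg_pos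
  have hd' : (P.tdeg : ℝ) ≠ 0 := by exact_mod_cast hd.ne'
  have hk := sc.k_pos e
  have htc := P.tcon_pos
  set es : ℝ → ℝ := fun t => (P.tcon / t) ^ (1 / (P.tdeg : ℝ)) with hes
  have hese : es (P.tOf e) = e := by
    simp only [hes, PerturbedOscillator.tOf]
    rw [div_div_cancel₀ htc.ne', one_div, Real.pow_rpow_inv_natCast he.le hd.ne']
  have h1 : HasDerivAt es (-(e / (P.tdeg * P.tOf e))) (P.tOf e) := by
    have h2 : HasDerivAt (fun t : ℝ => P.tcon / t) (-(P.tcon / P.tOf e ^ 2)) (P.tOf e) := by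
      simp only [div_eq_mul_inv]
      exact ((hasDerivAt_inv ht.ne').const_mul P.tcon).congr_deriv (by ring)
    have hne : P.tcon / P.tOf e ≠ 0 := (div_pos htc ht).ne'
    refine (h2.rpow_const (p := 1 / (P.tdeg : ℝ)) (Or.inl hne)).congr_deriv ?_
    rw [Real.rpow_sub_one hne]
    have : (P.tcon / P.tOf e) ^ (1 / (P.tdeg : ℝ)) = e := hese
    rw [this]
    field_simp
  have h3 : HasDerivAt (fun e => (1 / (e ^ (2 * P.b) * sc.k e)) ^ (2 * P.h))
      (-(2 * P.h) * (2 * P.b / e + deriv sc.k e / sc.k e) * Q.Istar (P.tOf e)) e := by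
    have hk' : HasDerivAt sc.k (deriv sc.k e) e :=
      (sc.hk.differentiable (by simp)).differentiableAt.hasDerivAt
    have h4 : HasDerivAt (fun e => 1 / (e ^ (2 * P.b) * sc.k e))
        (-(2 * P.b / e + deriv sc.k e / sc.k e) * (1 / (e ^ (2 * P.b) * sc.k e))) e := by
      refine ((hasDerivAt_const _ (1 : ℝ)).div ((hasDerivAt_pow (2 * P.b) e).mul hk')
        (mul_pos (pow_pos he _) hk).ne').congr_deriv ?_
      obtain ⟨m, hm⟩ : ∃ m, 2 * P.b = m + 1 := ⟨2 * P.b - 1, by have := P.one_le_b; omega⟩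
      have hm' : (2 * P.b : ℝ) = m + 1 := by exact_mod_cast hm
      simp only [hm', hm, Nat.add_sub_cancel, Pi.mul_apply]
      push_cast
      field_simp
      ring
    refine (h4.pow (2 * P.h)).congr_deriv ?_
    rw [sc.Istar_eq e he he']
    obtain ⟨m, hm⟩ : ∃ m, 2 * P.h = m + 1 := ⟨2 * P.h - 1, by have := P.two_le_h; omega⟩
    have hm' : (2 * P.h : ℝ) = m + 1 := by exact_mod_cast hm
    simp only [hm', hm, Nat.add_sub_cancel, pow_succ]
    push_cast
    ring
  have h5 : HasDerivAt Q.Istar (sc.J e / P.tOf e * Q.Istar (P.tOf e)) (P.tOf e) := by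
    rw [← hese] at h3
    have h6 := HasDerivAt.comp (P.tOf e) h3 h1
    refine (h6.congr_deriv ?_).congr_of_eventuallyEq ?_
    · rw [hese, J]
      field_simp
    · have hlt : ∀ᶠ t in 𝓝 (P.tOf e), es t < sc.e₀ := by
        have := h1.continuousAt.tendsto
        rw [hese] at this
        exact this.eventually_lt_const he'
      filter_upwards [hlt, eventually_gt_nhds ht] with t h7 h8
      have h9 : 0 < es t := Real.rpow_pos_of_pos (div_pos htc h8) _
      have h10 : P.tOf (es t) = t := by
        simp only [hes, PerturbedOscillator.tOf]
        rw [one_div, Real.rpow_inv_natCast_pow (div_pos htc h8).le hd.ne', div_div_cancel₀ htc.ne']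
      simp only [Function.comp_apply]
      rw [← sc.Istar_eq _ h9 h7, h10]
  have hI : Q.Istar (P.tOf e) ≠ 0 := by
    rw [sc.Istar_eq e he he']; positivity
  rw [h5.deriv]
  field_simp

end ResonantFrame.Scaling

namespace ResonantFrame.Scaling

variable {P : PerturbedOscillator} {Q : ResonantFrame P} (sc : Q.Scaling)

/-- The part of τ^(M/N) dr/dτ that is free of f and g: the drift of the weight t^μ and of I_*(t).
`rf` and `rg` are the factors of the scaled f and g. -/
noncomputable def r0 (p : (ℝ × ℝ × ℝ) × ℝ) : ℝ :=
  P.mu * P.tcon ^ (-P.nu) * p.2 ^ (P.N - P.M) * p.1.1 -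
    P.tcon ^ (P.mu - P.nu) / (2 * P.h) * p.2 ^ (P.N - 2 * P.M) * (sc.v p * sc.J p.2)

noncomputable def rf (p : (ℝ × ℝ × ℝ) × ℝ) : ℝ :=
  P.tcon ^ (1 - P.nu + P.mu - (P.a : ℝ) / P.q) / (2 * P.h) *
    (sc.v p * (sc.k p.2 / sc.v p) * scaledU' P.h P.u (sc.X (sc.eps p, sc.ang p)) (sc.eps p))

noncomputable def rg (p : (ℝ × ℝ × ℝ) × ℝ) : ℝ :=
  P.tcon ^ (1 - P.nu + P.mu - (P.a : ℝ) / P.q) / (2 * P.h) *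
    (sc.v p * (sc.k p.2 / sc.v p) ^ P.h * sc.Y (sc.eps p, sc.ang p))

/-- The scaled frequency as a function of `e` and of the relative deviation of `I^(1/(2h))`. -/
noncomputable def freq (p : ℝ × ℝ) : ℝ :=
  (1 + clampHalf p.2) ^ (P.h - 1) * sc.w (p.1 ^ (2 * P.b) * sc.k p.1 / (1 + clampHalf p.2))

/-- The detuning ω(I) - ω(I_*). It vanishes with the relative deviation u = c e^M r, where c is
`cr`, so dividing by e^M leaves c r times a Hadamard quotient of the scaled frequency. -/
noncomputable def th0 (p : (ℝ × ℝ × ℝ) × ℝ) : ℝ :=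
  P.tcon ^ (-((P.b : ℝ) / P.q)) * sc.cr * p.1.1 *
    (hadQ sc.freq (p.2, sc.cr * p.2 ^ P.M * p.1.1) / sc.k p.2 ^ (P.h - 1))

/-- The factor e^M shows that f and g enter the phase equation only at higher order; `thg` has the
same factor. The leading phase velocity is therefore the detuning alone. -/
noncomputable def thf (p : (ℝ × ℝ × ℝ) × ℝ) : ℝ :=
  P.tcon ^ (1 - P.nu - (P.a : ℝ) / P.q) / (2 * P.h) *
    (p.2 ^ P.M * sc.w (sc.eps p) * (sc.k p.2 / sc.v p) * sc.Yd (sc.eps p, sc.ang p))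

noncomputable def thg (p : (ℝ × ℝ × ℝ) × ℝ) : ℝ :=
  -(P.tcon ^ (1 - P.nu - (P.a : ℝ) / P.q) / (2 * P.h)) *
    (p.2 ^ P.M * sc.w (sc.eps p) * (sc.k p.2 / sc.v p) ^ P.h * sc.Xd (sc.eps p, sc.ang p))

theorem smoothPer_r : SmoothPer Q.period (fun p => p.1.1) := SmoothPer.of_re contDiff_fst

theorem smoothPer_r0 : SmoothPer Q.period sc.r0 :=
  (((SmoothPer.const _).mul (sc.smoothPer_epow _)).mul smoothPer_r).sub
    (((SmoothPer.const _).mul (sc.smoothPer_epow _)).mul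
      (sc.smoothPer_v.mul (SmoothPer.of_e sc.contDiff_J)))

theorem smoothPer_rf : SmoothPer Q.period sc.rf := by
  refine (SmoothPer.const _).mul ((sc.smoothPer_v.mul sc.smoothPer_kv).mul ?_)
  have h1 := contDiff_scaledU' (h := P.h) (u := P.u)
  exact sc.smoothPer_comp (g := fun q => scaledU' P.h P.u (sc.X q) q.1)
    (h1.comp (sc.hX.prodMk contDiff_fst)) fun ε φ => by simp only [sc.X_per]

theorem smoothPer_rg : SmoothPer Q.period sc.rg :=
  (SmoothPer.const _).mul ((sc.smoothPer_v.mul (sc.smoothPer_kv.pow _)).mul sc.smoothPer_Y)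

theorem one_add_clampHalf_pos (x : ℝ) : 0 < 1 + clampHalf x := by
  have := abs_lt.1 (abs_clampHalf_lt x); linarith

theorem contDiff_freq : ContDiff ℝ ∞ sc.freq := by
  have h1 : ContDiff ℝ ∞ fun p : ℝ × ℝ => 1 + clampHalf p.2 :=
    contDiff_const.add (contDiff_clampHalf.comp contDiff_snd)
  have h2 : ContDiff ℝ ∞ fun p : ℝ × ℝ => p.1 ^ (2 * P.b) * sc.k p.1 :=
    (contDiff_fst.pow _).mul (sc.hk.comp contDiff_fst)
  exact (h1.pow _).mul (sc.hw.comp (h2.div h1 fun p => (one_add_clampHalf_pos _).ne'))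

theorem smoothPer_th0 : SmoothPer Q.period sc.th0 := by
  refine ((SmoothPer.const _).mul smoothPer_r).mul (SmoothPer.div ?_ (sc.smoothPer_k.pow _)
    fun p => pow_ne_zero _ (sc.k_pos _).ne')
  exact SmoothPer.of_re (g := fun q => hadQ sc.freq (q.2, sc.cr * q.2 ^ P.M * q.1))
    ((contDiff_hadQ sc.contDiff_freq).comp (by fun_prop))

theorem smoothPer_weps : SmoothPer Q.period (fun p => sc.w (sc.eps p)) :=
  sc.smoothPer_comp (g := fun q => sc.w q.1) (sc.hw.comp contDiff_fst) fun _ _ => rfl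

theorem smoothPer_thf : SmoothPer Q.period sc.thf :=
  (SmoothPer.const _).mul ((((sc.smoothPer_epow _).mul sc.smoothPer_weps).mul
    sc.smoothPer_kv).mul (sc.smoothPer_comp sc.contDiff_Yd sc.Yd_per))

theorem smoothPer_thg : SmoothPer Q.period sc.thg :=
  (SmoothPer.const _).mul ((((sc.smoothPer_epow _).mul sc.smoothPer_weps).mul
    (sc.smoothPer_kv.pow _)).mul (sc.smoothPer_comp sc.contDiff_Xd sc.Xd_per))

/-- The coefficient of `r` in the leading term of `dθ/dτ`. -/
noncomputable def c0 : ℝ :=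
  P.tcon ^ (-((P.b : ℝ) / P.q)) * sc.cr * (((P.h : ℝ) - 1) * sc.w 0 / sc.k 0 ^ (P.h - 1))

theorem c0_pos : 0 < sc.c0 := by
  have h1 := Real.rpow_pos_of_pos P.tcon_pos (-((P.b : ℝ) / P.q))
  have h2 := sc.cr_pos
  have h3 := P.h_sub_one_pos
  have h4 := sc.w_pos 0
  have h5 := sc.k_pos 0
  unfold c0
  positivity

/-- At e = 0 the scaled frequency is (1 + u)^(h-1) w(0). Its slope at u = 0 is positive because h ≥
2, which is the twist that makes Ω_0 = c ϱ with c > 0. -/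
theorem hadQ_freq_zero : hadQ sc.freq (0, 0) = ((P.h : ℝ) - 1) * sc.w 0 := by
  have hh := P.two_le_h
  have hb := P.one_le_b
  have h1 : HasDerivAt (fun u => sc.freq (0, u)) (hadQ sc.freq (0, 0)) 0 := by
    have h2 : HasDerivAt (fun u => sc.freq (0, 0) + u * hadQ sc.freq (0, u))
        (1 * hadQ sc.freq (0, 0) + 0 * lastDeriv (hadQ sc.freq) (0, 0)) 0 :=
      ((hasDerivAt_id (0 : ℝ)).mul
        (hasDerivAt_last (contDiff_hadQ sc.contDiff_freq) 0 0)).const_add _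
    simp only [one_mul, zero_mul, add_zero] at h2
    refine h2.congr_of_eventuallyEq (Eventually.of_forall fun u => ?_)
    exact eq_add_mul_hadQ sc.contDiff_freq 0 u
  have h3 : HasDerivAt (fun u : ℝ => (1 + u) ^ (P.h - 1) * sc.w 0)
      (((P.h - 1 : ℕ) : ℝ) * (1 + 0) ^ (P.h - 1 - 1) * 1 * sc.w 0) 0 :=
    (((hasDerivAt_id (0 : ℝ)).const_add 1).pow (P.h - 1)).mul_const _
  have h4 : (fun u => sc.freq (0, u)) =ᶠ[𝓝 0] fun u : ℝ => (1 + u) ^ (P.h - 1) * sc.w 0 := by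
    have : ∀ᶠ u : ℝ in 𝓝 0, |u| < 1 / 4 := by
      have := (continuous_abs (G := ℝ)).tendsto 0
      rw [abs_zero] at this
      exact this.eventually_lt_const (by norm_num)
    filter_upwards [this] with u hu
    simp only [freq]
    rw [clampHalf_eq hu.le, zero_pow (by omega), zero_mul, zero_div]
  rw [h1.unique (h3.congr_of_eventuallyEq h4)]
  simp [Nat.cast_sub (show 1 ≤ P.h by omega)]

theorem th0_zero (hM : 0 < P.M) (r θ ζ : ℝ) : sc.th0 ((r, θ, ζ), 0) = sc.c0 * r := by
  simp only [th0, c0]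
  rw [zero_pow hM.ne', mul_zero, zero_mul, sc.hadQ_freq_zero]
  ring

variable {sc} {R : ℝ}

theorem rpow_M_div_N {τ : ℝ} (hτ : 0 < τ) : τ ^ ((P.M : ℝ) / P.N) = (P.eOf τ ^ P.M)⁻¹ := by
  rw [P.eOf_pow hτ, Real.rpow_neg hτ.le, inv_inv]

theorem tdeg_mul_a_div_q (P : PerturbedOscillator) :
    (P.tdeg : ℝ) * ((P.a : ℝ) / P.q) = 2 * ((P.h : ℝ) - 1) * P.a := by
  have := P.q_pos
  rw [P.tdeg_cast]; field_simp

theorem tdeg_mul_b_div_q (P : PerturbedOscillator) :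
    (P.tdeg : ℝ) * ((P.b : ℝ) / P.q) = 2 * ((P.h : ℝ) - 1) * P.b := by
  have := P.q_pos
  rw [P.tdeg_cast]; field_simp

theorem tdeg_mul_mu (hrc : P.ResonanceCondition) : (P.tdeg : ℝ) * P.mu = P.M := by
  rw [P.M_cast hrc, P.tdeg_cast]; ring

/-- An exact identity once the cut-off is inactive. Every real power of t becomes an integer power
of e, and the weights of f and g absorb precisely what is not e^M. -/
theorem Good.rField_eq (hrc : P.ResonanceCondition) {τ : ℝ} (hτ : 0 < τ)
    (hg : sc.Good R (P.eOf τ)) {r : ℝ} (hr : |r| ≤ R) (θ : ℝ) :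
    τ ^ ((P.M : ℝ) / P.N) * Q.rField r θ τ =
      sc.r0 ((r, θ, P.vartheta * τ), P.eOf τ) +
      sc.rf ((r, θ, P.vartheta * τ), P.eOf τ) * Q.scaledPert P.f (wf P) r θ τ +
      sc.rg ((r, θ, P.vartheta * τ), P.eOf τ) * Q.scaledPert P.g (wg P) r θ τ := by
  rw [scaledPert_eq _ _ _ _ hτ, scaledPert_eq _ _ _ _ hτ, rpow_M_div_N hτ]
  simp only [rField, F]
  rw [Q.S_time hτ, P.time_eq Q hτ]
  have heps := hg.eps_pos (r := r) (θ := θ) (ζ := P.vartheta * τ)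
  have hvp := hg.v_eq (θ := θ) (ζ := P.vartheta * τ) hr
  have hE := hg.energyOf_eq hrc (θ := θ) (ζ := P.vartheta * τ) hr
  have hX := hg.X_eq hrc (θ := θ) (ζ := P.vartheta * τ) hr
  have hY := hg.Y_eq hrc (θ := θ) (ζ := P.vartheta * τ) hr
  have he := hg.e_pos
  have hJ := sc.deriv_Istar he hg.e_lt
  have hcr := tpow_mu (sc := sc) hrc he
  have hv0 := sc.v_pos ((r, θ, P.vartheta * τ), P.eOf τ)
  have hdef : sc.eps ((r, θ, P.vartheta * τ), P.eOf τ) = P.eOf τ ^ (2 * P.b) *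
    (sc.k (P.eOf τ) / sc.v ((r, θ, P.vartheta * τ), P.eOf τ)) := rfl
  have hk := sc.k_pos (P.eOf τ)
  rw [hcr, ← hvp, hJ]
  simp only [r0, rf, rg]
  have hU : deriv P.U (Q.X (θ + P.vartheta * τ / Q.kap) (Q.energyOf r (P.tOf (P.eOf τ)))) =
      (1 / sc.eps ((r, θ, P.vartheta * τ), P.eOf τ)) ^ (2 * P.h - 1) * scaledU' P.h P.u
        (sc.X (sc.eps ((r, θ, P.vartheta * τ), P.eOf τ), sc.ang ((r, θ, P.vartheta * τ), P.eOf τ)))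
        (sc.eps ((r, θ, P.vartheta * τ), P.eOf τ)) := by
    rw [(P.hasDerivAt_U _).deriv, hX, scaledU'_mul _ _ (one_div_pos.2 heps), one_div_one_div]
  rw [hU]
  generalize hF : P.f (Q.X (θ + P.vartheta * τ / Q.kap) (Q.energyOf r (P.tOf (P.eOf τ))))
    (Q.Y (θ + P.vartheta * τ / Q.kap) (Q.energyOf r (P.tOf (P.eOf τ)))) (P.vartheta * τ)
    (P.tOf (P.eOf τ)) = FF
  generalize hG : P.g (Q.X (θ + P.vartheta * τ / Q.kap) (Q.energyOf r (P.tOf (P.eOf τ))))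
    (Q.Y (θ + P.vartheta * τ / Q.kap) (Q.energyOf r (P.tOf (P.eOf τ)))) (P.vartheta * τ)
    (P.tOf (P.eOf τ)) = GG
  rw [hY, hE]
  generalize sc.Y _ = YY
  generalize scaledU' _ _ _ _ = UU
  generalize sc.J _ = JJ
  have htp := P.tOf_pos he
  have hh := P.two_le_h
  have hMN := P.two_M_le_N hrc
  have hN := P.N_cast_tdeg
  have hMu := tdeg_mul_mu hrc
  have hA : P.tOf (P.eOf τ) ^ (1 - P.nu) / P.tOf (P.eOf τ) = P.tcon ^ (-P.nu) * P.eOf τ ^ P.N := by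
    rw [← Real.rpow_sub_one htp.ne', show 1 - P.nu - 1 = -P.nu by ring,
      P.tOf_rpow he _ (-(P.N : ℤ)), neg_neg, zpow_natCast]
    push_cast; rw [hN]; ring
  have hC : P.tOf (P.eOf τ) ^ (1 - P.nu) * P.tOf (P.eOf τ) ^ P.mu / P.tOf (P.eOf τ) =
      P.tcon ^ (P.mu - P.nu) * P.eOf τ ^ (P.N - P.M) := by
    rw [← Real.rpow_add htp, ← Real.rpow_sub_one htp.ne',
      show 1 - P.nu + P.mu - 1 = P.mu - P.nu by ring,
      P.tOf_rpow he _ (-((P.N - P.M : ℕ) : ℤ)), neg_neg, zpow_natCast]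
    push_cast [Nat.cast_sub (show P.M ≤ P.N by omega)]
    rw [hN, ← hMu]; ring
  have hB : P.tOf (P.eOf τ) ^ (1 - P.nu) * P.tOf (P.eOf τ) ^ P.mu *
      P.tOf (P.eOf τ) ^ (-((P.a : ℝ) / P.q)) =
      P.tcon ^ (1 - P.nu + P.mu - (P.a : ℝ) / P.q) *
        P.eOf τ ^ (2 * ((P.h : ℤ) - 1) * (P.a + P.b) - P.M) := by
    rw [← Real.rpow_add htp, ← Real.rpow_add htp, ← sub_eq_add_neg,
      P.tOf_rpow he _ (-(2 * ((P.h : ℤ) - 1) * (P.a + P.b) - P.M)), neg_neg]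
    push_cast
    have h1 := tdeg_mul_a_div_q P
    have h2 := tdeg_mul_b_div_q P
    rw [P.nu_eq]
    linear_combination hMu - h1 - h2
  generalize P.tOf (P.eOf τ) ^ (1 - P.nu) = T1 at *
  -- This exponent identity is the integer formula for M; it explains why M is the right
  -- normalisation of the radial equation.
  have hW : P.eOf τ ^ (2 * ((P.h : ℤ) - 1) * (P.a + P.b) - P.M) * P.eOf τ ^ (2 * P.b) =
      P.eOf τ ^ (2 * P.b * wf P) * P.eOf τ ^ P.M := by
    rw [← zpow_natCast _ (2 * P.b), ← zpow_natCast _ P.M, ← zpow_add₀ he.ne', ← zpow_add₀ he.ne']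
    congr 1
    have := P.M_eq hrc
    simp only [wf]
    push_cast
    linear_combination (-2 : ℤ) * this
  have hW' : P.eOf τ ^ (2 * ((P.h : ℤ) - 1) * (P.a + P.b) - P.M) * (P.eOf τ ^ (2 * P.b)) ^ P.h =
      P.eOf τ ^ (2 * P.b * wg P) * P.eOf τ ^ P.M := by
    rw [← pow_mul, ← zpow_natCast _ (2 * P.b * P.h), ← zpow_natCast _ P.M, ← zpow_add₀ he.ne',
      ← zpow_add₀ he.ne']
    congr 1
    have := P.M_eq hrc
    simp only [wg]
    push_cast
    linear_combination (-2 : ℤ) * this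
  set ε := sc.eps ((r, θ, P.vartheta * τ), P.eOf τ)
  set e := P.eOf τ
  set t := P.tOf e
  set V := sc.v ((r, θ, P.vartheta * τ), e)
  have d1 : (1 / ε) ^ (2 * P.h - 1) * UU / (1 / ε) ^ (2 * P.h) = UU * ε := by
    obtain ⟨k, hk⟩ : ∃ k, 2 * P.h = k + 1 := ⟨2 * P.h - 1, by omega⟩
    rw [hk, Nat.add_sub_cancel, pow_succ]
    field_simp
  have d2 : (1 / ε) ^ P.h * YY / (1 / ε) ^ (2 * P.h) = YY * ε ^ P.h := by
    have hE0 : ε ^ P.h ≠ 0 := (pow_pos heps _).ne'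
    rw [one_div, inv_pow, inv_pow, two_mul, pow_add]
    generalize ε ^ P.h = E0 at hE0
    field_simp
  obtain ⟨d, hd⟩ := Nat.exists_eq_add_of_le hMN
  rw [show P.N - 2 * P.M = d by omega, show P.N - P.M = P.M + d by omega]
  rw [show P.N - P.M = P.M + d by omega] at hC
  rw [hd] at hA
  have heM : e ^ P.M ≠ 0 := (pow_pos he _).ne'
  have hsplit : T1 * (P.mu * r / t + t ^ P.mu * V / (2 * P.h) *
      (t ^ (-((P.a : ℝ) / P.q)) * (FF * ((1 / ε) ^ (2 * P.h - 1) * UU) + GG * ((1 / ε) ^ P.h * YY)) /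
        (1 / ε) ^ (2 * P.h) - JJ / t)) =
      (T1 / t) * (P.mu * r) + V / (2 * P.h) * (T1 * t ^ P.mu * t ^ (-((P.a : ℝ) / P.q))) *
        (FF * ((1 / ε) ^ (2 * P.h - 1) * UU / (1 / ε) ^ (2 * P.h)) +
          GG * ((1 / ε) ^ P.h * YY / (1 / ε) ^ (2 * P.h))) -
        V / (2 * P.h) * (T1 * t ^ P.mu / t) * JJ := by ring
  rw [hsplit, hA, hB, hC, d1, d2]
  have d3 : ∀ A B : ℝ, (e ^ P.M)⁻¹ * (e ^ (2 * ((P.h : ℤ) - 1) * (P.a + P.b) - P.M) *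
      (FF * (UU * ε) + GG * (YY * ε ^ P.h))) =
      (sc.k e / V) * UU * (e ^ (2 * P.b * wf P) * FF) +
        (sc.k e / V) ^ P.h * YY * (e ^ (2 * P.b * wg P) * GG) := by
    intro A B
    rw [hdef, mul_pow]
    rw [inv_mul_eq_iff_eq_mul₀ heM]
    linear_combination (FF * UU * (sc.k e / V)) * hW + (GG * YY * (sc.k e / V) ^ P.h) * hW'
  have d4 := d3 0 0
  have d5 : (e ^ P.M)⁻¹ * e ^ P.M = 1 := inv_mul_cancel₀ heM
  rw [pow_add, pow_add, two_mul, pow_add]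
  linear_combination (V / (2 * P.h) * P.tcon ^ (1 - P.nu + P.mu - (P.a : ℝ) / P.q)) * d4 +
    (P.tcon ^ (-P.nu) * e ^ P.M * e ^ d * P.mu * r -
      V / (2 * P.h) * P.tcon ^ (P.mu - P.nu) * e ^ d * JJ) * d5

end ResonantFrame.Scaling

namespace ResonantFrame.Scaling

variable {P : PerturbedOscillator} {Q : ResonantFrame P} {sc : Q.Scaling} {R : ℝ}

/-- The resonance equation replaces S'/ϰ by ω(I_*), so the bracket is a difference of the scaled
frequency at u and at 0, divided by k^(h-1). -/
theorem Good.freq_diff (hrc : P.ResonanceCondition) {e : ℝ} (hg : sc.Good R e) {r : ℝ}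
    (hr : |r| ≤ R) (θ ζ : ℝ) :
    (e ^ P.M)⁻¹ * (P.tOf e ^ (1 - P.nu) *
      (Q.om (Q.energyOf r (P.tOf e)) - deriv P.S (P.tOf e) / Q.kap)) = sc.th0 ((r, θ, ζ), e) := by
  have he := hg.e_pos
  have hh := P.two_le_h
  have hk := sc.k_pos e
  have htp := P.tOf_pos he
  rw [← Q.Istar_eq _ (sc.t₁_le e he hg.e_lt), sc.Istar_eq e he hg.e_lt,
    hg.energyOf_eq hrc (θ := θ) (ζ := ζ) hr, sc.om_eq _ hg.z_gt.le, sc.om_eq _ hg.zstar_gt.le,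
    one_div_one_div, one_div_one_div]
  have hT : P.tOf e ^ (1 - P.nu) = P.tcon ^ (-((P.b : ℝ) / P.q)) * e ^ (2 * P.b * (P.h - 1)) := by
    rw [show 1 - P.nu = -((P.b : ℝ) / P.q) by rw [P.nu_eq]; ring,
      P.tOf_rpow he _ (-((2 * P.b * (P.h - 1) : ℕ) : ℤ)), neg_neg, zpow_natCast]
    push_cast [Nat.cast_sub (show 1 ≤ P.h by omega)]
    linear_combination -tdeg_mul_b_div_q P
  have hq := eq_add_mul_hadQ sc.contDiff_freq e (sc.cr * e ^ P.M * r)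
  have hv := hg.v_eq (θ := θ) (ζ := ζ) hr
  have hvd : sc.v ((r, θ, ζ), e) = 1 + clampHalf (sc.cr * e ^ P.M * r) := rfl
  have h0 : clampHalf 0 = 0 := clampHalf_eq (by norm_num)
  have f1 : sc.freq (e, sc.cr * e ^ P.M * r) =
      sc.v ((r, θ, ζ), e) ^ (P.h - 1) * sc.w (sc.eps ((r, θ, ζ), e)) := by
    simp only [freq, eps, ← hvd, mul_div_assoc]
  have f2 : sc.freq (e, 0) = sc.w (e ^ (2 * P.b) * sc.k e) := by
    simp only [freq, h0, add_zero, one_pow, one_mul, div_one]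
  have hz : (1 / sc.eps ((r, θ, ζ), e)) ^ (P.h - 1) * e ^ (2 * P.b * (P.h - 1)) =
      sc.v ((r, θ, ζ), e) ^ (P.h - 1) / sc.k e ^ (P.h - 1) := by
    rw [pow_mul, ← mul_pow, mul_comm, inv_eps ((r, θ, ζ), e) he, div_pow]
  have hz' : (1 / (e ^ (2 * P.b) * sc.k e)) ^ (P.h - 1) * e ^ (2 * P.b * (P.h - 1)) =
      1 / sc.k e ^ (P.h - 1) := by
    rw [pow_mul e (2 * P.b), ← mul_pow, ← one_div_pow]
    congr 1
    field_simp
  rw [f1, f2] at hq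
  have heM : e ^ P.M ≠ 0 := (pow_pos he _).ne'
  rw [inv_mul_eq_iff_eq_mul₀ heM, hT, th0]
  generalize (1 / sc.eps ((r, θ, ζ), e)) ^ (P.h - 1) = z1 at *
  generalize (1 / (e ^ (2 * P.b) * sc.k e)) ^ (P.h - 1) = z2 at *
  linear_combination P.tcon ^ (-((P.b : ℝ) / P.q)) * (sc.w (sc.eps ((r, θ, ζ), e)) * hz -
    sc.w (e ^ (2 * P.b) * sc.k e) * hz' + hq / sc.k e ^ (P.h - 1))

theorem Good.thetaField_eq (hrc : P.ResonanceCondition) {τ : ℝ} (hτ : 0 < τ)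
    (hg : sc.Good R (P.eOf τ)) {r : ℝ} (hr : |r| ≤ R) (θ : ℝ) :
    τ ^ ((P.M : ℝ) / P.N) * Q.thetaField r θ τ =
      sc.th0 ((r, θ, P.vartheta * τ), P.eOf τ) +
      sc.thf ((r, θ, P.vartheta * τ), P.eOf τ) * Q.scaledPert P.f (wf P) r θ τ +
      sc.thg ((r, θ, P.vartheta * τ), P.eOf τ) * Q.scaledPert P.g (wg P) r θ τ := by
  rw [scaledPert_eq _ _ _ _ hτ, scaledPert_eq _ _ _ _ hτ, rpow_M_div_N hτ]
  simp only [thetaField, G]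
  rw [Q.S_time hτ, P.time_eq Q hτ]
  have heps := hg.eps_pos (r := r) (θ := θ) (ζ := P.vartheta * τ)
  have hE := hg.energyOf_eq hrc (θ := θ) (ζ := P.vartheta * τ) hr
  have he := hg.e_pos
  have hk := sc.k_pos (P.eOf τ)
  have hv0 := sc.v_ne ((r, θ, P.vartheta * τ), P.eOf τ)
  have hdef : sc.eps ((r, θ, P.vartheta * τ), P.eOf τ) = P.eOf τ ^ (2 * P.b) *
    (sc.k (P.eOf τ) / sc.v ((r, θ, P.vartheta * τ), P.eOf τ)) := rfl
  have hdX := sc.deriv_X (hg.z_gt (r := r) (θ := θ) (ζ := P.vartheta * τ))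
    (θ + P.vartheta * τ / Q.kap)
  have hdY := sc.deriv_Y (hg.z_gt (r := r) (θ := θ) (ζ := P.vartheta * τ))
    (θ + P.vartheta * τ / Q.kap)
  have hom := sc.om_eq _ (hg.z_gt (r := r) (θ := θ) (ζ := P.vartheta * τ)).le
  rw [one_div_one_div] at hdX hdY hom
  rw [← hE] at hdX hdY hom
  rw [← hg.freq_diff hrc hr θ (P.vartheta * τ)]
  simp only [thf, thg]
  rw [hdX, hdY]
  generalize P.f _ _ _ _ = FF
  generalize P.g _ _ _ _ = GG
  rw [hE]
  rw [hE] at hom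
  have htp := P.tOf_pos he
  have hh := P.two_le_h
  have hN := P.N_cast_tdeg
  have hB : P.tOf (P.eOf τ) ^ (1 - P.nu) * P.tOf (P.eOf τ) ^ (-((P.a : ℝ) / P.q)) =
      P.tcon ^ (1 - P.nu - (P.a : ℝ) / P.q) *
        P.eOf τ ^ (2 * ((P.h : ℤ) - 1) * (P.a + P.b)) := by
    rw [← Real.rpow_add htp, ← sub_eq_add_neg,
      P.tOf_rpow he _ (-(2 * ((P.h : ℤ) - 1) * (P.a + P.b))), neg_neg]
    push_cast
    have h1 := tdeg_mul_a_div_q P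
    have h2 := tdeg_mul_b_div_q P
    rw [P.nu_eq]
    linear_combination - h1 - h2
  generalize P.tOf (P.eOf τ) ^ (1 - P.nu) = T1 at *
  -- Compared with the radial equation there is no factor t^μ. Once the common factor e^M is divided
  -- out, one more e^M remains.
  have hW : P.eOf τ ^ (2 * ((P.h : ℤ) - 1) * (P.a + P.b)) * P.eOf τ ^ (2 * P.b) =
      P.eOf τ ^ (2 * P.b * wf P) * (P.eOf τ ^ P.M * P.eOf τ ^ P.M) := by
    rw [← pow_add, ← zpow_natCast _ (2 * P.b), ← zpow_natCast _ (P.M + P.M), ← zpow_add₀ he.ne',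
      ← zpow_add₀ he.ne']
    congr 1
    have := P.M_eq hrc
    simp only [wf]
    push_cast
    linear_combination (-2 : ℤ) * this
  have hW' : P.eOf τ ^ (2 * ((P.h : ℤ) - 1) * (P.a + P.b)) * (P.eOf τ ^ (2 * P.b)) ^ P.h =
      P.eOf τ ^ (2 * P.b * wg P) * (P.eOf τ ^ P.M * P.eOf τ ^ P.M) := by
    rw [← pow_add, ← pow_mul, ← zpow_natCast _ (2 * P.b * P.h), ← zpow_natCast _ (P.M + P.M),
      ← zpow_add₀ he.ne', ← zpow_add₀ he.ne']
    congr 1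
    have := P.M_eq hrc
    simp only [wg]
    push_cast
    linear_combination (-2 : ℤ) * this
  have hang : sc.ang ((r, θ, P.vartheta * τ), P.eOf τ) = θ + P.vartheta * τ / Q.kap := rfl
  rw [hang]
  generalize sc.Xd _ = XX
  generalize sc.Yd _ = YY
  have hh0 : (P.h : ℝ) ≠ 0 := by positivity
  set ε := sc.eps ((r, θ, P.vartheta * τ), P.eOf τ)
  set e := P.eOf τ
  set t := P.tOf e
  set V := sc.v ((r, θ, P.vartheta * τ), e)
  have heM : e ^ P.M ≠ 0 := (pow_pos he _).ne'
  have heb : e ^ (2 * P.b) ≠ 0 := (pow_pos he _).ne'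
  obtain ⟨k, hk⟩ : ∃ k, P.h = k + 1 := ⟨P.h - 1, by omega⟩
  have d1 : Q.om ((1 / ε) ^ (2 * P.h)) * ((1 / ε) ^ P.h * YY / ((2 * P.h : ℕ) * (1 / ε) ^ (2 * P.h)))
      = sc.w ε / (2 * P.h) * YY * ε := by
    rw [hom, two_mul P.h, pow_add, show P.h - 1 = k by omega]
    push_cast
    rw [show (1 / ε) ^ P.h = (1 / ε) ^ k * (1 / ε) by rw [hk, pow_succ], one_div, inv_pow]
    have hE0 : ε ^ k ≠ 0 := (pow_pos heps _).ne'
    generalize ε ^ k = E0 at hE0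
    generalize (P.h : ℝ) = H at hh0
    field_simp
    norm_num
  have d2 : Q.om ((1 / ε) ^ (2 * P.h)) * (XX * (1 / ε / ((2 * P.h : ℕ) * (1 / ε) ^ (2 * P.h))))
      = sc.w ε / (2 * P.h) * XX * ε ^ P.h := by
    rw [hom, two_mul P.h, pow_add, show P.h - 1 = k by omega]
    push_cast
    rw [show (1 / ε) ^ P.h = (1 / ε) ^ k * (1 / ε) by rw [hk, pow_succ],
      show ε ^ P.h = ε ^ k * ε by rw [hk, pow_succ], one_div, inv_pow]
    have hE0 : ε ^ k ≠ 0 := (pow_pos heps _).ne'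
    generalize ε ^ k = E0 at hE0
    generalize (P.h : ℝ) = H at hh0
    field_simp
    norm_num
  rw [inv_mul_eq_iff_eq_mul₀ heM]
  have d3 : T1 * (Q.om ((1 / ε) ^ (2 * P.h)) + t ^ (-((P.a : ℝ) / P.q)) *
      (Q.om ((1 / ε) ^ (2 * P.h)) * (FF * ((1 / ε) ^ P.h * YY /
        ((2 * P.h : ℕ) * (1 / ε) ^ (2 * P.h))) - GG * (XX * (1 / ε / ((2 * P.h : ℕ) *
          (1 / ε) ^ (2 * P.h)))))) - deriv P.S t / Q.kap) =
      T1 * (Q.om ((1 / ε) ^ (2 * P.h)) - deriv P.S t / Q.kap) +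
      (T1 * t ^ (-((P.a : ℝ) / P.q))) * (FF * (Q.om ((1 / ε) ^ (2 * P.h)) * ((1 / ε) ^ P.h * YY /
        ((2 * P.h : ℕ) * (1 / ε) ^ (2 * P.h)))) - GG * (Q.om ((1 / ε) ^ (2 * P.h)) *
          (XX * (1 / ε / ((2 * P.h : ℕ) * (1 / ε) ^ (2 * P.h)))))) := by ring
  rw [d3, d1, d2, hB, hdef, mul_pow]
  have d4 : ∀ x : ℝ, e ^ P.M * ((e ^ P.M)⁻¹ * x) = x := fun x => by
    rw [← mul_assoc, mul_inv_cancel₀ heM, one_mul]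
  rw [mul_add (e ^ P.M), mul_add (e ^ P.M), d4]
  generalize sc.w _ = WW
  linear_combination (P.tcon ^ (1 - P.nu - (P.a : ℝ) / P.q) / (2 * P.h)) * WW *
    ((sc.k e / V) * YY * FF * hW - (sc.k e / V) ^ P.h * XX * GG * hW')

theorem exists_isExp_rField (hrc : P.ResonanceCondition) (sc : Q.Scaling) (n : ℕ) :
    ∃ u, Q.IsExp n u (fun r θ τ => τ ^ ((P.M : ℝ) / P.N) * Q.rField r θ τ) := by
  obtain ⟨uf, hf⟩ := hasExp_f hrc sc n
  obtain ⟨ug, hg⟩ := hasExp_g hrc sc n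
  refine ⟨_, (((IsExp.of_smooth sc.smoothPer_r0 n).add (IsExp.smooth_mul sc.smoothPer_rf hf)).add
    (IsExp.smooth_mul sc.smoothPer_rg hg)).congr fun R => ?_⟩
  obtain ⟨τ₁, hτ₁, h⟩ := sc.exists_good (P.M_pos hrc) R
  exact ⟨τ₁, fun τ hτ r θ hr => (h τ hτ).rField_eq hrc (hτ₁.trans_le hτ) hr θ⟩

theorem exists_isExp_thetaField (hrc : P.ResonanceCondition) (sc : Q.Scaling) (n : ℕ) :
    ∃ u, Q.IsExp n u (fun r θ τ => τ ^ ((P.M : ℝ) / P.N) * Q.thetaField r θ τ) ∧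
      ∀ r θ ζ, u ((r, θ, ζ), 0) = sc.c0 * r := by
  obtain ⟨uf, hf⟩ := hasExp_f hrc sc n
  obtain ⟨ug, hg⟩ := hasExp_g hrc sc n
  have hM := P.M_pos hrc
  refine ⟨_, (((IsExp.of_smooth sc.smoothPer_th0 n).add
    (IsExp.smooth_mul sc.smoothPer_thf hf)).add
    (IsExp.smooth_mul sc.smoothPer_thg hg)).congr fun R => ?_, fun r θ ζ => ?_⟩
  · obtain ⟨τ₁, hτ₁, h⟩ := sc.exists_good (P.M_pos hrc) R
    exact ⟨τ₁, fun τ hτ r θ hr => (h τ hτ).thetaField_eq hrc (hτ₁.trans_le hτ) hr θ⟩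
  · simp only [sc.th0_zero hM, thf, thg, zero_pow hM.ne']
    ring

end ResonantFrame.Scaling

/-! ### The coefficients of the (r,θ)-system -/

/-- Smooth functions of `(r,θ,ζ)` that are `2π`-periodic in `θ` and `per`-periodic in `ζ`. -/
structure CoefPer (per : ℝ) (c : ℝ → ℝ → ℝ → ℝ) : Prop where
  smooth : ContDiff ℝ ∞ (fun x : ℝ × ℝ × ℝ => c x.1 x.2.1 x.2.2)
  per_θ : ∀ r θ ζ, c r (θ + 2 * Real.pi) ζ = c r θ ζ
  per_ζ : ∀ r θ ζ, c r θ (ζ + per) = c r θ ζ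

theorem SmoothPer.of_coef {per : ℝ} {c : ℝ → ℝ → ℝ → ℝ} (hc : CoefPer per c) :
    SmoothPer per (fun p => c p.1.1 p.1.2.1 p.1.2.2) :=
  ⟨hc.smooth.comp contDiff_fst, fun _ _ _ _ => hc.per_θ _ _ _, fun _ _ _ _ => hc.per_ζ _ _ _⟩

theorem SmoothPer.tcoef {per : ℝ} {u : (ℝ × ℝ × ℝ) × ℝ → ℝ} (hu : SmoothPer per u) (k : ℕ) :
    CoefPer per (fun r θ ζ => tcoef u k (r, θ, ζ)) :=
  ⟨contDiff_tcoef hu.smooth k, fun r θ ζ => hadQ_iterate_congr (hu.per_θ r θ ζ) k 0,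
    fun r θ ζ => hadQ_iterate_congr (hu.per_ζ r θ ζ) k 0⟩

theorem SmoothPer.hadQ_iterate {per : ℝ} {u : (ℝ × ℝ × ℝ) × ℝ → ℝ} (hu : SmoothPer per u) (k : ℕ) :
    SmoothPer per (hadQ^[k] u) :=
  ⟨contDiff_hadQ_iterate hu.smooth k, fun r θ ζ => hadQ_iterate_congr (hu.per_θ r θ ζ) k,
    fun r θ ζ => hadQ_iterate_congr (hu.per_ζ r θ ζ) k⟩

namespace ResonantFrame

variable {P : PerturbedOscillator} {Q : ResonantFrame P}

theorem per_ζ_nat {u : (ℝ × ℝ × ℝ) × ℝ → ℝ} (hu : SmoothPer Q.period u) (r θ ζ : ℝ) (m : ℕ) (e : ℝ) :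
    u ((r, θ, ζ + m * Q.period), e) = u ((r, θ, ζ), e) := by
  have : Function.Periodic (fun ζ => u ((r, θ, ζ), e)) Q.period := fun ζ => hu.per_ζ r θ ζ e
  exact this.nat_mul m ζ

/-- The coefficients recovered by `asympCoeff` are the Taylor coefficients in `e`. -/
theorem asympCoeff_eq_tcoef {u : (ℝ × ℝ × ℝ) × ℝ → ℝ} (hu : SmoothPer Q.period u) {Φ : ℝ → ℝ}
    {r θ C τ₁ : ℝ} {n : ℕ}
    (h : ∀ τ ≥ τ₁, |Φ τ - u ((r, θ, P.vartheta * τ), P.eOf τ)| ≤ C * P.eOf τ ^ (n + 1)) (ζ : ℝ) :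
    ∀ K ≤ n, asympCoeff P.N P.vartheta Q.period Φ K ζ = tcoef u K (r, θ, ζ) := by
  intro K
  induction K using Nat.strong_induction_on with
  | _ K ih =>
    intro hK
    rw [asympCoeff]
    have hθ := P.vartheta_pos
    have hper := Q.period_pos
    -- Along these times ϑτ equals ζ modulo the averaging period, so the smooth expansion is
    -- evaluated at one fixed phase while e tends to 0.
    set s : ℕ → ℝ := fun m => (ζ + m * Q.period) / P.vartheta with hs
    have hsT : Tendsto s atTop atTop :=
      Tendsto.atTop_div_const hθ (tendsto_atTop_add_const_left _ _
        (tendsto_natCast_atTop_atTop.atTop_mul_const hper))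
    have heT : Tendsto (fun m => P.eOf (s m)) atTop (𝓝 0) := P.tendsto_eOf.comp hsT
    have hlim : Tendsto (fun m => hadQ^[K] u ((r, θ, ζ), P.eOf (s m))) atTop
        (𝓝 (tcoef u K (r, θ, ζ))) := by
      have h1 : Continuous fun e : ℝ => hadQ^[K] u ((r, θ, ζ), e) := by
        have := (contDiff_hadQ_iterate hu.smooth K).continuous
        fun_prop
      exact (h1.tendsto 0).comp heT
    refine Tendsto.limUnder_eq ?_
    have hdiff : Tendsto (fun m => C * P.eOf (s m) ^ (n + 1 - K)) atTop (𝓝 0) := by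
      have := (heT.pow (n + 1 - K)).const_mul C
      rwa [zero_pow (by omega), mul_zero] at this
    rw [← add_zero (tcoef u K (r, θ, ζ))]
    have hd2 : Tendsto (fun m => (s m) ^ ((K : ℝ) / P.N) *
        (Φ (s m) - u ((r, θ, ζ), P.eOf (s m)))) atTop (𝓝 0) := by
      refine squeeze_zero_norm' ?_ hdiff
      filter_upwards [hsT.eventually_ge_atTop τ₁, hsT.eventually_gt_atTop 0] with m h1 h2
      have he := P.eOf_pos h2
      have h3 := h (s m) h1
      have h4 : P.vartheta * s m = ζ + m * Q.period := by
        simp only [hs]; field_simp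
      rw [h4, per_ζ_nat hu] at h3
      have h5 : (s m) ^ ((K : ℝ) / P.N) = (P.eOf (s m) ^ K)⁻¹ := by
        rw [P.eOf_pow h2, Real.rpow_neg h2.le, inv_inv]
      rw [Real.norm_eq_abs, abs_mul, h5, abs_of_pos (inv_pos.2 (pow_pos he _)),
        inv_mul_le_iff₀ (pow_pos he _)]
      refine h3.trans (le_of_eq ?_)
      rw [mul_left_comm, ← pow_add, show K + (n + 1 - K) = n + 1 by omega]
    refine Tendsto.congr' ?_ (hlim.add hd2)
    filter_upwards [hsT.eventually_gt_atTop 0] with m h2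
    have he := P.eOf_pos h2
    have h5 : (s m) ^ ((K : ℝ) / P.N) = (P.eOf (s m) ^ K)⁻¹ := by
      rw [P.eOf_pow h2, Real.rpow_neg h2.le, inv_inv]
    have h6 : ∑ j : Fin K, s m ^ (-((j : ℝ) / P.N)) *
        asympCoeff P.N P.vartheta Q.period Φ j ζ =
        ∑ j ∈ Finset.range K, P.eOf (s m) ^ j * tcoef u j (r, θ, ζ) := by
      rw [Finset.sum_range]
      refine Finset.sum_congr rfl fun j _ => ?_
      rw [ih j j.2 (by have := j.2; omega), P.eOf_pow h2]
    have h7 := taylor_hadQ hu.smooth K (r, θ, ζ) (P.eOf (s m))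
    change _ = s m ^ ((K : ℝ) / P.N) * (Φ (s m) - ∑ j : Fin K, s m ^ (-((j : ℝ) / P.N)) *
        asympCoeff P.N P.vartheta Q.period Φ j ζ)
    rw [h6, h5, h7]
    have : P.eOf (s m) ^ K ≠ 0 := (pow_pos he _).ne'
    field_simp
    ring

/-- The expansion of a function whose coefficients are given by `asympCoeff`. -/
theorem IsExp.coeff {Φ : ℝ → ℝ → ℝ → ℝ} {n : ℕ} {u : (ℝ × ℝ × ℝ) × ℝ → ℝ} (h : Q.IsExp n u Φ)
    {K : ℕ} (hK : K ≤ n) (r θ ζ : ℝ) :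
    asympCoeff P.N P.vartheta Q.period (Φ r θ) K ζ = tcoef u K (r, θ, ζ) := by
  obtain ⟨C, τ₁, h1⟩ := h.2 |r|
  exact asympCoeff_eq_tcoef h.1 (fun τ hτ => h1 τ hτ r θ le_rfl) ζ K hK

theorem IsExp.partial_sum {Φ : ℝ → ℝ → ℝ → ℝ} {n : ℕ} {u : (ℝ × ℝ × ℝ) × ℝ → ℝ}
    (h : Q.IsExp n u Φ) (R : ℝ) : ∃ C τ₁, ∀ τ ≥ τ₁, ∀ r θ, |r| ≤ R →
      |Φ r θ τ - ∑ K ∈ Finset.range (n + 1), P.eOf τ ^ K *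
        asympCoeff P.N P.vartheta Q.period (Φ r θ) K (P.vartheta * τ)| ≤ C * P.eOf τ ^ (n + 1) := by
  obtain ⟨C, τ₁, h1⟩ := h.2 R
  obtain ⟨C', hC', h2⟩ := (h.1.hadQ_iterate (n + 1)).bounded Q.period_pos R 1
  obtain ⟨τ₂, hτ₂, h3⟩ := exists_eOf_small (P := P) one_pos
  refine ⟨C + C', max τ₁ τ₂, fun τ hτ r θ hr => ?_⟩
  have a := h1 τ ((le_max_left _ _).trans hτ) r θ hr
  have b := h3 τ ((le_max_right _ _).trans hτ)
  have c := h2 r θ (P.vartheta * τ) (P.eOf τ) hr (by rw [abs_of_pos b.1]; exact b.2.le)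
  have h4 : ∑ K ∈ Finset.range (n + 1), P.eOf τ ^ K *
        asympCoeff P.N P.vartheta Q.period (Φ r θ) K (P.vartheta * τ) =
      u ((r, θ, P.vartheta * τ), P.eOf τ) -
        P.eOf τ ^ (n + 1) * hadQ^[n + 1] u ((r, θ, P.vartheta * τ), P.eOf τ) := by
    rw [taylor_hadQ h.1.smooth (n + 1) (r, θ, P.vartheta * τ) (P.eOf τ), add_sub_cancel_right]
    refine Finset.sum_congr rfl fun K hK => ?_
    rw [h.coeff (by rw [Finset.mem_range] at hK; omega)]
  have hp := pow_pos b.1 (n + 1)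
  rw [h4, sub_sub_eq_add_sub, add_comm, add_sub_assoc, add_comm, add_mul]
  refine (abs_add_le _ _).trans (add_le_add a ?_)
  rw [abs_mul, abs_of_pos hp, mul_comm]
  exact mul_le_mul_of_nonneg_right c hp.le

end ResonantFrame

namespace PerturbedOscillator

variable {P : PerturbedOscillator} (Q : ResonantFrame P) (hrc : P.ResonanceCondition)

theorem coefPer_Acoeff (hrc : P.ResonanceCondition) (K : ℕ) : CoefPer Q.period (Q.Acoeff K) := by
  obtain ⟨sc⟩ := Q.nonempty_scaling
  obtain ⟨u, hu⟩ := ResonantFrame.Scaling.exists_isExp_rField hrc sc K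
  have : Q.Acoeff K = fun r θ ζ => tcoef u K (r, θ, ζ) := by
    funext r θ ζ; exact hu.coeff le_rfl r θ ζ
  rw [this]
  exact hu.1.tcoef K

theorem coefPer_Bcoeff (hrc : P.ResonanceCondition) (K : ℕ) : CoefPer Q.period (Q.Bcoeff K) := by
  obtain ⟨sc⟩ := Q.nonempty_scaling
  obtain ⟨u, hu, -⟩ := ResonantFrame.Scaling.exists_isExp_thetaField hrc sc K
  have : Q.Bcoeff K = fun r θ ζ => tcoef u K (r, θ, ζ) := by
    funext r θ ζ; exact hu.coeff le_rfl r θ ζ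
  rw [this]
  exact hu.1.tcoef K

theorem exists_Bcoeff_zero (hrc : P.ResonanceCondition) :
    ∃ c > 0, ∀ r θ ζ, Q.Bcoeff 0 r θ ζ = c * r := by
  obtain ⟨sc⟩ := Q.nonempty_scaling
  obtain ⟨u, hu, h0⟩ := ResonantFrame.Scaling.exists_isExp_thetaField hrc sc 0
  refine ⟨sc.c0, sc.c0_pos, fun r θ ζ => ?_⟩
  rw [← h0 r θ ζ]
  exact hu.coeff le_rfl r θ ζ

theorem rField_expansion (hrc : P.ResonanceCondition) (n : ℕ) (R : ℝ) :
    ∃ C τ₁, ∀ τ ≥ τ₁, ∀ r θ, |r| ≤ R →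
      |τ ^ ((P.M : ℝ) / P.N) * Q.rField r θ τ - ∑ K ∈ Finset.range (n + 1), P.eOf τ ^ K *
        Q.Acoeff K r θ (P.vartheta * τ)| ≤ C * P.eOf τ ^ (n + 1) := by
  obtain ⟨sc⟩ := Q.nonempty_scaling
  obtain ⟨u, hu⟩ := ResonantFrame.Scaling.exists_isExp_rField hrc sc n
  exact hu.partial_sum R

theorem thetaField_expansion (hrc : P.ResonanceCondition) (n : ℕ) (R : ℝ) :
    ∃ C τ₁, ∀ τ ≥ τ₁, ∀ r θ, |r| ≤ R →
      |τ ^ ((P.M : ℝ) / P.N) * Q.thetaField r θ τ - ∑ K ∈ Finset.range (n + 1), P.eOf τ ^ K *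
        Q.Bcoeff K r θ (P.vartheta * τ)| ≤ C * P.eOf τ ^ (n + 1) := by
  obtain ⟨sc⟩ := Q.nonempty_scaling
  obtain ⟨u, hu, -⟩ := ResonantFrame.Scaling.exists_isExp_thetaField hrc sc n
  exact hu.partial_sum R

end PerturbedOscillator

/-! ### Comparison of polynomial asymptotics -/

section PolynomialAsymptotics

/-- A polynomial of degree less than `n` that is `O(e^n)` as `e → 0+` vanishes. -/
theorem coeff_eq_zero_of_isBigO {n : ℕ} : ∀ {d : ℕ → ℝ},
    ((fun e : ℝ => ∑ j ∈ Finset.range n, e ^ j * d j) =O[𝓝[>] 0] fun e => e ^ n) →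
    ∀ j < n, d j = 0 := by
  induction n with
  | zero => intro d _ j hj; omega
  | succ n ih =>
    intro d h
    have h0 : d 0 = 0 := by
      have h1 : Tendsto (fun e : ℝ => ∑ j ∈ Finset.range (n + 1), e ^ j * d j) (𝓝[>] 0) (𝓝 (d 0)) := by
        have : Continuous fun e : ℝ => ∑ j ∈ Finset.range (n + 1), e ^ j * d j := by fun_prop
        have h2 := this.tendsto 0
        rw [Finset.sum_eq_single 0 (fun j _ hj => by rw [zero_pow hj, zero_mul]) (by simp)] at h2
        simpa using h2.mono_left nhdsWithin_le_nhds
      have h3 : Tendsto (fun e : ℝ => e ^ (n + 1)) (𝓝[>] 0) (𝓝 0) := by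
        have := (continuous_pow (M := ℝ) (n + 1)).tendsto 0
        rw [zero_pow (by omega)] at this
        exact this.mono_left nhdsWithin_le_nhds
      exact tendsto_nhds_unique h1 (h.trans_tendsto h3)
    have h1 : ((fun e : ℝ => ∑ j ∈ Finset.range n, e ^ j * d (j + 1)) =O[𝓝[>] 0] fun e => e ^ n) := by
      obtain ⟨C, hC⟩ := h.bound
      refine IsBigO.of_bound C ?_
      filter_upwards [hC, self_mem_nhdsWithin] with e he he0
      have he0 : 0 < e := he0
      rw [Finset.sum_range_succ', h0, mul_zero, add_zero, pow_succ, norm_mul] at he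
      have : ∑ j ∈ Finset.range n, e ^ (j + 1) * d (j + 1) =
          (∑ j ∈ Finset.range n, e ^ j * d (j + 1)) * e := by
        rw [Finset.sum_mul]; exact Finset.sum_congr rfl fun j _ => by ring
      rw [this, norm_mul, ← mul_assoc] at he
      exact le_of_mul_le_mul_right he (norm_pos_iff.2 he0.ne')
    intro j hj
    rcases j with _ | j
    · exact h0
    · exact ih h1 j (by omega)

theorem isBigO_pow_pow_zero {m n : ℕ} (h : n ≤ m) :
    (fun e : ℝ => e ^ m) =O[𝓝 0] fun e => e ^ n := by
  obtain ⟨k, rfl⟩ := Nat.exists_eq_add_of_le h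
  have h1 : ContinuousAt (fun e : ℝ => e ^ k) 0 := (continuous_pow k).continuousAt
  simpa [pow_add] using (isBigO_refl (fun e : ℝ => e ^ n) (𝓝 0)).mul (h1.isBigO_one ℝ)

theorem isBigO_sum_Ico {f : ℕ → ℝ → ℝ} (hf : ∀ j, ContinuousAt (f j) 0) (m k n : ℕ) :
    (fun e : ℝ => ∑ j ∈ Finset.Ico k n, e ^ (m + j) * f j e) =O[𝓝 0] fun e => e ^ (m + k) := by
  refine IsBigO.fun_sum fun j hj => ?_
  have h1 := (isBigO_pow_pow_zero (show m + k ≤ m + j by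
    have := (Finset.mem_Ico.1 hj).1; omega)).mul ((hf j).isBigO_one ℝ)
  simpa using h1

theorem isBigO_sum_sub (c : ℕ → ℝ) (m : ℕ) {k n : ℕ} (h : k ≤ n) :
    (fun e : ℝ => ∑ j ∈ Finset.range n, e ^ (m + j) * c j -
      ∑ j ∈ Finset.range k, e ^ (m + j) * c j) =O[𝓝 0] fun e => e ^ (m + k) := by
  have := isBigO_sum_Ico (f := fun j _ => c j) (fun j => continuousAt_const) m k n
  refine this.congr_left fun e => ?_
  rw [Finset.sum_Ico_eq_sub _ h]

theorem isBigO_taylor {G : Type} [NormedAddCommGroup G] [NormedSpace ℝ G] [ProperSpace G]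
    {u : G × ℝ → ℝ} (hu : ContDiff ℝ ∞ u) (n : ℕ) (x : G) :
    (fun e => u (x, e) - ∑ j ∈ Finset.range n, e ^ j * tcoef u j x) =O[𝓝 0] fun e => e ^ n := by
  have h1 : ContinuousAt (fun e : ℝ => hadQ^[n] u (x, e)) 0 := by
    have := (contDiff_hadQ_iterate hu n).continuous
    fun_prop
  have h2 := (isBigO_refl (fun e : ℝ => e ^ n) (𝓝 0)).mul (h1.isBigO_one ℝ)
  refine (h2.congr_left fun e => ?_).congr_right fun e => by simp
  rw [taylor_hadQ hu n x e]; ring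

theorem isBigO_mul_sub_mul {a a' b b' g : ℝ → ℝ} {l : Filter ℝ} (ha : (fun e => a e - a' e) =O[l] g)
    (hb : (fun e => b e - b' e) =O[l] g) (hb1 : b =O[l] fun _ => (1 : ℝ))
    (ha1 : a' =O[l] fun _ => (1 : ℝ)) : (fun e => a e * b e - a' e * b' e) =O[l] g := by
  have h1 : (fun e => (a e - a' e) * b e) =O[l] g := by simpa using ha.mul hb1
  have h2 : (fun e => a' e * (b e - b' e)) =O[l] g := by simpa using ha1.mul hb
  exact (h1.add h2).congr_left fun e => by ring

/-- Strict differentiability at (x,y) makes L Lipschitz near that point, to which both pairs of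
arguments converge. -/
theorem isBigO_comp_sub {L : ℝ → ℝ → ℝ} (hL : ContDiff ℝ ∞ (fun q : ℝ × ℝ => L q.1 q.2))
    {x y : ℝ} {a b c d g : ℝ → ℝ} (ha : ContinuousAt a 0) (hb : ContinuousAt b 0)
    (hc : ContinuousAt c 0) (hd : ContinuousAt d 0) (ha0 : a 0 = x) (hb0 : b 0 = y) (hc0 : c 0 = x)
    (hd0 : d 0 = y) (hac : (fun e => a e - c e) =O[𝓝 0] g) (hbd : (fun e => b e - d e) =O[𝓝 0] g) :
    (fun e => L (a e) (b e) - L (c e) (d e)) =O[𝓝 0] g := by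
  have h1 : HasStrictFDerivAt (fun q : ℝ × ℝ => L q.1 q.2)
      (fderiv ℝ (fun q : ℝ × ℝ => L q.1 q.2) (x, y)) (x, y) :=
    hL.contDiffAt.hasStrictFDerivAt (by simp)
  have h2 := h1.isBigO_sub
  have h3 : Tendsto (fun e => ((a e, b e), (c e, d e))) (𝓝 0) (𝓝 ((x, y), (x, y))) := by
    have h4 : ContinuousAt (fun e => ((a e, b e), (c e, d e))) 0 :=
      (ha.prodMk hb).prodMk (hc.prodMk hd)
    have := h4.tendsto
    simpa only [ha0, hb0, hc0, hd0] using this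
  have h5 := h2.comp_tendsto h3
  refine h5.trans ?_
  exact hac.prod_left hbd

end PolynomialAsymptotics

/-! ### The averaging recursion -/

/-- Smooth functions of `(R,Ψ)` that are `2π`-periodic in `Ψ`. -/
structure AvgPer (L : ℝ → ℝ → ℝ) : Prop where
  smooth : ContDiff ℝ ∞ (fun q : ℝ × ℝ => L q.1 q.2)
  per : ∀ x y, L x (y + 2 * Real.pi) = L x y

theorem contDiff_of_forall_eq {E : Type} [NormedAddCommGroup E] [NormedSpace ℝ E] {f g : E → ℝ}
    (hf : ContDiff ℝ ∞ f) (h : ∀ x, g x = f x) : ContDiff ℝ ∞ g := by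
  rwa [funext h]

namespace CoefPer

variable {per : ℝ} {c : ℝ → ℝ → ℝ → ℝ}

theorem hasFDerivAt (hc : CoefPer per c) (r θ ζ : ℝ) :
    HasFDerivAt (fun x : ℝ × ℝ × ℝ => c x.1 x.2.1 x.2.2)
      (fderiv ℝ (fun x : ℝ × ℝ × ℝ => c x.1 x.2.1 x.2.2) (r, θ, ζ)) (r, θ, ζ) :=
  (hc.smooth.differentiable (by simp) (r, θ, ζ)).hasFDerivAt

theorem hasDerivAt_r (hc : CoefPer per c) (r θ ζ : ℝ) :
    HasDerivAt (fun r' => c r' θ ζ)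
      (fderiv ℝ (fun x : ℝ × ℝ × ℝ => c x.1 x.2.1 x.2.2) (r, θ, ζ) (1, 0, 0)) r :=
  HasFDerivAt.comp_hasDerivAt (f := fun r' : ℝ => (r', θ, ζ)) r (hc.hasFDerivAt r θ ζ)
    ((hasDerivAt_id r).prodMk (hasDerivAt_const r (θ, ζ)))

theorem hasDerivAt_θ (hc : CoefPer per c) (r θ ζ : ℝ) :
    HasDerivAt (fun θ' => c r θ' ζ)
      (fderiv ℝ (fun x : ℝ × ℝ × ℝ => c x.1 x.2.1 x.2.2) (r, θ, ζ) (0, 1, 0)) θ :=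
  HasFDerivAt.comp_hasDerivAt (f := fun θ' : ℝ => (r, θ', ζ)) θ (hc.hasFDerivAt r θ ζ)
    ((hasDerivAt_const θ r).prodMk ((hasDerivAt_id θ).prodMk (hasDerivAt_const θ ζ)))

theorem hasDerivAt_ζ (hc : CoefPer per c) (r θ ζ : ℝ) :
    HasDerivAt (fun ζ' => c r θ ζ')
      (fderiv ℝ (fun x : ℝ × ℝ × ℝ => c x.1 x.2.1 x.2.2) (r, θ, ζ) (0, 0, 1)) ζ :=
  HasFDerivAt.comp_hasDerivAt (f := fun ζ' : ℝ => (r, θ, ζ')) ζ (hc.hasFDerivAt r θ ζ)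
    ((hasDerivAt_const ζ r).prodMk ((hasDerivAt_const ζ θ).prodMk (hasDerivAt_id ζ)))

theorem smooth_fderiv (hc : CoefPer per c) (v : ℝ × ℝ × ℝ) :
    ContDiff ℝ ∞ (fun x => fderiv ℝ (fun x : ℝ × ℝ × ℝ => c x.1 x.2.1 x.2.2) x v) :=
  (hc.smooth.fderiv_right (m := ∞) (by simp)).clm_apply contDiff_const

theorem deriv_r (hc : CoefPer per c) : CoefPer per (fun r θ ζ => deriv (fun r' => c r' θ ζ) r) := by
  refine ⟨contDiff_of_forall_eq (hc.smooth_fderiv (1, 0, 0)) fun x => (hc.hasDerivAt_r x.1 x.2.1 x.2.2).deriv,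
    fun r θ ζ => ?_, fun r θ ζ => ?_⟩
  · simp only [hc.per_θ]
  · simp only [hc.per_ζ]

theorem deriv_θ (hc : CoefPer per c) : CoefPer per (fun r θ ζ => deriv (fun θ' => c r θ' ζ) θ) := by
  refine ⟨contDiff_of_forall_eq (hc.smooth_fderiv (0, 1, 0)) fun x => (hc.hasDerivAt_θ x.1 x.2.1 x.2.2).deriv,
    fun r θ ζ => ?_, fun r θ ζ => ?_⟩
  · rw [← deriv_comp_add_const]
    simp only [hc.per_θ]
  · simp only [hc.per_ζ]

theorem deriv_ζ (hc : CoefPer per c) : CoefPer per (fun r θ ζ => deriv (fun ζ' => c r θ ζ') ζ) := by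
  refine ⟨contDiff_of_forall_eq (hc.smooth_fderiv (0, 0, 1)) fun x => (hc.hasDerivAt_ζ x.1 x.2.1 x.2.2).deriv,
    fun r θ ζ => ?_, fun r θ ζ => ?_⟩
  · simp only [hc.per_θ]
  · rw [← deriv_comp_add_const]
    simp only [hc.per_ζ]

theorem smooth' (hc : CoefPer per c) :
    ContDiff ℝ ∞ (fun x : (ℝ × ℝ) × ℝ => c x.1.1 x.1.2 x.2) :=
  hc.smooth.comp (by fun_prop : ContDiff ℝ ∞ fun x : (ℝ × ℝ) × ℝ => (x.1.1, x.1.2, x.2))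

theorem periodAvg (hc : CoefPer per c) : AvgPer (fun r θ => periodAvg per (c r θ)) := by
  refine ⟨(contDiff_intervalIntegral_param hc.smooth' 0 per).div_const per, fun x y => ?_⟩
  have : c x (y + 2 * Real.pi) = c x y := funext fun ζ => hc.per_θ x y ζ
  rw [this]

theorem continuous_ζ (hc : CoefPer per c) (r θ : ℝ) : Continuous (c r θ) :=
  hc.smooth.continuous.comp (by fun_prop : Continuous fun ζ : ℝ => (r, θ, ζ))

theorem sub_avg (hc : CoefPer per c) :
    CoefPer per (fun r θ ζ => c r θ ζ - _root_.periodAvg per (c r θ)) := by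
  refine ⟨hc.smooth.sub (hc.periodAvg.smooth.comp (by fun_prop :
    ContDiff ℝ ∞ fun x : ℝ × ℝ × ℝ => (x.1, x.2.1))), fun r θ ζ => ?_, fun r θ ζ => ?_⟩
  · rw [hc.per_θ, hc.periodAvg.per]
  · rw [hc.per_ζ]

/-- The increment of the primitive over a period is the mean times the period, which is zero. -/
theorem primitive (hc : CoefPer per c) (h0 : ∀ r θ, ∫ x in (0 : ℝ)..per, c r θ x = 0) :
    CoefPer per (fun r θ ζ => ∫ x in (0 : ℝ)..ζ, c r θ x) := by
  refine ⟨(contDiff_primitive_param hc.smooth').comp (by fun_prop :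
    ContDiff ℝ ∞ fun x : ℝ × ℝ × ℝ => ((x.1, x.2.1), x.2.2)), fun r θ ζ => ?_, fun r θ ζ => ?_⟩
  · have : c r (θ + 2 * Real.pi) = c r θ := funext fun ζ => hc.per_θ r θ ζ
    rw [this]
  · have hi := fun a b => (hc.continuous_ζ r θ).intervalIntegrable (μ := MeasureTheory.volume) a b
    have hp : Function.Periodic (c r θ) per := hc.per_ζ r θ
    rw [← intervalIntegral.integral_add_adjacent_intervals (hi 0 ζ) (hi ζ _),
      hp.intervalIntegral_add_eq ζ 0, zero_add, h0, add_zero]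

theorem const_mul (hc : CoefPer per c) (k : ℝ) : CoefPer per (fun r θ ζ => k * c r θ ζ) :=
  ⟨contDiff_const.mul hc.smooth, fun r θ ζ => by rw [hc.per_θ], fun r θ ζ => by rw [hc.per_ζ]⟩

theorem integral_sub_avg (hper : 0 < per) (hc : CoefPer per c) (r θ : ℝ) :
    ∫ x in (0 : ℝ)..per, (c r θ x - _root_.periodAvg per (c r θ)) = 0 := by
  rw [intervalIntegral.integral_sub ((hc.continuous_ζ r θ).intervalIntegrable _ _)
    intervalIntegrable_const, intervalIntegral.integral_const, _root_.periodAvg]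
  simp only [sub_zero, smul_eq_mul]
  field_simp
  ring

theorem zeroMeanPrimitive (hper : 0 < per) (vth : ℝ) (hc : CoefPer per c) :
    CoefPer per (fun r θ => zeroMeanPrimitive vth per (c r θ)) :=
  ((hc.sub_avg.primitive (hc.integral_sub_avg hper)).const_mul (-(1 / vth))).sub_avg

/-- The homological equation that removes the oscillating part at each order. -/
theorem deriv_zeroMeanPrimitive {vth : ℝ} (hv : vth ≠ 0) (hc : CoefPer per c) (r θ ζ : ℝ) :
    vth * deriv (_root_.zeroMeanPrimitive vth per (c r θ)) ζ =
      _root_.periodAvg per (c r θ) - c r θ ζ := by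
  have hcont : Continuous fun x => c r θ x - _root_.periodAvg per (c r θ) :=
    (hc.continuous_ζ r θ).sub continuous_const
  have h1 : HasDerivAt (fun ζ => ∫ x in (0 : ℝ)..ζ, (c r θ x - _root_.periodAvg per (c r θ)))
      (c r θ ζ - _root_.periodAvg per (c r θ)) ζ :=
    intervalIntegral.integral_hasDerivAt_right (hcont.intervalIntegrable _ _)
      (hcont.stronglyMeasurableAtFilter _ _) hcont.continuousAt
  have h2 : HasDerivAt (_root_.zeroMeanPrimitive vth per (c r θ))
      (-(1 / vth) * (c r θ ζ - _root_.periodAvg per (c r θ))) ζ :=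
    (h1.const_mul (-(1 / vth))).sub_const _
  rw [h2.deriv]
  field_simp
  ring

end CoefPer

section Mismatch

variable {per : ℝ} (M N : ℕ) (A B : ℕ → ℝ → ℝ → ℝ → ℝ) (s₁ s₂ : ℝ)
  (w ρ ψ : ℕ → ℝ → ℝ → ℝ → ℝ) (L : ℕ → ℝ → ℝ → ℝ)

/-- The common form of `mismatchR` and `mismatchPsi`, with `k` terms of the vector field and `K`
terms of the transformation. -/
noncomputable def mismatch (k K : ℕ) (p : (ℝ × ℝ × ℝ) × ℝ) : ℝ :=
  (∑ j ∈ Finset.range k, p.2 ^ j * A j p.1.1 p.1.2.1 p.1.2.2) *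
      (s₁ + ∑ j ∈ Finset.range K, p.2 ^ (M + j) *
        deriv (fun r' => w j r' p.1.2.1 p.1.2.2) p.1.1)
    + (∑ j ∈ Finset.range k, p.2 ^ j * B j p.1.1 p.1.2.1 p.1.2.2) *
      (s₂ + ∑ j ∈ Finset.range K, p.2 ^ (M + j) *
        deriv (fun θ' => w j p.1.1 θ' p.1.2.2) p.1.2.1)
    - ∑ j ∈ Finset.range K, p.2 ^ (N + j) * (((M + j : ℕ) : ℝ) / N * w j p.1.1 p.1.2.1 p.1.2.2)
    - ∑ j ∈ Finset.range K, p.2 ^ j *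
        L j (p.1.1 + ∑ i ∈ Finset.range K, p.2 ^ (M + i) * ρ i p.1.1 p.1.2.1 p.1.2.2)
          (p.1.2.1 + ∑ i ∈ Finset.range K, p.2 ^ (M + i) * ψ i p.1.1 p.1.2.1 p.1.2.2)

variable {M N A B s₁ s₂ w ρ ψ L}

theorem smoothPer_powsum {c : ℕ → ℝ → ℝ → ℝ → ℝ} {K : ℕ} (hc : ∀ j < K, CoefPer per (c j)) (m : ℕ) :
    SmoothPer per (fun p => ∑ j ∈ Finset.range K, p.2 ^ (m + j) * c j p.1.1 p.1.2.1 p.1.2.2) :=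
  SmoothPer.sum fun j hj => (SmoothPer.of_e (contDiff_id.pow _)).mul
    (SmoothPer.of_coef (hc j (Finset.mem_range.1 hj)))

theorem smoothPer_mismatch {k K : ℕ} (hA : ∀ j, CoefPer per (A j)) (hB : ∀ j, CoefPer per (B j))
    (hw : ∀ j < K, CoefPer per (w j)) (hρ : ∀ j < K, CoefPer per (ρ j))
    (hψ : ∀ j < K, CoefPer per (ψ j)) (hL : ∀ j < K, AvgPer (L j)) :
    SmoothPer per (mismatch M N A B s₁ s₂ w ρ ψ L k K) := by
  have h1 := smoothPer_powsum (K := k) (fun j _ => hA j) 0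
  have h2 := smoothPer_powsum (K := k) (fun j _ => hB j) 0
  simp only [zero_add] at h1 h2
  have h3 := smoothPer_powsum (fun j hj => (hw j hj).deriv_r) M
  have h4 := smoothPer_powsum (fun j hj => (hw j hj).deriv_θ) M
  have h5 := smoothPer_powsum (fun j hj => (hw j hj).const_mul (((M + j : ℕ) : ℝ) / N)) N
  have h6 := smoothPer_powsum hρ M
  have h7 := smoothPer_powsum hψ M
  refine (((h1.mul ((SmoothPer.const s₁).add h3)).add (h2.mul ((SmoothPer.const s₂).add h4))).sub
    h5).sub (SmoothPer.sum fun j hj => (SmoothPer.of_e (contDiff_id.pow _)).mul ?_)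
  have hLj := hL j (Finset.mem_range.1 hj)
  refine ⟨hLj.smooth.comp (ContDiff.prodMk ?_ ?_), fun r θ ζ e => ?_, fun r θ ζ e => ?_⟩
  · exact (contDiff_fst.comp contDiff_fst).add h6.smooth
  · exact (contDiff_fst.comp (contDiff_snd.comp contDiff_fst)).add h7.smooth
  · have a := h6.per_θ r θ ζ e
    have b := h7.per_θ r θ ζ e
    simp only at a b ⊢
    rw [a, b, add_right_comm, hLj.per]
  · have a := h6.per_ζ r θ ζ e
    have b := h7.per_ζ r θ ζ e
    simp only at a b ⊢
    rw [a, b]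

variable (vth : ℝ)

/-- The mismatch of the whole transformation of order `n`. -/
noncomputable def fullMismatch (M N : ℕ) (A B : ℕ → ℝ → ℝ → ℝ → ℝ) (s₁ s₂ : ℝ)
    (w ρ ψ : ℕ → ℝ → ℝ → ℝ → ℝ) (L : ℕ → ℝ → ℝ → ℝ) (vth : ℝ) (n : ℕ) (p : (ℝ × ℝ × ℝ) × ℝ) : ℝ :=
  mismatch M N A B s₁ s₂ w ρ ψ L (n + 1) (n + 1) p +
    ∑ j ∈ Finset.range (n + 1), p.2 ^ j * (vth * deriv (fun ζ' => w j p.1.1 p.1.2.1 ζ') p.1.2.2)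

theorem smoothPer_fullMismatch {n : ℕ} (hA : ∀ j, CoefPer per (A j)) (hB : ∀ j, CoefPer per (B j))
    (hw : ∀ j, CoefPer per (w j)) (hρ : ∀ j, CoefPer per (ρ j))
    (hψ : ∀ j, CoefPer per (ψ j)) (hL : ∀ j, AvgPer (L j)) :
    SmoothPer per (fullMismatch M N A B s₁ s₂ w ρ ψ L vth n) := by
  have h1 := smoothPer_powsum (K := n + 1) (fun j _ => (hw j).deriv_ζ.const_mul vth) 0
  simp only [zero_add] at h1
  exact (smoothPer_mismatch hA hB (fun j _ => hw j) (fun j _ => hρ j) (fun j _ => hψ j)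
    fun j _ => hL j).add h1

/-- The coefficients of the full mismatch are determined by the partial ones. -/
theorem tcoef_fullMismatch {n K : ℕ} (hM : 0 < M) (hN : 0 < N) (hK : K ≤ n)
    (hA : ∀ j, CoefPer per (A j)) (hB : ∀ j, CoefPer per (B j))
    (hw : ∀ j, CoefPer per (w j)) (hρ : ∀ j, CoefPer per (ρ j))
    (hψ : ∀ j, CoefPer per (ψ j)) (hL : ∀ j, AvgPer (L j)) (r θ ζ : ℝ) :
    tcoef (fullMismatch M N A B s₁ s₂ w ρ ψ L vth n) K (r, θ, ζ) =
      tcoef (mismatch M N A B s₁ s₂ w ρ ψ L (K + 1) K) K (r, θ, ζ) +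
        (vth * deriv (fun ζ' => w K r θ ζ') ζ - L K r θ) := by
  have hF := (smoothPer_fullMismatch (M := M) (N := N) (s₁ := s₁) (s₂ := s₂) vth (n := n)
    hA hB hw hρ hψ hL).smooth
  have hm := (smoothPer_mismatch (M := M) (N := N) (s₁ := s₁) (s₂ := s₂) (k := K + 1) (K := K) hA hB
    (fun j _ => hw j) (fun j _ => hρ j) (fun j _ => hψ j) fun j _ => hL j).smooth
  have hle : ∀ {m : ℕ}, K + 1 ≤ m → (fun e : ℝ => e ^ m) =O[𝓝 0] fun e => e ^ (K + 1) :=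
    fun h => isBigO_pow_pow_zero h
  have hbd : ∀ {f : ℝ → ℝ}, Continuous f → f =O[𝓝 0] fun _ => (1 : ℝ) :=
    fun h => h.continuousAt.isBigO_one ℝ
  -- differences of the partial sums
  have sA := isBigO_sum_sub (fun j => A j r θ ζ) 0 (show K + 1 ≤ n + 1 by omega)
  have sB := isBigO_sum_sub (fun j => B j r θ ζ) 0 (show K + 1 ≤ n + 1 by omega)
  simp only [zero_add] at sA sB
  have sr := (isBigO_sum_sub (fun j => deriv (fun r' => w j r' θ ζ) r) M
    (show K ≤ n + 1 by omega)).trans (hle (by omega))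
  have sθ := (isBigO_sum_sub (fun j => deriv (fun θ' => w j r θ' ζ) θ) M
    (show K ≤ n + 1 by omega)).trans (hle (by omega))
  have sw := (isBigO_sum_sub (fun j => ((M + j : ℕ) : ℝ) / N * w j r θ ζ) N
    (show K ≤ n + 1 by omega)).trans (hle (by omega))
  have sρ := (isBigO_sum_sub (fun j => ρ j r θ ζ) M
    (show K ≤ n + 1 by omega)).trans (hle (by omega))
  have sψ := (isBigO_sum_sub (fun j => ψ j r θ ζ) M
    (show K ≤ n + 1 by omega)).trans (hle (by omega))
  have sζ := isBigO_sum_sub (fun j => vth * deriv (fun ζ' => w j r θ ζ') ζ) 0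
    (show K + 1 ≤ n + 1 by omega)
  simp only [zero_add] at sζ
  have p1 := isBigO_mul_sub_mul (g := fun e => e ^ (K + 1)) sA (b := fun e => s₁ +
      ∑ j ∈ Finset.range (n + 1), e ^ (M + j) * deriv (fun r' => w j r' θ ζ) r)
    (b' := fun e => s₁ + ∑ j ∈ Finset.range K, e ^ (M + j) * deriv (fun r' => w j r' θ ζ) r)
    (sr.congr_left fun e => by ring) (hbd (by fun_prop)) (hbd (by fun_prop))
  have p2 := isBigO_mul_sub_mul (g := fun e => e ^ (K + 1)) sB (b := fun e => s₂ +
      ∑ j ∈ Finset.range (n + 1), e ^ (M + j) * deriv (fun θ' => w j r θ' ζ) θ)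
    (b' := fun e => s₂ + ∑ j ∈ Finset.range K, e ^ (M + j) * deriv (fun θ' => w j r θ' ζ) θ)
    (sθ.congr_left fun e => by ring) (hbd (by fun_prop)) (hbd (by fun_prop))
  obtain ⟨pr, hpr⟩ : ∃ pr : ℕ → ℝ → ℝ, ∀ m e, pr m e =
    r + ∑ i ∈ Finset.range m, e ^ (M + i) * ρ i r θ ζ := ⟨_, fun _ _ => rfl⟩
  obtain ⟨pθ, hpθ⟩ : ∃ pθ : ℕ → ℝ → ℝ, ∀ m e, pθ m e =
    θ + ∑ i ∈ Finset.range m, e ^ (M + i) * ψ i r θ ζ := ⟨_, fun _ _ => rfl⟩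
  have cpr : ∀ m, Continuous (pr m) := fun m => by
    rw [show pr m = _ from funext (hpr m)]; fun_prop
  have cpθ : ∀ m, Continuous (pθ m) := fun m => by
    rw [show pθ m = _ from funext (hpθ m)]; fun_prop
  have pr0 : ∀ m, pr m 0 = r := fun m => by
    rw [hpr, Finset.sum_eq_zero, add_zero]
    intro i _; rw [zero_pow (by omega), zero_mul]
  have pθ0 : ∀ m, pθ m 0 = θ := fun m => by
    rw [hpθ, Finset.sum_eq_zero, add_zero]
    intro i _; rw [zero_pow (by omega), zero_mul]
  have cL : ∀ j m, Continuous fun e => L j (pr m e) (pθ m e) := fun j m =>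
    (hL j).smooth.continuous.comp ((cpr m).prodMk (cpθ m))
  have l1 := isBigO_sum_Ico (f := fun j e => L j (pr (n + 1) e) (pθ (n + 1) e))
    (fun j => (cL j _).continuousAt) 0 (K + 1) (n + 1)
  simp only [zero_add] at l1
  have l2 : (fun e : ℝ => ∑ j ∈ Finset.range K, e ^ j * (L j (pr (n + 1) e) (pθ (n + 1) e) -
      L j (pr K e) (pθ K e))) =O[𝓝 0] fun e => e ^ (K + 1) := by
    refine IsBigO.fun_sum fun j _ => ?_
    have h1 := isBigO_comp_sub (hL j).smooth (cpr (n + 1)).continuousAt (cpθ (n + 1)).continuousAt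
      (cpr K).continuousAt (cpθ K).continuousAt (pr0 _) (pθ0 _) (pr0 _) (pθ0 _)
      (g := fun e => e ^ (K + 1)) (sρ.congr_left fun e => by rw [hpr, hpr]; ring)
      (sψ.congr_left fun e => by rw [hpθ, hpθ]; ring)
    simpa using (hbd (continuous_pow j)).mul h1
  -- The arguments of the averaged functions differ from (r,θ) by O(e^M) with M ≥ 1, so at order e^K
  -- the new term contributes only L_K(r,θ).
  have l3 : (fun e : ℝ => e ^ K * (L K (pr (n + 1) e) (pθ (n + 1) e) - L K r θ)) =O[𝓝 0]
      fun e => e ^ (K + 1) := by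
    have h0 : ∀ c : ℕ → ℝ, (fun e : ℝ => ∑ i ∈ Finset.range (n + 1), e ^ (M + i) * c i) =O[𝓝 0]
        fun e => e ^ 1 := fun c => by
      have := isBigO_sum_sub c M (Nat.zero_le (n + 1))
      simp only [Finset.range_zero, Finset.sum_empty, sub_zero] at this
      exact this.trans (isBigO_pow_pow_zero (by omega))
    have h1 := isBigO_comp_sub (hL K).smooth (cpr (n + 1)).continuousAt (cpθ (n + 1)).continuousAt
      (c := fun _ => r) (d := fun _ => θ) continuousAt_const continuousAt_const (pr0 _) (pθ0 _) rfl
      rfl (g := fun e => e ^ 1) ((h0 fun i => ρ i r θ ζ).congr_left fun e => by rw [hpr]; ring)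
      ((h0 fun i => ψ i r θ ζ).congr_left fun e => by rw [hpθ]; ring)
    have := (isBigO_refl (fun e : ℝ => e ^ K) (𝓝 0)).mul h1
    simpa only [← pow_add] using this
  have hsum := ((((p1.add p2).sub sw).add sζ).sub ((l1.add l2).add l3))
  have tF := isBigO_taylor hF (K + 1) (r, θ, ζ)
  have tm := isBigO_taylor hm (K + 1) (r, θ, ζ)
  have tot := (hsum.sub tF).add tm
  -- All other terms of index K or higher carry at least e^(K+1). The difference of the Taylor
  -- polynomials is thus a polynomial of degree at most K that is O(e^(K+1)), and so vanishes.
  have hz := coeff_eq_zero_of_isBigO (n := K + 1) (d := fun j =>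
    tcoef (fullMismatch M N A B s₁ s₂ w ρ ψ L vth n) j (r, θ, ζ) -
    tcoef (mismatch M N A B s₁ s₂ w ρ ψ L (K + 1) K) j (r, θ, ζ) -
    vth * deriv (fun ζ' => w j r θ ζ') ζ + if j = K then L K r θ else 0) ?_ K (by omega)
  · simp only [if_true] at hz
    linarith
  · refine (tot.mono nhdsWithin_le_nhds).congr_left fun e => ?_
    have e1 : ∑ j ∈ Finset.range (n + 1), e ^ j * L j (pr (n + 1) e) (pθ (n + 1) e) =
        ∑ j ∈ Finset.range K, e ^ j * L j (pr (n + 1) e) (pθ (n + 1) e) +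
        e ^ K * L K (pr (n + 1) e) (pθ (n + 1) e) +
        ∑ j ∈ Finset.Ico (K + 1) (n + 1), e ^ j * L j (pr (n + 1) e) (pθ (n + 1) e) := by
      rw [← Finset.sum_range_succ, Finset.sum_range_add_sum_Ico _ (by omega)]
    have e2 : ∑ j ∈ Finset.range (K + 1), e ^ j * (if j = K then L K r θ else 0) =
        e ^ K * L K r θ := by
      rw [Finset.sum_eq_single K (fun j _ hj => by rw [if_neg hj, mul_zero]) (by simp), if_pos rfl]
    simp only [mul_add, mul_sub, Finset.sum_add_distrib, Finset.sum_sub_distrib, e2]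
    simp only [fullMismatch, mismatch, ← hpr, ← hpθ, e1]
    ring

end Mismatch

section AveragingRecursion

variable {M N : ℕ} {vth per : ℝ} {A B : ℕ → ℝ → ℝ → ℝ → ℝ}

theorem mismatchR_eq (T : ℕ → AvgTerm) (K : ℕ) (r θ ζ e : ℝ) :
    mismatchR M N A B K (fun j => T j) r θ ζ e =
      mismatch M N A B 1 0 (fun j => (T j).rho) (fun j => (T j).rho) (fun j => (T j).psi)
        (fun j => (T j).Lam) (K + 1) K ((r, θ, ζ), e) := by
  simp only [mismatchR, mismatch, Finset.sum_range (n := K), zero_add]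
  congr 2
  exact Finset.sum_congr rfl fun j _ => by ring

theorem mismatchPsi_eq (T : ℕ → AvgTerm) (K : ℕ) (r θ ζ e : ℝ) :
    mismatchPsi M N A B K (fun j => T j) r θ ζ e =
      mismatch M N A B 0 1 (fun j => (T j).psi) (fun j => (T j).rho) (fun j => (T j).psi)
        (fun j => (T j).Om) (K + 1) K ((r, θ, ζ), e) := by
  simp only [mismatchPsi, mismatch, Finset.sum_range (n := K), zero_add]
  congr 2
  exact Finset.sum_congr rfl fun j _ => by ring

/-- Smoothness and periodicity of one order of the averaging procedure. -/
structure AvgTerm.Good (per : ℝ) (T : AvgTerm) : Prop where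
  rho : CoefPer per T.rho
  psi : CoefPer per T.psi
  Lam : AvgPer T.Lam
  Om : AvgPer T.Om

theorem matchR_eq (hA : ∀ j, CoefPer per (A j)) (hB : ∀ j, CoefPer per (B j)) {T : ℕ → AvgTerm}
    {K : ℕ} (hT : ∀ j < K, (T j).Good per) (r θ ζ : ℝ) :
    matchR M N A B K (fun j => T j) r θ ζ =
      tcoef (mismatch M N A B 1 0 (fun j => (T j).rho) (fun j => (T j).rho) (fun j => (T j).psi)
        (fun j => (T j).Lam) (K + 1) K) K (r, θ, ζ) := by
  rw [matchR, ← iteratedDeriv_eq_tcoef (smoothPer_mismatch hA hB (fun j hj => (hT j hj).rho)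
    (fun j hj => (hT j hj).rho) (fun j hj => (hT j hj).psi) fun j hj => (hT j hj).Lam).smooth]
  congr 2
  funext e
  exact mismatchR_eq T K r θ ζ e

theorem matchPsi_eq (hA : ∀ j, CoefPer per (A j)) (hB : ∀ j, CoefPer per (B j)) {T : ℕ → AvgTerm}
    {K : ℕ} (hT : ∀ j < K, (T j).Good per) (r θ ζ : ℝ) :
    matchPsi M N A B K (fun j => T j) r θ ζ =
      tcoef (mismatch M N A B 0 1 (fun j => (T j).psi) (fun j => (T j).rho) (fun j => (T j).psi)
        (fun j => (T j).Om) (K + 1) K) K (r, θ, ζ) := by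
  rw [matchPsi, ← iteratedDeriv_eq_tcoef (smoothPer_mismatch hA hB (fun j hj => (hT j hj).psi)
    (fun j hj => (hT j hj).rho) (fun j hj => (hT j hj).psi) fun j hj => (hT j hj).Om).smooth]
  congr 2
  funext e
  exact mismatchPsi_eq T K r θ ζ e

theorem coefPer_matchR (hA : ∀ j, CoefPer per (A j)) (hB : ∀ j, CoefPer per (B j))
    {T : ℕ → AvgTerm} {K : ℕ} (hT : ∀ j < K, (T j).Good per) :
    CoefPer per (matchR M N A B K (fun j => T j)) := by
  have h := (smoothPer_mismatch (M := M) (N := N) (s₁ := 1) (s₂ := 0) (k := K + 1) hA hB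
    (fun j hj => (hT j hj).rho)
    (fun j hj => (hT j hj).rho) (fun j hj => (hT j hj).psi) fun j hj => (hT j hj).Lam).tcoef K
  convert h using 4 with r θ ζ
  exact matchR_eq hA hB hT r θ ζ

theorem coefPer_matchPsi (hA : ∀ j, CoefPer per (A j)) (hB : ∀ j, CoefPer per (B j))
    {T : ℕ → AvgTerm} {K : ℕ} (hT : ∀ j < K, (T j).Good per) :
    CoefPer per (matchPsi M N A B K (fun j => T j)) := by
  have h := (smoothPer_mismatch (M := M) (N := N) (s₁ := 0) (s₂ := 1) (k := K + 1) hA hB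
    (fun j hj => (hT j hj).psi)
    (fun j hj => (hT j hj).rho) (fun j hj => (hT j hj).psi) fun j hj => (hT j hj).Om).tcoef K
  convert h using 4 with r θ ζ
  exact matchPsi_eq hA hB hT r θ ζ

theorem avgTerm_good (hper : 0 < per) (hA : ∀ j, CoefPer per (A j)) (hB : ∀ j, CoefPer per (B j))
    (K : ℕ) : (avgTerm M N vth per A B K).Good per := by
  induction K using Nat.strong_induction_on with
  | _ K ih =>
    have hR := coefPer_matchR (M := M) (N := N) hA hB ih
    have hP := coefPer_matchPsi (M := M) (N := N) hA hB ih
    rw [avgTerm]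
    exact ⟨hR.zeroMeanPrimitive hper vth, hP.zeroMeanPrimitive hper vth, hR.periodAvg,
      hP.periodAvg⟩

/-- At order K the mismatch consists of the already known part, plus ϑ ∂_ζ ρ_K - Λ_K; the recursion
solves exactly this homological equation. -/
theorem tcoef_fullMismatch_R (hper : 0 < per) (hv : vth ≠ 0) (hM : 0 < M) (hN : 0 < N)
    (hA : ∀ j, CoefPer per (A j)) (hB : ∀ j, CoefPer per (B j)) {n K : ℕ} (hK : K ≤ n)
    (r θ ζ : ℝ) :
    tcoef (fullMismatch M N A B 1 0 (fun j => (avgTerm M N vth per A B j).rho)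
      (fun j => (avgTerm M N vth per A B j).rho) (fun j => (avgTerm M N vth per A B j).psi)
      (fun j => (avgTerm M N vth per A B j).Lam) vth n) K (r, θ, ζ) = 0 := by
  have hT := fun j => avgTerm_good (M := M) (N := N) (vth := vth) hper hA hB j
  rw [tcoef_fullMismatch vth hM hN hK hA hB (fun j => (hT j).rho) (fun j => (hT j).rho)
    (fun j => (hT j).psi) fun j => (hT j).Lam, ← matchR_eq hA hB fun j _ => hT j]
  have h1 : (avgTerm M N vth per A B K).rho = fun r θ => zeroMeanPrimitive vth per
      (matchR M N A B K (fun j => avgTerm M N vth per A B j) r θ) := by rw [avgTerm]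
  have h2 : (avgTerm M N vth per A B K).Lam = fun r θ => periodAvg per
      (matchR M N A B K (fun j => avgTerm M N vth per A B j) r θ) := by rw [avgTerm]
  rw [h1, h2]
  have := (coefPer_matchR (M := M) (N := N) hA hB fun j (_ : j < K) => hT j).deriv_zeroMeanPrimitive
    hv r θ ζ
  simp only at this ⊢
  rw [this]
  ring

theorem tcoef_fullMismatch_Psi (hper : 0 < per) (hv : vth ≠ 0) (hM : 0 < M) (hN : 0 < N)
    (hA : ∀ j, CoefPer per (A j)) (hB : ∀ j, CoefPer per (B j)) {n K : ℕ} (hK : K ≤ n)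
    (r θ ζ : ℝ) :
    tcoef (fullMismatch M N A B 0 1 (fun j => (avgTerm M N vth per A B j).psi)
      (fun j => (avgTerm M N vth per A B j).rho) (fun j => (avgTerm M N vth per A B j).psi)
      (fun j => (avgTerm M N vth per A B j).Om) vth n) K (r, θ, ζ) = 0 := by
  have hT := fun j => avgTerm_good (M := M) (N := N) (vth := vth) hper hA hB j
  rw [tcoef_fullMismatch vth hM hN hK hA hB (fun j => (hT j).psi) (fun j => (hT j).rho)
    (fun j => (hT j).psi) fun j => (hT j).Om, ← matchPsi_eq hA hB fun j _ => hT j]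
  have h1 : (avgTerm M N vth per A B K).psi = fun r θ => zeroMeanPrimitive vth per
      (matchPsi M N A B K (fun j => avgTerm M N vth per A B j) r θ) := by rw [avgTerm]
  have h2 : (avgTerm M N vth per A B K).Om = fun r θ => periodAvg per
      (matchPsi M N A B K (fun j => avgTerm M N vth per A B j) r θ) := by rw [avgTerm]
  rw [h1, h2]
  have := (coefPer_matchPsi (M := M) (N := N) hA hB fun j (_ : j < K) => hT j).deriv_zeroMeanPrimitive
    hv r θ ζ
  simp only at this ⊢
  rw [this]
  ring

/-- The first averaged frequency is the average of the first coefficient. -/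
theorem avgTerm_zero_Om (hper : 0 < per) {c : ℝ} (hc : ∀ r θ ζ, B 0 r θ ζ = c * r) (r θ : ℝ) :
    (avgTerm M N vth per A B 0).Om r θ = c * r := by
  have h2 : (avgTerm M N vth per A B 0).Om = fun r θ => periodAvg per
      (matchPsi M N A B 0 (fun j => avgTerm M N vth per A B j) r θ) := by rw [avgTerm]
  rw [h2]
  have h3 : ∀ ζ, matchPsi M N A B 0 (fun j => avgTerm M N vth per A B j) r θ ζ = c * r := fun ζ => by
    simp [matchPsi, mismatchPsi, hc]
  simp only [periodAvg, h3, intervalIntegral.integral_const, sub_zero, smul_eq_mul]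
  field_simp

/-- With vanishing Taylor coefficients only the smooth remainder is left. Periodicity bounds it
uniformly in θ and ζ. -/
theorem fullMismatch_bound (hper : 0 < per) {n : ℕ} {u : (ℝ × ℝ × ℝ) × ℝ → ℝ} (hu : SmoothPer per u)
    (h0 : ∀ K ≤ n, ∀ r θ ζ, tcoef u K (r, θ, ζ) = 0) (R : ℝ) :
    ∃ C, 0 ≤ C ∧ ∀ r θ ζ e, |r| ≤ R → |e| ≤ 1 → |u ((r, θ, ζ), e)| ≤ C * |e| ^ (n + 1) := by
  obtain ⟨C, hC, h⟩ := (hu.hadQ_iterate (n + 1)).bounded hper R 1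
  refine ⟨C, hC, fun r θ ζ e hr he => ?_⟩
  rw [taylor_hadQ hu.smooth (n + 1) (r, θ, ζ) e, Finset.sum_eq_zero, zero_add, abs_mul, abs_pow,
    mul_comm]
  · exact mul_le_mul_of_nonneg_right (h r θ ζ e hr he) (by positivity)
  · intro K hK
    rw [h0 K (by rw [Finset.mem_range] at hK; omega), mul_zero]

end AveragingRecursion

/-! ### Remainders of the full averaged system -/

namespace PerturbedOscillator

variable {P : PerturbedOscillator} (Q : ResonantFrame P)

theorem term_good (hrc : P.ResonanceCondition) (K : ℕ) : (Q.term K).Good Q.period :=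
  avgTerm_good Q.period_pos (coefPer_Acoeff Q hrc) (coefPer_Bcoeff Q hrc) K

theorem exists_Om_zero (hrc : P.ResonanceCondition) : ∃ c > 0, ∀ r θ, Q.Om 0 r θ = c * r := by
  obtain ⟨c, hc, h⟩ := exists_Bcoeff_zero Q hrc
  exact ⟨c, hc, avgTerm_zero_Om Q.period_pos h⟩

theorem weight_eq {τ : ℝ} (hτ : 0 < τ) (K : ℕ) : Q.weight K τ = P.eOf τ ^ (P.M + K) := by
  rw [P.eOf_pow hτ, ResonantFrame.weight]; push_cast; rfl

theorem Rn_eq {τ : ℝ} (hτ : 0 < τ) (n : ℕ) (r θ : ℝ) :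
    Q.Rn n r θ τ = r + ∑ K ∈ Finset.range (n + 1), P.eOf τ ^ (P.M + K) *
      (Q.term K).rho r θ (P.vartheta * τ) := by
  rw [ResonantFrame.Rn, P.zeta_eq Q hτ]
  simp only [weight_eq Q hτ]

theorem Psin_eq {τ : ℝ} (hτ : 0 < τ) (n : ℕ) (r θ : ℝ) :
    Q.Psin n r θ τ = θ + ∑ K ∈ Finset.range (n + 1), P.eOf τ ^ (P.M + K) *
      (Q.term K).psi r θ (P.vartheta * τ) := by
  rw [ResonantFrame.Psin, P.zeta_eq Q hτ]
  simp only [weight_eq Q hτ]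

theorem hasDerivAt_weight {τ : ℝ} (hτ : 0 < τ) (K : ℕ) :
    HasDerivAt (Q.weight K) (-(((P.M + K : ℕ) : ℝ) / P.N * P.eOf τ ^ (P.M + K + P.N))) τ := by
  refine (Real.hasDerivAt_rpow_const (p := -(((P.M : ℝ) + K) / P.N))
    (Or.inl hτ.ne')).congr_deriv ?_
  rw [pow_add, P.eOf_pow_N hτ, P.eOf_pow hτ, Real.rpow_sub_one hτ.ne']
  push_cast
  ring

/-- The sum part of the near-identity transformation and its derivatives. -/
theorem hasDerivAt_powsum_r {c : ℕ → ℝ → ℝ → ℝ → ℝ} (hc : ∀ j, CoefPer Q.period (c j)) (n M : ℕ)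
    (r θ ζ e : ℝ) :
    HasDerivAt (fun r' => ∑ K ∈ Finset.range n, e ^ (M + K) * c K r' θ ζ)
      (∑ K ∈ Finset.range n, e ^ (M + K) * deriv (fun r' => c K r' θ ζ) r) r :=
  HasDerivAt.fun_sum fun K _ =>
    (((hc K).hasDerivAt_r r θ ζ).differentiableAt.hasDerivAt).const_mul _

theorem hasDerivAt_powsum_θ {c : ℕ → ℝ → ℝ → ℝ → ℝ} (hc : ∀ j, CoefPer Q.period (c j)) (n M : ℕ)
    (r θ ζ e : ℝ) :
    HasDerivAt (fun θ' => ∑ K ∈ Finset.range n, e ^ (M + K) * c K r θ' ζ)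
      (∑ K ∈ Finset.range n, e ^ (M + K) * deriv (fun θ' => c K r θ' ζ) θ) θ :=
  HasDerivAt.fun_sum fun K _ =>
    (((hc K).hasDerivAt_θ r θ ζ).differentiableAt.hasDerivAt).const_mul _

/-- Differentiating a weight costs e^N, because de/dτ = -e^(N+1)/N; differentiating the fast phase
costs nothing. -/
theorem hasDerivAt_powsum_τ {c : ℕ → ℝ → ℝ → ℝ → ℝ} (hc : ∀ j, CoefPer Q.period (c j)) (n : ℕ)
    (r θ : ℝ) {τ : ℝ} (hτ : 0 < τ) :
    HasDerivAt (fun τ' => ∑ K ∈ Finset.range n, Q.weight K τ' * c K r θ (Q.zeta τ'))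
      (P.eOf τ ^ P.M * (∑ K ∈ Finset.range n, P.eOf τ ^ K *
          (P.vartheta * deriv (fun ζ' => c K r θ ζ') (P.vartheta * τ)) -
        ∑ K ∈ Finset.range n, P.eOf τ ^ (P.N + K) *
          (((P.M + K : ℕ) : ℝ) / P.N * c K r θ (P.vartheta * τ)))) τ := by
  rw [← Finset.sum_sub_distrib, Finset.mul_sum]
  refine HasDerivAt.fun_sum fun K _ => ?_
  have h1 : HasDerivAt (fun τ' => c K r θ (Q.zeta τ'))
      (deriv (fun ζ' => c K r θ ζ') (P.vartheta * τ) * P.vartheta) τ := by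
    have h2 : HasDerivAt (fun τ' : ℝ => P.vartheta * τ') P.vartheta τ := by
      simpa using (hasDerivAt_id τ).const_mul P.vartheta
    have h3 := ((hc K).hasDerivAt_ζ r θ (P.vartheta * τ)).differentiableAt.hasDerivAt
    refine (HasDerivAt.comp τ h3 h2).congr_of_eventuallyEq ?_
    filter_upwards [eventually_gt_nhds hτ] with τ' hτ'
    simp only [Function.comp_apply, P.zeta_eq Q hτ']
  refine ((hasDerivAt_weight Q hτ K).mul h1).congr_deriv ?_
  rw [weight_eq Q hτ, P.zeta_eq Q hτ]
  ring

/-- The error of the averaged equation along the transformation, for a component with leading part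
`s₁ r + s₂ θ`. -/
theorem totalDeriv_bound (hrc : P.ResonanceCondition) {s₁ s₂ : ℝ} {w : ℕ → ℝ → ℝ → ℝ → ℝ}
    {L : ℕ → ℝ → ℝ → ℝ} (hw : ∀ j, CoefPer Q.period (w j)) (hL : ∀ j, AvgPer (L j)) (n : ℕ)
    (h0 : ∀ K ≤ n, ∀ r θ ζ, tcoef (fullMismatch P.M P.N Q.Acoeff Q.Bcoeff s₁ s₂ w
      (fun j => (Q.term j).rho) (fun j => (Q.term j).psi) L P.vartheta n) K (r, θ, ζ) = 0) (R : ℝ) :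
    ∃ C τ₁, 0 < τ₁ ∧ ∀ τ ≥ τ₁, ∀ r θ, |r| ≤ R →
      |Q.totalDeriv (fun r θ τ => s₁ * r + s₂ * θ + ∑ K ∈ Finset.range (n + 1),
          Q.weight K τ * w K r θ (Q.zeta τ)) r θ τ -
        ∑ K ∈ Finset.range (n + 1), Q.weight K τ * L K (Q.Rn n r θ τ) (Q.Psin n r θ τ)| ≤
      C * P.eOf τ ^ (P.M + n + 1) := by
  have hT := term_good Q hrc
  obtain ⟨CA, τA, hA⟩ := rField_expansion Q hrc n R
  obtain ⟨CB, τB, hB⟩ := thetaField_expansion Q hrc n R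
  have hu := smoothPer_fullMismatch (M := P.M) (N := P.N) (s₁ := s₁) (s₂ := s₂) P.vartheta (n := n)
    (coefPer_Acoeff Q hrc) (coefPer_Bcoeff Q hrc) hw (fun j => (hT j).rho) (fun j => (hT j).psi) hL
  obtain ⟨C, hC, hF⟩ := fullMismatch_bound Q.period_pos hu h0 R
  have hr' := smoothPer_powsum (K := n + 1) (fun j _ => (hw j).deriv_r) P.M
  have hθ' := smoothPer_powsum (K := n + 1) (fun j _ => (hw j).deriv_θ) P.M
  obtain ⟨C₁, hC₁, h1⟩ := ((SmoothPer.const s₁).add hr').bounded Q.period_pos R 1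
  obtain ⟨C₂, hC₂, h2⟩ := ((SmoothPer.const s₂).add hθ').bounded Q.period_pos R 1
  obtain ⟨τ₂, hτ₂, h3⟩ := ResonantFrame.exists_eOf_small (P := P) one_pos
  refine ⟨CA * C₁ + CB * C₂ + C, max (max τA τB) τ₂, lt_max_of_lt_right hτ₂, fun τ hτ r θ hr => ?_⟩
  have a := hA τ ((le_max_left _ _).trans ((le_max_left _ _).trans hτ)) r θ hr
  have b := hB τ ((le_max_right _ _).trans ((le_max_left _ _).trans hτ)) r θ hr
  have hτ2 := (le_max_right _ _).trans hτ
  have hτ0 : 0 < τ := hτ₂.trans_le hτ2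
  obtain ⟨he, he1⟩ := h3 τ hτ2
  have hea : |P.eOf τ| ≤ 1 := by rw [abs_of_pos he]; exact he1.le
  have c := hF r θ (P.vartheta * τ) (P.eOf τ) hr hea
  have d1 := h1 r θ (P.vartheta * τ) (P.eOf τ) hr hea
  have d2 := h2 r θ (P.vartheta * τ) (P.eOf τ) hr hea
  rw [abs_of_pos he] at c
  have hMN := ResonantFrame.Scaling.rpow_M_div_N (P := P) hτ0
  rw [hMN] at a b
  have heM : 0 < P.eOf τ ^ P.M := pow_pos he _
  have D1 : deriv (fun r' => s₁ * r' + s₂ * θ + ∑ K ∈ Finset.range (n + 1),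
      Q.weight K τ * w K r' θ (Q.zeta τ)) r = s₁ + ∑ K ∈ Finset.range (n + 1),
      P.eOf τ ^ (P.M + K) * deriv (fun r' => w K r' θ (P.vartheta * τ)) r := by
    simp only [weight_eq Q hτ0, P.zeta_eq Q hτ0]
    refine HasDerivAt.deriv (HasDerivAt.add ?_ (hasDerivAt_powsum_r Q hw _ _ _ _ _ _))
    simpa using ((hasDerivAt_id r).const_mul s₁).add_const (s₂ * θ)
  have D2 : deriv (fun θ' => s₁ * r + s₂ * θ' + ∑ K ∈ Finset.range (n + 1),
      Q.weight K τ * w K r θ' (Q.zeta τ)) θ = s₂ + ∑ K ∈ Finset.range (n + 1),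
      P.eOf τ ^ (P.M + K) * deriv (fun θ' => w K r θ' (P.vartheta * τ)) θ := by
    simp only [weight_eq Q hτ0, P.zeta_eq Q hτ0]
    refine HasDerivAt.deriv (HasDerivAt.add ?_ (hasDerivAt_powsum_θ Q hw _ _ _ _ _ _))
    simpa using ((hasDerivAt_id θ).const_mul s₂).const_add (s₁ * r)
  have D3 := ((hasDerivAt_powsum_τ Q hw (n + 1) r θ hτ0).const_add (s₁ * r + s₂ * θ)).deriv
  rw [ResonantFrame.totalDeriv, D1, D2, D3, Rn_eq Q hτ0, Psin_eq Q hτ0]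
  simp only [weight_eq Q hτ0]
  simp only [fullMismatch, mismatch] at c
  simp only at d1 d2
  have hpull : ∀ X : ℕ → ℝ, ∑ K ∈ Finset.range (n + 1), P.eOf τ ^ (P.M + K) * X K =
      P.eOf τ ^ P.M * ∑ K ∈ Finset.range (n + 1), P.eOf τ ^ K * X K := fun X => by
    rw [Finset.mul_sum]; exact Finset.sum_congr rfl fun K _ => by rw [pow_add, mul_assoc]
  rw [hpull (fun K => L K _ _)]
  generalize (∑ K ∈ Finset.range (n + 1), P.eOf τ ^ K * Q.Acoeff K r θ (P.vartheta * τ)) = SA at *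
  generalize (∑ K ∈ Finset.range (n + 1), P.eOf τ ^ K * Q.Bcoeff K r θ (P.vartheta * τ)) = SB at *
  generalize (s₁ + ∑ K ∈ Finset.range (n + 1),
      P.eOf τ ^ (P.M + K) * deriv (fun r' => w K r' θ (P.vartheta * τ)) r) = X1 at *
  generalize (s₂ + ∑ K ∈ Finset.range (n + 1),
      P.eOf τ ^ (P.M + K) * deriv (fun θ' => w K r θ' (P.vartheta * τ)) θ) = X2 at *
  generalize Q.rField r θ τ = F1 at *
  generalize Q.thetaField r θ τ = F2 at *
  generalize (∑ K ∈ Finset.range (n + 1), P.eOf τ ^ K *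
    (P.vartheta * deriv (fun ζ' => w K r θ ζ') (P.vartheta * τ))) = Y1 at *
  generalize (∑ K ∈ Finset.range (n + 1), P.eOf τ ^ (P.N + K) *
    (((P.M + K : ℕ) : ℝ) / P.N * w K r θ (P.vartheta * τ))) = Y2 at *
  generalize (∑ K ∈ Finset.range (n + 1), P.eOf τ ^ K * L K _ _) = Y3 at *
  -- The error splits into the truncation errors of the two right-hand sides and the full mismatch,
  -- each O(e^(n+1)) after extraction of e^M.
  have key : X1 * F1 + X2 * F2 + P.eOf τ ^ P.M * (Y1 - Y2) - P.eOf τ ^ P.M * Y3 =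
      P.eOf τ ^ P.M * (((P.eOf τ ^ P.M)⁻¹ * F1 - SA) * X1 + ((P.eOf τ ^ P.M)⁻¹ * F2 - SB) * X2 +
        (SA * X1 + SB * X2 - Y2 - Y3 + Y1)) := by
    field_simp
    ring
  rw [key, abs_mul, abs_of_pos heM, add_assoc P.M, pow_add (P.eOf τ) P.M, mul_left_comm]
  refine mul_le_mul_of_nonneg_left ?_ heM.le
  refine (abs_add_le _ _).trans ?_
  rw [add_mul]
  refine add_le_add ((abs_add_le _ _).trans ?_) c
  rw [add_mul, abs_mul, abs_mul]
  have hp := pow_pos he (n + 1)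
  have hCA : 0 ≤ CA * P.eOf τ ^ (n + 1) := (abs_nonneg _).trans a
  have hCB : 0 ≤ CB * P.eOf τ ^ (n + 1) := (abs_nonneg _).trans b
  refine add_le_add ((mul_le_mul a d1 (abs_nonneg _) hCA).trans (le_of_eq (by ring)))
    ((mul_le_mul b d2 (abs_nonneg _) hCB).trans (le_of_eq (by ring)))

theorem totalDeriv_Rn_bound (hrc : P.ResonanceCondition) (n : ℕ) (R : ℝ) :
    ∃ C τ₁, 0 < τ₁ ∧ ∀ τ ≥ τ₁, ∀ r θ, |r| ≤ R →
      |Q.totalDeriv (Q.Rn n) r θ τ - ∑ K ∈ Finset.range (n + 1), Q.weight K τ *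
        Q.Lam K (Q.Rn n r θ τ) (Q.Psin n r θ τ)| ≤ C * P.eOf τ ^ (P.M + n + 1) := by
  have hT := term_good Q hrc
  have h := totalDeriv_bound Q hrc (s₁ := 1) (s₂ := 0) (fun j => (hT j).rho) (fun j => (hT j).Lam) n
    (fun K hK r θ ζ => tcoef_fullMismatch_R Q.period_pos P.vartheta_pos.ne' (P.M_pos hrc) P.N_pos
      (coefPer_Acoeff Q hrc) (coefPer_Bcoeff Q hrc) hK r θ ζ) R
  simp only [one_mul, zero_mul, add_zero] at h
  exact h

theorem totalDeriv_Psin_bound (hrc : P.ResonanceCondition) (n : ℕ) (R : ℝ) :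
    ∃ C τ₁, 0 < τ₁ ∧ ∀ τ ≥ τ₁, ∀ r θ, |r| ≤ R →
      |Q.totalDeriv (Q.Psin n) r θ τ - ∑ K ∈ Finset.range (n + 1), Q.weight K τ *
        Q.Om K (Q.Rn n r θ τ) (Q.Psin n r θ τ)| ≤ C * P.eOf τ ^ (P.M + n + 1) := by
  have hT := term_good Q hrc
  have h := totalDeriv_bound Q hrc (s₁ := 0) (s₂ := 1) (fun j => (hT j).psi) (fun j => (hT j).Om) n
    (fun K hK r θ ζ => tcoef_fullMismatch_Psi Q.period_pos P.vartheta_pos.ne' (P.M_pos hrc) P.N_pos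
      (coefPer_Acoeff Q hrc) (coefPer_Bcoeff Q hrc) hK r θ ζ) R
  simp only [one_mul, zero_mul, zero_add] at h
  exact h

/-- The remainders of the full averaged system at the points of the image of the strip. -/
theorem remainder_bound (hrc : P.ResonanceCondition) (n : ℕ) (r₀ : ℝ) :
    ∃ C τ₁, 0 < τ₁ ∧ ∀ τ ≥ τ₁, ∀ R Ψ, (R, Ψ) ∈ Q.nearId n τ '' ResonantFrame.strip r₀ →
      |Q.LamRem n r₀ R Ψ τ| ≤ C * P.eOf τ ^ (P.M + n + 1) ∧
      |Q.OmRem n r₀ R Ψ τ| ≤ C * P.eOf τ ^ (P.M + n + 1) := by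
  obtain ⟨C₁, τ₁, hτ₁, h1⟩ := totalDeriv_Rn_bound Q hrc n r₀
  obtain ⟨C₂, τ₂, hτ₂, h2⟩ := totalDeriv_Psin_bound Q hrc n r₀
  refine ⟨max C₁ C₂, max τ₁ τ₂, lt_max_of_lt_left hτ₁, fun τ hτ R Ψ hmem => ?_⟩
  have hτ0 : 0 < τ := hτ₁.trans_le ((le_max_left _ _).trans hτ)
  have hp := pow_pos (P.eOf_pos hτ0) (P.M + n + 1)
  have hm : Q.preimage n r₀ R Ψ τ ∈ ResonantFrame.strip r₀ := Function.invFunOn_mem hmem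
  have he : Q.nearId n τ (Q.preimage n r₀ R Ψ τ) = (R, Ψ) := Function.invFunOn_eq hmem
  simp only [ResonantFrame.nearId, Prod.mk.injEq] at he
  have a := h1 τ ((le_max_left _ _).trans hτ) (Q.preimage n r₀ R Ψ τ).1
    (Q.preimage n r₀ R Ψ τ).2 hm
  have b := h2 τ ((le_max_right _ _).trans hτ) (Q.preimage n r₀ R Ψ τ).1
    (Q.preimage n r₀ R Ψ τ).2 hm
  rw [he.1, he.2] at a b
  exact ⟨a.trans (mul_le_mul_of_nonneg_right (le_max_left _ _) hp.le),
    b.trans (mul_le_mul_of_nonneg_right (le_max_right _ _) hp.le)⟩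

end PerturbedOscillator

/-! ### Local Taylor bounds and the Hamiltonian splitting -/

section LocalEstimates

/-- First order Taylor estimate on a ball, with the derivative taken at an arbitrary point. -/
theorem exists_linear_bound {f : ℝ × ℝ → ℝ} (hf : ContDiff ℝ ∞ f) (c₀ : ℝ × ℝ) (r : ℝ) :
    ∃ C, 0 ≤ C ∧ ∀ c ∈ Metric.closedBall c₀ r, ∀ p ∈ Metric.closedBall c₀ r,
      ∀ q ∈ Metric.closedBall c₀ r, ∀ d, ‖p - c‖ ≤ d → ‖q - c‖ ≤ d →
      |f q - f p - fderiv ℝ f c (q - p)| ≤ C * d * ‖q - p‖ := by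
  have hK : IsCompact (Metric.closedBall c₀ r) := isCompact_closedBall c₀ r
  have hconv : Convex ℝ (Metric.closedBall c₀ r) := convex_closedBall c₀ r
  have h1 : ContDiff ℝ ∞ (fderiv ℝ f) := hf.fderiv_right (m := ∞) (by simp)
  obtain ⟨C, hC⟩ := hK.exists_bound_of_continuousOn
    ((h1.continuous_fderiv (by simp)).continuousOn (s := Metric.closedBall c₀ r))
  have hLip : ∀ c ∈ Metric.closedBall c₀ r, ∀ q ∈ Metric.closedBall c₀ r,
      ‖fderiv ℝ f q - fderiv ℝ f c‖ ≤ C * ‖q - c‖ := fun c hc q hq =>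
    hconv.norm_image_sub_le_of_norm_fderiv_le
      (fun x _ => (h1.differentiable (by simp)).differentiableAt) hC hc hq
  refine ⟨max C 0, le_max_right _ _, fun c hc p hp q hq d hpd hqd => ?_⟩
  have hs : Convex ℝ (Metric.closedBall c₀ r ∩ Metric.closedBall c d) :=
    hconv.inter (convex_closedBall c d)
  rw [← mem_closedBall_iff_norm] at hpd hqd
  refine hs.norm_image_sub_le_of_norm_fderiv_le'
    (fun x _ => (hf.differentiable (by simp)).differentiableAt) (fun x hx => ?_) ⟨hp, hpd⟩ ⟨hq, hqd⟩
  have h2 := mem_closedBall_iff_norm.1 hx.2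
  have h3 : 0 ≤ ‖x - c‖ := norm_nonneg _
  calc ‖fderiv ℝ f x - fderiv ℝ f c‖ ≤ C * ‖x - c‖ := hLip c hc x hx.1
    _ ≤ max C 0 * ‖x - c‖ := mul_le_mul_of_nonneg_right (le_max_left _ _) h3
    _ ≤ max C 0 * d := mul_le_mul_of_nonneg_left h2 (le_max_right _ _)

theorem exists_lipschitz_bound {f : ℝ × ℝ → ℝ} (hf : ContDiff ℝ ∞ f) (c₀ : ℝ × ℝ) (r : ℝ) :
    ∃ C, 0 ≤ C ∧ ∀ p ∈ Metric.closedBall c₀ r, ∀ q ∈ Metric.closedBall c₀ r,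
      |f q - f p| ≤ C * ‖q - p‖ := by
  obtain ⟨C, hC⟩ := (isCompact_closedBall c₀ r).exists_bound_of_continuousOn
    ((hf.continuous_fderiv (by simp)).continuousOn (s := Metric.closedBall c₀ r))
  refine ⟨max C 0, le_max_right _ _, fun p hp q hq => ?_⟩
  exact ((convex_closedBall c₀ r).norm_image_sub_le_of_norm_fderiv_le
    (fun x _ => (hf.differentiable (by simp)).differentiableAt) hC hp hq).trans
    (mul_le_mul_of_nonneg_right (le_max_left _ _) (norm_nonneg _))

/-- A smooth function that vanishes for `x = 0` is `x` times a smooth function. -/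
theorem exists_eq_mul_of_zero {f : ℝ × ℝ → ℝ} (hf : ContDiff ℝ ∞ f) (h0 : ∀ y, f (0, y) = 0) :
    ∃ g : ℝ × ℝ → ℝ, ContDiff ℝ ∞ g ∧ ∀ x y, f (x, y) = x * g (x, y) := by
  have hf' : ContDiff ℝ ∞ fun p : ℝ × ℝ => f (p.2, p.1) := hf.comp (by fun_prop)
  refine ⟨fun p => hadQ (fun p : ℝ × ℝ => f (p.2, p.1)) (p.2, p.1),
    (contDiff_hadQ hf').comp (by fun_prop : ContDiff ℝ ∞ fun p : ℝ × ℝ => (p.2, p.1)), fun x y => ?_⟩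
  have := eq_add_mul_hadQ hf' y x
  simp only [h0, zero_add] at this
  exact this

theorem fderiv_apply_eq {f : ℝ × ℝ → ℝ} {p : ℝ × ℝ} {f₁ f₂ : ℝ} (hf : DifferentiableAt ℝ f p)
    (h1 : HasDerivAt (fun x => f (x, p.2)) f₁ p.1) (h2 : HasDerivAt (fun y => f (p.1, y)) f₂ p.2)
    (z : ℝ × ℝ) : fderiv ℝ f p z = f₁ * z.1 + f₂ * z.2 := by
  have a : HasDerivAt (fun x => f (x, p.2)) (fderiv ℝ f p (1, 0)) p.1 :=
    HasFDerivAt.comp_hasDerivAt (f := fun x : ℝ => (x, p.2)) p.1 hf.hasFDerivAt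
      ((hasDerivAt_id p.1).prodMk (hasDerivAt_const p.1 p.2))
  have b : HasDerivAt (fun y => f (p.1, y)) (fderiv ℝ f p (0, 1)) p.2 :=
    HasFDerivAt.comp_hasDerivAt (f := fun y : ℝ => (p.1, y)) p.2 hf.hasFDerivAt
      ((hasDerivAt_const p.2 p.1).prodMk (hasDerivAt_id p.2))
  rw [h1.unique a, h2.unique b]
  have : z = z.1 • ((1 : ℝ), (0 : ℝ)) + z.2 • ((0 : ℝ), (1 : ℝ)) := by ext <;> simp
  conv_lhs => rw [this]
  rw [map_add, map_smul, map_smul]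
  simp [mul_comm]

end LocalEstimates

/-- Averaged right-hand sides with Hamiltonian part: `∂_ϱ H = Ω`, `∂_φ H = E - Λ`. -/
structure LockedSystem where
  M : ℕ
  N : ℕ
  L : ℕ
  D : ℕ
  n : ℕ
  Lam : ℕ → ℝ × ℝ → ℝ
  Om : ℕ → ℝ × ℝ → ℝ
  H : ℕ → ℝ × ℝ → ℝ
  E : ℕ → ℝ × ℝ → ℝ
  c₀ : ℝ
  φ₀ : ℝ
  lam : ℝ
  gam : ℝ
  one_le_M : 1 ≤ M
  N_pos : 0 < N
  M_le_D : M ≤ D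
  L_lt : L + 1 ≤ 2 * M
  L_add_M : L + M ≤ N
  n_ge : L + D ≤ n
  c₀_pos : 0 < c₀
  lam_neg : lam < 0
  Lam_smooth : ∀ K, ContDiff ℝ ∞ (Lam K)
  Om_smooth : ∀ K, ContDiff ℝ ∞ (Om K)
  H_smooth : ∀ K, ContDiff ℝ ∞ (H K)
  E_smooth : ∀ K, ContDiff ℝ ∞ (E K)
  Om_zero : ∀ p, Om 0 p = c₀ * p.1
  Lam_zero : ∀ K < L, ∀ p, Lam K p = 0
  E_zero : ∀ K y, E K (0, y) = 0
  E_low : ∀ K < D, ∀ p, E K p = 0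
  H_fderiv : ∀ K p z, fderiv ℝ (H K) p z = Om K p * z.1 + (E K p - Lam K p) * z.2
  Lam_L : ∀ z, fderiv ℝ (Lam L) (0, φ₀) z =
    (if L = 0 then 0 else fderiv ℝ (Lam L) (0, φ₀) (1, 0)) * z.1 + lam * z.2
  E_D : HasDerivAt (fun x => E D (x, φ₀)) gam 0

/-- Take H = ∫₀^ϱ Ω(t,φ) dt - ∫₀^φ Λ(0,t) dt and let E be the defect ∂_φ H + Λ. It vanishes at ϱ =
0, and symmetry of second derivatives gives ∂_ϱ E = ∂_ϱ Λ + ∂_φ Ω. -/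
theorem exists_potentials {Lam Om : ℝ × ℝ → ℝ} (hLam : ContDiff ℝ ∞ Lam) (hOm : ContDiff ℝ ∞ Om) :
    ∃ H E : ℝ × ℝ → ℝ, ContDiff ℝ ∞ H ∧ ContDiff ℝ ∞ E ∧ (∀ y, E (0, y) = 0) ∧
      (∀ p z, fderiv ℝ H p z = Om p * z.1 + (E p - Lam p) * z.2) ∧
      ∀ p : ℝ × ℝ, HasDerivAt (fun x => E (x, p.2))
        (deriv (fun x => Lam (x, p.2)) p.1 + deriv (fun y => Om (p.1, y)) p.2) p.1 := by
  have hOm' : ContDiff ℝ ∞ fun q : ℝ × ℝ => Om (q.2, q.1) := hOm.comp (by fun_prop)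
  have hJ : ContDiff ℝ ∞ fun p : ℝ × ℝ => ∫ t in (0 : ℝ)..p.1, Om (t, p.2) :=
    (contDiff_primitive_param hOm').comp (by fun_prop : ContDiff ℝ ∞ fun p : ℝ × ℝ => (p.2, p.1))
  have hI : ContDiff ℝ ∞ fun p : ℝ × ℝ => ∫ t in (0 : ℝ)..p.2, Lam (0, t) :=
    (contDiff_primitive_param (f := fun q : ℝ × ℝ => Lam (0, q.2)) (hLam.comp (by fun_prop)))
  obtain ⟨I, hIdef⟩ : ∃ I : ℝ × ℝ → ℝ, I = fun p => ∫ t in (0 : ℝ)..p.2, Lam (0, t) := ⟨_, rfl⟩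
  obtain ⟨J, hJdef⟩ : ∃ J : ℝ × ℝ → ℝ, J = fun p => ∫ t in (0 : ℝ)..p.1, Om (t, p.2) := ⟨_, rfl⟩
  rw [← hIdef] at hI
  rw [← hJdef] at hJ
  have dI : ∀ x y, HasDerivAt (fun y => I (x, y)) (Lam (0, y)) y := fun x y => by
    have hc : Continuous fun t : ℝ => Lam (0, t) := hLam.continuous.comp (by fun_prop)
    rw [hIdef]
    exact intervalIntegral.integral_hasDerivAt_right (hc.intervalIntegrable _ _)
      (hc.stronglyMeasurableAtFilter _ _) hc.continuousAt
  have dI' : ∀ x y, HasDerivAt (fun x => I (x, y)) 0 x := fun x y => by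
    rw [hIdef]; exact hasDerivAt_const x (∫ t in (0 : ℝ)..y, Lam (0, t))
  have dJ : ∀ x y, HasDerivAt (fun x => J (x, y)) (Om (x, y)) x := fun x y => by
    have hc : Continuous fun t : ℝ => Om (t, y) := hOm.continuous.comp (by fun_prop)
    rw [hJdef]
    exact intervalIntegral.integral_hasDerivAt_right (hc.intervalIntegrable _ _)
      (hc.stronglyMeasurableAtFilter _ _) hc.continuousAt
  have hJd : ∀ p, DifferentiableAt ℝ J p := fun p => (hJ.differentiable (by simp)).differentiableAt
  have dJy : ∀ x y, HasDerivAt (fun y => J (x, y)) (fderiv ℝ J (x, y) (0, 1)) y := fun x y =>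
    HasFDerivAt.comp_hasDerivAt (f := fun y : ℝ => (x, y)) y (hJd (x, y)).hasFDerivAt
      ((hasDerivAt_const y x).prodMk (hasDerivAt_id y))
  have hE : ContDiff ℝ ∞ fun p : ℝ × ℝ => fderiv ℝ J p (0, 1) + Lam p - Lam (0, p.2) :=
    ((((hJ.fderiv_right (m := ∞) (by simp)).clm_apply contDiff_const)).add hLam).sub
      (hLam.comp (by fun_prop))
  refine ⟨fun p => J p - I p, fun p => fderiv ℝ J p (0, 1) + Lam p - Lam (0, p.2), hJ.sub hI, hE,
    fun y => ?_, fun p z => ?_, fun p => ?_⟩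
  · have h1 : HasDerivAt (fun y => J (0, y)) 0 y := by
      rw [hJdef]; simpa using hasDerivAt_const y (0 : ℝ)
    simp only [(dJy 0 y).unique h1]; simp
  · rw [fderiv_apply_eq ((hJ.sub hI).differentiable (by simp)).differentiableAt
      ((dJ p.1 p.2).sub (dI' p.1 p.2)) ((dJy p.1 p.2).sub (dI p.1 p.2))]
    simp only [Prod.mk.eta]
    ring
  · have hd : DifferentiableAt ℝ (fderiv ℝ J) p :=
      ((hJ.fderiv_right (m := ∞) (by simp)).differentiable (by simp)).differentiableAt
    have h2 : HasDerivAt (fun x => fderiv ℝ J (x, p.2) (0, 1))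
        (fderiv ℝ (fderiv ℝ J) p (1, 0) (0, 1)) p.1 :=
      (HasFDerivAt.comp_hasDerivAt (f := fun x : ℝ => (x, p.2)) p.1 hd.hasFDerivAt
        ((hasDerivAt_id p.1).prodMk (hasDerivAt_const p.1 p.2))).clm_apply
        (hasDerivAt_const p.1 ((0 : ℝ), (1 : ℝ))) |>.congr_deriv (by simp)
    have h3 : HasDerivAt (fun y => fderiv ℝ J (p.1, y) (1, 0))
        (fderiv ℝ (fderiv ℝ J) p (0, 1) (1, 0)) p.2 :=
      (HasFDerivAt.comp_hasDerivAt (f := fun y : ℝ => (p.1, y)) p.2 hd.hasFDerivAt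
        ((hasDerivAt_const p.2 p.1).prodMk (hasDerivAt_id p.2))).clm_apply
        (hasDerivAt_const p.2 ((1 : ℝ), (0 : ℝ))) |>.congr_deriv (by simp)
    have hsym : fderiv ℝ (fderiv ℝ J) p (1, 0) (0, 1) = fderiv ℝ (fderiv ℝ J) p (0, 1) (1, 0) :=
      ((contDiff_infty.1 hJ 2).contDiffAt.isSymmSndFDerivAt (by simp)) (1, 0) (0, 1)
    have h4 : ∀ x y, fderiv ℝ J (x, y) (1, 0) = Om (x, y) := fun x y => by
      rw [fderiv_apply_eq (hJd (x, y)) (dJ x y) (dJy x y)]; simp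
    simp only [h4] at h3
    have h5 : HasDerivAt (fun x => Lam (x, p.2)) (deriv (fun x => Lam (x, p.2)) p.1) p.1 := by
      refine DifferentiableAt.hasDerivAt ?_
      have : ContDiff ℝ ∞ fun x => Lam (x, p.2) := hLam.comp (by fun_prop)
      exact (this.differentiable (by simp)).differentiableAt
    rw [hsym, ← h3.deriv] at h2
    exact ((h2.add h5).sub_const (Lam (0, p.2))).congr_deriv (add_comm _ _)

/-! ### Uniform estimates for displacements from the reference solution -/

namespace LockedSystem

variable (S : LockedSystem)

/-- The function `∂_φ H`. -/
def F (K : ℕ) (p : ℝ × ℝ) : ℝ := S.E K p - S.Lam K p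

theorem F_smooth (K : ℕ) : ContDiff ℝ ∞ (S.F K) := (S.E_smooth K).sub (S.Lam_smooth K)

theorem F_zero {K : ℕ} (hD : K < S.D) (hL : K < S.L) (p : ℝ × ℝ) : S.F K p = 0 := by
  rw [F, S.E_low K hD, S.Lam_zero K hL, sub_zero]

theorem H_differentiable (K : ℕ) : Differentiable ℝ (S.H K) :=
  (S.H_smooth K).differentiable (by simp)

theorem H_hasFDerivAt (K : ℕ) (p : ℝ × ℝ) : HasFDerivAt (S.H K) (fderiv ℝ (S.H K) p) p :=
  (S.H_differentiable K p).hasFDerivAt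

theorem H_deriv_x (K : ℕ) (x y : ℝ) : HasDerivAt (fun x => S.H K (x, y)) (S.Om K (x, y)) x := by
  have := HasFDerivAt.comp_hasDerivAt (f := fun x : ℝ => (x, y)) x (S.H_hasFDerivAt K (x, y))
    ((hasDerivAt_id x).prodMk (hasDerivAt_const x y))
  exact this.congr_deriv (by rw [S.H_fderiv]; simp)

theorem H_deriv_y (K : ℕ) (x y : ℝ) : HasDerivAt (fun y => S.H K (x, y)) (S.F K (x, y)) y := by
  have := HasFDerivAt.comp_hasDerivAt (f := fun y : ℝ => (x, y)) y (S.H_hasFDerivAt K (x, y))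
    ((hasDerivAt_const y x).prodMk (hasDerivAt_id y))
  exact this.congr_deriv (by rw [S.H_fderiv, F]; simp)

/-- Below both L and D the functions E_K and Λ_K vanish, so ∂_φ H_K = 0. Low-order terms therefore
see only z₁, which is smaller than z₂ by the factor s^L. -/
theorem H_indep {K : ℕ} (hD : K < S.D) (hL : K < S.L) (x y y' : ℝ) : S.H K (x, y) = S.H K (x, y') := by
  refine is_const_of_deriv_eq_zero (f := fun y => S.H K (x, y))
    (fun y => (S.H_deriv_y K x y).differentiableAt) (fun y => ?_) y y'
  rw [(S.H_deriv_y K x y).deriv, S.F_zero hD hL]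

theorem Om_indep {K : ℕ} (hD : K < S.D) (hL : K < S.L) (x y y' : ℝ) :
    S.Om K (x, y) = S.Om K (x, y') := by
  refine (S.H_deriv_x K x y).unique ?_
  simp only [S.H_indep hD hL _ y y']
  exact S.H_deriv_x K x y'

/-- K = 0 is explicit. For K > 0, 2K ≤ L < 2M ≤ 2D gives K < L and K < D. -/
theorem Om_indep_of_le {K : ℕ} (hK : 2 * K ≤ S.L) (x y y' : ℝ) : S.Om K (x, y) = S.Om K (x, y') := by
  rcases Nat.eq_zero_or_pos K with rfl | h0
  · rw [S.Om_zero, S.Om_zero]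
  · have := S.L_lt; have := S.M_le_D
    exact S.Om_indep (by omega) (by omega) x y y'

/-- A point `p` near the reference solution with velocity `v`, a displacement `z`, measured with the
weights `s^L` and `1`, and a remainder `ρ`; here `s^2 = e`. -/
structure Cfg (Cb : ℝ) where
  s : ℝ
  W : ℝ
  p : ℝ × ℝ
  z : ℝ × ℝ
  v : ℝ × ℝ
  ρ : ℝ × ℝ
  s_pos : 0 < s
  s_le : s ≤ 1
  Cb_s : Cb * s ≤ 1
  W_nonneg : 0 ≤ W
  W_le : W ≤ 1
  p1 : |p.1| ≤ Cb * s ^ (2 * S.M)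
  p2 : |p.2 - S.φ₀| ≤ Cb * s ^ 2
  z1 : |z.1| ≤ s ^ S.L * W
  z2 : |z.2| ≤ W
  v_le : ‖v‖ ≤ Cb * s ^ (2 * S.N + 2)
  ρ_le : ‖ρ‖ ≤ Cb * s ^ (2 * (S.M + S.n + 1))

variable {S} {Cb : ℝ}

namespace Cfg

theorem Cb_nonneg (c : S.Cfg Cb) : 0 ≤ Cb := by
  have h1 := (abs_nonneg _).trans c.p2
  exact nonneg_of_mul_nonneg_left h1 (pow_pos c.s_pos 2)

theorem sL_le (c : S.Cfg Cb) (m : ℕ) : c.s ^ m ≤ 1 := pow_le_one₀ c.s_pos.le c.s_le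

theorem norm_z_le (c : S.Cfg Cb) : ‖c.z‖ ≤ c.W := by
  refine max_le ?_ c.z2
  have h1 := c.sL_le S.L
  have h2 := c.W_nonneg
  exact c.z1.trans (by nlinarith)

theorem norm_p_sub_le (c : S.Cfg Cb) : ‖c.p - (0, S.φ₀)‖ ≤ Cb * c.s := by
  have hC := c.Cb_nonneg
  have hM := S.one_le_M
  have h : ∀ {k}, 1 ≤ k → c.s ^ k ≤ c.s := fun {k} hk => by
    simpa using pow_le_pow_of_le_one c.s_pos.le c.s_le hk
  refine max_le ?_ ?_
  · simp only [Prod.fst_sub, sub_zero]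
    exact c.p1.trans (mul_le_mul_of_nonneg_left (h (by omega)) hC)
  · simp only [Prod.snd_sub]
    exact c.p2.trans (mul_le_mul_of_nonneg_left (h (by omega)) hC)

theorem norm_pz_sub_le (c : S.Cfg Cb) : ‖c.p + c.z - (0, S.φ₀)‖ ≤ Cb * c.s + c.W := by
  rw [add_sub_right_comm]
  exact (norm_add_le _ _).trans (add_le_add c.norm_p_sub_le c.norm_z_le)

theorem p_mem (c : S.Cfg Cb) : c.p ∈ Metric.closedBall (0, S.φ₀) 2 :=
  mem_closedBall_iff_norm.2 (c.norm_p_sub_le.trans (by linarith [c.Cb_s]))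

theorem pz_mem (c : S.Cfg Cb) : c.p + c.z ∈ Metric.closedBall (0, S.φ₀) 2 :=
  mem_closedBall_iff_norm.2 (c.norm_pz_sub_le.trans (by linarith [c.Cb_s, c.W_le]))

/-- The displacement in the first coordinate only. -/
def fstOnly (c : S.Cfg Cb) : S.Cfg Cb :=
  { c with z := (c.z.1, 0), z2 := by simpa using c.W_nonneg }

/-- The displacement scaled by `t ∈ [0,1]`. -/
def ray (c : S.Cfg Cb) (t : ℝ) (h0 : 0 ≤ t) (h1 : t ≤ 1) : S.Cfg Cb :=
  { c with
    z := t • c.z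
    z1 := by
      simp only [Prod.smul_fst, smul_eq_mul, abs_mul, abs_of_nonneg h0]
      exact (mul_le_of_le_one_left (abs_nonneg _) h1).trans c.z1
    z2 := by
      simp only [Prod.smul_snd, smul_eq_mul, abs_mul, abs_of_nonneg h0]
      exact (mul_le_of_le_one_left (abs_nonneg _) h1).trans c.z2 }

end Cfg

variable (S) (Cb)

/-- Estimates are stated as `=O[⊤]` on the type of configurations, which means one constant for all
of them. This allows the calculus of O-symbols to be used for uniform bounds. -/
theorem isBigO_s {k m : ℕ} (h : k ≤ m) :
    (fun c : S.Cfg Cb => c.s ^ m) =O[⊤] fun c => c.s ^ k := by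
  refine isBigO_top.2 ⟨1, fun c => ?_⟩
  have h0 := c.s_pos
  rw [one_mul, Real.norm_of_nonneg (by positivity), Real.norm_of_nonneg (by positivity)]
  exact pow_le_pow_of_le_one c.s_pos.le c.s_le h

theorem isBigO_z1 : (fun c : S.Cfg Cb => c.z.1) =O[⊤] fun c => c.s ^ S.L * c.W :=
  isBigO_top.2 ⟨1, fun c => by
    rw [one_mul]; exact c.z1.trans (le_abs_self _)⟩

theorem isBigO_z2 : (fun c : S.Cfg Cb => c.z.2) =O[⊤] fun c => c.W :=
  isBigO_top.2 ⟨1, fun c => by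
    rw [one_mul]; exact c.z2.trans (le_abs_self _)⟩

theorem isBigO_W : (fun c : S.Cfg Cb => c.W) =O[⊤] fun _ => (1 : ℝ) :=
  isBigO_top.2 ⟨1, fun c => by
    rw [Real.norm_of_nonneg c.W_nonneg]; simpa using c.W_le⟩

theorem isBigO_x : (fun c : S.Cfg Cb => c.p.1) =O[⊤] fun c => c.s ^ (2 * S.M) :=
  isBigO_top.2 ⟨Cb, fun c => by
    rw [Real.norm_of_nonneg (pow_pos c.s_pos _).le]; exact c.p1⟩

theorem isBigO_x' : (fun c : S.Cfg Cb => c.p.1) =O[⊤] fun c => c.s ^ (S.L + 1) :=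
  (isBigO_x S Cb).trans (isBigO_s S Cb S.L_lt)

/-- `s + W`, the small factor. -/
theorem isBigO_s_sW : (fun c : S.Cfg Cb => c.s) =O[⊤] fun c => c.s + c.W :=
  isBigO_top.2 ⟨1, fun c => by
    have h0 := c.s_pos; have h1 := c.W_nonneg
    rw [one_mul, Real.norm_of_nonneg h0.le, Real.norm_of_nonneg (by positivity)]; linarith⟩

theorem isBigO_W_sW : (fun c : S.Cfg Cb => c.W) =O[⊤] fun c => c.s + c.W :=
  isBigO_top.2 ⟨1, fun c => by
    have h0 := c.s_pos; have h1 := c.W_nonneg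
    rw [one_mul, Real.norm_of_nonneg h1, Real.norm_of_nonneg (by positivity)]; linarith⟩

theorem isBigO_lip {f : ℝ × ℝ → ℝ} (hf : ContDiff ℝ ∞ f) :
    (fun c : S.Cfg Cb => f (c.p + c.z) - f c.p) =O[⊤] fun c => c.W := by
  obtain ⟨C, hC, h⟩ := exists_lipschitz_bound hf (0, S.φ₀) 2
  refine isBigO_top.2 ⟨C, fun c => ?_⟩
  have h1 := h c.p c.p_mem (c.p + c.z) c.pz_mem
  rw [add_sub_cancel_left] at h1
  rw [Real.norm_of_nonneg c.W_nonneg]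
  exact h1.trans (mul_le_mul_of_nonneg_left c.norm_z_le hC)

/-- Only z₁ contributes to the increment, which gains the factor s^L over the plain Lipschitz bound.
-/
theorem isBigO_indep {f : ℝ × ℝ → ℝ} (hf : ContDiff ℝ ∞ f) (hi : ∀ x y y', f (x, y) = f (x, y')) :
    (fun c : S.Cfg Cb => f (c.p + c.z) - f c.p) =O[⊤] fun c => c.s ^ S.L * c.W := by
  obtain ⟨C, hC, h⟩ := exists_lipschitz_bound hf (0, S.φ₀) 2
  refine isBigO_top.2 ⟨C, fun c => ?_⟩
  have h1 := h c.p c.p_mem (c.p + (c.z.1, 0)) c.fstOnly.pz_mem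
  rw [add_sub_cancel_left] at h1
  have h2 : f (c.p + (c.z.1, 0)) = f (c.p + c.z) := hi _ _ _
  rw [h2] at h1
  have h3 : ‖((c.z.1, 0) : ℝ × ℝ)‖ = |c.z.1| := by simp
  rw [h3] at h1
  rw [Real.norm_of_nonneg (mul_nonneg (pow_pos c.s_pos _).le c.W_nonneg)]
  exact h1.trans (mul_le_mul_of_nonneg_left c.z1 hC)

theorem isBigO_second {f : ℝ × ℝ → ℝ} (hf : ContDiff ℝ ∞ f) :
    (fun c : S.Cfg Cb => f (c.p + c.z) - f c.p - fderiv ℝ f c.p c.z) =O[⊤] fun c => c.W * c.W := by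
  obtain ⟨C, hC, h⟩ := exists_linear_bound hf (0, S.φ₀) 2
  refine isBigO_top.2 ⟨C, fun c => ?_⟩
  have h1 := h c.p c.p_mem c.p c.p_mem (c.p + c.z) c.pz_mem c.W (by simpa using c.W_nonneg)
    (by rw [add_sub_cancel_left]; exact c.norm_z_le)
  rw [add_sub_cancel_left] at h1
  have h0 := c.W_nonneg
  rw [Real.norm_of_nonneg (mul_nonneg h0 h0), ← mul_assoc]
  exact h1.trans (mul_le_mul_of_nonneg_left c.norm_z_le (by positivity))

theorem fderiv_snd_eq_zero {f : ℝ × ℝ → ℝ} (hf : ContDiff ℝ ∞ f)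
    (hi : ∀ x y y', f (x, y) = f (x, y')) (p : ℝ × ℝ) (t : ℝ) : fderiv ℝ f p (0, t) = 0 := by
  have hd : DifferentiableAt ℝ f p := (hf.differentiable (by simp)).differentiableAt
  have b : HasDerivAt (fun y => f (p.1, y)) (fderiv ℝ f p (0, 1)) p.2 :=
    HasFDerivAt.comp_hasDerivAt (f := fun y : ℝ => (p.1, y)) p.2 hd.hasFDerivAt
      ((hasDerivAt_const p.2 p.1).prodMk (hasDerivAt_id p.2))
  simp only [fun y => hi p.1 y 0] at b
  have h0 := b.unique (hasDerivAt_const p.2 _)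
  have : ((0 : ℝ), t) = t • ((0 : ℝ), (1 : ℝ)) := by ext <;> simp
  rw [this, map_smul, h0, smul_zero]

theorem isBigO_second_indep {f : ℝ × ℝ → ℝ} (hf : ContDiff ℝ ∞ f)
    (hi : ∀ x y y', f (x, y) = f (x, y')) :
    (fun c : S.Cfg Cb => f (c.p + c.z) - f c.p - fderiv ℝ f c.p c.z) =O[⊤]
      fun c => c.s ^ S.L * c.W * (c.s ^ S.L * c.W) := by
  obtain ⟨C, hC, h⟩ := exists_linear_bound hf (0, S.φ₀) 2
  refine isBigO_top.2 ⟨C, fun c => ?_⟩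
  have h3 : ‖((c.z.1, 0) : ℝ × ℝ)‖ = |c.z.1| := by simp
  have h1 := h c.p c.p_mem c.p c.p_mem (c.p + (c.z.1, 0)) c.fstOnly.pz_mem (c.s ^ S.L * c.W)
    (by simpa using mul_nonneg (pow_pos c.s_pos _).le c.W_nonneg)
    (by rw [add_sub_cancel_left, h3]; exact c.z1)
  rw [add_sub_cancel_left, h3] at h1
  have h2 : f (c.p + (c.z.1, 0)) = f (c.p + c.z) := hi _ _ _
  have h4 : fderiv ℝ f c.p c.z = fderiv ℝ f c.p (c.z.1, 0) := by
    have : c.z = (c.z.1, 0) + (0, c.z.2) := by ext <;> simp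
    conv_lhs => rw [this]
    rw [map_add, fderiv_snd_eq_zero hf hi, add_zero]
  have h0 := mul_nonneg (pow_pos c.s_pos S.L).le c.W_nonneg
  rw [Real.norm_of_nonneg (mul_nonneg h0 h0), ← mul_assoc, h4, ← h2]
  exact h1.trans (mul_le_mul_of_nonneg_left c.z1 (mul_nonneg hC h0))

/-- The differential is frozen at (0,φ₀). Both p and p + z are within a multiple of s + W of that
point, which is the relative error. -/
theorem isBigO_linear {f : ℝ × ℝ → ℝ} (hf : ContDiff ℝ ∞ f) :
    (fun c : S.Cfg Cb => f (c.p + c.z) - f c.p - fderiv ℝ f (0, S.φ₀) c.z) =O[⊤]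
      fun c => (c.s + c.W) * c.W := by
  obtain ⟨C, hC, h⟩ := exists_linear_bound hf (0, S.φ₀) 2
  refine isBigO_top.2 ⟨C * max Cb 1, fun c => ?_⟩
  have hb := c.Cb_nonneg
  have h0 := c.W_nonneg
  have hs := c.s_pos
  have hle : Cb * c.s + c.W ≤ max Cb 1 * (c.s + c.W) := by
    have h1 : Cb * c.s ≤ max Cb 1 * c.s := mul_le_mul_of_nonneg_right (le_max_left _ _) hs.le
    have h2 : 1 * c.W ≤ max Cb 1 * c.W := mul_le_mul_of_nonneg_right (le_max_right _ _) h0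
    linarith
  have h1 := h (0, S.φ₀) (by simp) c.p c.p_mem (c.p + c.z) c.pz_mem (max Cb 1 * (c.s + c.W))
    ((c.norm_p_sub_le.trans (by linarith)).trans hle) (c.norm_pz_sub_le.trans hle)
  rw [add_sub_cancel_left] at h1
  rw [Real.norm_of_nonneg (show 0 ≤ (c.s + c.W) * c.W by positivity)]
  refine h1.trans ((mul_le_mul_of_nonneg_left c.norm_z_le (by positivity)).trans (le_of_eq ?_))
  ring

theorem isBigO_cont {g : ℝ × ℝ → ℝ} (hg : ContDiff ℝ ∞ g) :
    (fun c : S.Cfg Cb => g (c.p + c.z)) =O[⊤] fun _ => (1 : ℝ) := by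
  obtain ⟨C, hC⟩ := (isCompact_closedBall ((0 : ℝ), S.φ₀) 2).exists_bound_of_continuousOn
    hg.continuous.continuousOn
  exact isBigO_top.2 ⟨C, fun c => by simpa using hC _ c.pz_mem⟩

/-- Writing f = ϱ g, the increment is z₁ g(p+z) + p₁ (g(p+z) - g(p)). The second term is small
enough because p₁ = O(s^(2M)) and L < 2M. -/
theorem isBigO_E {f : ℝ × ℝ → ℝ} (hf : ContDiff ℝ ∞ f) (h0 : ∀ y, f (0, y) = 0) :
    (fun c : S.Cfg Cb => f (c.p + c.z) - f c.p) =O[⊤] fun c => c.s ^ S.L * c.W := by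
  obtain ⟨g, hg, hfg⟩ := exists_eq_mul_of_zero hf h0
  have h1 : (fun c : S.Cfg Cb => c.z.1 * g (c.p + c.z)) =O[⊤] fun c => c.s ^ S.L * c.W := by
    simpa using (isBigO_z1 S Cb).mul (isBigO_cont S Cb hg)
  have h2 : (fun c : S.Cfg Cb => c.p.1 * (g (c.p + c.z) - g c.p)) =O[⊤]
      fun c => c.s ^ S.L * c.W :=
    ((isBigO_x' S Cb).trans (isBigO_s S Cb (Nat.le_succ _))).mul (isBigO_lip S Cb hg)
  refine (h1.add h2).congr_left fun c => ?_
  have e1 : f (c.p + c.z) = (c.p.1 + c.z.1) * g (c.p + c.z) := hfg _ _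
  have e2 : f c.p = c.p.1 * g c.p := hfg _ _
  rw [e1, e2]; ring

/-- The increment of `E_D`. -/
theorem isBigO_E_D : (fun c : S.Cfg Cb => S.E S.D (c.p + c.z) - S.E S.D c.p - S.gam * c.z.1) =O[⊤]
    fun c => c.s ^ S.L * ((c.s + c.W) * c.W) := by
  obtain ⟨g, hg, hfg⟩ := exists_eq_mul_of_zero (S.E_smooth S.D) (S.E_zero S.D)
  have hgam : g (0, S.φ₀) = S.gam := by
    have h1 : HasDerivAt (fun x => x * g (x, S.φ₀)) (g (0, S.φ₀)) 0 := by
      have hd : Differentiable ℝ fun x : ℝ => g (x, S.φ₀) :=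
        (hg.comp (by fun_prop : ContDiff ℝ ∞ fun x : ℝ => (x, S.φ₀))).differentiable (by simp)
      exact ((hasDerivAt_id (0 : ℝ)).mul (hd 0).hasDerivAt).congr_deriv (by simp)
    simp only [← hfg] at h1
    exact h1.unique S.E_D
  obtain ⟨C, hC, h⟩ := exists_lipschitz_bound hg (0, S.φ₀) 2
  have h3 : (fun c : S.Cfg Cb => g (c.p + c.z) - S.gam) =O[⊤] fun c => c.s + c.W := by
    have h4 : (fun c : S.Cfg Cb => g (c.p + c.z) - S.gam) =O[⊤] fun c => Cb * c.s + c.W := by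
      refine isBigO_top.2 ⟨C, fun c => ?_⟩
      have h1 := h (0, S.φ₀) (by simp) _ c.pz_mem
      have hb := c.Cb_nonneg
      have h0 := c.W_nonneg
      have hs := c.s_pos
      rw [hgam] at h1
      rw [Real.norm_of_nonneg (show 0 ≤ Cb * c.s + c.W by positivity)]
      exact h1.trans (mul_le_mul_of_nonneg_left c.norm_pz_sub_le hC)
    exact h4.trans (((isBigO_s_sW S Cb).const_mul_left Cb).add (isBigO_W_sW S Cb))
  have h1 : (fun c : S.Cfg Cb => c.z.1 * (g (c.p + c.z) - S.gam)) =O[⊤]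
      fun c => c.s ^ S.L * ((c.s + c.W) * c.W) :=
    ((isBigO_z1 S Cb).mul h3).congr_right fun c => by ring
  have h2 : (fun c : S.Cfg Cb => c.p.1 * (g (c.p + c.z) - g c.p)) =O[⊤]
      fun c => c.s ^ S.L * ((c.s + c.W) * c.W) := by
    have h5 := ((isBigO_x' S Cb).mul (isBigO_lip S Cb hg))
    have h6 : (fun c : S.Cfg Cb => c.s ^ (S.L + 1) * c.W) =O[⊤]
        fun c => c.s ^ S.L * ((c.s + c.W) * c.W) :=
      ((isBigO_refl (fun c : S.Cfg Cb => c.s ^ S.L) ⊤).mul ((isBigO_s_sW S Cb).mul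
        (isBigO_refl (fun c : S.Cfg Cb => c.W) ⊤))).congr_left fun c => by ring
    exact h5.trans h6
  refine (h1.add h2).congr_left fun c => ?_
  have e1 : S.E S.D (c.p + c.z) = (c.p.1 + c.z.1) * g (c.p + c.z) := hfg _ _
  have e2 : S.E S.D c.p = c.p.1 * g c.p := hfg _ _
  rw [e1, e2]; ring

end LockedSystem

theorem isBigO_sum_single {α : Type} {l : Filter α} {f : ℕ → α → ℝ} {v B : α → ℝ} {j m : ℕ}
    (hj : j < m) (h : ∀ K, K ≠ j → f K =O[l] B) (h' : (fun c => f j c - v c) =O[l] B) :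
    (fun c => ∑ K ∈ Finset.range m, f K c - v c) =O[l] B := by
  have h1 : (fun c => ∑ K ∈ Finset.range m, (f K c - if K = j then v c else 0)) =O[l] B := by
    refine IsBigO.fun_sum fun K _ => ?_
    by_cases hK : K = j
    · subst hK; simpa using h'
    · simpa [hK] using h K hK
  refine h1.congr_left fun c => ?_
  rw [Finset.sum_sub_distrib, Finset.sum_ite_eq', if_pos (Finset.mem_range.2 hj)]

/-! ### Increments of the averaged right-hand sides -/

namespace LockedSystem

variable {S : LockedSystem} {Cb : ℝ}

namespace Cfg

/-- The increment of `∂_ϱ H`. -/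
def a (c : S.Cfg Cb) : ℝ :=
  ∑ K ∈ Finset.range (S.n + 1), c.s ^ (2 * K) * (S.Om K (c.p + c.z) - S.Om K c.p)

/-- The increment of `∂_φ H`. -/
def b (c : S.Cfg Cb) : ℝ :=
  ∑ K ∈ Finset.range (S.n + 1), c.s ^ (2 * K) * (S.F K (c.p + c.z) - S.F K c.p)

/-- The increment of `E`. -/
def dE (c : S.Cfg Cb) : ℝ :=
  ∑ K ∈ Finset.range (S.n + 1), c.s ^ (2 * K) * (S.E K (c.p + c.z) - S.E K c.p)

/-- The second order remainder of `H_K`. -/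
noncomputable def VK (c : S.Cfg Cb) (K : ℕ) : ℝ :=
  S.H K (c.p + c.z) - S.H K c.p - fderiv ℝ (S.H K) c.p c.z

/-- The second-order remainder of the truncated Hamiltonian ∑ e^K H_K, with e = s². -/
noncomputable def V (c : S.Cfg Cb) : ℝ := ∑ K ∈ Finset.range (S.n + 1), c.s ^ (2 * K) * c.VK K

/-- This arises from differentiating the weights e^(K-L), whose logarithmic rate is (L - K) e^N / N.
The term K = L drops out. -/
noncomputable def T (c : S.Cfg Cb) : ℝ :=
  ∑ K ∈ Finset.range (S.n + 1), c.s ^ (2 * K) * (((S.L : ℝ) - K) * c.VK K)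

/-- The contribution of the motion of the reference solution. -/
noncomputable def SK (c : S.Cfg Cb) (K : ℕ) : ℝ :=
  (S.Om K (c.p + c.z) - S.Om K c.p) * c.v.1 + (S.F K (c.p + c.z) - S.F K c.p) * c.v.2 -
    (fderiv ℝ (S.Om K) c.p c.v * c.z.1 + fderiv ℝ (S.F K) c.p c.v * c.z.2)

noncomputable def shift (c : S.Cfg Cb) : ℝ :=
  ∑ K ∈ Finset.range (S.n + 1), c.s ^ (2 * K) * c.SK K

/-- The size of the errors that are not compensated by the damping. -/
def err (c : S.Cfg Cb) : ℝ := c.s ^ (2 * S.N + 1) + c.s ^ (2 * (S.M + S.D) + 1)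

end Cfg

variable (S Cb)

theorem isBigO_err {k : ℕ} (h : 2 * S.N + 1 ≤ k ∨ 2 * (S.M + S.D) + 1 ≤ k) :
    (fun c : S.Cfg Cb => c.s ^ k) =O[⊤] fun c => c.err := by
  refine isBigO_top.2 ⟨1, fun c => ?_⟩
  have h0 := c.s_pos
  have e : 0 ≤ c.err := by unfold Cfg.err; positivity
  rw [one_mul, Real.norm_of_nonneg (by positivity), Real.norm_of_nonneg e]
  have h1 : 0 < c.s ^ (2 * S.N + 1) := by positivity
  have h2 : 0 < c.s ^ (2 * (S.M + S.D) + 1) := by positivity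
  unfold Cfg.err
  rcases h with h | h
  · linarith [pow_le_pow_of_le_one h0.le c.s_le h]
  · linarith [pow_le_pow_of_le_one h0.le c.s_le h]

theorem isBigO_err' {k m : ℕ} (h : 2 * S.N + 1 + m ≤ k ∨ 2 * (S.M + S.D) + 1 + m ≤ k) :
    (fun c : S.Cfg Cb => c.s ^ k) =O[⊤] fun c => c.s ^ m * c.err := by
  have h1 := (isBigO_refl (fun c : S.Cfg Cb => c.s ^ m) ⊤).mul
    (isBigO_err S Cb (k := k - m) (by omega))
  refine h1.congr_left fun c => ?_
  rw [← pow_add]; congr 1; omega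

theorem isBigO_W1 (k : ℕ) : (fun c : S.Cfg Cb => c.s ^ k * c.W) =O[⊤] fun c => c.s ^ k := by
  simpa using (isBigO_refl (fun c : S.Cfg Cb => c.s ^ k) ⊤).mul (isBigO_W S Cb)

theorem isBigO_sum {f : ℕ → S.Cfg Cb → ℝ} {g B : S.Cfg Cb → ℝ} {K k : ℕ} (hf : f K =O[⊤] g)
    (hk : k ≤ 2 * K) (h : (fun c => c.s ^ k * g c) =O[⊤] B) :
    (fun c => c.s ^ (2 * K) * f K c) =O[⊤] B :=
  ((isBigO_s S Cb hk).mul hf).trans h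

/-- The term K = 0 is exactly c₀ z₁. If 0 < 2K ≤ L then Ω_K does not depend on φ, and its increment
already has the factor s^L; if 2K > L, the prefactor s^(2K) supplies s^(L+1). -/
theorem isBigO_a : (fun c : S.Cfg Cb => c.a - S.c₀ * c.z.1) =O[⊤]
    fun c => c.s ^ (S.L + 1) * c.W := by
  have hM := S.L_lt
  refine isBigO_sum_single (f := fun K (c : S.Cfg Cb) => c.s ^ (2 * K) * (S.Om K (c.p + c.z) - S.Om K c.p))
    (j := 0) (by omega) (fun K hK => ?_) ?_
  · by_cases h : 2 * K ≤ S.L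
    · refine isBigO_sum S Cb (f := fun K (c : S.Cfg Cb) => S.Om K (c.p + c.z) - S.Om K c.p) (k := 1)
        (isBigO_indep S Cb (S.Om_smooth K) (S.Om_indep_of_le h)) (by omega) ?_
      exact (isBigO_refl _ _).congr_left fun c => by ring
    · exact isBigO_sum S Cb (f := fun K (c : S.Cfg Cb) => S.Om K (c.p + c.z) - S.Om K c.p) (k := S.L + 1)
        (isBigO_lip S Cb (S.Om_smooth K)) (by omega) (isBigO_refl _ _)
  · refine (isBigO_zero _ _).congr_left fun c => ?_
    simp only [S.Om_zero, Prod.fst_add]; ring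

theorem isBigO_pow_sW (k : ℕ) : (fun c : S.Cfg Cb => c.s ^ (k + 1) * c.W) =O[⊤]
    fun c => c.s ^ k * ((c.s + c.W) * c.W) :=
  ((isBigO_refl (fun c : S.Cfg Cb => c.s ^ k) ⊤).mul ((isBigO_s_sW S Cb).mul
    (isBigO_refl (fun c : S.Cfg Cb => c.W) ⊤))).congr_left fun c => by ring

theorem isBigO_pow_sW' {k m : ℕ} (h : k + 1 ≤ m) : (fun c : S.Cfg Cb => c.s ^ m * c.W) =O[⊤]
    fun c => c.s ^ k * ((c.s + c.W) * c.W) :=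
  ((isBigO_s S Cb h).mul (isBigO_refl _ _)).trans (isBigO_pow_sW S Cb k)

theorem isBigO_dEK (K : ℕ) : (fun c : S.Cfg Cb => S.E K (c.p + c.z) - S.E K c.p) =O[⊤]
    fun c => c.s ^ S.L * c.W := isBigO_E S Cb (S.E_smooth K) (S.E_zero K)

/-- For K < L only E_K can contribute, and only if K ≥ D; the factors s^(2D) and s^L then suffice
because 2D ≥ 2M > L. At K = L the φ-derivative of Λ_L gives the leading term. The ϱ-derivative is
harmless: z₁ is O(s^L W) if L > 0, and the coefficient is zero if L = 0. -/
theorem isBigO_b : (fun c : S.Cfg Cb => c.b - -(S.lam * c.s ^ (2 * S.L) * c.z.2)) =O[⊤]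
    fun c => c.s ^ (2 * S.L) * ((c.s + c.W) * c.W) := by
  have hM := S.L_lt
  have hMD := S.M_le_D
  have hn := S.n_ge
  refine isBigO_sum_single (f := fun K (c : S.Cfg Cb) => c.s ^ (2 * K) * (S.F K (c.p + c.z) - S.F K c.p))
    (j := S.L) (by omega) (fun K hK => ?_) ?_
  · rcases lt_or_gt_of_ne hK with h | h
    · by_cases hD : K < S.D
      · simp only [S.F_zero hD h, sub_zero, mul_zero]
        exact isBigO_zero _ _
      · simp only [F, S.Lam_zero K h, sub_zero]
        refine isBigO_sum S Cb (f := fun K (c : S.Cfg Cb) => S.E K (c.p + c.z) - S.E K c.p) (k := S.L + 1)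
          (isBigO_dEK S Cb K) (by omega) ?_
        refine (isBigO_pow_sW S Cb (2 * S.L)).congr_left fun c => by ring
    · exact isBigO_sum S Cb (f := fun K (c : S.Cfg Cb) => S.F K (c.p + c.z) - S.F K c.p) (k := 2 * S.L + 1)
        (isBigO_lip S Cb (S.F_smooth K)) (by omega) (isBigO_pow_sW S Cb _)
  · have hW : ∀ {k}, 1 ≤ k → (fun c : S.Cfg Cb => c.s ^ k * c.W) =O[⊤]
        fun c => (c.s + c.W) * c.W := fun {k} hk => by
      simpa using isBigO_pow_sW' S Cb (k := 0) (m := k) (by omega)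
    have h1 : (fun c : S.Cfg Cb => S.E S.L (c.p + c.z) - S.E S.L c.p) =O[⊤]
        fun c => (c.s + c.W) * c.W := by
      by_cases hD : S.L < S.D
      · simp only [S.E_low _ hD, sub_zero]; exact isBigO_zero _ _
      · have := S.one_le_M
        exact (isBigO_dEK S Cb S.L).trans (hW (by omega))
    have h2 : (fun c : S.Cfg Cb => (if S.L = 0 then 0 else fderiv ℝ (S.Lam S.L) (0, S.φ₀) (1, 0)) *
        c.z.1) =O[⊤] fun c => (c.s + c.W) * c.W := by
      by_cases hL : S.L = 0
      · simp only [if_pos hL, zero_mul]; exact isBigO_zero _ _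
      · exact ((isBigO_z1 S Cb).trans (hW (by omega))).const_mul_left _
    have h3 := isBigO_linear S Cb (S.Lam_smooth S.L)
    refine ((isBigO_refl (fun c : S.Cfg Cb => c.s ^ (2 * S.L)) ⊤).mul
      ((h1.sub h3).sub h2)).congr_left fun c => ?_
    rw [S.Lam_L]
    simp only [F]
    ring

/-- The terms below D vanish, and those above D carry an additional s². -/
theorem isBigO_dE : (fun c : S.Cfg Cb => c.dE - S.gam * c.s ^ (2 * S.D) * c.z.1) =O[⊤]
    fun c => c.s ^ (2 * S.D + S.L) * ((c.s + c.W) * c.W) := by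
  have hn := S.n_ge
  refine isBigO_sum_single (f := fun K (c : S.Cfg Cb) => c.s ^ (2 * K) * (S.E K (c.p + c.z) - S.E K c.p))
    (j := S.D) (by omega) (fun K hK => ?_) ?_
  · rcases lt_or_gt_of_ne hK with h | h
    · simp only [S.E_low K h, sub_zero, mul_zero]
      exact isBigO_zero _ _
    · refine isBigO_sum S Cb (f := fun K (c : S.Cfg Cb) => S.E K (c.p + c.z) - S.E K c.p) (k := 2 * S.D + 1)
        (isBigO_dEK S Cb K) (by omega) ?_
      exact (isBigO_pow_sW S Cb (2 * S.D + S.L)).congr_left fun c => by ring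
  · exact ((isBigO_refl (fun c : S.Cfg Cb => c.s ^ (2 * S.D)) ⊤).mul
      (isBigO_E_D S Cb)).congr (fun c => by ring) fun c => by ring

/-- The value of `H_0`, which depends on `ϱ` only, if `L > 0`. -/
theorem VK_zero (hL : 0 < S.L) (c : S.Cfg Cb) : c.VK 0 = S.c₀ * c.z.1 ^ 2 / 2 := by
  have hD : 0 < S.D := lt_of_lt_of_le S.one_le_M S.M_le_D
  have h1 : ∀ x, HasDerivAt (fun x => S.H 0 (x, 0) - S.c₀ * x ^ 2 / 2) 0 x := fun x => by
    have := (S.H_deriv_x 0 x 0).sub (((hasDerivAt_pow 2 x).const_mul S.c₀).div_const 2)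
    exact this.congr_deriv (by simp only [S.Om_zero]; push_cast; ring)
  have h2 := is_const_of_deriv_eq_zero (fun x => (h1 x).differentiableAt) (fun x => (h1 x).deriv)
    (c.p + c.z).1 c.p.1
  have e1 : S.H 0 (c.p + c.z) = S.H 0 ((c.p + c.z).1, 0) := S.H_indep hD hL _ _ _
  have e2 : S.H 0 c.p = S.H 0 (c.p.1, 0) := S.H_indep hD hL _ _ _
  rw [Cfg.VK, e1, e2, S.H_fderiv, S.Om_zero, S.E_low 0 hD, S.Lam_zero 0 hL]
  simp only [Prod.fst_add] at h2 ⊢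
  linear_combination h2

/-- The second order remainder of a function that is constant on `x = 0`. -/
theorem isBigO_second_const {f : ℝ × ℝ → ℝ} (hf : ContDiff ℝ ∞ f) (h0 : ∀ y, f (0, y) = f (0, 0))
    (hL : 1 ≤ S.L) :
    (fun c : S.Cfg Cb => f (c.p + c.z) - f c.p - fderiv ℝ f c.p c.z) =O[⊤] fun c => c.s ^ 1 := by
  obtain ⟨g, hg, hfg⟩ := exists_eq_mul_of_zero (f := fun p => f p - f (0, 0))
    (hf.sub contDiff_const) (fun y => by rw [h0, sub_self])
  have hfg' : ∀ p : ℝ × ℝ, f p = p.1 * g p + f (0, 0) := fun p => by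
    have := hfg p.1 p.2; simp only [Prod.mk.eta] at this; linarith
  have hd : ∀ p z : ℝ × ℝ, fderiv ℝ f p z = z.1 * g p + p.1 * fderiv ℝ g p z := fun p z => by
    have h1 : HasFDerivAt f (p.1 • fderiv ℝ g p + g p • ContinuousLinearMap.fst ℝ ℝ ℝ) p := by
      rw [funext hfg']
      exact (hasFDerivAt_fst.mul (hg.differentiable (by simp) p).hasFDerivAt).add_const _
    rw [h1.fderiv]; simp; ring
  have h1 : (fun c : S.Cfg Cb => c.p.1 * (g (c.p + c.z) - g c.p - fderiv ℝ g c.p c.z)) =O[⊤]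
      fun c => c.s ^ 1 := by
    have h2 := ((isBigO_x' S Cb).trans (isBigO_s S Cb (show 1 ≤ S.L + 1 by omega))).mul
      ((isBigO_second S Cb hg).trans (((isBigO_W S Cb).mul (isBigO_W S Cb))))
    simpa using h2
  have h2 : (fun c : S.Cfg Cb => c.z.1 * (g (c.p + c.z) - g c.p)) =O[⊤] fun c => c.s ^ 1 := by
    have h3 := (((isBigO_z1 S Cb).trans (isBigO_W1 S Cb _)).trans (isBigO_s S Cb hL)).mul
      ((isBigO_lip S Cb hg).trans (isBigO_W S Cb))
    simpa using h3
  refine (h1.add h2).congr_left fun c => ?_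
  rw [hfg' (c.p + c.z), hfg' c.p, hd]
  simp only [Prod.fst_add]
  ring

/-- The term K = 0 is exactly L c₀ z₁²/2 and K = L is absent. For K > L the factor s^(2K) is small
enough. For 0 < K < L and K < D the remainder depends on z₁ alone and is O(s^(2L)). For D ≤ K < L,
H_K is constant on ϱ = 0; its remainder gains one s, and L + M ≤ N supplies the rest. -/
theorem isBigO_T : (fun c : S.Cfg Cb => c.s ^ (2 * S.N) * c.T -
      c.s ^ (2 * S.N) * (S.L * (S.c₀ * c.z.1 ^ 2 / 2))) =O[⊤] fun c => c.s ^ (2 * S.L) * c.err := by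
  have hM := S.one_le_M
  have hLN := S.L_add_M
  have h : (fun c : S.Cfg Cb => ∑ K ∈ Finset.range (S.n + 1), c.s ^ (2 * S.N) *
      (c.s ^ (2 * K) * (((S.L : ℝ) - K) * c.VK K)) -
      c.s ^ (2 * S.N) * (S.L * (S.c₀ * c.z.1 ^ 2 / 2))) =O[⊤] fun c => c.s ^ (2 * S.L) * c.err := by
    refine isBigO_sum_single (j := 0) (by omega) (fun K hK => ?_) ?_
    · have key : ∀ {m : ℕ}, (fun c : S.Cfg Cb => c.VK K) =O[⊤] (fun c => c.s ^ m) →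
          (2 * S.N + 1 + 2 * S.L ≤ 2 * S.N + 2 * K + m ∨
            2 * (S.M + S.D) + 1 + 2 * S.L ≤ 2 * S.N + 2 * K + m) →
          (fun c : S.Cfg Cb => c.s ^ (2 * S.N) * (c.s ^ (2 * K) * (((S.L : ℝ) - K) * c.VK K)))
            =O[⊤] fun c => c.s ^ (2 * S.L) * c.err := fun {m} h1 h2 => by
        have h3 := (isBigO_refl (fun c : S.Cfg Cb => c.s ^ (2 * S.N + 2 * K)) ⊤).mul
          (h1.const_mul_left ((S.L : ℝ) - K))
        refine (h3.congr (fun c => by rw [pow_add]; ring) fun c => (pow_add _ _ _).symm).trans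
          (isBigO_err' S Cb h2)
      rcases lt_trichotomy K S.L with h | h | h
      · by_cases hD : K < S.D
        · refine key (m := 2 * S.L) ?_ (by omega)
          refine (isBigO_second_indep S Cb (S.H_smooth K) (S.H_indep hD h)).trans ?_
          refine ((isBigO_W1 S Cb S.L).mul (isBigO_W1 S Cb S.L)).congr_right fun c => ?_
          rw [two_mul, pow_add]
        · refine key (m := 1) (isBigO_second_const S Cb (S.H_smooth K) (fun y => ?_) (by omega))
            (by omega)
          refine is_const_of_deriv_eq_zero (f := fun y => S.H K (0, y))
            (fun y => (S.H_deriv_y K 0 y).differentiableAt) (fun y => ?_) y 0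
          rw [(S.H_deriv_y K 0 y).deriv, F, S.E_zero, S.Lam_zero K h, sub_zero]
      · subst h
        simp only [sub_self, zero_mul, mul_zero]
        exact isBigO_zero _ _
      · refine key (m := 0) ?_ (by omega)
        exact ((isBigO_second S Cb (S.H_smooth K)).trans
          ((isBigO_W S Cb).mul (isBigO_W S Cb))).congr_right fun c => by simp
    · refine (isBigO_zero _ _).congr_left fun c => ?_
      rcases Nat.eq_zero_or_pos S.L with hL | hL
      · simp [hL]
      · rw [VK_zero S Cb hL]; simp
  refine h.congr_left fun c => ?_
  rw [← Finset.mul_sum]; rfl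

theorem isBigO_v : (fun c : S.Cfg Cb => c.v) =O[⊤] fun c => c.s ^ (2 * S.N + 2) :=
  isBigO_top.2 ⟨Cb, fun c => by
    rw [Real.norm_of_nonneg (pow_pos c.s_pos _).le]; exact c.v_le⟩

theorem isBigO_ρ : (fun c : S.Cfg Cb => c.ρ) =O[⊤] fun c => c.s ^ (2 * (S.M + S.n + 1)) :=
  isBigO_top.2 ⟨Cb, fun c => by
    rw [Real.norm_of_nonneg (pow_pos c.s_pos _).le]; exact c.ρ_le⟩

theorem isBigO_fderiv_v {f : ℝ × ℝ → ℝ} (hf : ContDiff ℝ ∞ f) :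
    (fun c : S.Cfg Cb => fderiv ℝ f c.p c.v) =O[⊤] fun c => c.s ^ (2 * S.N + 2) := by
  obtain ⟨C, hC⟩ := (isCompact_closedBall ((0 : ℝ), S.φ₀) 2).exists_bound_of_continuousOn
    (hf.continuous_fderiv (by simp)).continuousOn
  refine IsBigO.trans ?_ (isBigO_v S Cb)
  exact isBigO_top.2 ⟨C, fun c => (ContinuousLinearMap.le_opNorm _ _).trans
    (mul_le_mul_of_nonneg_right (hC _ c.p_mem) (norm_nonneg _))⟩

/-- The velocity contributes s^(2N+2). For K < L and K < D, where H_K depends on ϱ only, the term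
reduces to v₁ times the second-order remainder of Ω_K, which is O(s^(2L)). Otherwise K ≥ L or K ≥ D,
and the factor s^(2K) suffices. -/
theorem isBigO_shift : (fun c : S.Cfg Cb => c.shift) =O[⊤] fun c => c.s ^ (2 * S.L) * c.err := by
  have hLN := S.L_add_M
  have hz1 : (fun c : S.Cfg Cb => c.z.1) =O[⊤] fun _ => (1 : ℝ) :=
    ((isBigO_z1 S Cb).trans (isBigO_W1 S Cb _)).trans (by simpa using isBigO_s S Cb (Nat.zero_le S.L))
  have hz2 : (fun c : S.Cfg Cb => c.z.2) =O[⊤] fun _ => (1 : ℝ) :=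
    (isBigO_z2 S Cb).trans (isBigO_W S Cb)
  have hv1 : (fun c : S.Cfg Cb => c.v.1) =O[⊤] fun c => c.s ^ (2 * S.N + 2) :=
    isBigO_fst_prod'.trans (isBigO_v S Cb)
  have hv2 : (fun c : S.Cfg Cb => c.v.2) =O[⊤] fun c => c.s ^ (2 * S.N + 2) :=
    isBigO_snd_prod'.trans (isBigO_v S Cb)
  refine IsBigO.fun_sum fun K _ => ?_
  by_cases hK : K < S.L ∧ K < S.D
  · have h1 := (isBigO_second_indep S Cb (S.Om_smooth K) (S.Om_indep hK.2 hK.1)).trans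
      ((isBigO_W1 S Cb S.L).mul (isBigO_W1 S Cb S.L))
    have h2 := ((isBigO_s S Cb (Nat.zero_le (2 * K))).mul (h1.mul hv1)).trans
      (((isBigO_err' S Cb (k := 2 * S.L + (2 * S.N + 2)) (m := 2 * S.L) (by omega))).congr_left
        fun c => show _ = c.s ^ 0 * (c.s ^ S.L * c.s ^ S.L * c.s ^ (2 * S.N + 2)) by
          rw [pow_add, two_mul, pow_add]; ring)
    refine h2.congr_left fun c => ?_
    have hF : ∀ p, S.F K p = 0 := S.F_zero hK.2 hK.1
    have hF' : fderiv ℝ (S.F K) c.p c.v = 0 := by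
      rw [show S.F K = fun _ => 0 from funext hF]; simp
    have hv : fderiv ℝ (S.Om K) c.p c.v = c.v.1 * fderiv ℝ (S.Om K) c.p (1, 0) := by
      have : c.v = c.v.1 • ((1 : ℝ), (0 : ℝ)) + (0, c.v.2) := by ext <;> simp
      conv_lhs => rw [this]
      rw [map_add, fderiv_snd_eq_zero (S.Om_smooth K) (S.Om_indep hK.2 hK.1), map_smul, add_zero,
        smul_eq_mul]
    have hz : fderiv ℝ (S.Om K) c.p c.z = c.z.1 * fderiv ℝ (S.Om K) c.p (1, 0) := by
      have : c.z = c.z.1 • ((1 : ℝ), (0 : ℝ)) + (0, c.z.2) := by ext <;> simp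
      conv_lhs => rw [this]
      rw [map_add, fderiv_snd_eq_zero (S.Om_smooth K) (S.Om_indep hK.2 hK.1), map_smul, add_zero,
        smul_eq_mul]
    rw [Cfg.SK, hF, hF, hF', hv, hz]
    ring
  · have h1 : (fun c : S.Cfg Cb => c.SK K) =O[⊤] fun c => c.s ^ (2 * S.N + 2) := by
      have i1 := ((isBigO_lip S Cb (S.Om_smooth K)).trans (isBigO_W S Cb)).mul hv1
      have i2 := ((isBigO_lip S Cb (S.F_smooth K)).trans (isBigO_W S Cb)).mul hv2
      have i3 := (isBigO_fderiv_v S Cb (S.Om_smooth K)).mul hz1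
      have i4 := (isBigO_fderiv_v S Cb (S.F_smooth K)).mul hz2
      simp only [one_mul, mul_one] at i1 i2 i3 i4
      exact (i1.add i2).sub (i3.add i4)
    have h2 := (isBigO_refl (fun c : S.Cfg Cb => c.s ^ (2 * K)) ⊤).mul h1
    refine (h2.congr_right fun c => (pow_add _ _ _).symm).trans (isBigO_err' S Cb (by omega))

end LockedSystem

/-! ### The energy V and its rate of change -/

namespace LockedSystem

variable {S : LockedSystem} {Cb : ℝ}

namespace Cfg

theorem ray_V_deriv (c : S.Cfg Cb) {t : ℝ} (h0 : 0 ≤ t) (h1 : t ≤ 1) :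
    HasDerivAt (fun t : ℝ => ∑ K ∈ Finset.range (S.n + 1), c.s ^ (2 * K) *
        (S.H K (c.p + t • c.z) - S.H K c.p - fderiv ℝ (S.H K) c.p (t • c.z)))
      ((c.ray t h0 h1).a * c.z.1 + (c.ray t h0 h1).b * c.z.2) t := by
  have hz : HasDerivAt (fun t : ℝ => t • c.z) c.z t := by
    simpa using (hasDerivAt_id t).smul_const c.z
  have h : ∀ K ∈ Finset.range (S.n + 1), HasDerivAt (fun t : ℝ => c.s ^ (2 * K) *
      (S.H K (c.p + t • c.z) - S.H K c.p - fderiv ℝ (S.H K) c.p (t • c.z)))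
      (c.s ^ (2 * K) * ((S.Om K (c.p + t • c.z) - S.Om K c.p) * c.z.1 +
        (S.F K (c.p + t • c.z) - S.F K c.p) * c.z.2)) t := fun K _ => by
    have h1 := HasFDerivAt.comp_hasDerivAt (f := fun t : ℝ => c.p + t • c.z) t
      (S.H_hasFDerivAt K (c.p + t • c.z)) (hz.const_add c.p)
    have h2 := (fderiv ℝ (S.H K) c.p).hasFDerivAt.comp_hasDerivAt (f := fun t : ℝ => t • c.z) t hz
    refine (((h1.sub_const (S.H K c.p)).sub h2).const_mul (c.s ^ (2 * K))).congr_deriv ?_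
    rw [S.H_fderiv, S.H_fderiv]
    simp only [F]
    ring
  refine (HasDerivAt.fun_sum h).congr_deriv ?_
  simp only [a, b, ray, Finset.sum_mul, ← Finset.sum_add_distrib]
  refine Finset.sum_congr rfl fun K _ => by ring

end Cfg

variable (S Cb)

/-- Along the segment t z the derivative of V is a z₁ + b z₂, taken at the scaled displacement.
Integrating the leading parts c₀ t z₁ and -λ s^(2L) t z₂ gives the quadratic form. The errors are
integrated by the mean value inequality. -/
theorem isBigO_V : (fun c : S.Cfg Cb => c.V -
      (S.c₀ * c.z.1 ^ 2 - S.lam * c.s ^ (2 * S.L) * c.z.2 ^ 2) / 2) =O[⊤]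
    fun c => c.s ^ (2 * S.L) * ((c.s + c.W) * c.W ^ 2) := by
  obtain ⟨C₁, hC₁⟩ := isBigO_top.1 (isBigO_a S Cb)
  obtain ⟨C₂, hC₂⟩ := isBigO_top.1 (isBigO_b S Cb)
  refine isBigO_top.2 ⟨|C₁| + |C₂|, fun c => ?_⟩
  have hs := c.s_pos
  have hW := c.W_nonneg
  have hs' : c.s ≤ c.s + c.W := by linarith
  have key := norm_image_sub_le_of_norm_deriv_le_segment_01'
    (f := fun t : ℝ => ∑ K ∈ Finset.range (S.n + 1), c.s ^ (2 * K) *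
        (S.H K (c.p + t • c.z) - S.H K c.p - fderiv ℝ (S.H K) c.p (t • c.z)) -
      t ^ 2 * ((S.c₀ * c.z.1 ^ 2 - S.lam * c.s ^ (2 * S.L) * c.z.2 ^ 2) / 2))
    -- Scaled configurations exist only for t in [0,1]; outside, the value 0 is never used.
    (f' := fun t => if h : 0 ≤ t ∧ t ≤ 1 then ((c.ray t h.1 h.2).a * c.z.1 +
      (c.ray t h.1 h.2).b * c.z.2) -
        t * (S.c₀ * c.z.1 ^ 2 - S.lam * c.s ^ (2 * S.L) * c.z.2 ^ 2) else 0)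
    (C := (|C₁| + |C₂|) * (c.s ^ (2 * S.L) * ((c.s + c.W) * c.W ^ 2)))
    (fun t ht => by
      rw [dif_pos ⟨ht.1, ht.2⟩]
      refine (HasDerivAt.sub (c.ray_V_deriv ht.1 ht.2) (((hasDerivAt_pow 2 t).mul_const
        ((S.c₀ * c.z.1 ^ 2 - S.lam * c.s ^ (2 * S.L) * c.z.2 ^ 2) / 2)).congr_deriv
          ?_)).hasDerivWithinAt
      push_cast; ring)
    (fun t ht => by
      rw [dif_pos ⟨ht.1, ht.2.le⟩]
      have i1 := hC₁ (c.ray t ht.1 ht.2.le)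
      have i2 := hC₂ (c.ray t ht.1 ht.2.le)
      have e1 : (c.ray t ht.1 ht.2.le).z.1 = t * c.z.1 := rfl
      have e2 : (c.ray t ht.1 ht.2.le).z.2 = t * c.z.2 := rfl
      have e3 : (c.ray t ht.1 ht.2.le).s = c.s := rfl
      have e4 : (c.ray t ht.1 ht.2.le).W = c.W := rfl
      rw [e1, e3, e4, Real.norm_of_nonneg (show 0 ≤ c.s ^ (S.L + 1) * c.W by positivity)] at i1
      rw [e2, e3, e4,
        Real.norm_of_nonneg (show 0 ≤ c.s ^ (2 * S.L) * ((c.s + c.W) * c.W) by positivity)] at i2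
      generalize (c.ray t ht.1 ht.2.le).a = A at i1 ⊢
      generalize (c.ray t ht.1 ht.2.le).b = B at i2 ⊢
      have j1 : ‖(A - S.c₀ * (t * c.z.1)) * c.z.1‖ ≤
          |C₁| * (c.s ^ (2 * S.L) * ((c.s + c.W) * c.W ^ 2)) := by
        rw [norm_mul]
        calc _ ≤ (|C₁| * (c.s ^ (S.L + 1) * c.W)) * (c.s ^ S.L * c.W) :=
              mul_le_mul (i1.trans (mul_le_mul_of_nonneg_right (le_abs_self _) (by positivity)))
                c.z1 (abs_nonneg _) (by positivity)
          _ = |C₁| * (c.s ^ (2 * S.L) * (c.s * c.W ^ 2)) := by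
              rw [two_mul, pow_add, pow_succ]; ring
          _ ≤ _ := by gcongr
      have j2 : ‖(B - -(S.lam * c.s ^ (2 * S.L) * (t * c.z.2))) * c.z.2‖ ≤
          |C₂| * (c.s ^ (2 * S.L) * ((c.s + c.W) * c.W ^ 2)) := by
        rw [norm_mul]
        calc _ ≤ (|C₂| * (c.s ^ (2 * S.L) * ((c.s + c.W) * c.W))) * c.W :=
              mul_le_mul (i2.trans (mul_le_mul_of_nonneg_right (le_abs_self _) (by positivity)))
                c.z2 (abs_nonneg _) (by positivity)
          _ = _ := by ring
      have e : A * c.z.1 + B * c.z.2 -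
          t * (S.c₀ * c.z.1 ^ 2 - S.lam * c.s ^ (2 * S.L) * c.z.2 ^ 2) =
          (A - S.c₀ * (t * c.z.1)) * c.z.1 +
            (B - -(S.lam * c.s ^ (2 * S.L) * (t * c.z.2))) * c.z.2 := by ring
      rw [e]
      exact (norm_add_le _ _).trans ((add_le_add j1 j2).trans (le_of_eq (by ring))))
  rw [Real.norm_of_nonneg (show 0 ≤ c.s ^ (2 * S.L) * ((c.s + c.W) * c.W ^ 2) by positivity)]
  refine le_trans (le_of_eq ?_) key
  congr 1
  simp [Cfg.V, Cfg.VK]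

end LockedSystem

namespace LockedSystem.Cfg

variable {S : LockedSystem} {Cb : ℝ}

/-- The velocity of the displacement. -/
def zdot (c : S.Cfg Cb) : ℝ × ℝ :=
  (c.s ^ (2 * S.M) * (c.dE - c.b) + c.ρ.1, c.s ^ (2 * S.M) * c.a + c.ρ.2)

/-- The derivative of `s^(-2L) (V + κ s^(2D) z₁ z₂)`, without the factor `s^(-2L)`. -/
noncomputable def bracket (c : S.Cfg Cb) (κ : ℝ) : ℝ :=
  c.a * c.zdot.1 + c.b * c.zdot.2 + c.shift + c.s ^ (2 * S.N) * c.T / S.N +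
    κ * (c.s ^ (2 * S.D) * (c.zdot.1 * c.z.2 + c.z.1 * c.zdot.2) +
      ((S.L : ℝ) - S.D) / S.N * c.s ^ (2 * S.N) * c.s ^ (2 * S.D) * (c.z.1 * c.z.2))

end LockedSystem.Cfg

namespace LockedSystem

variable (S : LockedSystem) (Cb : ℝ)

/-- The Hamiltonian part cancels in a (dE - b) + b a = a dE, which leaves γ c₀ z₁². The cross term
adds κ (a z₁ - b z₂), that is, κ (c₀ z₁² + λ s^(2L) z₂²), at the same order s^(2(M+D)). Everything
else is either cubic or of relative size s. -/
theorem isBigO_bracket (κ : ℝ) : (fun c : S.Cfg Cb => c.bracket κ -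
      (c.s ^ (2 * (S.M + S.D)) * ((S.gam + κ) * (S.c₀ * c.z.1 ^ 2) +
          κ * (S.lam * c.s ^ (2 * S.L) * c.z.2 ^ 2)) +
        c.s ^ (2 * S.N) * (S.L * (S.c₀ * c.z.1 ^ 2 / 2)) / S.N)) =O[⊤]
    fun c => c.s ^ (2 * S.L) * (c.s ^ (2 * (S.M + S.D)) * ((c.s + c.W) * c.W ^ 2) + c.err) := by
  have hLM := S.L_lt
  have hMD := S.M_le_D
  have hn := S.n_ge
  have herr0 : ∀ c : S.Cfg Cb, 0 ≤ c.err := fun c => by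
    have := c.s_pos; unfold Cfg.err; positivity
  have toA : (fun c : S.Cfg Cb => c.s ^ (2 * S.L) * (c.s ^ (2 * (S.M + S.D)) *
      ((c.s + c.W) * c.W ^ 2))) =O[⊤]
      fun c => c.s ^ (2 * S.L) * (c.s ^ (2 * (S.M + S.D)) * ((c.s + c.W) * c.W ^ 2) + c.err) :=
    isBigO_top.2 ⟨1, fun c => by
      have h1 := c.s_pos; have h2 := c.W_nonneg; have h3 := herr0 c
      rw [one_mul, Real.norm_of_nonneg (by positivity), Real.norm_of_nonneg (by positivity)]
      gcongr; linarith⟩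
  have toE : (fun c : S.Cfg Cb => c.s ^ (2 * S.L) * c.err) =O[⊤]
      fun c => c.s ^ (2 * S.L) * (c.s ^ (2 * (S.M + S.D)) * ((c.s + c.W) * c.W ^ 2) + c.err) :=
    isBigO_top.2 ⟨1, fun c => by
      have h1 := c.s_pos; have h2 := c.W_nonneg; have h3 := herr0 c
      rw [one_mul, Real.norm_of_nonneg (by positivity), Real.norm_of_nonneg (by positivity)]
      gcongr
      have : 0 ≤ c.s ^ (2 * (S.M + S.D)) * ((c.s + c.W) * c.W ^ 2) := by positivity
      linarith⟩
  have hs1 : ∀ k, (fun c : S.Cfg Cb => c.s ^ k * c.W) =O[⊤] fun c => c.s ^ k := isBigO_W1 S Cb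
  have ha : (fun c : S.Cfg Cb => c.a) =O[⊤] fun c => c.s ^ S.L * c.W := by
    have h1 := ((isBigO_a S Cb).trans ((isBigO_s S Cb (Nat.le_succ S.L)).mul
      (isBigO_refl _ _))).add ((isBigO_z1 S Cb).const_mul_left S.c₀)
    exact h1.congr_left fun c => by ring
  have hb : (fun c : S.Cfg Cb => c.b) =O[⊤] fun c => c.s ^ (2 * S.L) * c.W := by
    have h0 : (fun c : S.Cfg Cb => c.s ^ (2 * S.L) * ((c.s + c.W) * c.W)) =O[⊤]
        fun c => c.s ^ (2 * S.L) * c.W := by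
      refine isBigO_top.2 ⟨2, fun c => ?_⟩
      have h1 := c.s_pos; have h2 := c.W_nonneg
      rw [Real.norm_of_nonneg (by positivity), Real.norm_of_nonneg (by positivity)]
      have h3 : c.s + c.W ≤ 2 := by linarith [c.s_le, c.W_le]
      calc _ ≤ c.s ^ (2 * S.L) * (2 * c.W) := by gcongr
        _ = _ := by ring
    have h1 := ((isBigO_b S Cb).trans h0).sub (((isBigO_refl (fun c : S.Cfg Cb =>
      c.s ^ (2 * S.L)) ⊤).mul (isBigO_z2 S Cb)).const_mul_left S.lam)
    exact h1.congr_left fun c => by ring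
  have hdE : (fun c : S.Cfg Cb => c.dE) =O[⊤] fun c => c.s ^ (2 * S.D + S.L) * c.W := by
    have h0 : (fun c : S.Cfg Cb => c.s ^ (2 * S.D + S.L) * ((c.s + c.W) * c.W)) =O[⊤]
        fun c => c.s ^ (2 * S.D + S.L) * c.W := by
      refine isBigO_top.2 ⟨2, fun c => ?_⟩
      have h1 := c.s_pos; have h2 := c.W_nonneg
      rw [Real.norm_of_nonneg (by positivity), Real.norm_of_nonneg (by positivity)]
      have h3 : c.s + c.W ≤ 2 := by linarith [c.s_le, c.W_le]
      calc _ ≤ c.s ^ (2 * S.D + S.L) * (2 * c.W) := by gcongr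
        _ = _ := by ring
    have h1 := ((isBigO_dE S Cb).trans h0).add ((((isBigO_refl (fun c : S.Cfg Cb =>
      c.s ^ (2 * S.D)) ⊤).mul (isBigO_z1 S Cb)).const_mul_left S.gam).congr_right
        (g₂ := fun c => c.s ^ (2 * S.D + S.L) * c.W) fun c => by ring)
    exact h1.congr_left fun c => by ring
  have hρ1 : (fun c : S.Cfg Cb => c.ρ.1) =O[⊤] fun c => c.s ^ (2 * (S.M + S.n + 1)) :=
    isBigO_fst_prod'.trans (isBigO_ρ S Cb)
  have hρ2 : (fun c : S.Cfg Cb => c.ρ.2) =O[⊤] fun c => c.s ^ (2 * (S.M + S.n + 1)) :=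
    isBigO_snd_prod'.trans (isBigO_ρ S Cb)
  have hz1 : (fun c : S.Cfg Cb => c.z.1) =O[⊤] fun c => c.s ^ 0 :=
    ((isBigO_z1 S Cb).trans (hs1 _)).trans (isBigO_s S Cb (Nat.zero_le _))
  have hz2 : (fun c : S.Cfg Cb => c.z.2) =O[⊤] fun c => c.s ^ 0 :=
    ((isBigO_z2 S Cb).trans (isBigO_W S Cb)).congr_right fun c => by simp
  have ha0 : (fun c : S.Cfg Cb => c.a) =O[⊤] fun c => c.s ^ 0 :=
    (ha.trans (hs1 _)).trans (isBigO_s S Cb (Nat.zero_le _))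
  have hb0 : (fun c : S.Cfg Cb => c.b) =O[⊤] fun c => c.s ^ 0 :=
    (hb.trans (hs1 _)).trans (isBigO_s S Cb (Nat.zero_le _))
  -- This is where n ≥ L + D is needed: s^(2(M+n+1)) is at most s^(2L) s^(2(M+D)+1).
  have E1 : (fun c : S.Cfg Cb => c.s ^ 0 * c.s ^ (2 * (S.M + S.n + 1))) =O[⊤]
      fun c => c.s ^ (2 * S.L) * c.err :=
    (isBigO_err' S Cb (k := 2 * (S.M + S.n + 1)) (m := 2 * S.L) (by omega)).congr_left
      fun c => by simp
  have hsD : (fun c : S.Cfg Cb => c.s ^ (2 * S.D)) =O[⊤] fun _ => (1 : ℝ) := by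
    simpa using isBigO_s S Cb (Nat.zero_le (2 * S.D))
  -- `r1` to `r4` treat the remainder ρ, `r5` the motion of the reference solution, `r6` the weights
  -- of V and `r7` the weight of the cross term.
  have r1 := ((ha0.mul hρ1).trans E1).trans toE
  have r2 := ((hb0.mul hρ2).trans E1).trans toE
  have r3 := (((hsD.mul (hz2.mul hρ1)).trans (by simpa only [one_mul, pow_zero] using E1)).trans
    toE).const_mul_left κ
  have r4 := (((hsD.mul (hz1.mul hρ2)).trans (by simpa only [one_mul, pow_zero] using E1)).trans
    toE).const_mul_left κ
  have r5 := (isBigO_shift S Cb).trans toE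
  have r6 := ((isBigO_T S Cb).trans toE).const_mul_left (1 / (S.N : ℝ))
  have r7 : (fun c : S.Cfg Cb => κ * (((S.L : ℝ) - S.D) / S.N) *
      (c.s ^ (2 * S.N + 2 * S.D) * (c.z.1 * c.z.2))) =O[⊤]
      fun c => c.s ^ (2 * S.L) * (c.s ^ (2 * (S.M + S.D)) * ((c.s + c.W) * c.W ^ 2) + c.err) := by
    refine (IsBigO.trans ?_ toE).const_mul_left _
    have h1 := (isBigO_refl (fun c : S.Cfg Cb => c.s ^ (2 * S.N + 2 * S.D)) ⊤).mul
      (((isBigO_z1 S Cb).trans (hs1 _)).mul hz2)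
    exact h1.trans ((isBigO_err' S Cb (k := 2 * S.N + 2 * S.D + S.L) (m := 2 * S.L)
      (by omega)).congr_left fun c => by rw [pow_add _ _ S.L]; ring)
  -- `q1` to `q4` replace a, dE and b by their leading parts. `q5` discards κ dE z₂, which is of
  -- higher order because 2D > L.
  have q1 : (fun c : S.Cfg Cb => c.s ^ (2 * S.M) * ((c.a - S.c₀ * c.z.1) * c.dE)) =O[⊤]
      fun c => c.s ^ (2 * S.L) * (c.s ^ (2 * (S.M + S.D)) * ((c.s + c.W) * c.W ^ 2) + c.err) := by
    have h1 := (isBigO_refl (fun c : S.Cfg Cb => c.s ^ (2 * S.M)) ⊤).mul ((isBigO_a S Cb).mul hdE)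
    have h2 := (isBigO_refl (fun c : S.Cfg Cb => c.s ^ (2 * S.L + 2 * (S.M + S.D)) * c.W ^ 2)
      ⊤).mul (isBigO_s_sW S Cb)
    refine (h1.congr_right fun c => ?_).trans ((h2.congr_right fun c => ?_).trans toA)
    · ring
    · ring
  have q2 : (fun c : S.Cfg Cb => c.s ^ (2 * S.M) * (S.c₀ * (c.z.1 *
      (c.dE - S.gam * c.s ^ (2 * S.D) * c.z.1)))) =O[⊤]
      fun c => c.s ^ (2 * S.L) * (c.s ^ (2 * (S.M + S.D)) * ((c.s + c.W) * c.W ^ 2) + c.err) := by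
    have h1 := (isBigO_refl (fun c : S.Cfg Cb => c.s ^ (2 * S.M)) ⊤).mul
      (((isBigO_z1 S Cb).mul (isBigO_dE S Cb)).const_mul_left S.c₀)
    refine (h1.congr_right fun c => ?_).trans toA
    ring
  have q3 : (fun c : S.Cfg Cb => κ * (c.s ^ (2 * S.M + 2 * S.D) * (c.z.1 *
      (c.a - S.c₀ * c.z.1)))) =O[⊤]
      fun c => c.s ^ (2 * S.L) * (c.s ^ (2 * (S.M + S.D)) * ((c.s + c.W) * c.W ^ 2) + c.err) := by
    have h1 := (isBigO_refl (fun c : S.Cfg Cb => c.s ^ (2 * S.M + 2 * S.D)) ⊤).mul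
      ((isBigO_z1 S Cb).mul (isBigO_a S Cb))
    have h2 := (isBigO_refl (fun c : S.Cfg Cb => c.s ^ (2 * S.L + 2 * (S.M + S.D)) * c.W ^ 2)
      ⊤).mul (isBigO_s_sW S Cb)
    refine ((h1.congr_right fun c => ?_).trans
      ((h2.congr_right fun c => ?_).trans toA)).const_mul_left κ
    · ring
    · ring
  have q4 : (fun c : S.Cfg Cb => κ * (c.s ^ (2 * S.M + 2 * S.D) * ((c.b -
      -(S.lam * c.s ^ (2 * S.L) * c.z.2)) * c.z.2))) =O[⊤]
      fun c => c.s ^ (2 * S.L) * (c.s ^ (2 * (S.M + S.D)) * ((c.s + c.W) * c.W ^ 2) + c.err) := by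
    have h1 := (isBigO_refl (fun c : S.Cfg Cb => c.s ^ (2 * S.M + 2 * S.D)) ⊤).mul
      ((isBigO_b S Cb).mul (isBigO_z2 S Cb))
    refine ((h1.congr_right fun c => ?_).trans toA).const_mul_left κ
    ring
  have q5 : (fun c : S.Cfg Cb => κ * (c.s ^ (2 * S.M + 2 * S.D) * (c.dE * c.z.2))) =O[⊤]
      fun c => c.s ^ (2 * S.L) * (c.s ^ (2 * (S.M + S.D)) * ((c.s + c.W) * c.W ^ 2) + c.err) := by
    have h0 := ((isBigO_s S Cb (show 2 * S.L + 1 ≤ 2 * S.D + S.L by omega)).mul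
      (isBigO_refl (fun c : S.Cfg Cb => c.W) ⊤))
    have h1 := (isBigO_refl (fun c : S.Cfg Cb => c.s ^ (2 * S.M + 2 * S.D)) ⊤).mul
      ((hdE.trans h0).mul (isBigO_z2 S Cb))
    have h2 := (isBigO_refl (fun c : S.Cfg Cb => c.s ^ (2 * S.L + 2 * (S.M + S.D)) * c.W ^ 2)
      ⊤).mul (isBigO_s_sW S Cb)
    refine ((h1.congr_right fun c => ?_).trans
      ((h2.congr_right fun c => ?_).trans toA)).const_mul_left κ
    · ring
    · ring
  have hsum := ((((((((((r1.add r2).add r3).add r4).add r5).add r6).add r7).add q1).add q2).add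
    q3).sub q4).add q5
  refine hsum.congr_left fun c => ?_
  simp only [Cfg.bracket, Cfg.zdot]
  have e1 : c.s ^ (2 * (S.M + S.D)) = c.s ^ (2 * S.M) * c.s ^ (2 * S.D) := by rw [mul_add, pow_add]
  rw [e1, pow_add, pow_add]
  ring

end LockedSystem

/-! ### Definiteness of the Lyapunov function and sign of its derivative -/

namespace LockedSystem

variable {S : LockedSystem} {Cb : ℝ}

namespace Cfg

/-- The Lyapunov function, multiplied by `s^(2L)`. -/
noncomputable def lyap (c : S.Cfg Cb) (κ : ℝ) : ℝ :=
  c.V + κ * (c.s ^ (2 * S.D) * (c.z.1 * c.z.2))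

/-- `W` is not larger than the weighted displacement. -/
def Tight (c : S.Cfg Cb) : Prop :=
  c.s ^ (2 * S.L) * c.W ^ 2 ≤ c.z.1 ^ 2 + c.s ^ (2 * S.L) * c.z.2 ^ 2

theorem z1_sq_le (c : S.Cfg Cb) : c.z.1 ^ 2 ≤ c.s ^ (2 * S.L) * c.W ^ 2 := by
  have h0 := c.W_nonneg
  have h1 := c.s_pos
  calc c.z.1 ^ 2 = |c.z.1| ^ 2 := (sq_abs _).symm
    _ ≤ (c.s ^ S.L * c.W) ^ 2 := by gcongr; exact c.z1
    _ = _ := by rw [two_mul, pow_add]; ring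

theorem z2_sq_le (c : S.Cfg Cb) : c.z.2 ^ 2 ≤ c.W ^ 2 := by
  rw [← sq_abs]; have := c.z2; gcongr

theorem abs_z1z2_le (c : S.Cfg Cb) :
    |c.s ^ (2 * S.D) * (c.z.1 * c.z.2)| ≤ c.s ^ (2 * S.L) * (c.s * c.W ^ 2) := by
  have h0 := c.W_nonneg
  have h1 := c.s_pos
  have h2 := S.L_lt
  have h3 := S.M_le_D
  rw [abs_mul, abs_mul, abs_of_nonneg (show 0 ≤ c.s ^ (2 * S.D) by positivity)]
  calc c.s ^ (2 * S.D) * (|c.z.1| * |c.z.2|) ≤ c.s ^ (2 * S.D) * ((c.s ^ S.L * c.W) * c.W) := by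
        gcongr
        · exact c.z1
        · exact c.z2
    _ = c.s ^ (2 * S.D + S.L) * c.W ^ 2 := by rw [pow_add]; ring
    _ ≤ c.s ^ (2 * S.L + 1) * c.W ^ 2 := by
        gcongr ?_ * _
        exact pow_le_pow_of_le_one h1.le c.s_le (by omega)
    _ = _ := by rw [pow_succ]; ring

end Cfg

variable (S Cb)

/-- The quadratic part of V is definite in the weighted norm. The corrections are bounded by
multiples of s + W times the same weight, and w is chosen so that they consume at most half of it.
-/
theorem exists_lyap_bounds (κ : ℝ) : ∃ m m' w : ℝ, 0 < m ∧ 0 < m' ∧ 0 < w ∧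
    ∀ c : S.Cfg Cb, c.s ≤ w → c.W ≤ w → c.Tight →
      m * (c.s ^ (2 * S.L) * c.W ^ 2) ≤ c.lyap κ ∧
        c.lyap κ ≤ m' * (c.s ^ (2 * S.L) * c.W ^ 2) := by
  obtain ⟨C, hC⟩ := isBigO_top.1 (isBigO_V S Cb)
  have hc := S.c₀_pos
  have hl := S.lam_neg
  have hk : 0 < min (S.c₀ / 2) (-S.lam / 2) := lt_min (by linarith) (by linarith)
  have hk1 := min_le_left (S.c₀ / 2) (-S.lam / 2)
  have hk2 := min_le_right (S.c₀ / 2) (-S.lam / 2)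
  generalize min (S.c₀ / 2) (-S.lam / 2) = k at hk hk1 hk2
  have hA : 0 < 2 * |C| + |κ| + 1 := by positivity
  refine ⟨k / 2, (S.c₀ - S.lam) / 2 + k / 2, k / (2 * (2 * |C| + |κ| + 1)), by positivity,
    by linarith, by positivity, fun c hs hW ht => ?_⟩
  have s0 := c.s_pos
  have W0 := c.W_nonneg
  have hV := hC c
  rw [Real.norm_eq_abs, Real.norm_of_nonneg
    (show 0 ≤ c.s ^ (2 * S.L) * ((c.s + c.W) * c.W ^ 2) by positivity)] at hV
  have hw : (2 * |C| + |κ|) * (k / (2 * (2 * |C| + |κ| + 1))) ≤ k / 2 := by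
    rw [mul_div_assoc', div_le_div_iff₀ (by positivity) (by positivity)]
    nlinarith [abs_nonneg C, abs_nonneg κ]
  have hκ : |κ * (c.s ^ (2 * S.D) * (c.z.1 * c.z.2))| ≤
      |κ| * (c.s ^ (2 * S.L) * (c.s * c.W ^ 2)) := by
    rw [abs_mul]; exact mul_le_mul_of_nonneg_left c.abs_z1z2_le (abs_nonneg _)
  have hsmall : |C| * (c.s ^ (2 * S.L) * ((c.s + c.W) * c.W ^ 2)) +
      |κ| * (c.s ^ (2 * S.L) * (c.s * c.W ^ 2)) ≤ k / 2 * (c.s ^ (2 * S.L) * c.W ^ 2) := by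
    have h1 : |C| * (c.s + c.W) + |κ| * c.s ≤ k / 2 := by
      refine le_trans ?_ hw
      nlinarith [abs_nonneg C, abs_nonneg κ]
    have h2 := mul_le_mul_of_nonneg_right h1
      (show 0 ≤ c.s ^ (2 * S.L) * c.W ^ 2 by positivity)
    exact le_trans (le_of_eq (by ring)) h2
  have hV' := hV.trans (mul_le_mul_of_nonneg_right (le_abs_self C) (by positivity))
  have i1 := abs_le.1 hV'
  have i2 := abs_le.1 hκ
  have z1 := c.z1_sq_le
  have z2 := mul_le_mul_of_nonneg_left c.z2_sq_le (show 0 ≤ c.s ^ (2 * S.L) by positivity)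
  have z1' := sq_nonneg c.z.1
  have z2' : 0 ≤ c.s ^ (2 * S.L) * c.z.2 ^ 2 := by positivity
  have ht' : c.s ^ (2 * S.L) * c.W ^ 2 ≤ c.z.1 ^ 2 + c.s ^ (2 * S.L) * c.z.2 ^ 2 := ht
  have e : S.lam * c.s ^ (2 * S.L) * c.z.2 ^ 2 = S.lam * (c.s ^ (2 * S.L) * c.z.2 ^ 2) := by ring
  rw [e] at i1
  unfold Cfg.lyap
  constructor
  · have := mul_le_mul_of_nonneg_left ht' hk.le
    have := mul_le_mul_of_nonneg_right hk1 z1'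
    have := mul_le_mul_of_nonneg_right hk2 z2'
    linarith [i1.1, i2.1]
  · have := mul_le_mul_of_nonneg_left z1 hc.le
    have := mul_le_mul_of_nonneg_left z2 (neg_nonneg.2 hl.le)
    linarith [i1.2, i2.2]

/-- The condition for asymptotic damping. -/
def Damped : Prop :=
  (S.gam < 0 ∧ S.M + S.D < S.N) ∨ (S.gam + (S.L : ℝ) / S.N < 0 ∧ S.M + S.D = S.N) ∨
    (S.gam < 0 ∧ S.L = 0 ∧ S.N < S.M + S.D)

/-- The leading part of the derivative of the Lyapunov function. -/
noncomputable def Cfg.lead {S : LockedSystem} {Cb : ℝ} (c : S.Cfg Cb) (κ : ℝ) : ℝ :=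
  c.s ^ (2 * (S.M + S.D)) * ((S.gam + κ) * (S.c₀ * c.z.1 ^ 2) +
    κ * (S.lam * c.s ^ (2 * S.L) * c.z.2 ^ 2)) +
      c.s ^ (2 * S.N) * (S.L * (S.c₀ * c.z.1 ^ 2 / 2)) / S.N

/-- Cubic errors are beaten by a small w, independent of η. Errors of size s without a factor W² are
beaten by taking s small against η², which is why the sign is claimed only for W ≥ η. -/
theorem exists_lead_le {κ k₁ k₂ C : ℝ} (hk₁ : 0 < k₁) (hk₂ : 0 < k₂) (hND : S.M + S.D ≤ S.N)
    (h : ∀ c : S.Cfg Cb, c.lead κ ≤ c.s ^ (2 * (S.M + S.D)) * (-k₁ * c.z.1 ^ 2 -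
      k₂ * (c.s ^ (2 * S.L) * c.z.2 ^ 2) + C * c.s * (c.s ^ (2 * S.L) * c.W ^ 2))) :
    ∃ w > 0, ∀ η > 0, ∃ s₂ > 0, ∀ c : S.Cfg Cb, c.s ≤ s₂ → c.W ≤ w → c.Tight → η ≤ c.W →
      c.bracket κ ≤ 0 := by
  obtain ⟨B, hB⟩ := isBigO_top.1 (isBigO_bracket S Cb κ)
  have hk : 0 < min k₁ k₂ := lt_min hk₁ hk₂
  have hk1 := min_le_left k₁ k₂
  have hk2 := min_le_right k₁ k₂
  generalize min k₁ k₂ = k at hk hk1 hk2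
  refine ⟨k / (4 * (|B| + 1)), by positivity, fun η hη =>
    ⟨min (k / (4 * (|B| + 1))) (k * η ^ 2 / (4 * (|C| + 2 * |B| + 1))), by positivity,
      fun c hs hW ht hηW => ?_⟩⟩
  have s0 := c.s_pos
  have W0 := c.W_nonneg
  have i1 := hB c
  have hNE : c.err ≤ 2 * (c.s ^ (2 * (S.M + S.D)) * c.s) := by
    have : c.s ^ (2 * S.N + 1) ≤ c.s ^ (2 * (S.M + S.D) + 1) :=
      pow_le_pow_of_le_one s0.le c.s_le (by omega)
    rw [Cfg.err, ← pow_succ]; linarith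
  have he0 : 0 ≤ c.err := by unfold Cfg.err; positivity
  rw [Real.norm_eq_abs, Real.norm_of_nonneg (by positivity)] at i1
  have i2 := (abs_le.1 (i1.trans (mul_le_mul_of_nonneg_right (le_abs_self B) (by positivity)))).2
  have i3 : c.bracket κ ≤ c.lead κ + |B| * (c.s ^ (2 * S.L) * (c.s ^ (2 * (S.M + S.D)) *
      ((c.s + c.W) * c.W ^ 2) + c.err)) := by
    have e : c.lead κ = c.s ^ (2 * (S.M + S.D)) * ((S.gam + κ) * (S.c₀ * c.z.1 ^ 2) +
      κ * (S.lam * c.s ^ (2 * S.L) * c.z.2 ^ 2)) +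
      c.s ^ (2 * S.N) * (S.L * (S.c₀ * c.z.1 ^ 2 / 2)) / S.N := rfl
    linarith
  have hW1 : c.W ^ 2 ≤ 1 := pow_le_one₀ W0 c.W_le
  have ht' : c.s ^ (2 * S.L) * c.W ^ 2 ≤ c.z.1 ^ 2 + c.s ^ (2 * S.L) * c.z.2 ^ 2 := ht
  have i4 : -k₁ * c.z.1 ^ 2 - k₂ * (c.s ^ (2 * S.L) * c.z.2 ^ 2) +
      C * c.s * (c.s ^ (2 * S.L) * c.W ^ 2) ≤
      c.s ^ (2 * S.L) * (-k * c.W ^ 2 + |C| * c.s) := by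
    have j1 := mul_le_mul_of_nonneg_right hk1 (sq_nonneg c.z.1)
    have j2 := mul_le_mul_of_nonneg_right hk2
      (show 0 ≤ c.s ^ (2 * S.L) * c.z.2 ^ 2 by positivity)
    have j3 := mul_le_mul_of_nonneg_left ht' hk.le
    have j4 : C * c.s * (c.s ^ (2 * S.L) * c.W ^ 2) ≤ |C| * c.s * (c.s ^ (2 * S.L) * 1) := by
      gcongr; exact le_abs_self C
    linarith
  have i5 : c.bracket κ ≤ c.s ^ (2 * (S.M + S.D)) * c.s ^ (2 * S.L) *
      (-k * c.W ^ 2 + |C| * c.s + |B| * ((c.s + c.W) * c.W ^ 2 + 2 * c.s)) := by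
    have j1 := (h c).trans (mul_le_mul_of_nonneg_left i4 (by positivity))
    have j2 : |B| * (c.s ^ (2 * S.L) * c.err) ≤
        |B| * (c.s ^ (2 * S.L) * (2 * (c.s ^ (2 * (S.M + S.D)) * c.s))) := by gcongr
    linarith
  refine i5.trans (mul_nonpos_of_nonneg_of_nonpos (by positivity) ?_)
  have b1 : |B| * (k / (4 * (|B| + 1))) ≤ k / 4 := by
    rw [mul_div_assoc', div_le_div_iff₀ (by positivity) (by positivity)]
    nlinarith [abs_nonneg B]
  have b2 : (|C| + 2 * |B|) * (k * η ^ 2 / (4 * (|C| + 2 * |B| + 1))) ≤ k * η ^ 2 / 4 := by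
    rw [mul_div_assoc', div_le_div_iff₀ (by positivity) (by positivity)]
    nlinarith [abs_nonneg B, abs_nonneg C, show 0 ≤ k * η ^ 2 by positivity]
  have b3 : |B| * (c.s + c.W) ≤ k / 2 := by
    have := mul_le_mul_of_nonneg_left (hs.trans (min_le_left _ _)) (abs_nonneg B)
    have := mul_le_mul_of_nonneg_left hW (abs_nonneg B)
    linarith
  have b4 : (|C| + 2 * |B|) * c.s ≤ k * η ^ 2 / 4 :=
    (mul_le_mul_of_nonneg_left (hs.trans (min_le_right _ _)) (by positivity)).trans b2
  have b5 := mul_le_mul_of_nonneg_right b3 (sq_nonneg c.W)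
  have b6 : k * η ^ 2 ≤ k * c.W ^ 2 := by gcongr
  have b7 : 0 ≤ k * c.W ^ 2 := by positivity
  linarith

/-- The choice of κ in the three regimes. In the first two the derivative is nonpositive in the
shell; in the third it is only bounded by an integrable function of τ. -/
theorem exists_bracket_bound (h : S.Damped) : ∃ κ C w : ℝ, 0 ≤ C ∧ 0 < w ∧ ∀ η > 0, ∃ s₂ > 0,
    ∀ c : S.Cfg Cb, c.s ≤ s₂ → c.W ≤ w → c.Tight → η ≤ c.W →
      c.bracket κ ≤ C * (c.s ^ (2 * S.L) * c.s ^ (2 * S.N + 1)) := by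
  have hN : (0 : ℝ) < S.N := by exact_mod_cast S.N_pos
  have hc := S.c₀_pos
  have hl := S.lam_neg
  have fin : ∀ κ, (∃ w > 0, ∀ η > 0, ∃ s₂ > 0, ∀ c : S.Cfg Cb, c.s ≤ s₂ → c.W ≤ w → c.Tight →
      η ≤ c.W → c.bracket κ ≤ 0) → ∃ κ C w : ℝ, 0 ≤ C ∧ 0 < w ∧ ∀ η > 0, ∃ s₂ > 0,
    ∀ c : S.Cfg Cb, c.s ≤ s₂ → c.W ≤ w → c.Tight → η ≤ c.W →
      c.bracket κ ≤ C * (c.s ^ (2 * S.L) * c.s ^ (2 * S.N + 1)) := by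
    rintro κ ⟨w, hw, h⟩
    exact ⟨κ, 0, w, le_rfl, hw, by simpa using h⟩
  rcases h with ⟨h1, h2⟩ | ⟨h1, h2⟩ | ⟨h1, h2, h3⟩
  -- Half of the damping is given to z₂. The contribution of the weights, of order s^(2N) ≤
  -- s^(2(M+D)+1), is absorbed in the error with constant C.
  · refine fin (-S.gam / 2) (exists_lead_le S Cb (k₁ := -(S.gam / 2) * S.c₀)
      (k₂ := S.gam / 2 * S.lam) (C := S.L * S.c₀ / 2 / S.N) (by nlinarith) (by nlinarith)
      h2.le fun c => ?_)
    have s0 := c.s_pos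
    have W0 := c.W_nonneg
    have e1 : c.s ^ (2 * S.N) * (S.L * (S.c₀ * c.z.1 ^ 2 / 2)) / S.N ≤
        (c.s ^ (2 * (S.M + S.D)) * c.s) *
          (S.L * (S.c₀ * (c.s ^ (2 * S.L) * c.W ^ 2) / 2)) / S.N := by
      rw [← pow_succ]
      gcongr ?_ * (_ * (_ * ?_ / _)) / _
      · exact pow_le_pow_of_le_one s0.le c.s_le (by omega)
      · exact c.z1_sq_le
    unfold Cfg.lead
    refine (add_le_add_right e1 _).trans (le_of_eq ?_)
    ring
  -- Both contributions are of the same order, and the effective rate is γ + L/(2N), negative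
  -- because L/(2N) ≤ L/N.
  · have hg : S.gam + (S.L : ℝ) / (2 * S.N) < 0 := by
      have : (S.L : ℝ) / (2 * S.N) ≤ S.L / S.N := by gcongr; linarith
      linarith
    refine fin (-(S.gam + (S.L : ℝ) / (2 * S.N)) / 2) (exists_lead_le S Cb
      (k₁ := -((S.gam + (S.L : ℝ) / (2 * S.N)) / 2) * S.c₀)
      (k₂ := (S.gam + (S.L : ℝ) / (2 * S.N)) / 2 * S.lam) (C := 0)
      (by nlinarith) (by nlinarith) h2.le fun c => le_of_eq ?_)
    rw [Cfg.lead, h2]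
    field_simp
    ring
  -- For L = 0 the weights contribute nothing and the damping term can be dropped by its sign. All
  -- other terms are of order s^(2(M+D)) ≤ s^(2N+1) or part of the error.
  · obtain ⟨B, hB⟩ := isBigO_top.1 (isBigO_bracket S Cb 0)
    refine ⟨0, 4 * |B|, 1, by positivity, one_pos, fun η _ => ⟨1, one_pos, fun c _ _ _ _ => ?_⟩⟩
    have s0 := c.s_pos
    have W0 := c.W_nonneg
    have he0 : 0 ≤ c.err := by unfold Cfg.err; positivity
    have i1 := hB c
    rw [Real.norm_eq_abs, Real.norm_of_nonneg (by positivity)] at i1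
    have i2 := (abs_le.1 (i1.trans (mul_le_mul_of_nonneg_right (le_abs_self B) (by positivity)))).2
    have j1 : c.s ^ (2 * (S.M + S.D)) ≤ c.s ^ (2 * S.N + 1) :=
      pow_le_pow_of_le_one s0.le c.s_le (by omega)
    have j2 : c.s ^ (2 * (S.M + S.D) + 1) ≤ c.s ^ (2 * S.N + 1) :=
      pow_le_pow_of_le_one s0.le c.s_le (by omega)
    have j3 : (c.s + c.W) * c.W ^ 2 ≤ 2 := by
      have : c.W ^ 2 ≤ 1 := pow_le_one₀ W0 c.W_le
      nlinarith [c.s_le, c.W_le]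
    have j4 : c.s ^ (2 * (S.M + S.D)) * ((c.s + c.W) * c.W ^ 2) + c.err ≤
        4 * c.s ^ (2 * S.N + 1) := by
      have : c.s ^ (2 * (S.M + S.D)) * ((c.s + c.W) * c.W ^ 2) ≤ c.s ^ (2 * S.N + 1) * 2 := by
        gcongr
      rw [Cfg.err]; linarith
    have j5 : |B| * (c.s ^ (2 * S.L) * (c.s ^ (2 * (S.M + S.D)) * ((c.s + c.W) * c.W ^ 2) +
        c.err)) ≤ |B| * (c.s ^ (2 * S.L) * (4 * c.s ^ (2 * S.N + 1))) := by gcongr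
    have j6 : c.s ^ (2 * (S.M + S.D)) * ((S.gam + 0) * (S.c₀ * c.z.1 ^ 2) +
        0 * (S.lam * c.s ^ (2 * S.L) * c.z.2 ^ 2)) ≤ 0 := by
      refine mul_nonpos_of_nonneg_of_nonpos (by positivity) ?_
      have : 0 ≤ S.c₀ * c.z.1 ^ 2 := by positivity
      nlinarith
    have j7 : c.s ^ (2 * S.N) * (S.L * (S.c₀ * c.z.1 ^ 2 / 2)) / (S.N : ℝ) = 0 := by
      rw [h2]; simp
    rw [j7] at i2
    linarith

end LockedSystem

/-! ### Evolution of the Lyapunov function along solutions -/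

/-- `τ^(-1/(2N))`. -/
noncomputable def halfRoot (N : ℕ) (τ : ℝ) : ℝ := τ ^ (-(1 / (2 * (N : ℝ))))

theorem halfRoot_pos (N : ℕ) {τ : ℝ} (hτ : 0 < τ) : 0 < halfRoot N τ := Real.rpow_pos_of_pos hτ _

theorem hasDerivAt_halfRoot {N : ℕ} (hN : 0 < N) {τ : ℝ} (hτ : 0 < τ) :
    HasDerivAt (halfRoot N) (-(1 / (2 * (N : ℝ))) * halfRoot N τ ^ (2 * N + 1)) τ := by
  have hN' : (0 : ℝ) < N := by exact_mod_cast hN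
  refine (Real.hasDerivAt_rpow_const (Or.inl hτ.ne')).congr_deriv ?_
  congr 1
  rw [halfRoot, ← Real.rpow_natCast, ← Real.rpow_mul hτ.le]
  congr 1
  push_cast
  field_simp
  ring

theorem hasDerivAt_halfRoot_pow {N : ℕ} (hN : 0 < N) {τ : ℝ} (hτ : 0 < τ) (k : ℕ) :
    HasDerivAt (fun τ => halfRoot N τ ^ (2 * k))
      (-(k / N : ℝ) * halfRoot N τ ^ (2 * N) * halfRoot N τ ^ (2 * k)) τ := by
  have hN' : (0 : ℝ) < N := by exact_mod_cast hN
  refine ((hasDerivAt_halfRoot hN hτ).pow (2 * k)).congr_deriv ?_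
  rcases Nat.eq_zero_or_pos k with rfl | hk
  · simp
  · have e : halfRoot N τ ^ (2 * k) = halfRoot N τ ^ (2 * k - 1) * halfRoot N τ := by
      rw [← pow_succ]; congr 1; omega
    rw [e, pow_succ]
    push_cast
    field_simp

theorem tendsto_halfRoot {N : ℕ} (hN : 0 < N) : Tendsto (halfRoot N) atTop (𝓝 0) :=
  tendsto_rpow_neg_atTop (by have : (0 : ℝ) < N := by exact_mod_cast hN
                             positivity)

namespace LockedSystem

variable (S : LockedSystem) {Cb : ℝ}

/-- The right-hand side of the truncated system. -/
noncomputable def field (τ : ℝ) (p : ℝ × ℝ) : ℝ × ℝ :=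
  (∑ K ∈ Finset.range (S.n + 1), halfRoot S.N τ ^ (2 * (S.M + K)) * S.Lam K p,
    ∑ K ∈ Finset.range (S.n + 1), halfRoot S.N τ ^ (2 * (S.M + K)) * S.Om K p)

/-- The Lyapunov function. -/
noncomputable def lyapAt (κ s : ℝ) (p P : ℝ × ℝ) : ℝ :=
  (∑ K ∈ Finset.range (S.n + 1), s ^ (2 * K) * (S.H K P - S.H K p -
      (S.Om K p * (P.1 - p.1) + S.F K p * (P.2 - p.2))) +
    κ * (s ^ (2 * S.D) * ((P.1 - p.1) * (P.2 - p.2)))) / s ^ (2 * S.L)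

variable {S}

theorem Cfg.lyap_eq (c : S.Cfg Cb) (κ : ℝ) :
    c.lyap κ / c.s ^ (2 * S.L) = S.lyapAt κ c.s c.p (c.p + c.z) := by
  simp only [lyap, lyapAt, V, VK, H_fderiv, F, Prod.fst_add, Prod.snd_add, add_sub_cancel_left]

theorem Cfg.field_add (c : S.Cfg Cb) {τ : ℝ} (hs : c.s = halfRoot S.N τ) :
    S.field τ (c.p + c.z) + c.ρ = S.field τ c.p + c.zdot := by
  ext
  · simp only [field, zdot, Prod.fst_add, ← hs, dE, b, ← Finset.sum_sub_distrib, Finset.mul_sum]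
    rw [← sub_eq_iff_eq_add', add_sub_right_comm, ← Finset.sum_sub_distrib]
    congr 1
    refine Finset.sum_congr rfl fun K _ => ?_
    rw [mul_add, pow_add, F, F]; ring
  · simp only [field, zdot, Prod.snd_add, ← hs, a, Finset.mul_sum]
    rw [← sub_eq_iff_eq_add', add_sub_right_comm, ← Finset.sum_sub_distrib]
    congr 1
    refine Finset.sum_congr rfl fun K _ => ?_
    rw [mul_add, pow_add]; ring

theorem _root_.HasDerivWithinAt.comp_smooth {f : ℝ × ℝ → ℝ} (hf : ContDiff ℝ ∞ f)
    {P : ℝ → ℝ × ℝ} {P' : ℝ × ℝ} {J : Set ℝ} {τ : ℝ} (hP : HasDerivWithinAt P P' J τ) :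
    HasDerivWithinAt (fun τ => f (P τ)) (fderiv ℝ f (P τ) P') J τ :=
  ((hf.differentiable (by simp)) (P τ)).hasFDerivAt.comp_hasDerivWithinAt τ hP

/-- Product rule. The weight e^K contributes -K e^N/N and the division by e^L contributes +L e^N/N;
together they give the term T of the bracket. -/
theorem hasDerivWithinAt_lyapAt {P p : ℝ → ℝ × ℝ} {J : Set ℝ} {τ : ℝ} (c : S.Cfg Cb) (κ : ℝ)
    (hτ : 0 < τ) (hs : c.s = halfRoot S.N τ) (hp : c.p = p τ) (hz : c.z = P τ - p τ)
    (hdp : HasDerivWithinAt p c.v J τ) (hdP : HasDerivWithinAt P (c.v + c.zdot) J τ) :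
    HasDerivWithinAt (fun τ => S.lyapAt κ (halfRoot S.N τ) (p τ) (P τ))
      (c.bracket κ / c.s ^ (2 * S.L)) J τ := by
  have s0 := c.s_pos
  have hN : (0 : ℝ) < S.N := by exact_mod_cast S.N_pos
  have hP : P τ = c.p + c.z := by rw [hp, hz]; abel
  have hsk := fun k => (hasDerivAt_halfRoot_pow S.N_pos hτ k).hasDerivWithinAt (s := J)
  have hdz : HasDerivWithinAt (fun τ => P τ - p τ) c.zdot J τ :=
    (hdP.sub hdp).congr_deriv (by abel)
  have hz1 : HasDerivWithinAt (fun τ => (P τ).1 - (p τ).1) c.zdot.1 J τ :=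
    (hasFDerivAt_fst (𝕜 := ℝ) (E := ℝ) (F := ℝ)).comp_hasDerivWithinAt τ hdz
  have hz2 : HasDerivWithinAt (fun τ => (P τ).2 - (p τ).2) c.zdot.2 J τ :=
    (hasFDerivAt_snd (𝕜 := ℝ) (E := ℝ) (F := ℝ)).comp_hasDerivWithinAt τ hdz
  have hVK : ∀ K, HasDerivWithinAt (fun τ => S.H K (P τ) - S.H K (p τ) -
      (S.Om K (p τ) * ((P τ).1 - (p τ).1) + S.F K (p τ) * ((P τ).2 - (p τ).2)))
      (c.SK K + (S.Om K (c.p + c.z) - S.Om K c.p) * c.zdot.1 +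
        (S.F K (c.p + c.z) - S.F K c.p) * c.zdot.2) J τ := fun K => by
    refine (((hdP.comp_smooth (S.H_smooth K)).sub (hdp.comp_smooth (S.H_smooth K))).sub
      (((hdp.comp_smooth (S.Om_smooth K)).mul hz1).add
        ((hdp.comp_smooth (S.F_smooth K)).mul hz2))).congr_deriv ?_
    rw [H_fderiv, H_fderiv, ← hp, hP, Cfg.SK]
    simp only [F, Prod.fst_add, Prod.snd_add, add_sub_cancel_left]
    ring
  have hsum := HasDerivWithinAt.fun_sum (u := Finset.range (S.n + 1)) fun K _ => (hsk K).mul (hVK K)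
  have hall := (hsum.add ((((hsk S.D).mul (hz1.mul hz2)).const_mul κ))).div (hsk S.L)
    (pow_ne_zero _ (halfRoot_pos _ hτ).ne')
  refine (hall.congr_of_eventuallyEq (Eventually.of_forall fun τ => rfl) rfl).congr_deriv ?_
  simp only [Pi.add_apply, Pi.mul_apply, ← hp, hP, ← hs, Prod.fst_add, Prod.snd_add,
    add_sub_cancel_left]
  have hV : ∀ K, S.H K (c.p + c.z) - S.H K c.p - (S.Om K c.p * c.z.1 + S.F K c.p * c.z.2) =
      c.VK K := fun K => by rw [Cfg.VK, S.H_fderiv, F]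
  simp only [hV]
  have e1 : ∑ K ∈ Finset.range (S.n + 1), (-((K : ℝ) / S.N) * c.s ^ (2 * S.N) * c.s ^ (2 * K) *
      c.VK K + c.s ^ (2 * K) * (c.SK K + (S.Om K (c.p + c.z) - S.Om K c.p) * c.zdot.1 +
        (S.F K (c.p + c.z) - S.F K c.p) * c.zdot.2)) =
      c.a * c.zdot.1 + c.b * c.zdot.2 + c.shift + c.s ^ (2 * S.N) * c.T / S.N -
        S.L / S.N * c.s ^ (2 * S.N) * c.V := by
    simp only [Cfg.a, Cfg.b, Cfg.shift, Cfg.T, Cfg.V, Finset.sum_mul, Finset.mul_sum,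
      Finset.sum_div, ← Finset.sum_add_distrib, ← Finset.sum_sub_distrib]
    refine Finset.sum_congr rfl fun K _ => ?_
    field_simp
    ring
  rw [e1]
  have e2 : ∑ K ∈ Finset.range (S.n + 1), c.s ^ (2 * K) * c.VK K = c.V := rfl
  rw [e2, Cfg.bracket]
  field_simp
  ring

end LockedSystem

/-! ### Stability by a slowly rising barrier -/

theorem exists_first_hit {f : ℝ → ℝ} {a b c x : ℝ} (hf : ContinuousOn f (Icc a b)) (ha : f a < c)
    (hx : x ∈ Icc a b) (hc : c ≤ f x) :
    ∃ y ∈ Icc a b, f y = c ∧ ∀ t ∈ Icc a y, f t ≤ c := by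
  have ivt : ∀ t ∈ Icc a b, c ≤ f t → ∃ t' ∈ Icc a t, f t' = c := fun t ht hct =>
    intermediate_value_Icc ht.1 (hf.mono (Icc_subset_Icc_right ht.2)) ⟨ha.le, hct⟩
  obtain ⟨x', hx', hfx'⟩ := ivt x hx hc
  have hcl : IsClosed (Icc a b ∩ f ⁻¹' {c}) :=
    hf.preimage_isClosed_of_isClosed isClosed_Icc isClosed_singleton
  obtain ⟨y, hy⟩ := (isCompact_Icc.of_isClosed_subset hcl inter_subset_left).exists_isLeast
    ⟨x', ⟨hx'.1, hx'.2.trans hx.2⟩, hfx'⟩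
  refine ⟨y, hy.1.1, hy.1.2, fun t ht => ?_⟩
  by_contra! hlt
  obtain ⟨t', ht', hft'⟩ := ivt t ⟨ht.1, ht.2.trans hy.1.1.2⟩ hlt.le
  have h1 := hy.2 (show t' ∈ _ from ⟨⟨ht'.1, (ht'.2.trans ht.2).trans hy.1.1.2⟩, hft'⟩)
  rw [le_antisymm (ht.2.trans h1) ht'.2, hft'] at hlt
  exact lt_irrefl _ hlt

namespace LockedSystem

variable {S : LockedSystem} {Cb : ℝ}

/-- The weighted size of a displacement. -/
noncomputable def wnorm (S : LockedSystem) (s : ℝ) (z : ℝ × ℝ) : ℝ := max (|z.1| / s ^ S.L) |z.2|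

theorem norm_le_wnorm {s : ℝ} (h0 : 0 < s) (h1 : s ≤ 1) (z : ℝ × ℝ) : ‖z‖ ≤ S.wnorm s z := by
  refine max_le (le_max_of_le_left ?_) (le_max_right _ _)
  rw [le_div_iff₀ (by positivity)]
  exact mul_le_of_le_one_right (norm_nonneg _) (pow_le_one₀ h0.le h1)

theorem wnorm_nonneg (s : ℝ) (z : ℝ × ℝ) : 0 ≤ S.wnorm s z := le_max_of_le_right (abs_nonneg _)

theorem wnorm_tight {s : ℝ} (h0 : 0 < s) (z : ℝ × ℝ) :
    s ^ (2 * S.L) * S.wnorm s z ^ 2 ≤ z.1 ^ 2 + s ^ (2 * S.L) * z.2 ^ 2 := by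
  have e : s ^ (2 * S.L) = (s ^ S.L) ^ 2 := by rw [two_mul, pow_add, sq]
  have h1 : 0 < s ^ S.L := by positivity
  rcases max_choice (|z.1| / s ^ S.L) |z.2| with h | h
  · rw [wnorm, h, e, div_pow, mul_div_cancel₀ _ (by positivity), sq_abs]
    exact le_add_of_nonneg_right (by positivity)
  · rw [wnorm, h, sq_abs]
    exact le_add_of_nonneg_left (sq_nonneg _)

/-- The properties of the reference solution. -/
structure IsReference (S : LockedSystem) (Cb : ℝ) (p : ℝ → ℝ × ℝ) (τ : ℝ) : Prop where
  hasDerivAt : HasDerivAt p (S.field τ (p τ)) τ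
  p1 : |(p τ).1| ≤ Cb * halfRoot S.N τ ^ (2 * S.M)
  p2 : |(p τ).2 - S.φ₀| ≤ Cb * halfRoot S.N τ ^ 2
  v_le : ‖S.field τ (p τ)‖ ≤ Cb * halfRoot S.N τ ^ (2 * S.N + 2)

theorem exists_cfg {p P : ℝ → ℝ × ℝ} {τ : ℝ} {J : Set ℝ} (hτ : 0 < τ)
    (hp : S.IsReference Cb p τ) (h1 : halfRoot S.N τ ≤ 1) (hC : Cb * halfRoot S.N τ ≤ 1)
    {ρ : ℝ × ℝ} (hρ : ‖ρ‖ ≤ Cb * halfRoot S.N τ ^ (2 * (S.M + S.n + 1)))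
    (hP : HasDerivWithinAt P (S.field τ (P τ) + ρ) J τ)
    (hW : S.wnorm (halfRoot S.N τ) (P τ - p τ) ≤ 1) :
    ∃ c : S.Cfg Cb, c.s = halfRoot S.N τ ∧ c.W = S.wnorm (halfRoot S.N τ) (P τ - p τ) ∧
      c.p = p τ ∧ c.z = P τ - p τ ∧ c.Tight ∧ HasDerivWithinAt p c.v J τ ∧
      HasDerivWithinAt P (c.v + c.zdot) J τ := by
  have h0 := halfRoot_pos S.N hτ
  let c : S.Cfg Cb :=
    { s := halfRoot S.N τ
      W := S.wnorm (halfRoot S.N τ) (P τ - p τ)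
      p := p τ
      z := P τ - p τ
      v := S.field τ (p τ)
      ρ := ρ
      s_pos := h0
      s_le := h1
      Cb_s := hC
      W_nonneg := wnorm_nonneg _ _
      W_le := hW
      p1 := hp.p1
      p2 := hp.p2
      z1 := by
        rw [mul_comm, ← div_le_iff₀ (by positivity)]
        exact le_max_left _ _
      z2 := le_max_right _ _
      v_le := hp.v_le
      ρ_le := hρ }
  refine ⟨c, rfl, rfl, rfl, rfl, wnorm_tight h0 _, hp.hasDerivAt.hasDerivWithinAt, ?_⟩
  have e : c.p + c.z = P τ := add_sub_cancel _ _
  have := c.field_add (τ := τ) rfl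
  rw [e] at this
  exact hP.congr_deriv this

/-- A barrier argument up to the first time at which the weighted distance W reaches w. The barrier
lies above m'η², so wherever the Lyapunov function touches it one has W ≥ η; there its derivative is
below that of the barrier. The barrier stays below m w², so W never reaches w. The equation is
required only while the solution is within ε of the reference, which allows its use inside
continuation arguments. -/
theorem stability (hS : S.Damped) {p : ℝ → ℝ × ℝ} {τ₁ : ℝ} (hp : ∀ τ ≥ τ₁, S.IsReference Cb p τ)
    {ε : ℝ} (hε : 0 < ε) : ∃ τ₂, ∀ τs ≥ τ₂, ∃ δ > 0, ∀ (T : ℝ) (P : ℝ → ℝ × ℝ),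
      ContinuousOn P (Icc τs T) →
      (∀ τ ∈ Icc τs T, ‖P τ - p τ‖ ≤ ε → ∃ ρ : ℝ × ℝ,
        ‖ρ‖ ≤ Cb * halfRoot S.N τ ^ (2 * (S.M + S.n + 1)) ∧
        HasDerivWithinAt P (S.field τ (P τ) + ρ) (Icc τs T) τ) →
      ‖P τs - p τs‖ < δ → ∀ τ ∈ Icc τs T, ‖P τ - p τ‖ < ε := by
  obtain ⟨κ, C, w₁, hC, hw₁, hbr⟩ := exists_bracket_bound S Cb hS
  obtain ⟨m, m', w₂, hm, hm', hw₂, hly⟩ := exists_lyap_bounds S Cb κ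
  have hN : (0 : ℝ) < S.N := by exact_mod_cast S.N_pos
  obtain ⟨w, hw, hww₁, hww₂, hw1, hwε⟩ : ∃ w : ℝ, 0 < w ∧ w ≤ w₁ ∧ w ≤ w₂ ∧ w ≤ 1 ∧ w ≤ ε :=
    ⟨min (min w₁ w₂) (min 1 ε), by positivity, (min_le_left _ _).trans (min_le_left _ _),
      (min_le_left _ _).trans (min_le_right _ _), (min_le_right _ _).trans (min_le_left _ _),
      (min_le_right _ _).trans (min_le_right _ _)⟩
  -- Below radius η the Lyapunov function is at most the initial height m w²/4 of the barrier.
  obtain ⟨η, hη, hηw, hηm⟩ : ∃ η : ℝ, 0 < η ∧ η < w ∧ m' * η ^ 2 ≤ m * w ^ 2 / 4 := by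
    have h0 : 0 < min (1 / 2) (m / (4 * m')) := by positivity
    have h1 := min_le_left (1 / 2) (m / (4 * m'))
    have h2 := min_le_right (1 / 2) (m / (4 * m'))
    generalize min (1 / 2) (m / (4 * m')) = x at h0 h1 h2
    refine ⟨w * x, by positivity, by nlinarith, ?_⟩
    rw [le_div_iff₀ (by positivity)] at h2
    have h3 : x ^ 2 ≤ x := by nlinarith
    have h4 : m' * x ^ 2 ≤ m / 4 := by nlinarith
    have h5 := mul_le_mul_of_nonneg_right h4 (sq_nonneg w)
    calc _ = m' * x ^ 2 * w ^ 2 := by ring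
      _ ≤ _ := h5
      _ = _ := by ring
  obtain ⟨s₂, hs₂, hbr⟩ := hbr η hη
  -- The barrier rises at rate A s^(2N+1)/(2N) = (C + 1) s^(2N+1), strictly faster than the bound C
  -- s^(2N+1).
  set A : ℝ := 2 * S.N * (C + 1) with hA
  have hA0 : 0 < A := by positivity
  obtain ⟨τ₃, hτ₃⟩ := eventually_atTop.1 ((tendsto_halfRoot S.N_pos).eventually_lt_const
    (show 0 < min (min s₂ w₂) (min (min 1 (1 / (|Cb| + 1))) (m * w ^ 2 / 4 / A)) by positivity))
  refine ⟨max (max τ₁ τ₃) 1, fun τs hτs => ?_⟩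
  have big : ∀ τ ≥ τs, 0 < τ ∧ S.IsReference Cb p τ ∧ halfRoot S.N τ ≤ s₂ ∧ halfRoot S.N τ ≤ w₂ ∧
      halfRoot S.N τ ≤ 1 ∧ Cb * halfRoot S.N τ ≤ 1 ∧ A * halfRoot S.N τ ≤ m * w ^ 2 / 4 := by
    intro τ hτ
    have h1 : max (max τ₁ τ₃) 1 ≤ τ := hτs.trans hτ
    have h2 : 0 < τ := lt_of_lt_of_le one_pos ((le_max_right _ _).trans h1)
    have h3 := hτ₃ τ (((le_max_right _ _).trans (le_max_left _ _)).trans h1)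
    have h0 := halfRoot_pos S.N h2
    simp only [lt_min_iff] at h3
    refine ⟨h2, hp τ (((le_max_left _ _).trans (le_max_left _ _)).trans h1), h3.1.1.le, h3.1.2.le,
      h3.2.1.1.le, ?_, ?_⟩
    · have h4 := h3.2.1.2
      rw [lt_div_iff₀ (by positivity)] at h4
      nlinarith [le_abs_self Cb]
    · have h4 := h3.2.2
      rw [lt_div_iff₀ hA0] at h4
      linarith
  have hs0 := halfRoot_pos S.N (big τs le_rfl).1
  -- The factor s(τs)^L converts the Euclidean-type bound into W ≤ η at the initial time, so δ
  -- depends on τs.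
  refine ⟨η * halfRoot S.N τs ^ S.L, by positivity, fun T P hPc hP hPs => ?_⟩
  have hWc : ContinuousOn (fun τ => S.wnorm (halfRoot S.N τ) (P τ - p τ)) (Icc τs T) := by
    have hpc : ContinuousOn p (Icc τs T) := fun τ hτ =>
      (big τ hτ.1).2.1.hasDerivAt.continuousAt.continuousWithinAt
    have hsc : ContinuousOn (halfRoot S.N) (Icc τs T) := fun τ hτ =>
      (hasDerivAt_halfRoot S.N_pos (big τ hτ.1).1).continuousAt.continuousWithinAt
    have hz := hPc.sub hpc
    exact (hz.fst.abs.div (hsc.pow _) fun τ hτ =>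
      (pow_pos (halfRoot_pos S.N (big τ hτ.1).1) _).ne').sup hz.snd.abs
  have cfg : ∀ τ ∈ Icc τs T, S.wnorm (halfRoot S.N τ) (P τ - p τ) ≤ w →
      ∃ c : S.Cfg Cb, c.s = halfRoot S.N τ ∧ c.W = S.wnorm (halfRoot S.N τ) (P τ - p τ) ∧
      c.p = p τ ∧ c.z = P τ - p τ ∧ c.Tight ∧ HasDerivWithinAt p c.v (Icc τs T) τ ∧
      HasDerivWithinAt P (c.v + c.zdot) (Icc τs T) τ := by
    intro τ hτ hWτ
    obtain ⟨h1, h2, -, -, h5, h6, -⟩ := big τ hτ.1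
    obtain ⟨ρ, hρ, hd⟩ := hP τ hτ ((norm_le_wnorm (halfRoot_pos S.N h1) h5 _).trans
      (hWτ.trans hwε))
    exact exists_cfg h1 h2 h5 h6 hρ hd (hWτ.trans hw1)
  have hW0 : S.wnorm (halfRoot S.N τs) (P τs - p τs) ≤ η := by
    obtain ⟨h1, -, -, -, h5, -, -⟩ := big τs le_rfl
    have h7 := (norm_fst_le _).trans hPs.le
    have h8 := (norm_snd_le _).trans hPs.le
    refine max_le ?_ (h8.trans ?_)
    · rwa [div_le_iff₀ (by positivity)]
    · exact mul_le_of_le_one_right hη.le (pow_le_one₀ hs0.le h5)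
  suffices h : ∀ τ ∈ Icc τs T, S.wnorm (halfRoot S.N τ) (P τ - p τ) < w from fun τ hτ =>
    (norm_le_wnorm (halfRoot_pos S.N (big τ hτ.1).1) (big τ hτ.1).2.2.2.2.1 _).trans_lt
      ((h τ hτ).trans_le hwε)
  by_contra! hex
  obtain ⟨τe, hτe, hWe⟩ := hex
  obtain ⟨τf, hτf, hWf, hleast⟩ := exists_first_hit hWc (hW0.trans_lt hηw) hτe hWe
  have hlt : τs < τf := by
    refine lt_of_le_of_ne hτf.1 fun h => ?_
    rw [← h] at hWf
    linarith
  have hsub : ∀ τ ∈ Icc τs τf, τ ∈ Icc τs T := fun τ hτ => ⟨hτ.1, hτ.2.trans hτf.2⟩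
  have hf : ∀ τ ∈ Icc τs τf, ∃ c : S.Cfg Cb, c.s = halfRoot S.N τ ∧
      c.W = S.wnorm (halfRoot S.N τ) (P τ - p τ) ∧ c.Tight ∧
      S.lyapAt κ (halfRoot S.N τ) (p τ) (P τ) = c.lyap κ / c.s ^ (2 * S.L) ∧
      HasDerivWithinAt (fun τ => S.lyapAt κ (halfRoot S.N τ) (p τ) (P τ))
        (c.bracket κ / c.s ^ (2 * S.L)) (Icc τs T) τ := by
    intro τ hτ
    obtain ⟨c, h1, h2, h3, h4, h5, h6, h7⟩ := cfg τ (hsub τ hτ) (hleast τ hτ)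
    refine ⟨c, h1, h2, h5, ?_, hasDerivWithinAt_lyapAt c κ (big τ hτ.1).1 h1 h3 h4 h6 h7⟩
    rw [c.lyap_eq, h1, h3, h4, add_sub_cancel]
  have hbd : ∀ τ ∈ Icc τs τf, m * S.wnorm (halfRoot S.N τ) (P τ - p τ) ^ 2 ≤
      S.lyapAt κ (halfRoot S.N τ) (p τ) (P τ) ∧ S.lyapAt κ (halfRoot S.N τ) (p τ) (P τ) ≤
      m' * S.wnorm (halfRoot S.N τ) (P τ - p τ) ^ 2 := by
    intro τ hτ
    obtain ⟨c, h1, h2, h3, h4, -⟩ := hf τ hτ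
    obtain ⟨-, -, -, h5, -⟩ := big τ hτ.1
    have hc := c.s_pos
    obtain ⟨i1, i2⟩ := hly c (h1.le.trans h5) (h2.le.trans ((hleast τ hτ).trans hww₂)) h3
    rw [h4, ← h2]
    constructor
    · rw [le_div_iff₀ (by positivity)]; linarith
    · rw [div_le_iff₀ (by positivity)]; linarith
  have key := image_le_of_deriv_right_lt_deriv_boundary'
    (f := fun τ => S.lyapAt κ (halfRoot S.N τ) (p τ) (P τ))
    (f' := fun τ => derivWithin (fun τ => S.lyapAt κ (halfRoot S.N τ) (p τ) (P τ)) (Ici τ) τ)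
    -- The total rise is at most A s(τs) ≤ m w²/4, because s is positive and decreasing.
    (B := fun τ => m * w ^ 2 / 4 + A * (halfRoot S.N τs - halfRoot S.N τ))
    (B' := fun τ => A * (1 / (2 * (S.N : ℝ)) * halfRoot S.N τ ^ (2 * S.N + 1)))
    (a := τs) (b := τf)
    (fun τ hτ => by
      obtain ⟨c, -, -, -, -, hd⟩ := hf τ hτ
      exact hd.continuousWithinAt.mono (Icc_subset_Icc_right hτf.2))
    (fun τ hτ => by
      obtain ⟨c, -, -, -, -, hd⟩ := hf τ ⟨hτ.1, hτ.2.le⟩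
      have : HasDerivWithinAt (fun τ => S.lyapAt κ (halfRoot S.N τ) (p τ) (P τ)) _ (Ici τ) τ :=
        hd.mono_of_mem_nhdsWithin (mem_of_superset (Icc_mem_nhdsGE (hτ.2.trans_le hτf.2))
          (Icc_subset_Icc_left hτ.1))
      exact this.differentiableWithinAt.hasDerivWithinAt)
    (by
      have := (hbd τs ⟨le_rfl, hlt.le⟩).2
      have h0 : S.wnorm (halfRoot S.N τs) (P τs - p τs) ^ 2 ≤ η ^ 2 := by
        have := wnorm_nonneg (S := S) (halfRoot S.N τs) (P τs - p τs)
        gcongr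
      have h1 := mul_le_mul_of_nonneg_left h0 hm'.le
      simp only [sub_self, mul_zero, add_zero]
      linarith)
    (fun τ hτ => ((((hasDerivAt_halfRoot S.N_pos (big τ hτ.1).1).const_sub _).const_mul
      A).const_add _).continuousAt.continuousWithinAt)
    (fun τ hτ => ((((hasDerivAt_halfRoot S.N_pos (big τ hτ.1).1).const_sub _).const_mul
      A).const_add _).hasDerivWithinAt.congr_deriv (by ring))
    (fun τ hτ heq => by
      have hτ' : τ ∈ Icc τs τf := ⟨hτ.1, hτ.2.le⟩
      obtain ⟨c, h1, h2, h3, h4, hd⟩ := hf τ hτ'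
      obtain ⟨b1, b2, b3, b4, b5, b6, b7⟩ := big τ hτ.1
      have hd' : HasDerivWithinAt (fun τ => S.lyapAt κ (halfRoot S.N τ) (p τ) (P τ)) _ (Ici τ) τ :=
        hd.mono_of_mem_nhdsWithin (mem_of_superset (Icc_mem_nhdsGE (hτ.2.trans_le hτf.2))
          (Icc_subset_Icc_left hτ.1))
      rw [hd'.derivWithin (uniqueDiffOn_Ici τ τ self_mem_Ici)]
      have hσ : halfRoot S.N τ ≤ halfRoot S.N τs :=
        Real.rpow_le_rpow_of_nonpos (big τs le_rfl).1 hτ.1 (by rw [neg_nonpos]; positivity)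
      have hηW : η ≤ c.W := by
        rw [h2]
        refine le_of_sq_le_sq ?_ (wnorm_nonneg _ _)
        have i1 := (hbd τ hτ').2
        have i2 : 0 ≤ A * (halfRoot S.N τs - halfRoot S.N τ) :=
          mul_nonneg hA0.le (sub_nonneg.2 hσ)
        have i3 : m' * η ^ 2 ≤ m' * S.wnorm (halfRoot S.N τ) (P τ - p τ) ^ 2 := by linarith
        exact le_of_mul_le_mul_left i3 hm'
      have i4 := hbr c (h1.le.trans b3) (h2.le.trans ((hleast τ hτ').trans hww₁)) h3 hηW
      have hc := c.s_pos
      have i5 : c.bracket κ / c.s ^ (2 * S.L) ≤ C * halfRoot S.N τ ^ (2 * S.N + 1) := by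
        rw [div_le_iff₀ (by positivity), ← h1]; linarith
      refine i5.trans_lt ?_
      have i6 : A * (1 / (2 * (S.N : ℝ)) * halfRoot S.N τ ^ (2 * S.N + 1)) =
          (C + 1) * halfRoot S.N τ ^ (2 * S.N + 1) := by
        rw [hA]; field_simp
      rw [i6]
      have := pow_pos (halfRoot_pos S.N b1) (2 * S.N + 1)
      linarith)
    (show τf ∈ Icc τs τf from ⟨hlt.le, le_rfl⟩)
  -- At the hitting time the Lyapunov function is at least m w², but the barrier is below m w²/2.
  have h1 := (hbd τf ⟨hlt.le, le_rfl⟩).1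
  rw [hWf] at h1
  have h2 := (big τs le_rfl).2.2.2.2.2.2
  have h3 : 0 < A * halfRoot S.N τf := mul_pos hA0 (halfRoot_pos S.N (big τf hlt.le).1)
  have h4 : 0 < m * w ^ 2 := by positivity
  linarith

end LockedSystem

/-! ### The velocity of the reference solution -/

theorem halfRoot_pow_two_mul_N {N : ℕ} (hN : 0 < N) {τ : ℝ} (hτ : 0 < τ) :
    halfRoot N τ ^ (2 * N) = τ⁻¹ := by
  have hN' : (0 : ℝ) < N := by exact_mod_cast hN
  rw [halfRoot, ← Real.rpow_natCast, ← Real.rpow_mul hτ.le, ← Real.rpow_neg_one]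
  congr 1
  push_cast
  field_simp

/-- Such a function grows at least like c log τ. -/
theorem not_bounded_of_deriv_ge {x u : ℝ → ℝ} {τ₀ c : ℝ} (hx : ∀ τ > τ₀, HasDerivAt x (u τ) τ)
    (hb : x =O[atTop] fun _ => (1 : ℝ)) (hc : 0 < c) (hu : ∀ᶠ τ in atTop, c * τ⁻¹ ≤ u τ) :
    False := by
  obtain ⟨C, hC⟩ := hb.bound
  obtain ⟨τ₁, h1⟩ := eventually_atTop.1 (hu.and (hC.and
    ((eventually_gt_atTop τ₀).and (eventually_gt_atTop (0 : ℝ)))))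
  have hmono : MonotoneOn (fun τ => x τ - c * Real.log τ) (Ici τ₁) := by
    have hd : ∀ τ ≥ τ₁, HasDerivAt (fun τ => x τ - c * Real.log τ) (u τ - c * τ⁻¹) τ :=
      fun τ hτ => (hx τ (h1 τ hτ).2.2.1).sub
        ((Real.hasDerivAt_log (h1 τ hτ).2.2.2.ne').const_mul c)
    refine monotoneOn_of_hasDerivWithinAt_nonneg (convex_Ici _)
      (fun τ hτ => (hd τ hτ).continuousAt.continuousWithinAt)
      (fun τ hτ => (hd τ (interior_subset hτ)).hasDerivWithinAt)
      (fun τ hτ => sub_nonneg.2 (h1 τ (interior_subset hτ)).1)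
  have hlim : Tendsto (fun τ => c * Real.log τ) atTop atTop :=
    Real.tendsto_log_atTop.const_mul_atTop hc
  obtain ⟨τ, h2, h3⟩ := ((hlim.eventually_gt_atTop (C - (x τ₁ - c * Real.log τ₁))).and
    (eventually_ge_atTop τ₁)).exists
  have h4 := hmono (self_mem_Ici (a := τ₁)) h3 h3
  have h5 := (h1 τ h3).2.1
  rw [norm_one, mul_one, Real.norm_eq_abs] at h5
  have h6 := le_abs_self (x τ)
  simp only at h4
  linarith

/-- An asymptotic expansion may not be differentiated, but here the derivative has its own expansion
through the equation. If a_j is its first nonzero coefficient with j ≤ N, the derivative has a fixed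
sign and size at least |a_j| τ^(-1)/2 eventually, which contradicts boundedness. -/
theorem isBigO_deriv_of_bounded {N : ℕ} (hN : 0 < N) {x u : ℝ → ℝ} {τ₀ : ℝ}
    (hx : ∀ τ > τ₀, HasDerivAt x (u τ) τ) (hb : x =O[atTop] fun _ => (1 : ℝ)) {a : ℕ → ℝ}
    (hu : (fun τ => u τ - ∑ j ∈ Finset.range (N + 1), (halfRoot N τ ^ 2) ^ j * a j) =O[atTop]
      fun τ => (halfRoot N τ ^ 2) ^ (N + 1)) :
    u =O[atTop] fun τ => (halfRoot N τ ^ 2) ^ (N + 1) := by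
  have he : Tendsto (fun τ => halfRoot N τ ^ 2) atTop (𝓝 0) := by
    simpa using (tendsto_halfRoot hN).pow 2
  have hle : ∀ {i j : ℕ}, i ≤ j → (fun τ => (halfRoot N τ ^ 2) ^ j) =O[atTop]
      fun τ => (halfRoot N τ ^ 2) ^ i := fun {i j} hij => by
    have h1 := ((he.isBigO_one ℝ).pow (j - i)).mul
      (isBigO_refl (fun τ => (halfRoot N τ ^ 2) ^ i) atTop)
    refine (h1.congr_left fun τ => ?_).congr_right fun τ => by simp
    rw [← pow_add]; congr 1; omega
  suffices h : ∀ j < N + 1, a j = 0 by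
    refine hu.congr_left fun τ => ?_
    rw [Finset.sum_eq_zero fun j hj => by rw [h j (Finset.mem_range.1 hj), mul_zero], sub_zero]
  by_contra! hex
  obtain ⟨j, ⟨hj, haj⟩, hmin⟩ := Nat.findX hex
  have h0 : ∀ i < j, a i = 0 := fun i hi => by
    have := hmin i hi
    push Not at this
    exact this (by omega)
  have h1 : (fun τ => u τ - (halfRoot N τ ^ 2) ^ j * a j) =O[atTop]
      fun τ => (halfRoot N τ ^ 2) ^ (j + 1) := by
    have h2 : (fun τ => ∑ i ∈ Finset.range (N + 1), (halfRoot N τ ^ 2) ^ i * a i -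
        (halfRoot N τ ^ 2) ^ j * a j) =O[atTop] fun τ => (halfRoot N τ ^ 2) ^ (j + 1) := by
      refine isBigO_sum_single hj (fun i hi => ?_) ((isBigO_zero _ _).congr_left fun τ => by simp)
      rcases lt_or_gt_of_ne hi with h | h
      · simp only [h0 i h, mul_zero]; exact isBigO_zero _ _
      · simpa [mul_comm] using (hle (show j + 1 ≤ i from h)).const_mul_left (a i)
    exact ((hu.trans (hle (show j + 1 ≤ N + 1 by omega))).add h2).congr_left fun τ => by ring
  have h2 : (fun τ => (halfRoot N τ ^ 2) ^ (j + 1)) =o[atTop]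
      fun τ => (halfRoot N τ ^ 2) ^ j := by
    have := (isLittleO_one_iff ℝ).2 he
    refine ((this.mul_isBigO (isBigO_refl (fun τ => (halfRoot N τ ^ 2) ^ j) atTop)).congr_left
      fun τ => ?_).congr_right fun τ => by simp
    rw [pow_succ]; ring
  have h3 := (h1.trans_isLittleO h2).bound (show 0 < |a j| / 2 by positivity)
  have hNj : ∀ᶠ τ in atTop, τ⁻¹ ≤ (halfRoot N τ ^ 2) ^ j := by
    filter_upwards [he.eventually_le_const one_pos, eventually_gt_atTop 0] with τ hτ1 hτ0
    rw [← halfRoot_pow_two_mul_N hN hτ0, pow_mul]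
    exact pow_le_pow_of_le_one (by positivity) hτ1 (by omega)
  rcases lt_or_gt_of_ne haj with hneg | hpos
  · refine not_bounded_of_deriv_ge (x := fun τ => -x τ) (u := fun τ => -u τ) (c := |a j| / 2)
      (fun τ hτ => (hx τ hτ).neg) hb.neg_left (by positivity) ?_
    filter_upwards [h3, hNj] with τ i1 i2
    rw [Real.norm_eq_abs, Real.norm_of_nonneg (by positivity)] at i1
    have := (abs_le.1 i1).2
    rw [abs_of_neg hneg] at this ⊢
    nlinarith
  · refine not_bounded_of_deriv_ge (x := x) (u := u) (c := |a j| / 2) hx hb (by positivity) ?_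
    filter_upwards [h3, hNj] with τ i1 i2
    rw [Real.norm_eq_abs, Real.norm_of_nonneg (by positivity)] at i1
    have := (abs_le.1 i1).1
    rw [abs_of_pos hpos] at this ⊢
    nlinarith

namespace LockedSystem

variable (S : LockedSystem)

theorem IsReference.mono {S : LockedSystem} {C C' : ℝ} {p : ℝ → ℝ × ℝ} {τ : ℝ} (hτ : 0 < τ)
    (h : S.IsReference C p τ) (hC : C ≤ C') : S.IsReference C' p τ := by
  have h0 := halfRoot_pos S.N hτ
  exact ⟨h.hasDerivAt, h.p1.trans (mul_le_mul_of_nonneg_right hC (by positivity)),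
    h.p2.trans (mul_le_mul_of_nonneg_right hC (by positivity)),
    h.v_le.trans (mul_le_mul_of_nonneg_right hC (by positivity))⟩

/-- Up to O(e^(N+1)) the solution is a polynomial in e, and inserting it in the right-hand side
yields a smooth function of e, which has a Taylor polynomial. -/
theorem isBigO_comp_expansion {N : ℕ} (hN : 0 < N) {p : ℝ → ℝ × ℝ} {P : ℝ → ℝ × ℝ}
    (hP : ContDiff ℝ ∞ P)
    (hp : (fun τ => p τ - P (halfRoot N τ ^ 2)) =O[atTop] fun τ => (halfRoot N τ ^ 2) ^ (N + 1))
    (M n : ℕ) {f : ℕ → ℝ × ℝ → ℝ} (hf : ∀ K, ContDiff ℝ ∞ (f K)) :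
    ∃ a : ℕ → ℝ, (fun τ => ∑ K ∈ Finset.range (n + 1), halfRoot N τ ^ (2 * (M + K)) * f K (p τ) -
      ∑ j ∈ Finset.range (N + 1), (halfRoot N τ ^ 2) ^ j * a j) =O[atTop]
      fun τ => (halfRoot N τ ^ 2) ^ (N + 1) := by
  have he : Tendsto (fun τ => halfRoot N τ ^ 2) atTop (𝓝 0) := by
    simpa using (tendsto_halfRoot hN).pow 2
  have hg : ContDiff ℝ ∞ fun q : ℝ × ℝ =>
      ∑ K ∈ Finset.range (n + 1), q.2 ^ (M + K) * f K (P q.2) :=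
    ContDiff.sum fun K _ => (contDiff_snd.pow _).mul ((hf K).comp (hP.comp contDiff_snd))
  refine ⟨fun j => tcoef (fun q : ℝ × ℝ =>
    ∑ K ∈ Finset.range (n + 1), q.2 ^ (M + K) * f K (P q.2)) j 0, ?_⟩
  have h1 := (isBigO_taylor hg (N + 1) 0).comp_tendsto he
  have hPt : Tendsto (fun τ => P (halfRoot N τ ^ 2)) atTop (𝓝 (P 0)) :=
    (hP.continuous.tendsto 0).comp he
  have hpt : Tendsto p atTop (𝓝 (P 0)) := by
    have h2 : Tendsto (fun τ => p τ - P (halfRoot N τ ^ 2)) atTop (𝓝 0) :=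
      hp.trans_tendsto (by simpa using he.pow (N + 1))
    simpa using h2.add hPt
  have h2 : ∀ K, (fun τ => halfRoot N τ ^ (2 * (M + K)) *
      (f K (p τ) - f K (P (halfRoot N τ ^ 2)))) =O[atTop]
      fun τ => (halfRoot N τ ^ 2) ^ (N + 1) := fun K => by
    obtain ⟨C, hC, hL⟩ := exists_lipschitz_bound (hf K) (P 0) 1
    have h3 : (fun τ => f K (p τ) - f K (P (halfRoot N τ ^ 2))) =O[atTop]
        fun τ => p τ - P (halfRoot N τ ^ 2) := by
      refine IsBigO.of_bound C ?_
      filter_upwards [hpt (Metric.closedBall_mem_nhds _ one_pos),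
        hPt (Metric.closedBall_mem_nhds _ one_pos)] with τ i1 i2
      exact hL _ i2 _ i1
    have h4 : (fun τ => halfRoot N τ ^ (2 * (M + K))) =O[atTop] fun _ => (1 : ℝ) := by
      simpa using ((tendsto_halfRoot hN).isBigO_one ℝ).pow (2 * (M + K))
    simpa using h4.mul (h3.trans hp)
  have h3 := IsBigO.fun_sum (s := Finset.range (n + 1)) fun K _ => h2 K
  refine (h3.add h1).congr_left fun τ => ?_
  simp only [Function.comp, mul_sub, Finset.sum_sub_distrib, pow_mul]
  ring

/-- The bounds on the position are the first terms of the expansions. The bound e^(N+1) on the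
velocity applies the logarithmic argument to both components, which are bounded. -/
theorem exists_reference {p : ℝ → ℝ × ℝ} {τ₀ : ℝ}
    (hd : ∀ τ > τ₀, HasDerivAt p (S.field τ (p τ)) τ) {c d : ℕ → ℝ} (hd0 : d 0 = S.φ₀)
    (h1 : ∀ m : ℕ, (fun τ => (p τ).1 - ∑ K ∈ Finset.range (m + 1),
      c K * (halfRoot S.N τ ^ 2) ^ (S.M + K)) =O[atTop]
      fun τ => (halfRoot S.N τ ^ 2) ^ (S.M + (m + 1)))
    (h2 : ∀ m : ℕ, (fun τ => (p τ).2 - ∑ K ∈ Finset.range (m + 1),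
      d K * (halfRoot S.N τ ^ 2) ^ K) =O[atTop] fun τ => (halfRoot S.N τ ^ 2) ^ (m + 1)) :
    ∃ C τ₁, 0 < τ₁ ∧ ∀ τ ≥ τ₁, S.IsReference C p τ := by
  have hN := S.N_pos
  have he : Tendsto (fun τ => halfRoot S.N τ ^ 2) atTop (𝓝 0) := by
    simpa using (tendsto_halfRoot hN).pow 2
  have hle : ∀ {i j : ℕ}, i ≤ j → (fun τ => (halfRoot S.N τ ^ 2) ^ j) =O[atTop]
      fun τ => (halfRoot S.N τ ^ 2) ^ i := fun {i j} hij => by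
    have h1 := ((he.isBigO_one ℝ).pow (j - i)).mul
      (isBigO_refl (fun τ => (halfRoot S.N τ ^ 2) ^ i) atTop)
    refine (h1.congr_left fun τ => ?_).congr_right fun τ => by simp
    rw [← pow_add]; congr 1; omega
  have b1 : (fun τ => (p τ).1) =O[atTop] fun τ => halfRoot S.N τ ^ (2 * S.M) := by
    have := ((h1 0).trans (hle (show S.M ≤ S.M + (0 + 1) by omega))).add
      ((isBigO_refl (fun τ => (halfRoot S.N τ ^ 2) ^ S.M) atTop).const_mul_left (c 0))
    simpa [pow_mul] using this
  have b2 : (fun τ => (p τ).2 - S.φ₀) =O[atTop] fun τ => halfRoot S.N τ ^ 2 := by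
    simpa [hd0] using h2 0
  have hb1 : (fun τ => (p τ).1) =O[atTop] fun _ => (1 : ℝ) :=
    b1.trans (by simpa using ((tendsto_halfRoot hN).isBigO_one ℝ).pow (2 * S.M))
  have hb2 : (fun τ => (p τ).2) =O[atTop] fun _ => (1 : ℝ) := by
    have := (b2.trans (he.isBigO_one ℝ)).add (isBigO_const_const S.φ₀ one_ne_zero atTop)
    simpa using this
  let P : ℝ → ℝ × ℝ := fun e => (∑ K ∈ Finset.range (S.N + 1), c K * e ^ (S.M + K),
    ∑ K ∈ Finset.range (S.N + 1), d K * e ^ K)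
  have hP : ContDiff ℝ ∞ P :=
    (ContDiff.sum fun K _ => contDiff_const.mul (contDiff_id.pow _)).prodMk
      (ContDiff.sum fun K _ => contDiff_const.mul (contDiff_id.pow _))
  have hp : (fun τ => p τ - P (halfRoot S.N τ ^ 2)) =O[atTop]
      fun τ => (halfRoot S.N τ ^ 2) ^ (S.N + 1) :=
    IsBigO.prod_left ((h1 S.N).trans (hle (by omega))) (h2 S.N)
  obtain ⟨a₁, ha₁⟩ := isBigO_comp_expansion hN hP hp S.M S.n S.Lam_smooth
  obtain ⟨a₂, ha₂⟩ := isBigO_comp_expansion hN hP hp S.M S.n S.Om_smooth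
  have v1 := isBigO_deriv_of_bounded hN (x := fun τ => (p τ).1) (fun τ hτ =>
    (hasFDerivAt_fst (𝕜 := ℝ) (E := ℝ) (F := ℝ)).comp_hasDerivAt τ (hd τ hτ)) hb1 ha₁
  have v2 := isBigO_deriv_of_bounded hN (x := fun τ => (p τ).2) (fun τ hτ =>
    (hasFDerivAt_snd (𝕜 := ℝ) (E := ℝ) (F := ℝ)).comp_hasDerivAt τ (hd τ hτ)) hb2 ha₂
  have v : (fun τ => S.field τ (p τ)) =O[atTop] fun τ => halfRoot S.N τ ^ (2 * S.N + 2) := by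
    have := IsBigO.prod_left v1 v2
    refine this.congr_right fun τ => ?_
    rw [← pow_mul]; ring
  obtain ⟨C₁, hC₁⟩ := b1.bound
  obtain ⟨C₂, hC₂⟩ := b2.bound
  obtain ⟨C₃, hC₃⟩ := v.bound
  obtain ⟨τ₁, hτ₁⟩ := eventually_atTop.1 (hC₁.and (hC₂.and (hC₃.and (eventually_gt_atTop τ₀))))
  refine ⟨max C₁ (max C₂ C₃), max τ₁ 1, by positivity, fun τ hτ => ?_⟩
  have h0 : 0 < τ := lt_of_lt_of_le one_pos ((le_max_right _ _).trans hτ)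
  have hs := halfRoot_pos S.N h0
  obtain ⟨i1, i2, i3, i4⟩ := hτ₁ τ ((le_max_left _ _).trans hτ)
  have n : ∀ k, ‖halfRoot S.N τ ^ k‖ = halfRoot S.N τ ^ k := fun k =>
    Real.norm_of_nonneg (by positivity)
  rw [n] at i1 i2 i3
  refine ⟨hd τ i4, i1.trans ?_, i2.trans ?_, i3.trans ?_⟩
  · exact mul_le_mul_of_nonneg_right (le_max_left _ _) (by positivity)
  · exact mul_le_mul_of_nonneg_right ((le_max_left _ _).trans (le_max_right _ _)) (by positivity)
  · exact mul_le_mul_of_nonneg_right ((le_max_right _ _).trans (le_max_right _ _)) (by positivity)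

end LockedSystem

/-! ### Transfer to the full averaged system -/

namespace PerturbedOscillator

variable {P : PerturbedOscillator} (Q : ResonantFrame P)

theorem Lam_contDiff (hrc : P.ResonanceCondition) (K : ℕ) :
    ContDiff ℝ ∞ fun p : ℝ × ℝ => Q.Lam K p.1 p.2 := (term_good Q hrc K).Lam.smooth

theorem Om_contDiff (hrc : P.ResonanceCondition) (K : ℕ) :
    ContDiff ℝ ∞ fun p : ℝ × ℝ => Q.Om K p.1 p.2 := (term_good Q hrc K).Om.smooth

theorem hasDerivAt_of_contDiff_fst {f : ℝ × ℝ → ℝ} (hf : ContDiff ℝ ∞ f) (x y : ℝ) :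
    HasDerivAt (fun x => f (x, y)) (deriv (fun x => f (x, y)) x) x :=
  ((hf.comp (by fun_prop : ContDiff ℝ ∞ fun x : ℝ => (x, y))).differentiable
    (by simp)).differentiableAt.hasDerivAt

theorem hasDerivAt_of_contDiff_snd {f : ℝ × ℝ → ℝ} (hf : ContDiff ℝ ∞ f) (x y : ℝ) :
    HasDerivAt (fun y => f (x, y)) (deriv (fun y => f (x, y)) y) y :=
  ((hf.comp (by fun_prop : ContDiff ℝ ∞ fun y : ℝ => (x, y))).differentiable
    (by simp)).differentiableAt.hasDerivAt

theorem exists_lockedSystem (hrc : P.ResonanceCondition) {L : ℕ} (hL : Q.IsLeadingOrder L)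
    {φ₀ : ℝ} (hlam : Q.lamL L φ₀ < 0) {D : ℕ} (hMD : P.M ≤ D)
    (hdiv : ∀ K < D, ∀ R Ψ : ℝ, Q.divergence K R Ψ = 0) {n : ℕ} (hn : L + D ≤ n) :
    ∃ S : LockedSystem, S.M = P.M ∧ S.N = P.N ∧ S.L = L ∧ S.D = D ∧ S.n = n ∧ S.φ₀ = φ₀ ∧
      S.gam = Q.gam D φ₀ ∧ (∀ K p, S.Lam K p = Q.Lam K p.1 p.2) ∧
      ∀ K p, S.Om K p = Q.Om K p.1 p.2 := by
  obtain ⟨c, hc, hOm0⟩ := exists_Om_zero Q hrc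
  choose H E hH hE hE0 hHd hEd using fun K =>
    exists_potentials (Lam_contDiff Q hrc K) (Om_contDiff Q hrc K)
  have hM := P.M_pos hrc
  refine ⟨{ M := P.M, N := P.N, L := L, D := D, n := n, Lam := fun K p => Q.Lam K p.1 p.2,
            Om := fun K p => Q.Om K p.1 p.2, H := H, E := E, c₀ := c, φ₀ := φ₀,
            lam := Q.lamL L φ₀, gam := Q.gam D φ₀, one_le_M := hM, N_pos := P.N_pos,
            M_le_D := hMD, L_lt := hL.2.1, L_add_M := hL.1, n_ge := hn, c₀_pos := hc,
            lam_neg := hlam, Lam_smooth := Lam_contDiff Q hrc, Om_smooth := Om_contDiff Q hrc,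
            H_smooth := hH, E_smooth := hE, Om_zero := fun p => hOm0 p.1 p.2,
            Lam_zero := fun K hK p => hL.2.2.1 K hK p.1 p.2, E_zero := hE0,
            E_low := fun K hK p => ?_, H_fderiv := hHd, Lam_L := fun z => ?_,
            E_D := hEd D (0, φ₀) }, rfl, rfl, rfl, rfl, rfl, rfl, rfl, fun _ _ => rfl,
            fun _ _ => rfl⟩
  -- Zero divergence makes E_K independent of ϱ, and it is zero on ϱ = 0.
  · have h1 : ∀ x, HasDerivAt (fun x => E K (x, p.2)) 0 x := fun x =>
      (hEd K (x, p.2)).congr_deriv (hdiv K hK x p.2)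
    have h2 := is_const_of_deriv_eq_zero (fun x => (h1 x).differentiableAt)
      (fun x => (h1 x).deriv) p.1 0
    exact h2.trans (hE0 K p.2)
  · have hd : DifferentiableAt ℝ (fun p : ℝ × ℝ => Q.Lam L p.1 p.2) (0, φ₀) :=
      ((Lam_contDiff Q hrc L).differentiable (by simp)).differentiableAt
    have h1 := fderiv_apply_eq hd (hasDerivAt_of_contDiff_fst (Lam_contDiff Q hrc L) 0 φ₀)
      (hasDerivAt_of_contDiff_snd (Lam_contDiff Q hrc L) 0 φ₀)
    have h2 : deriv (fun y => Q.Lam L 0 y) φ₀ = Q.lamL L φ₀ := rfl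
    rw [h1, h1, h2]
    by_cases h0 : L = 0
    -- For L = 0 the divergence of order 0 < D vanishes and Ω_0 = c ϱ does not depend on φ, so ∂_ϱ
    -- Λ_0(0,φ₀) = 0.
    · subst h0
      have h3 := hdiv 0 (by omega) 0 φ₀
      simp only [ResonantFrame.divergence, hOm0, mul_zero, deriv_const, add_zero] at h3
      simp [h3]
    · simp [h0]

theorem eOf_eq_halfRoot {τ : ℝ} (hτ : 0 < τ) : P.eOf τ = halfRoot P.N τ ^ 2 := by
  have hN : (0 : ℝ) < P.N := by exact_mod_cast P.N_pos
  rw [halfRoot, eOf, ← Real.rpow_natCast, ← Real.rpow_mul hτ.le]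
  congr 1
  push_cast
  field_simp

theorem weight_eq_halfRoot {τ : ℝ} (hτ : 0 < τ) (K : ℕ) :
    Q.weight K τ = halfRoot P.N τ ^ (2 * (P.M + K)) := by
  rw [weight_eq Q hτ, eOf_eq_halfRoot hτ, ← pow_mul]

/-- The right-hand side of the full averaged system. -/
noncomputable def avgField (n : ℕ) (r₀ τ : ℝ) (p : ℝ × ℝ) : ℝ × ℝ :=
  (∑ K ∈ Finset.range (n + 1), Q.weight K τ * Q.Lam K p.1 p.2 + Q.LamRem n r₀ p.1 p.2 τ,
    ∑ K ∈ Finset.range (n + 1), Q.weight K τ * Q.Om K p.1 p.2 + Q.OmRem n r₀ p.1 p.2 τ)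

/-- The remainders of the full system play the role of ρ, and the constant of the configurations is
taken large enough for both the reference solution and these remainders. -/
theorem averaged_stability (hrc : P.ResonanceCondition) {L : ℕ} (hL : Q.IsLeadingOrder L)
    {φ₀ : ℝ} (hlam : Q.lamL L φ₀ < 0) {D : ℕ} (hMD : P.M ≤ D)
    (hdiv : ∀ K < D, ∀ R Ψ : ℝ, Q.divergence K R Ψ = 0) {n : ℕ} (hn : L + D ≤ n) (r₀ : ℝ)
    {τ₀ : ℝ} {ϱ φ : ℝ → ℝ}
    (hsol : Q.IsTruncatedSolution L n ϱ φ τ₀) (hasy : Q.HasLockedExpansion φ₀ ϱ φ)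
    (hcond : (Q.gam D φ₀ < 0 ∧ P.M + D < P.N) ∨
      (Q.gam D φ₀ + (L : ℝ) / P.N < 0 ∧ P.M + D = P.N) ∨
      (Q.gam D φ₀ < 0 ∧ L = 0 ∧ P.N < P.M + D)) {ε : ℝ} (hε : 0 < ε) :
    ∃ τ₂, ∀ τs ≥ τ₂, ∃ δ > 0, ∀ (T : ℝ) (p : ℝ → ℝ × ℝ), ContinuousOn p (Icc τs T) →
      (∀ τ ∈ Icc τs T, ‖p τ - (ϱ τ, φ τ)‖ ≤ ε → p τ ∈ Q.nearId n τ '' ResonantFrame.strip r₀ ∧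
        HasDerivWithinAt p (avgField Q n r₀ τ (p τ)) (Icc τs T) τ) →
      ‖p τs - (ϱ τs, φ τs)‖ < δ → ∀ τ ∈ Icc τs T, ‖p τ - (ϱ τ, φ τ)‖ < ε := by
  obtain ⟨S, hSM, hSN, hSL, hSD, hSn, hSφ, hSg, hLam, hOm⟩ :=
    exists_lockedSystem Q hrc hL hlam hMD hdiv hn
  have hdamp : S.Damped := by
    rw [LockedSystem.Damped, hSM, hSN, hSL, hSD, hSg]; exact hcond
  have hfield : ∀ τ > 0, ∀ p : ℝ × ℝ, S.field τ p =
      (∑ K ∈ Finset.range (n + 1), Q.weight K τ * Q.Lam K p.1 p.2,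
        ∑ K ∈ Finset.range (n + 1), Q.weight K τ * Q.Om K p.1 p.2) := fun τ hτ p => by
    simp only [LockedSystem.field, weight_eq_halfRoot Q hτ, hSM, hSN, hSn, hLam, hOm]
  have hsum : ∀ τ x y, ∑ K ∈ Finset.Icc L n, Q.weight K τ * Q.Lam K x y =
      ∑ K ∈ Finset.range (n + 1), Q.weight K τ * Q.Lam K x y := fun τ x y => by
    refine Finset.sum_subset (fun K hK => ?_) fun K hK hK' => ?_
    · simp only [Finset.mem_Icc, Finset.mem_range] at hK ⊢; omega
    · simp only [Finset.mem_Icc, Finset.mem_range] at hK hK'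
      rw [hL.2.2.1 K (by omega), mul_zero]
  obtain ⟨c, d, hd0, hexp⟩ := hasy
  have hpos : ∀ᶠ τ : ℝ in atTop, 0 < τ := eventually_gt_atTop 0
  obtain ⟨C₁, τ₁, hτ₁, href⟩ := S.exists_reference (p := fun τ => (ϱ τ, φ τ)) (τ₀ := max τ₀ 0)
    (fun τ hτ => by
      have h0 : 0 < τ := (le_max_right _ _).trans_lt hτ
      obtain ⟨h1, h2⟩ := hsol τ ((le_max_left _ _).trans_lt hτ)
      rw [hfield τ h0]
      rw [hsum] at h1
      exact h1.prodMk h2) (c := c) (d := d) (hd0.trans hSφ.symm)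
    (fun m => by
      refine (hexp m).1.congr' ?_ ?_
      · filter_upwards [hpos] with τ hτ
        simp only [weight_eq_halfRoot Q hτ, hSM, hSN, pow_mul]
      · filter_upwards [hpos] with τ hτ
        simp only [weight_eq_halfRoot Q hτ, hSM, hSN, pow_mul])
    (fun m => by
      refine (hexp m).2.congr' ?_ ?_
      · filter_upwards [hpos] with τ hτ
        simp only [← P.eOf_pow hτ, eOf_eq_halfRoot hτ, hSN]
      · filter_upwards [hpos] with τ hτ
        have := P.eOf_pow hτ (m + 1)
        push_cast at this
        rw [← this, eOf_eq_halfRoot hτ, hSN])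
  obtain ⟨C₂, τ₂, hτ₂, hrem⟩ := remainder_bound Q hrc n r₀
  have href' : ∀ τ ≥ τ₁, S.IsReference (max C₁ C₂) (fun τ => (ϱ τ, φ τ)) τ := fun τ hτ =>
    (href τ hτ).mono (hτ₁.trans_le hτ) (le_max_left _ _)
  obtain ⟨τ₃, hst⟩ := S.stability hdamp href' hε
  refine ⟨max τ₃ τ₂, fun τs hτs => ?_⟩
  obtain ⟨δ, hδ, h⟩ := hst τs ((le_max_left _ _).trans hτs)
  refine ⟨δ, hδ, fun T p hpc hp hps => h T p hpc (fun τ hτ hpε => ?_) hps⟩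
  obtain ⟨hmem, hd⟩ := hp τ hτ hpε
  have hτ' : τ₂ ≤ τ := (le_max_right _ _).trans (hτs.trans hτ.1)
  have h0 : 0 < τ := hτ₂.trans_le hτ'
  obtain ⟨b1, b2⟩ := hrem τ hτ' (p τ).1 (p τ).2 hmem
  refine ⟨(Q.LamRem n r₀ (p τ).1 (p τ).2 τ, Q.OmRem n r₀ (p τ).1 (p τ).2 τ), ?_, ?_⟩
  · rw [hSM, hSN, hSn, pow_mul, ← eOf_eq_halfRoot h0]
    have he := pow_pos (P.eOf_pos h0) (P.M + n + 1)
    have hle : C₂ * P.eOf τ ^ (P.M + n + 1) ≤ max C₁ C₂ * P.eOf τ ^ (P.M + n + 1) :=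
      mul_le_mul_of_nonneg_right (le_max_right _ _) he.le
    exact max_le (b1.trans hle) (b2.trans hle)
  · rw [hfield τ h0]
    exact hd

end PerturbedOscillator

/-! ### Global solutions of bounded smooth systems -/

section GlobalExistence

variable {G : Type} [NormedAddCommGroup G] [NormedSpace ℝ G] [FiniteDimensional ℝ G]

theorem exists_lipschitz_on_compact {F : ℝ × G → G} (hF : ContDiffOn ℝ ∞ F {q | 0 < q.1})
    {a : ℝ} (ha : 0 < a) (T : ℝ) (z₀ : G) (R : ℝ) :
    ∃ K : NNReal, ∀ τ ∈ Icc a T, LipschitzOnWith K (fun z => F (τ, z)) (Metric.closedBall z₀ R) := by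
  have hopen : IsOpen {q : ℝ × G | 0 < q.1} := isOpen_lt continuous_const continuous_fst
  have hsub : Icc a T ×ˢ Metric.closedBall z₀ R ⊆ {q : ℝ × G | 0 < q.1} := fun q hq =>
    ha.trans_le hq.1.1
  obtain ⟨C, hC⟩ := (isCompact_Icc.prod (isCompact_closedBall z₀ R)).exists_bound_of_continuousOn
    ((hF.continuousOn_fderiv_of_isOpen hopen (by simp)).mono hsub)
  refine ⟨C.toNNReal, fun τ hτ => ?_⟩
  have hd : ∀ z, HasFDerivAt (fun z => F (τ, z))
      ((fderiv ℝ F (τ, z)).comp (ContinuousLinearMap.inr ℝ ℝ G)) z := fun z => by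
    have h1 : DifferentiableAt ℝ F (τ, z) := (hF.contDiffAt (hopen.mem_nhds
      (ha.trans_le hτ.1))).differentiableAt (by simp)
    exact h1.hasFDerivAt.comp z (hasFDerivAt_prodMk_right τ z)
  refine (convex_closedBall z₀ R).lipschitzOnWith_of_nnnorm_hasFDerivWithin_le
    (fun z _ => (hd z).hasFDerivWithinAt) fun z hz => ?_
  have h2 : ‖(fderiv ℝ F (τ, z)).comp (ContinuousLinearMap.inr ℝ ℝ G)‖ ≤ C := by
    refine (ContinuousLinearMap.opNorm_comp_le _ _).trans ?_
    have h3 := hC (τ, z) ⟨hτ, hz⟩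
    have h4 : ‖ContinuousLinearMap.inr ℝ ℝ G‖ ≤ 1 :=
      ContinuousLinearMap.opNorm_le_bound _ zero_le_one fun x => by simp
    calc _ ≤ ‖fderiv ℝ F (τ, z)‖ * 1 := mul_le_mul_of_nonneg_left h4 (norm_nonneg _)
      _ ≤ C := by rwa [mul_one]
  exact NNReal.le_toNNReal_of_coe_le h2

/-- With speed at most B a solution cannot leave the ball of radius B (T - a), so with this radius
Picard–Lindelöf covers the whole interval at once. -/
theorem exists_solution_Icc {F : ℝ × G → G} (hF : ContDiffOn ℝ ∞ F {q | 0 < q.1}) {a : ℝ}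
    (ha : 0 < a) {B : ℝ} (hB : ∀ τ ≥ a, ∀ z, ‖F (τ, z)‖ ≤ B) (z₀ : G) {T : ℝ} (hT : a ≤ T) :
    ∃ z : ℝ → G, z a = z₀ ∧ ∀ τ ∈ Icc a T, HasDerivWithinAt z (F (τ, z τ)) (Icc a T) τ ∧
      z τ ∈ Metric.closedBall z₀ (B * (T - a)) := by
  have hB0 : 0 ≤ B := (norm_nonneg _).trans (hB a le_rfl z₀)
  obtain ⟨K, hK⟩ := exists_lipschitz_on_compact hF ha T z₀ (B * (T - a))
  have hpl : IsPicardLindelof (fun τ z => F (τ, z)) (⟨a, le_rfl, hT⟩ : Icc a T) z₀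
      (⟨B * (T - a), mul_nonneg hB0 (sub_nonneg.2 hT)⟩ : NNReal) 0 ⟨B, hB0⟩ K := by
    refine ⟨hK, fun z _ => ?_, fun τ hτ z _ => hB τ hτ.1 z, ?_⟩
    · exact hF.continuousOn.comp (by fun_prop) fun τ hτ => ha.trans_le hτ.1
    · simp only [NNReal.coe_zero, sub_zero, sub_self, max_eq_left (sub_nonneg.2 hT)]
      exact le_rfl
  obtain ⟨z, hz0, hz⟩ := hpl.exists_eq_forall_mem_Icc_hasDerivWithinAt₀
  refine ⟨z, hz0, fun τ hτ => ⟨hz τ hτ, ?_⟩⟩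
  have h1 := norm_image_sub_le_of_norm_deriv_le_segment' (f := z) (a := a) (b := T)
    (fun x hx => hz x hx) (fun x hx => hB x hx.1 (z x)) τ hτ
  rw [mem_closedBall_iff_norm, ← hz0]
  exact h1.trans (mul_le_mul_of_nonneg_left (by linarith [hτ.2]) hB0)

/-- Solutions on [a, a + m] agree on their common intervals by uniqueness on a large ball. The glued
solution uses at time τ the one of index ⌈τ - a⌉. -/
theorem exists_solution_Ici {F : ℝ × G → G} (hF : ContDiffOn ℝ ∞ F {q | 0 < q.1}) {a : ℝ}
    (ha : 0 < a) {B : ℝ} (hB : ∀ τ ≥ a, ∀ z, ‖F (τ, z)‖ ≤ B) (z₀ : G) :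
    ∃ z : ℝ → G, z a = z₀ ∧ ∀ τ ≥ a, HasDerivWithinAt z (F (τ, z τ)) (Ici a) τ := by
  have hB0 : 0 ≤ B := (norm_nonneg _).trans (hB a le_rfl z₀)
  choose z hz0 hz using fun m : ℕ => exists_solution_Icc hF ha hB z₀
    (show a ≤ a + m by linarith [m.cast_nonneg (α := ℝ)])
  have huniq : ∀ i j : ℕ, i ≤ j → ∀ τ ∈ Icc a (a + i), z i τ = z j τ := fun i j hij => by
    have hij' : (i : ℝ) ≤ j := by exact_mod_cast hij
    have hsub : Icc a (a + i) ⊆ Icc a (a + j) := Icc_subset_Icc_right (by linarith)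
    obtain ⟨K, hK⟩ := exists_lipschitz_on_compact hF ha (a + i) z₀ (B * j)
    have hbig : ∀ k : ℕ, k ≤ j → ∀ τ ∈ Icc a (a + k), z k τ ∈ Metric.closedBall z₀ (B * j) :=
      fun k hk τ hτ => by
        have hk' : (k : ℝ) ≤ j := by exact_mod_cast hk
        refine Metric.closedBall_subset_closedBall ?_ (hz k τ hτ).2
        exact mul_le_mul_of_nonneg_left (by linarith) hB0
    have hright : ∀ k : ℕ, i ≤ k → ∀ τ ∈ Ico a (a + i),
        HasDerivWithinAt (z k) (F (τ, z k τ)) (Ici τ) τ := fun k hk τ hτ => by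
      have hk' : (i : ℝ) ≤ k := by exact_mod_cast hk
      have hlt : τ < a + k := by linarith [hτ.2]
      exact (hz k τ ⟨hτ.1, hlt.le⟩).1.mono_of_mem_nhdsWithin
        (mem_of_superset (Icc_mem_nhdsGE hlt) (Icc_subset_Icc_left hτ.1))
    exact ODE_solution_unique_of_mem_Icc_right (v := fun τ z => F (τ, z))
      (s := fun _ => Metric.closedBall z₀ (B * j))
      (fun τ hτ => hK τ ⟨hτ.1, hτ.2.le⟩)
      (fun τ hτ => (hz i τ hτ).1.continuousWithinAt) (hright i le_rfl)
      (fun τ hτ => hbig i hij τ ⟨hτ.1, hτ.2.le⟩)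
      (fun τ hτ => ((hz j τ (hsub hτ)).1.continuousWithinAt).mono hsub) (hright j hij)
      (fun τ hτ => hbig j le_rfl τ (hsub ⟨hτ.1, hτ.2.le⟩)) ((hz0 i).trans (hz0 j).symm)
  have heq : ∀ m : ℕ, ∀ τ ∈ Icc a (a + m), z ⌈τ - a⌉₊ τ = z m τ := fun m τ hτ => by
    have h1 : τ ≤ a + ⌈τ - a⌉₊ := by linarith [Nat.le_ceil (τ - a)]
    rcases le_total ⌈τ - a⌉₊ m with h | h
    · exact huniq _ _ h τ ⟨hτ.1, h1⟩
    · exact (huniq _ _ h τ hτ).symm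
  refine ⟨fun τ => z ⌈τ - a⌉₊ τ, by simp [hz0], fun τ hτ => ?_⟩
  obtain ⟨m, hm⟩ := exists_nat_gt (τ - a)
  have hτm : τ ∈ Icc a (a + m) := ⟨hτ, by linarith⟩
  have h1 : HasDerivWithinAt (fun τ => z ⌈τ - a⌉₊ τ) (F (τ, z ⌈τ - a⌉₊ τ)) (Icc a (a + m)) τ := by
    rw [heq m τ hτm]
    exact (hz m τ hτm).1.congr (fun x hx => heq m x hx) (heq m τ hτm)
  refine h1.mono_of_mem_nhdsWithin ?_
  rw [← Ici_inter_Iic]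
  exact inter_mem_nhdsWithin _ (Iic_mem_nhds (by linarith))

end GlobalExistence

/-! ### Invertibility of the near-identity transformation -/

theorem CoefPer.exists_bound {per : ℝ} (hper : 0 < per) {c : ℝ → ℝ → ℝ → ℝ} (hc : CoefPer per c)
    (R : ℝ) : ∃ C, 0 ≤ C ∧ ∀ r θ ζ, |r| ≤ R → |c r θ ζ| ≤ C := by
  obtain ⟨C, hC, h⟩ := (SmoothPer.of_coef hc).bounded hper R 0
  exact ⟨C, hC, fun r θ ζ hr => h r θ ζ 0 hr (by simp)⟩

theorem CoefPer.exists_lipschitz {per : ℝ} (hper : 0 < per) {c : ℝ → ℝ → ℝ → ℝ}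
    (hc : CoefPer per c) (R : ℝ) : ∃ C, 0 ≤ C ∧ ∀ (z z' : ℝ × ℝ) (ζ : ℝ), |z.1| ≤ R → |z'.1| ≤ R →
      |c z.1 z.2 ζ - c z'.1 z'.2 ζ| ≤ C * ‖z - z'‖ := by
  obtain ⟨C₁, hC₁, h1⟩ := hc.deriv_r.exists_bound hper R
  obtain ⟨C₂, hC₂, h2⟩ := hc.deriv_θ.exists_bound hper R
  refine ⟨C₁ + C₂, by positivity, fun z z' ζ hz hz' => ?_⟩
  have i1 : |c z.1 z.2 ζ - c z'.1 z.2 ζ| ≤ C₁ * |z.1 - z'.1| :=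
    (convex_Icc (-R) R).norm_image_sub_le_of_norm_deriv_le (f := fun r => c r z.2 ζ)
      (fun r _ => (hc.hasDerivAt_r r z.2 ζ).differentiableAt)
      (fun r hr => h1 r z.2 ζ (abs_le.2 hr)) (abs_le.1 hz') (abs_le.1 hz)
  have i2 : |c z'.1 z.2 ζ - c z'.1 z'.2 ζ| ≤ C₂ * |z.2 - z'.2| :=
    convex_univ.norm_image_sub_le_of_norm_deriv_le (f := fun θ => c z'.1 θ ζ)
      (fun θ _ => (hc.hasDerivAt_θ z'.1 θ ζ).differentiableAt)
      (fun θ _ => h2 z'.1 θ ζ hz') (mem_univ _) (mem_univ _)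
  have n1 : |z.1 - z'.1| ≤ ‖z - z'‖ := norm_fst_le (z - z')
  have n2 : |z.2 - z'.2| ≤ ‖z - z'‖ := norm_snd_le (z - z')
  calc |c z.1 z.2 ζ - c z'.1 z'.2 ζ|
      ≤ |c z.1 z.2 ζ - c z'.1 z.2 ζ| + |c z'.1 z.2 ζ - c z'.1 z'.2 ζ| := abs_sub_le _ _ _
    _ ≤ C₁ * ‖z - z'‖ + C₂ * ‖z - z'‖ := add_le_add
        (i1.trans (mul_le_mul_of_nonneg_left n1 hC₁)) (i2.trans (mul_le_mul_of_nonneg_left n2 hC₂))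
    _ = _ := by ring

theorem abs_powsum_le {n M : ℕ} (hM : 1 ≤ M) {e : ℝ} (h0 : 0 ≤ e) (h1 : e ≤ 1) {x C : ℕ → ℝ} {X : ℝ}
    (hx : ∀ K, |x K| ≤ C K * X) :
    |∑ K ∈ Finset.range n, e ^ (M + K) * x K| ≤ (∑ K ∈ Finset.range n, C K) * e * X := by
  refine (Finset.abs_sum_le_sum_abs _ _).trans ?_
  rw [Finset.sum_mul, Finset.sum_mul]
  refine Finset.sum_le_sum fun K _ => ?_
  rw [abs_mul, abs_of_nonneg (by positivity)]
  have h2 : e ^ (M + K) ≤ e := by simpa using pow_le_pow_of_le_one h0 h1 (show 1 ≤ M + K by omega)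
  calc e ^ (M + K) * |x K| ≤ e * (C K * X) :=
        mul_le_mul h2 (hx K) (abs_nonneg _) h0
    _ = _ := by ring

namespace PerturbedOscillator

variable {P : PerturbedOscillator} (Q : ResonantFrame P)

/-- M ≥ 1 gives each correction at least one factor e, and periodicity makes the bounds and
Lipschitz constants uniform on the unbounded strip. -/
theorem nearId_bounds (hrc : P.ResonanceCondition) (n : ℕ) (R : ℝ) :
    ∃ C, 0 ≤ C ∧ ∀ τ > 0, P.eOf τ ≤ 1 → ∀ z z' : ℝ × ℝ, |z.1| ≤ R → |z'.1| ≤ R →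
      ‖Q.nearId n τ z - z‖ ≤ C * P.eOf τ ∧
      ‖(Q.nearId n τ z - z) - (Q.nearId n τ z' - z')‖ ≤ C * P.eOf τ * ‖z - z'‖ := by
  have hT := term_good Q hrc
  have hM := P.M_pos hrc
  choose C₁ hC₁ h1 using fun K => (hT K).rho.exists_bound Q.period_pos R
  choose C₂ hC₂ h2 using fun K => (hT K).psi.exists_bound Q.period_pos R
  choose C₃ hC₃ h3 using fun K => (hT K).rho.exists_lipschitz Q.period_pos R
  choose C₄ hC₄ h4 using fun K => (hT K).psi.exists_lipschitz Q.period_pos R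
  refine ⟨∑ K ∈ Finset.range (n + 1), (C₁ K + C₂ K + C₃ K + C₄ K),
    Finset.sum_nonneg fun K _ => by linarith [hC₁ K, hC₂ K, hC₃ K, hC₄ K],
    fun τ hτ he1 z z' hz hz' => ?_⟩
  have he := (P.eOf_pos hτ).le
  have e1 : ∀ z : ℝ × ℝ, Q.nearId n τ z - z =
      (∑ K ∈ Finset.range (n + 1), P.eOf τ ^ (P.M + K) *
        (Q.term K).rho z.1 z.2 (P.vartheta * τ),
       ∑ K ∈ Finset.range (n + 1), P.eOf τ ^ (P.M + K) *
        (Q.term K).psi z.1 z.2 (P.vartheta * τ)) := fun z => by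
    ext
    · simp [ResonantFrame.nearId, Rn_eq Q hτ]
    · simp [ResonantFrame.nearId, Psin_eq Q hτ]
  have hle : ∀ D : ℕ → ℝ, (∀ K, D K ≤ C₁ K + C₂ K + C₃ K + C₄ K) → ∀ X, 0 ≤ X →
      (∑ K ∈ Finset.range (n + 1), D K) * P.eOf τ * X ≤
        (∑ K ∈ Finset.range (n + 1), (C₁ K + C₂ K + C₃ K + C₄ K)) * P.eOf τ * X :=
    fun D hD X hX => mul_le_mul_of_nonneg_right (mul_le_mul_of_nonneg_right
      (Finset.sum_le_sum fun K _ => hD K) he) hX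
  constructor
  · rw [e1]
    refine max_le ?_ ?_
    · have := (abs_powsum_le (n := n + 1) hM he he1
        (fun K => (h1 K z.1 z.2 (P.vartheta * τ) hz).trans (by rw [mul_one]))).trans
        (hle C₁ (fun K => by linarith [hC₂ K, hC₃ K, hC₄ K]) 1 zero_le_one)
      rwa [mul_one] at this
    · have := (abs_powsum_le (n := n + 1) hM he he1
        (fun K => (h2 K z.1 z.2 (P.vartheta * τ) hz).trans (by rw [mul_one]))).trans
        (hle C₂ (fun K => by linarith [hC₁ K, hC₃ K, hC₄ K]) 1 zero_le_one)
      rwa [mul_one] at this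
  · rw [e1, e1, Prod.mk_sub_mk, ← Finset.sum_sub_distrib, ← Finset.sum_sub_distrib]
    simp only [← mul_sub]
    refine max_le ?_ ?_
    · exact (abs_powsum_le (n := n + 1) hM he he1
        (fun K => h3 K z z' (P.vartheta * τ) hz hz')).trans
        (hle C₃ (fun K => by linarith [hC₁ K, hC₂ K, hC₄ K]) _ (norm_nonneg _))
    · exact (abs_powsum_le (n := n + 1) hM he he1
        (fun K => h4 K z z' (P.vartheta * τ) hz hz')).trans
        (hle C₄ (fun K => by linarith [hC₁ K, hC₂ K, hC₃ K]) _ (norm_nonneg _))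

/-- The near-identity transformation is injective on the strip, moves its points by little, and
covers a smaller strip. -/
theorem nearId_invertible (hrc : P.ResonanceCondition) (n : ℕ) {r₀ : ℝ} (hr₀ : 0 < r₀) :
    ∃ τ₁ > 0, ∀ τ ≥ τ₁, InjOn (Q.nearId n τ) (ResonantFrame.strip r₀) ∧
      (∀ z ∈ ResonantFrame.strip r₀, ‖Q.nearId n τ z - z‖ ≤ r₀ / 8) ∧
      ∀ p : ℝ × ℝ, |p.1| ≤ r₀ / 4 → ∃ z ∈ ResonantFrame.strip r₀, Q.nearId n τ z = p := by
  obtain ⟨C, hC, h⟩ := nearId_bounds Q hrc n r₀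
  obtain ⟨τ₁, hτ₁, hsm⟩ := ResonantFrame.exists_eOf_small (P := P)
    (show 0 < min 1 (min (1 / 2) (r₀ / 8) / (C + 1)) by positivity)
  refine ⟨τ₁, hτ₁, fun τ hτ => ?_⟩
  have hτ0 : 0 < τ := hτ₁.trans_le hτ
  obtain ⟨he0, he⟩ := hsm τ hτ
  have he1 : P.eOf τ ≤ 1 := he.le.trans (min_le_left _ _)
  have he2 : C * P.eOf τ ≤ min (1 / 2) (r₀ / 8) := by
    have := he.le.trans (min_le_right _ _)
    rw [le_div_iff₀ (by positivity)] at this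
    nlinarith
  have hh : C * P.eOf τ ≤ 1 / 2 := he2.trans (min_le_left _ _)
  have hr : C * P.eOf τ ≤ r₀ / 8 := he2.trans (min_le_right _ _)
  refine ⟨fun z hz z' hz' heq => ?_, fun z hz => (h τ hτ0 he1 z z hz hz).1.trans hr, fun p hp => ?_⟩
  · have h1 := (h τ hτ0 he1 z z' hz hz').2
    rw [heq, sub_sub_sub_cancel_left, norm_sub_rev] at h1
    have h2 : ‖z - z'‖ ≤ 1 / 2 * ‖z - z'‖ :=
      h1.trans (mul_le_mul_of_nonneg_right hh (norm_nonneg _))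
    have h3 : ‖z - z'‖ = 0 := le_antisymm (by linarith) (norm_nonneg _)
    exact sub_eq_zero.1 (norm_eq_zero.1 h3)
  -- Composing with the retraction onto the strip gives a contraction of the whole plane. Its fixed
  -- point satisfies |z₁| ≤ r₀/4 + r₀/8, so the retraction acts as the identity there.
  · let π : ℝ × ℝ → ℝ × ℝ := fun z => (max (-r₀) (min r₀ z.1), z.2)
    have hπ : ∀ z, |(π z).1| ≤ r₀ := fun z =>
      abs_le.2 ⟨le_max_left _ _, max_le (by linarith) (min_le_left _ _)⟩
    have hπL : LipschitzWith 1 π := by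
      have h1 : LipschitzWith 1 fun z : ℝ × ℝ => max (-r₀) (min r₀ z.1) :=
        (LipschitzWith.prod_fst.const_min r₀).const_max (-r₀)
      simpa using h1.prodMk LipschitzWith.prod_snd
    have hcon : ContractingWith (1 / 2) fun z => p - (Q.nearId n τ (π z) - π z) := by
      refine ⟨by rw [← NNReal.coe_lt_coe]; norm_num, LipschitzWith.of_dist_le_mul fun z z' => ?_⟩
      rw [dist_eq_norm, sub_sub_sub_cancel_left, norm_sub_rev]
      have h1 := (h τ hτ0 he1 (π z) (π z') (hπ z) (hπ z')).2
      have h2 := hπL.dist_le_mul z z'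
      rw [dist_eq_norm, NNReal.coe_one, one_mul] at h2
      calc _ ≤ C * P.eOf τ * ‖π z - π z'‖ := h1
        _ ≤ 1 / 2 * dist z z' := mul_le_mul hh h2 (norm_nonneg _) (by norm_num)
        _ = _ := by norm_num
    have hfix : p - (Q.nearId n τ (π (hcon.fixedPoint _)) - π (hcon.fixedPoint _)) =
      hcon.fixedPoint _ := hcon.fixedPoint_isFixedPt
    generalize hcon.fixedPoint _ = z at hfix
    have h1 := (h τ hτ0 he1 (π z) (π z) (hπ z) (hπ z)).1.trans hr
    have h2 := (norm_fst_le _).trans h1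
    have h3 : z.1 = p.1 - (Q.nearId n τ (π z) - π z).1 := by
      conv_lhs => rw [← hfix]
      rfl
    have h4 : |z.1| ≤ r₀ := by
      rw [h3]
      refine (abs_sub _ _).trans ?_
      rw [Real.norm_eq_abs] at h2
      linarith
    have h5 : π z = z := by
      have := abs_le.1 h4
      ext
      · simp only [π]; rw [min_eq_right this.2, max_eq_right this.1]
      · rfl
    rw [h5] at hfix
    refine ⟨z, h4, ?_⟩
    have := sub_eq_iff_eq_add.1 hfix
    rw [this]; abel

end PerturbedOscillator

/-! ### A bounded smooth extension of the (r,θ)-system -/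

namespace PerturbedOscillator

variable {P : PerturbedOscillator} {Q : ResonantFrame P}

theorem contDiffOn_eOf : ContDiffOn ℝ ∞ P.eOf {τ | 0 < τ} := fun _ hτ =>
  (Real.contDiffAt_rpow_const_of_ne (ne_of_gt hτ)).contDiffWithinAt

theorem contDiffOn_tOf : ContDiffOn ℝ ∞ P.tOf {e | 0 < e} := fun _ he =>
  (contDiffAt_const.div (contDiffAt_id.pow _) (pow_pos he _).ne').contDiffWithinAt

/-- A smooth extension of the scaled perturbation. -/
noncomputable def smoothPert (sc : Q.Scaling) (F : ℝ → ℝ → ℝ → ℝ → ℝ) (w : ℤ) (τ : ℝ)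
    (p : (ℝ × ℝ × ℝ) × ℝ) : ℝ :=
  p.2 ^ (2 * P.b * w) * F (sc.xs p / p.2 ^ (2 * P.b)) (sc.ys p / p.2 ^ (2 * P.b * P.h))
    (P.vartheta * τ) (P.tOf p.2)

theorem smoothPert_eq (hrc : P.ResonanceCondition) {sc : Q.Scaling} {R : ℝ} {τ : ℝ} (hτ : 0 < τ)
    (hg : sc.Good R (P.eOf τ)) {r : ℝ} (hr : |r| ≤ R) (θ : ℝ) (F : ℝ → ℝ → ℝ → ℝ → ℝ) (w : ℤ) :
    smoothPert sc F w τ ((r, θ, P.vartheta * τ), P.eOf τ) = Q.scaledPert F w r θ τ := by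
  have he := P.eOf_pos hτ
  rw [ResonantFrame.scaledPert_eq F w r θ hτ, smoothPert]
  simp only
  rw [← hg.mul_X hrc hr, ← hg.mul_Y hrc hr, mul_div_cancel_left₀ _ (pow_ne_zero _ he.ne'),
    mul_div_cancel_left₀ _ (pow_ne_zero _ he.ne')]

theorem contDiffOn_smoothPert (sc : Q.Scaling) {F : ℝ → ℝ → ℝ → ℝ → ℝ}
    (hF : ContDiffOn ℝ ∞ (fun z : ℝ × ℝ × ℝ × ℝ => F z.1 z.2.1 z.2.2.1 z.2.2.2) {z | 0 < z.2.2.2})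
    (w : ℤ) {p : ℝ × ℝ × ℝ → (ℝ × ℝ × ℝ) × ℝ} (hp : ContDiffOn ℝ ∞ p {q | 0 < q.1})
    (hp2 : ∀ q : ℝ × ℝ × ℝ, 0 < q.1 → 0 < (p q).2) :
    ContDiffOn ℝ ∞ (fun q : ℝ × ℝ × ℝ => smoothPert sc F w q.1 (p q)) {q | 0 < q.1} := by
  have h2 : ContDiffOn ℝ ∞ (fun q => (p q).2) {q : ℝ × ℝ × ℝ | 0 < q.1} := hp.snd
  have hpow : ∀ k : ℕ, ∀ q ∈ {q : ℝ × ℝ × ℝ | 0 < q.1}, (p q).2 ^ k ≠ 0 := fun k q hq =>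
    (pow_pos (hp2 q hq) k).ne'
  have hx := ((sc.smoothPer_xs.smooth.comp_contDiffOn hp).div (h2.pow (2 * P.b)) (hpow _))
  have hy := ((sc.smoothPer_ys.smooth.comp_contDiffOn hp).div (h2.pow (2 * P.b * P.h)) (hpow _))
  have ht := contDiffOn_tOf (P := P).comp h2 (fun q hq => hp2 q hq)
  have hz : ContDiffOn ℝ ∞ (fun q : ℝ × ℝ × ℝ => P.vartheta * q.1) {q | 0 < q.1} :=
    (contDiff_const.mul contDiff_fst).contDiffOn
  have hw : ContDiffOn ℝ ∞ (fun q => (p q).2 ^ (2 * P.b * w)) {q : ℝ × ℝ × ℝ | 0 < q.1} := by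
    intro q hq
    have h3 : ContDiffAt ℝ ∞ (fun x : ℝ => x ^ (2 * P.b * w)) (p q).2 := by
      have h4 : ContDiffAt ℝ ∞ (fun x : ℝ => x ^ ((2 * P.b * w : ℤ) : ℝ)) (p q).2 :=
        Real.contDiffAt_rpow_const_of_ne (hp2 q hq).ne'
      simpa only [Real.rpow_intCast] using h4
    exact h3.comp_contDiffWithinAt q (h2 q hq)
  have hall := hF.comp (hx.prodMk (hy.prodMk (hz.prodMk ht)))
    (fun q hq => P.tOf_pos (hp2 q hq))
  exact hw.mul hall

/-- A smooth bounded vector field that agrees with the `(r, θ)`-system on a strip. -/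
theorem exists_cutoff_field (Q : ResonantFrame P) (hrc : P.ResonanceCondition) {r₀ : ℝ}
    (hr₀ : 0 < r₀) : ∃ (F : ℝ × ℝ × ℝ → ℝ × ℝ) (B τ₁ : ℝ), 0 < τ₁ ∧
      ContDiffOn ℝ ∞ F {q | 0 < q.1} ∧ (∀ τ ≥ τ₁, ∀ z, ‖F (τ, z)‖ ≤ B) ∧
      ∀ τ ≥ τ₁, ∀ z : ℝ × ℝ, |z.1| ≤ r₀ →
        F (τ, z) = (Q.rField z.1 z.2 τ, Q.thetaField z.1 z.2 τ) := by
  obtain ⟨sc⟩ := Q.nonempty_scaling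
  have hM := P.M_pos hrc
  obtain ⟨τ₁, hτ₁, hgood⟩ := sc.exists_good hM (2 * r₀)
  -- The clamp takes values below 2r₀ in modulus and is the identity for |r| ≤ r₀. The expansions on
  -- |r| ≤ 2r₀ then bound the modified field everywhere.
  obtain ⟨β, hβ, hβr, hβid⟩ := exists_smooth_clamp (show 0 < 2 * r₀ by positivity)
  obtain ⟨C₁, τ₂, h1⟩ := rField_expansion Q hrc 0 (2 * r₀)
  obtain ⟨C₂, τ₃, h2⟩ := thetaField_expansion Q hrc 0 (2 * r₀)
  obtain ⟨C₃, hC₃, h3⟩ := (coefPer_Acoeff Q hrc 0).exists_bound Q.period_pos (2 * r₀)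
  obtain ⟨C₄, hC₄, h4⟩ := (coefPer_Bcoeff Q hrc 0).exists_bound Q.period_pos (2 * r₀)
  obtain ⟨τ₄, hτ₄, hsm⟩ := ResonantFrame.exists_eOf_small (P := P) one_pos
  let p : ℝ × ℝ × ℝ → (ℝ × ℝ × ℝ) × ℝ := fun q =>
    ((β q.2.1, q.2.2, P.vartheta * q.1), P.eOf q.1)
  have hp : ContDiffOn ℝ ∞ p {q | 0 < q.1} := by
    have he : ContDiffOn ℝ ∞ (fun q : ℝ × ℝ × ℝ => P.eOf q.1) {q | 0 < q.1} :=
      contDiffOn_eOf.comp contDiff_fst.contDiffOn fun q hq => hq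
    exact ContDiffOn.prodMk (ContDiff.contDiffOn (by fun_prop)) he
  have hp2 : ∀ q : ℝ × ℝ × ℝ, 0 < q.1 → 0 < (p q).2 := fun q hq => P.eOf_pos hq
  have hf := contDiffOn_smoothPert sc P.f_smooth (ResonantFrame.wf P) hp hp2
  have hg := contDiffOn_smoothPert sc P.g_smooth (ResonantFrame.wg P) hp hp2
  have hsm' : ∀ {u}, SmoothPer Q.period u → ContDiffOn ℝ ∞ (fun q => u (p q)) {q | 0 < q.1} :=
    fun hu => hu.smooth.comp_contDiffOn hp
  have hpow : ContDiffOn ℝ ∞ (fun q => (p q).2 ^ P.M) {q | 0 < q.1} := hp.snd.pow _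
  let F : ℝ × ℝ × ℝ → ℝ × ℝ := fun q =>
    ((p q).2 ^ P.M * (sc.r0 (p q) +
        sc.rf (p q) * smoothPert sc P.f (ResonantFrame.wf P) q.1 (p q) +
        sc.rg (p q) * smoothPert sc P.g (ResonantFrame.wg P) q.1 (p q)),
      (p q).2 ^ P.M * (sc.th0 (p q) +
        sc.thf (p q) * smoothPert sc P.f (ResonantFrame.wf P) q.1 (p q) +
        sc.thg (p q) * smoothPert sc P.g (ResonantFrame.wg P) q.1 (p q)))
  have hF : ∀ τ ≥ max (max τ₁ τ₂) (max τ₃ τ₄), ∀ z : ℝ × ℝ, F (τ, z) =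
      (P.eOf τ ^ P.M * (τ ^ ((P.M : ℝ) / P.N) * Q.rField (β z.1) z.2 τ),
        P.eOf τ ^ P.M * (τ ^ ((P.M : ℝ) / P.N) * Q.thetaField (β z.1) z.2 τ)) := fun τ hτ z => by
    have i1 : τ₁ ≤ τ := ((le_max_left _ _).trans (le_max_left _ _)).trans hτ
    have i0 : 0 < τ := hτ₁.trans_le i1
    have hr : |β z.1| ≤ 2 * r₀ := (hβr _).le
    rw [(hgood τ i1).rField_eq hrc i0 hr, (hgood τ i1).thetaField_eq hrc i0 hr,
      ← smoothPert_eq hrc i0 (hgood τ i1) hr, ← smoothPert_eq hrc i0 (hgood τ i1) hr]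
  refine ⟨F, max (C₃ + |C₁|) (C₄ + |C₂|), max (max τ₁ τ₂) (max τ₃ τ₄),
    lt_max_of_lt_left (lt_max_of_lt_left hτ₁), ?_, fun τ hτ z => ?_, fun τ hτ z hz => ?_⟩
  · exact (hpow.mul (((hsm' sc.smoothPer_r0).add ((hsm' sc.smoothPer_rf).mul hf)).add
      ((hsm' sc.smoothPer_rg).mul hg))).prodMk (hpow.mul (((hsm' sc.smoothPer_th0).add
      ((hsm' sc.smoothPer_thf).mul hf)).add ((hsm' sc.smoothPer_thg).mul hg)))
  · rw [hF τ hτ z]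
    have hr : |β z.1| ≤ 2 * r₀ := (hβr _).le
    obtain ⟨he0, he1⟩ := hsm τ (((le_max_right _ _).trans (le_max_right _ _)).trans hτ)
    have hb : ∀ {x y C C' : ℝ}, |x - ∑ K ∈ Finset.range (0 + 1), P.eOf τ ^ K * y| ≤
        C * P.eOf τ ^ (0 + 1) → |y| ≤ C' → ‖P.eOf τ ^ P.M * x‖ ≤ C' + |C| := by
      intro x y C C' hx hy
      simp only [zero_add, Finset.range_one, Finset.sum_singleton, pow_zero, one_mul, pow_one] at hx
      have hM1 : P.eOf τ ^ P.M ≤ 1 := pow_le_one₀ he0.le he1.le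
      have i1 : |x| ≤ C' + |C| := by
        have i2 := abs_sub_abs_le_abs_sub x y
        have i3 : C * P.eOf τ ≤ |C| * 1 :=
          mul_le_mul (le_abs_self C) he1.le he0.le (abs_nonneg _)
        linarith
      rw [norm_mul, Real.norm_of_nonneg (by positivity)]
      exact (mul_le_of_le_one_left (norm_nonneg _) hM1).trans i1
    refine max_le ((hb ?_ (h3 (β z.1) z.2 (P.vartheta * τ) hr)).trans (le_max_left _ _))
      ((hb ?_ (h4 (β z.1) z.2 (P.vartheta * τ) hr)).trans (le_max_right _ _))
    · simpa using h1 τ (((le_max_right _ _).trans (le_max_left _ _)).trans hτ) (β z.1) z.2 hr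
    · simpa using h2 τ (((le_max_left _ _).trans (le_max_right _ _)).trans hτ) (β z.1) z.2 hr
  · have i0 : 0 < τ := hτ₁.trans_le (((le_max_left _ _).trans (le_max_left _ _)).trans hτ)
    rw [hF τ hτ z, hβid z.1 (by linarith), ResonantFrame.Scaling.rpow_M_div_N i0]
    have he := pow_ne_zero P.M (P.eOf_pos i0).ne'
    rw [mul_inv_cancel_left₀ he, mul_inv_cancel_left₀ he]

end PerturbedOscillator

/-! ### Passage between the systems and the main theorem -/

namespace PerturbedOscillator

variable {P : PerturbedOscillator} (Q : ResonantFrame P)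

theorem hasDerivWithinAt_totalDeriv {W : ℝ → ℝ → ℝ → ℝ} {z : ℝ → ℝ × ℝ} {J : Set ℝ} {τ : ℝ}
    (hW : DifferentiableAt ℝ (fun q : ℝ × ℝ × ℝ => W q.1 q.2.1 q.2.2) ((z τ).1, (z τ).2, τ))
    (hz : HasDerivWithinAt z (Q.rField (z τ).1 (z τ).2 τ, Q.thetaField (z τ).1 (z τ).2 τ) J τ) :
    HasDerivWithinAt (fun τ => W (z τ).1 (z τ).2 τ) (Q.totalDeriv W (z τ).1 (z τ).2 τ) J τ := by
  have h1 : HasDerivWithinAt (fun τ => (z τ).1) (Q.rField (z τ).1 (z τ).2 τ) J τ :=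
    (hasFDerivAt_fst (𝕜 := ℝ) (E := ℝ) (F := ℝ)).comp_hasDerivWithinAt τ hz
  have h2 : HasDerivWithinAt (fun τ => (z τ).2) (Q.thetaField (z τ).1 (z τ).2 τ) J τ :=
    (hasFDerivAt_snd (𝕜 := ℝ) (E := ℝ) (F := ℝ)).comp_hasDerivWithinAt τ hz
  have h := HasFDerivAt.comp_hasDerivWithinAt (f := fun τ : ℝ => ((z τ).1, (z τ).2, τ)) τ
    hW.hasFDerivAt (h1.prodMk (h2.prodMk (hasDerivWithinAt_id τ J)))
  refine h.congr_deriv ?_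
  generalize (z τ).1 = r at *
  generalize (z τ).2 = θ at *
  have d1 : HasDerivAt (fun r' => W r' θ τ) _ r :=
    HasFDerivAt.comp_hasDerivAt (f := fun r' : ℝ => (r', θ, τ)) r hW.hasFDerivAt
      ((hasDerivAt_id r).prodMk (hasDerivAt_const r (θ, τ)))
  have d2 : HasDerivAt (fun θ' => W r θ' τ) _ θ :=
    HasFDerivAt.comp_hasDerivAt (f := fun θ' : ℝ => (r, θ', τ)) θ hW.hasFDerivAt
      ((hasDerivAt_const θ r).prodMk ((hasDerivAt_id θ).prodMk (hasDerivAt_const θ τ)))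
  have d3 : HasDerivAt (fun τ' => W r θ τ') _ τ :=
    HasFDerivAt.comp_hasDerivAt (f := fun τ' : ℝ => (r, θ, τ')) τ hW.hasFDerivAt
      ((hasDerivAt_const τ r).prodMk ((hasDerivAt_const τ θ).prodMk (hasDerivAt_id τ)))
  rw [ResonantFrame.totalDeriv, d1.deriv, d2.deriv, d3.deriv]
  generalize fderiv ℝ (fun q : ℝ × ℝ × ℝ => W q.1 q.2.1 q.2.2) (r, θ, τ) = A
  have e : (Q.rField r θ τ, Q.thetaField r θ τ, (1 : ℝ)) =
      Q.rField r θ τ • ((1 : ℝ), (0 : ℝ), (0 : ℝ)) + Q.thetaField r θ τ • ((0 : ℝ), (1 : ℝ), (0 : ℝ)) +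
        ((0 : ℝ), (0 : ℝ), (1 : ℝ)) := by ext <;> simp
  rw [e, map_add, map_add, map_smul, map_smul]
  simp only [smul_eq_mul, Prod.mk_zero_zero]
  ring

theorem differentiableAt_add_powsum {c : ℕ → ℝ → ℝ → ℝ → ℝ} (hc : ∀ j, CoefPer Q.period (c j))
    (n : ℕ) {τ : ℝ} (hτ : 0 < τ) (r θ : ℝ) : DifferentiableAt ℝ (fun q : ℝ × ℝ × ℝ =>
      ∑ K ∈ Finset.range (n + 1), Q.weight K q.2.2 * c K q.1 q.2.1 (Q.zeta q.2.2)) (r, θ, τ) := by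
  have hev : (fun q : ℝ × ℝ × ℝ => ∑ K ∈ Finset.range (n + 1), Q.weight K q.2.2 *
      c K q.1 q.2.1 (Q.zeta q.2.2)) =ᶠ[𝓝 (r, θ, τ)] fun q => ∑ K ∈ Finset.range (n + 1),
        Q.weight K q.2.2 * c K q.1 q.2.1 (P.vartheta * q.2.2) := by
    have : ∀ᶠ q : ℝ × ℝ × ℝ in 𝓝 (r, θ, τ), 0 < q.2.2 :=
      (isOpen_lt continuous_const continuous_snd.snd).mem_nhds hτ
    filter_upwards [this] with q hq
    rw [P.zeta_eq Q hq]
  refine DifferentiableAt.congr_of_eventuallyEq ?_ hev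
  refine DifferentiableAt.fun_sum fun K _ => DifferentiableAt.mul ?_ ?_
  · exact (hasDerivAt_weight Q hτ K).differentiableAt.comp (r, θ, τ)
      (f := fun q : ℝ × ℝ × ℝ => q.2.2) (by fun_prop)
  · have h1 : Differentiable ℝ fun x : ℝ × ℝ × ℝ => c K x.1 x.2.1 x.2.2 :=
      (hc K).smooth.differentiable (by simp)
    have h2 : Differentiable ℝ fun q : ℝ × ℝ × ℝ => (q.1, q.2.1, P.vartheta * q.2.2) := by fun_prop
    exact (h1.comp h2) (r, θ, τ)

/-- The near-identity transformation maps solutions of the `(r, θ)`-system to solutions of the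
averaged system. -/
theorem hasDerivWithinAt_nearId (hrc : P.ResonanceCondition) (n : ℕ) {r₀ τ : ℝ} (hτ : 0 < τ)
    (hinj : InjOn (Q.nearId n τ) (ResonantFrame.strip r₀)) {z : ℝ → ℝ × ℝ} {J : Set ℝ}
    (hzr : |(z τ).1| ≤ r₀)
    (hz : HasDerivWithinAt z (Q.rField (z τ).1 (z τ).2 τ, Q.thetaField (z τ).1 (z τ).2 τ) J τ) :
    HasDerivWithinAt (fun τ => Q.nearId n τ (z τ)) (avgField Q n r₀ τ (Q.nearId n τ (z τ))) J τ := by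
  have hT := term_good Q hrc
  -- Injectivity on the strip forces the chosen preimage to be z itself, so the exact remainder
  -- turns the averaged right-hand side into the total derivative along z.
  have hpre : Q.preimage n r₀ (Q.nearId n τ (z τ)).1 (Q.nearId n τ (z τ)).2 τ = z τ := by
    have hmem : Q.nearId n τ (z τ) ∈ Q.nearId n τ '' ResonantFrame.strip r₀ := ⟨_, hzr, rfl⟩
    exact hinj (Function.invFunOn_mem hmem) hzr (Function.invFunOn_eq hmem)
  have hd : avgField Q n r₀ τ (Q.nearId n τ (z τ)) =
      (Q.totalDeriv (Q.Rn n) (z τ).1 (z τ).2 τ, Q.totalDeriv (Q.Psin n) (z τ).1 (z τ).2 τ) := by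
    rw [avgField, ResonantFrame.LamRem, ResonantFrame.OmRem, hpre, add_sub_cancel, add_sub_cancel]
  rw [hd]
  refine (hasDerivWithinAt_totalDeriv Q ?_ hz).prodMk (hasDerivWithinAt_totalDeriv Q ?_ hz)
  · exact differentiableAt_fst.add
      (differentiableAt_add_powsum Q (fun j => (hT j).rho) n hτ _ _)
  · exact (differentiableAt_snd.fst).add
      (differentiableAt_add_powsum Q (fun j => (hT j).psi) n hτ _ _)

theorem tendsto_locked (hrc : P.ResonanceCondition) {φ₀ : ℝ} {ϱ φ : ℝ → ℝ}
    (hasy : Q.HasLockedExpansion φ₀ ϱ φ) : Tendsto ϱ atTop (𝓝 0) := by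
  have hM : (0 : ℝ) < P.M := by exact_mod_cast P.M_pos hrc
  have hN : (0 : ℝ) < P.N := by exact_mod_cast P.N_pos
  have hw : ∀ K, Tendsto (Q.weight K) atTop (𝓝 0) := fun K =>
    tendsto_rpow_neg_atTop (by positivity)
  obtain ⟨c, d, -, h⟩ := hasy
  have h1 := (h 0).1.trans_tendsto (hw (0 + 1))
  have h2 := h1.add ((hw 0).const_mul (c 0))
  simpa using h2

end PerturbedOscillator

/-- The estimate applies to every solution at once by `averaged_stability`. Existence follows by
transporting a global solution of the cut-off system, with the same estimate ruling out an exit from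
the strip. -/
theorem mainTheorem4 (P : PerturbedOscillator) (Q : ResonantFrame P)
    (hrc : P.ResonanceCondition)
    (L : ℕ) (hL : Q.IsLeadingOrder L)
    (φ₀ : ℝ) (hφ₀ : Q.Lam L 0 φ₀ = 0) (hlam : Q.lamL L φ₀ < 0)
    (D : ℕ) (hMD : P.M ≤ D)
    (hdiv : ∀ K < D, ∀ R Ψ : ℝ, Q.divergence K R Ψ = 0) (hgam : Q.gam D φ₀ ≠ 0)
    (n : ℕ) (hn : L + D ≤ n) (r₀ : ℝ) (hr₀ : 0 < r₀)
    (τ₀ : ℝ) (hτ₀ : 0 < τ₀) (ϱ φ : ℝ → ℝ)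
    (hsol : Q.IsTruncatedSolution L n ϱ φ τ₀) (hasy : Q.HasLockedExpansion φ₀ ϱ φ)
    (hcond : (Q.gam D φ₀ < 0 ∧ P.M + D < P.N) ∨
      (Q.gam D φ₀ + (L : ℝ) / P.N < 0 ∧ P.M + D = P.N) ∨
      (Q.gam D φ₀ < 0 ∧ L = 0 ∧ P.N < P.M + D)) :
    ∀ ε > 0, ∃ δ > 0, ∃ τs > τ₀, ∀ Rs Ψs : ℝ, |Rs - ϱ τs| < δ → |Ψs - φ τs| < δ →
      (∃ R Ψ : ℝ → ℝ, Q.IsAveragedSolution n r₀ R Ψ (Set.Ici τs) ∧ R τs = Rs ∧ Ψ τs = Ψs) ∧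
      (∀ (T : ℝ) (R Ψ : ℝ → ℝ), Q.IsAveragedSolution n r₀ R Ψ (Set.Icc τs T) →
        R τs = Rs → Ψ τs = Ψs →
        ∀ τ ∈ Set.Ioc τs T, |R τ - ϱ τ| + |Ψ τ - φ τ| < ε) := by
  intro ε hε
  -- The half of ε is for the sum of the two components. The bound r₀/16, together with |ϱ| < r₀/16
  -- at late times, keeps |R| ≤ r₀/8.
  obtain ⟨τ₁, hst⟩ := PerturbedOscillator.averaged_stability Q hrc hL hlam hMD hdiv hn r₀ hsol hasy hcond
    (show 0 < min (ε / 2) (r₀ / 16) by positivity)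
  obtain ⟨τ₂, hτ₂, hid⟩ := PerturbedOscillator.nearId_invertible Q hrc n hr₀
  obtain ⟨F, B, τ₃, hτ₃, hF, hFB, hFeq⟩ := PerturbedOscillator.exists_cutoff_field Q hrc hr₀
  obtain ⟨τ₄, hϱ⟩ := eventually_atTop.1 ((PerturbedOscillator.tendsto_locked Q hrc hasy).abs.eventually_lt_const
    (show |(0 : ℝ)| < r₀ / 16 by rw [abs_zero]; positivity))
  obtain ⟨τs, h0, h1, h2, h3, h4⟩ : ∃ τs > τ₀, τ₁ ≤ τs ∧ τ₂ ≤ τs ∧ τ₃ ≤ τs ∧ τ₄ ≤ τs :=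
    ⟨max (max τ₁ τ₂) (max τ₃ τ₄) + max τ₀ 0 + 1,
      by
        have := (hτ₂.trans_le (le_max_right τ₁ τ₂)).trans_le (le_max_left _ (max τ₃ τ₄))
        have := le_max_left τ₀ 0
        show τ₀ < _
        linarith,
      by have := (le_max_left τ₁ τ₂).trans (le_max_left _ (max τ₃ τ₄))
         have := le_max_right τ₀ 0; linarith,
      by have := (le_max_right τ₁ τ₂).trans (le_max_left _ (max τ₃ τ₄))
         have := le_max_right τ₀ 0; linarith,
      by have := (le_max_left τ₃ τ₄).trans (le_max_right (max τ₁ τ₂) _)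
         have := le_max_right τ₀ 0; linarith,
      by have := (le_max_right τ₃ τ₄).trans (le_max_right (max τ₁ τ₂) _)
         have := le_max_right τ₀ 0; linarith⟩
  have hτs : 0 < τs := hτ₀.trans h0
  obtain ⟨δ, hδ, hstab⟩ := hst τs h1
  -- The bound r₀/16 places the initial point in the part of the plane covered by the image of the
  -- strip.
  refine ⟨min δ (r₀ / 16), by positivity, τs, h0, fun Rs Ψs hRs hΨs => ?_⟩
  have hδs : ‖(Rs, Ψs) - (ϱ τs, φ τs)‖ < δ :=
    max_lt (hRs.trans_le (min_le_left _ _)) (hΨs.trans_le (min_le_left _ _))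
  have hcloseR : ∀ {x τ : ℝ}, τs ≤ τ → |x - ϱ τ| ≤ r₀ / 16 → |x| ≤ r₀ / 8 := by
    intro x τ hτ hx
    have i1 := hϱ τ (h4.trans hτ)
    have i2 := abs_sub_abs_le_abs_sub x (ϱ τ)
    linarith
  constructor
  · have hRs8 : |Rs| ≤ r₀ / 8 := hcloseR le_rfl (hRs.le.trans (min_le_right _ _))
    obtain ⟨z₀, hz₀, hz₀eq⟩ := (hid τs h2).2.2 (Rs, Ψs) (by
      change |Rs| ≤ r₀ / 4; linarith)
    obtain ⟨z, hzs, hz⟩ := exists_solution_Ici hF hτs (fun τ hτ => hFB τ (h3.trans hτ)) z₀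
    have hnear : ∀ τ ≥ τs, |(z τ).1| ≤ r₀ → |(Q.nearId n τ (z τ)).1| ≤ r₀ / 8 →
        |(z τ).1| ≤ r₀ / 4 := fun τ hτ hr hx => by
      have i1 := (norm_fst_le _).trans ((hid τ (h2.trans hτ)).2.1 (z τ) hr)
      have i2 := abs_sub_abs_le_abs_sub (z τ).1 (Q.nearId n τ (z τ)).1
      rw [Prod.fst_sub, Real.norm_eq_abs, abs_sub_comm] at i1
      linarith
    have hd : ∀ τ ≥ τs, |(z τ).1| ≤ r₀ → HasDerivWithinAt (fun τ => Q.nearId n τ (z τ))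
        (PerturbedOscillator.avgField Q n r₀ τ (Q.nearId n τ (z τ))) (Ici τs) τ := fun τ hτ hr => by
      refine PerturbedOscillator.hasDerivWithinAt_nearId Q hrc n (hτs.trans_le hτ) (hid τ (h2.trans hτ)).1 hr ?_
      rw [← hFeq τ (h3.trans hτ) (z τ) hr]
      exact hz τ hτ
    have hstart : |(z τs).1| ≤ r₀ / 4 := by
      refine hnear τs le_rfl (by rw [hzs]; exact hz₀) ?_
      rw [hzs, hz₀eq]; exact hRs8
    -- Up to a first time with |r| = r₀ the image solves the averaged system, so stability gives |R|
    -- ≤ r₀/8. The transformation moves points by at most r₀/8, so |r| ≤ r₀/4 at that time, a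
    -- contradiction.
    have hin : ∀ τ ≥ τs, |(z τ).1| ≤ r₀ := by
      by_contra! hex
      obtain ⟨τe, hτe, hlt⟩ := hex
      have hcont : ContinuousOn (fun τ => |(z τ).1|) (Icc τs τe) := fun τ hτ =>
        ((hz τ hτ.1).continuousWithinAt.mono Icc_subset_Ici_self).fst.abs
      obtain ⟨τf, hτf, hfr, hle⟩ := exists_first_hit hcont (show |(z τs).1| < r₀ by linarith)
        ⟨hτe, le_rfl⟩ hlt.le
      have hcl := hstab τf (fun τ => Q.nearId n τ (z τ))
        (fun τ hτ => (hd τ hτ.1 (hle τ hτ)).continuousWithinAt.mono Icc_subset_Ici_self)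
        (fun τ hτ _ => ⟨⟨z τ, hle τ hτ, rfl⟩, (hd τ hτ.1 (hle τ hτ)).mono Icc_subset_Ici_self⟩)
        (by simp only [hzs, hz₀eq]; exact hδs) τf ⟨hτf.1, le_rfl⟩
      have i1 := ((norm_fst_le _).trans hcl.le).trans (min_le_right _ _)
      have i2 := hnear τf hτf.1 hfr.le (hcloseR hτf.1 i1)
      linarith
    refine ⟨fun τ => (Q.nearId n τ (z τ)).1, fun τ => (Q.nearId n τ (z τ)).2, fun τ hτ => ?_, ?_, ?_⟩
    · have hdτ := hd τ hτ (hin τ hτ)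
      exact ⟨⟨z τ, hin τ hτ, rfl⟩,
        (hasFDerivAt_fst (𝕜 := ℝ) (E := ℝ) (F := ℝ)).comp_hasDerivWithinAt τ hdτ,
        (hasFDerivAt_snd (𝕜 := ℝ) (E := ℝ) (F := ℝ)).comp_hasDerivWithinAt τ hdτ⟩
    · simp only [hzs, hz₀eq]
    · simp only [hzs, hz₀eq]
  · intro T R Ψ hRΨ hR0 hΨ0 τ hτ
    have hcl := hstab T (fun τ => (R τ, Ψ τ))
      (fun τ hτ => ((hRΨ τ hτ).2.1.continuousWithinAt).prodMk (hRΨ τ hτ).2.2.continuousWithinAt)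
      (fun τ hτ _ => ⟨(hRΨ τ hτ).1, (hRΨ τ hτ).2.1.prodMk (hRΨ τ hτ).2.2⟩)
      (by simp only [hR0, hΨ0]; exact hδs) τ ⟨hτ.1.le, hτ.2⟩
    have i1 : |R τ - ϱ τ| < ε / 2 := ((norm_fst_le _).trans_lt hcl).trans_le (min_le_left _ _)
    have i2 : |Ψ τ - φ τ| < ε / 2 := ((norm_snd_le _).trans_lt hcl).trans_le (min_le_left _ _)
    linarith
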